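/- Let $d\ge 2$ and $\beta>0$, and let $\rho\in C^\infty(\mathbb R^d\setminus\{0\})$ be a homogeneous distance function of degree $\beta$, i.e. $\rho(\xi)>0$ and $\rho(t^{1/\beta}\xi)=t\rho(\xi)$ for all $\xi\ne0$, $t>0$. Let $\frac{2d}{d-1}<p<\infty$ and $\lambda(p)=d\left(\frac12-\frac1p\right)-\frac12$. Let $1\le q\le\infty$ and $\gamma\in\mathbb R$, where $\gamma>1-\frac1q$ if $1<q\le\infty$, and $\gamma\ge0$ if $q=1$. Put $$h_{\lambda,\gamma}(r)=\frac{(1-r)_+^{\lambda}}{\left(1+\log\frac1{1-r}\right)^{\gamma}}$$ (understood as $0$ for $r\ge1$), let $$K_t(x)=(2\pi)^{-d}\int_{\mathbb R^d}h_{\lambda(p),\gamma}\left(\tfrac{\rho(\xi)}{t}\right)e^{i\langle x,\xi\rangle}\,d\xi,$$ and let $S_t^{\lambda(p),\gamma}f=K_t*f$, so that $\widehat{S_t^{\lambda(p),\gamma}f}(\xi)=h_{\lambda(p),\gamma}(\rho(\xi)/t)\,\widehat f(\xi)$ for Schwartz functions $f$. Then for every complex-valued $f$ in the Lorentz space $L^{p,q}(\mathbb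 R^d)$ the integral defining $K_t*f(x)$ converges absolutely for all $t>0$ and all $x\in\mathbb R^d$, and $$\lim_{t\to\infty}S_t^{\lambda(p),\gamma}f(x)=f(x)\quad\text{for almost every }x\in\mathbb R^d.$$ For $q=1$ and $\gamma=0$ this covers the Riesz means $S_t^{\lambda(p)}f$, with multiplier $(1-\rho(\xi)/t)_+^{\lambda(p)}$, themselves. -/

import Mathlib

open MeasureTheory Filter Topology Set
open scoped ENNReal

noncomputable section

/-- A smooth homogeneous distance function of degree `β` on `ℝ^d`: smooth and positive away from
the origin, with `ρ (t^{1/β} ξ) = t ρ(ξ)` for `t > 0`.  (The value at the origin is irrelevant.) -/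
structure IsHomogeneousDistance {d : ℕ} (β : ℝ) (ρ : EuclideanSpace ℝ (Fin d) → ℝ) : Prop where
  degree_pos : 0 < β
  smooth : ContDiffOn ℝ (⊤ : ℕ∞) ρ {0}ᶜ
  pos : ∀ ξ, ξ ≠ 0 → 0 < ρ ξ
  homogeneous : ∀ t : ℝ, 0 < t → ∀ ξ, ξ ≠ 0 → ρ (t ^ (1 / β) • ξ) = t * ρ ξ

/-- The Lorentz quasi-norm of `L^{p,q}(μ)`, `0 < p < ∞`, `0 < q ≤ ∞`, written with the distribution
function: `(p ∫₀^∞ (s μ{|f| > s}^{1/p})^q ds/s)^{1/q}` for `q < ∞`, and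
`sup_{s > 0} s μ{|f| > s}^{1/p}` for `q = ∞`. -/
def eLorentzNorm {X : Type*} [MeasurableSpace X] (f : X → ℂ) (p : ℝ) (q : ℝ≥0∞)
    (μ : Measure X) : ℝ≥0∞ :=
  if q = ⊤ then
    ⨆ (s : ℝ) (_ : 0 < s), ENNReal.ofReal s * μ {x | s < ‖f x‖} ^ (1 / p)
  else
    (ENNReal.ofReal p * ∫⁻ s in Ioi (0 : ℝ),
      (ENNReal.ofReal s * μ {x | s < ‖f x‖} ^ (1 / p)) ^ q.toReal / ENNReal.ofReal s)
        ^ (1 / q.toReal)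

/-- Membership in the Lorentz space `L^{p,q}(μ)`. -/
def MemLorentz {X : Type*} [MeasurableSpace X] (f : X → ℂ) (p : ℝ) (q : ℝ≥0∞)
    (μ : Measure X) : Prop :=
  AEStronglyMeasurable f μ ∧ eLorentzNorm f p q μ < ⊤

/-- The critical index `λ(p) = d (1/2 - 1/p) - 1/2`. -/
def criticalIndex (d : ℕ) (p : ℝ) : ℝ := d * (1 / 2 - 1 / p) - 1 / 2

/-- `h_{λ,γ}(r) = (1-r)_+^λ / (1 + log (1/(1-r)))^γ`, understood as `0` for `r ≥ 1`. -/
def hlog (lam γ r : ℝ) : ℝ :=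
  if r < 1 then (1 - r) ^ lam / (1 + Real.log (1 / (1 - r))) ^ γ else 0

/-- The convolution kernel
`K_t(x) = (2π)^{-d} ∫ h_{λ,γ}(ρ(ξ)/t) e^{i⟨x,ξ⟩} dξ`, i.e. the inverse Fourier transform of the
multiplier `h_{λ,γ}(ρ(·)/t)`. -/
def rieszKernel {d : ℕ} (ρ : EuclideanSpace ℝ (Fin d) → ℝ) (lam γ t : ℝ)
    (x : EuclideanSpace ℝ (Fin d)) : ℂ :=
  ((2 * Real.pi) ^ d : ℝ)⁻¹ *
    ∫ ξ : EuclideanSpace ℝ (Fin d),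
      (hlog lam γ (ρ ξ / t) : ℂ) * Complex.exp (Complex.I * (inner ℝ x ξ : ℝ))

/-- The generalized Riesz mean `S_t^{λ,γ} f = K_t * f`. -/
def rieszMean {d : ℕ} (ρ : EuclideanSpace ℝ (Fin d) → ℝ) (lam γ t : ℝ)
    (f : EuclideanSpace ℝ (Fin d) → ℂ) (x : EuclideanSpace ℝ (Fin d)) : ℂ :=
  ∫ y, rieszKernel ρ lam γ t (x - y) * f y

/-- The multiplier `h_{λ,γ}(ρ(·)/t)` is integrable, so the kernel is a genuine integral. -/
theorem IsHomogeneousDistance.integrable_multiplier {d : ℕ} (hd : 1 ≤ d) {β : ℝ}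
    {ρ : EuclideanSpace ℝ (Fin d) → ℝ} (hρ : IsHomogeneousDistance β ρ) {lam γ t : ℝ}
    (hlam : 0 ≤ lam) (hγ : 0 ≤ γ) (ht : 0 < t) :
    Integrable (fun ξ => hlog lam γ (ρ ξ / t)) := by
  have : Nonempty (Fin d) := ⟨⟨0, hd⟩⟩
  have hne : ∀ᵐ ξ : EuclideanSpace ℝ (Fin d), ξ ≠ 0 := by
    simp [ae_iff]
  have hmeas : Measurable (hlog lam γ) := by
    unfold hlog
    refine Measurable.ite measurableSet_Iio ?_ measurable_const
    fun_prop
  have hρm : AEMeasurable ρ := by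
    have h1 : AEMeasurable ρ (volume.restrict {0}ᶜ) :=
      (hρ.smooth.continuousOn).aemeasurable (measurableSet_singleton _).compl
    have h2 : volume.restrict ({0}ᶜ : Set (EuclideanSpace ℝ (Fin d))) = volume :=
      Measure.restrict_eq_self_of_ae_mem hne
    rwa [h2] at h1
  -- a lower bound for `ρ` on the unit sphere
  obtain ⟨c, hc, hcb⟩ : ∃ c : ℝ, 0 < c ∧ ∀ ξ : EuclideanSpace ℝ (Fin d), ‖ξ‖ = 1 → c ≤ ρ ξ := by
    have hS : IsCompact (Metric.sphere (0 : EuclideanSpace ℝ (Fin d)) 1) := isCompact_sphere _ _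
    have hSn : (Metric.sphere (0 : EuclideanSpace ℝ (Fin d)) 1).Nonempty :=
      NormedSpace.sphere_nonempty.2 zero_le_one
    have hcont : ContinuousOn ρ (Metric.sphere (0 : EuclideanSpace ℝ (Fin d)) 1) :=
      hρ.smooth.continuousOn.mono fun x hx h0 => by
        rw [mem_singleton_iff] at h0; subst h0; simp at hx
    obtain ⟨z, hz, hmin⟩ := hS.exists_isMinOn hSn hcont
    refine ⟨ρ z, hρ.pos z ?_, fun ξ hξ => hmin (by simpa using hξ)⟩
    rintro rfl
    simp at hz
  have hlow : ∀ ξ, ξ ≠ 0 → ρ ξ < t → ‖ξ‖ ≤ (t / c) ^ (1 / β) := by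
    intro ξ hξ hlt
    have hn : 0 < ‖ξ‖ := norm_pos_iff.2 hξ
    have hβ := hρ.degree_pos
    have hu : ‖(‖ξ‖⁻¹ • ξ)‖ = 1 := by
      rw [norm_smul, norm_inv, norm_norm, inv_mul_cancel₀ hn.ne']
    have hu0 : ‖ξ‖⁻¹ • ξ ≠ 0 := by
      intro h; rw [h] at hu; simp at hu
    have h1 := hρ.homogeneous (‖ξ‖ ^ β) (Real.rpow_pos_of_pos hn _) _ hu0
    rw [← Real.rpow_mul hn.le, mul_one_div_cancel hβ.ne', Real.rpow_one, smul_smul,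
      mul_inv_cancel₀ hn.ne', one_smul] at h1
    have h2 : ‖ξ‖ ^ β ≤ t / c := by
      rw [le_div_iff₀ hc]
      calc ‖ξ‖ ^ β * c ≤ ‖ξ‖ ^ β * ρ (‖ξ‖⁻¹ • ξ) := by gcongr; exact hcb _ hu
        _ ≤ t := by rw [← h1]; exact hlt.le
    calc ‖ξ‖ = (‖ξ‖ ^ β) ^ (1 / β) := by
          rw [← Real.rpow_mul hn.le, mul_one_div_cancel hβ.ne', Real.rpow_one]
      _ ≤ _ := Real.rpow_le_rpow (by positivity) h2 (by positivity)
  have hbd : ∀ r : ℝ, 0 < r → |hlog lam γ r| ≤ 1 := by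
    intro r hr
    unfold hlog
    split_ifs with h
    · have h1 : 0 < 1 - r := by linarith
      have h2 : 0 ≤ Real.log (1 / (1 - r)) :=
        Real.log_nonneg (by rw [le_div_iff₀ h1]; linarith)
      have h3 : 1 ≤ (1 + Real.log (1 / (1 - r))) ^ γ := Real.one_le_rpow (by linarith) hγ
      have h4 : (1 - r) ^ lam ≤ 1 := Real.rpow_le_one h1.le (by linarith) hlam
      rw [abs_of_nonneg (by positivity)]
      exact (div_le_one (by linarith)).2 (h4.trans h3)
    · simp
  have hI : Integrable ((Metric.closedBall (0 : EuclideanSpace ℝ (Fin d))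
      ((t / c) ^ (1 / β))).indicator (fun _ => (1 : ℝ))) :=
    (integrable_indicator_iff Metric.isClosed_closedBall.measurableSet).2
      (integrableOn_const (isCompact_closedBall _ _).measure_lt_top.ne)
  refine hI.mono' (hmeas.comp_aemeasurable (hρm.div_const t)).aestronglyMeasurable ?_
  filter_upwards [hne] with ξ hξ
  rw [Real.norm_eq_abs]
  by_cases hb : ρ ξ < t
  · rw [indicator_of_mem (by simpa using hlow ξ hξ hb)]
    exact hbd _ (div_pos (hρ.pos ξ hξ) ht)
  · have : ¬ ρ ξ / t < 1 := by rw [div_lt_one ht]; exact hb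
    simp only [hlog, this, if_false, abs_zero]
    exact indicator_nonneg (fun _ _ => zero_le_one) _

/-- For integrable (in particular for Schwartz) `f`, the convolution `K_t * f` is given by the
Fourier multiplier formula
`S_t f(x) = (2π)^{-d} ∫ h_{λ,γ}(ρ(ξ)/t) (∫ f(y) e^{-i⟨y,ξ⟩} dy) e^{i⟨x,ξ⟩} dξ`. -/
theorem IsHomogeneousDistance.rieszMean_eq_multiplier {d : ℕ} (hd : 1 ≤ d) {β : ℝ}
    {ρ : EuclideanSpace ℝ (Fin d) → ℝ} (hρ : IsHomogeneousDistance β ρ) {lam γ t : ℝ}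
    (hlam : 0 ≤ lam) (hγ : 0 ≤ γ) (ht : 0 < t) {f : EuclideanSpace ℝ (Fin d) → ℂ}
    (hf : Integrable f) (x : EuclideanSpace ℝ (Fin d)) :
    rieszMean ρ lam γ t f x = ((2 * Real.pi) ^ d : ℝ)⁻¹ *
      ∫ ξ : EuclideanSpace ℝ (Fin d), (hlog lam γ (ρ ξ / t) : ℂ) *
        (∫ y, f y * Complex.exp (-Complex.I * (inner ℝ y ξ : ℝ))) *
          Complex.exp (Complex.I * (inner ℝ x ξ : ℝ)) := by
  have hm := (hρ.integrable_multiplier hd hlam hγ ht).ofReal (𝕜 := ℂ)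
  have hprod := hf.mul_prod hm
  have hF : Integrable (fun z : EuclideanSpace ℝ (Fin d) × EuclideanSpace ℝ (Fin d) =>
      Complex.exp (Complex.I * (inner ℝ (x - z.1) z.2 : ℝ)) *
        (f z.1 * (hlog lam γ (ρ z.2 / t) : ℂ))) (volume.prod volume) := by
    refine hprod.bdd_mul (c := 1) (Continuous.aestronglyMeasurable (by fun_prop))
      (ae_of_all _ fun z => ?_)
    rw [mul_comm, Complex.norm_exp_ofReal_mul_I]
  have hswap := integral_integral_swap (f := fun y ξ =>
      Complex.exp (Complex.I * (inner ℝ (x - y) ξ : ℝ)) *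
        (f y * (hlog lam γ (ρ ξ / t) : ℂ))) hF
  have hL : rieszMean ρ lam γ t f x = ((2 * Real.pi) ^ d : ℝ)⁻¹ * ∫ y, ∫ ξ,
      Complex.exp (Complex.I * (inner ℝ (x - y) ξ : ℝ)) *
        (f y * (hlog lam γ (ρ ξ / t) : ℂ)) := by
    unfold rieszMean rieszKernel
    rw [← integral_const_mul]
    congr 1 with y
    rw [mul_assoc, ← integral_mul_const]
    congr 2 with ξ
    ring
  rw [hL, hswap]
  congr 2 with ξ
  rw [← integral_const_mul, ← integral_mul_const]
  congr 1 with y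
  have he : Complex.exp (Complex.I * (inner ℝ (x - y) ξ : ℝ)) =
      Complex.exp (-Complex.I * (inner ℝ y ξ : ℝ)) *
        Complex.exp (Complex.I * (inner ℝ x ξ : ℝ)) := by
    rw [← Complex.exp_add, inner_sub_left]
    congr 1
    push_cast
    ring
  rw [he]
  ring

end

/-!
Write `λ = λ(p)`, so that `λ + 1/2 = d(1/2 - 1/p)`, and split the time axis into the dyadic blocks
`t ∈ [2^i, 2^{i+1}]`; by homogeneity a block is the interval `[1, 2]` acting on the dilated
function `F(s⁻¹ ·)`, `s = 2^{i/β}` (`IsHomogeneousDistance.rieszMean_scale`). A function `f` of the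
Lorentz class is locally square integrable, and is treated by `L²` methods alone: no maximal
theorem and no interpolation is needed, because only almost everywhere convergence on bounded sets
as `t → ∞` is at stake.

*Representation of the multiplier.* A smooth cutoff in `ρ` isolates the shell `1/3 ≤ ρ ≤ 3`; the
low-frequency remainder has a kernel `O(|x|^{-d})` (`IsHomogeneousDistance.exists_invFT_low_le`). On
the shell `h_{λ,γ}` is a superposition of powers `(1 - r)_+^{λ+a}` against a finite measure in `a`
with Laplace transform `(1 + L)^{-γ}`, and by Laplace inversion each power is, for all `t ∈ [1, 2]`
simultaneously, a superposition over `τ` of the exponentials `e^{-(λ+a+iτ)(ρ-1/3)}` with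
coefficients `O(e^{a/4}(1+|τ|)^{-λ-1-min(a,1)})` (`exists_enorm_invFT_hlog_le`). The supremum over
`t` is thereby dominated by one integral of wave packets.

*Far part.* Let `F` be supported in `|y| ≥ D`. In the unit time block and for `|x| ≤ D/2`, the
frequencies `|τ| ≤ cD` contribute only rapidly decreasing terms (nonstationary phase,
`IsHomogeneousDistance.exists_phaseFT_bounds`), while for `|τ| ≥ cD` Cauchy–Schwarz in `τ` and the
local smoothing inequality `∫_{|x|≤r} ∫ |e^{-iτρ(D)} g|² dτ dx ≤ C r ‖g‖₂²`, proved by Schur's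
test, give the factor `D^{-λ-1/2}(1 + log D)^{-γ}`
(`IsHomogeneousDistance.exists_far_unit_bound`). After rescaling, the annulus `|y| ∼ 2^k`
contributes to the block `i`, in the `L²` mean over a fixed ball of points `x`, at most a constant
times `s^{-λ} (1+k)^{-γ} 2^{-kd(1/2-1/p)} ‖f 1_{|y|∼2^k}‖₂`, besides the low-frequency term
`2^{-kd} ‖f 1_{|y|∼2^k}‖₁`, which is dominated by the tail of a convergent series independent of
`i`. The hypothesis on `q, γ` makes these numbers summable over `k` for `f ∈ L^{p,q}`
(`MemLorentz.tsum_annuli_lt_top`), and `∑ s^{-λ} < ∞`; so the far part is eventually small almost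
everywhere (`IsHomogeneousDistance.exists_far_mean_small`). The same bounds at a single point and
duality give the absolute convergence of `K_t * f`.

*Near part.* For `F ∈ L¹ ∩ L²` the means are compared with a mollification at scale `s⁻¹`, which
converges almost everywhere by Lebesgue's theorem. The difference, after taking the supremum over a
block, is controlled in `L²` by the frequencies comparable to the block, hence is square summable
over the blocks (`IsHomogeneousDistance.exists_mean_sub_mollify_le`,
`IsHomogeneousDistance.tsum_dilated_ne_top`) and tends to zero almost everywhere.
-/

/-! ### Bessel inequalities by Schur's test -/

section Bessel

/-- A Bessel inequality: the operator `g ↦ ∫ φ(·, x) g(x) dx` is bounded on `L²` as soon as the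
kernel of its `T*T` satisfies Schur's test. -/
theorem lintegral_enorm_integral_sq_le {Ω X : Type*} [MeasurableSpace Ω] [MeasurableSpace X]
    (P : Measure Ω) [IsFiniteMeasure P] (m : Measure X) [SFinite m] (φ : Ω → X → ℂ)
    (hφ : Measurable (Function.uncurry φ)) (hφ1 : ∀ ω x, ‖φ ω x‖ ≤ 1)
    {g : X → ℂ} (hg : Integrable g m) (K : X → X → ℝ≥0∞) (hKm : Measurable (Function.uncurry K))
    (hKs : ∀ x y, K x y = K y x)
    (hK : ∀ x y, ‖∫ ω, φ ω x * (starRingEnd ℂ) (φ ω y) ∂P‖ₑ ≤ K x y) (C : ℝ≥0∞)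
    (hC : ∀ x, ∫⁻ y, K x y ∂m ≤ C) :
    ∫⁻ ω, ‖∫ x, φ ω x * g x ∂m‖ₑ ^ 2 ∂P ≤ C * ∫⁻ x, ‖g x‖ₑ ^ 2 ∂m := by
  set G : Ω → ℂ := fun ω => ∫ x, φ ω x * g x ∂m with hG
  have hmeas3 : AEStronglyMeasurable (fun z : Ω × (X × X) =>
      φ z.1 z.2.1 * g z.2.1 * (starRingEnd ℂ) (φ z.1 z.2.2 * g z.2.2)) (P.prod (m.prod m)) := by
    have h1 : AEStronglyMeasurable (fun z : Ω × (X × X) => g z.2.1) (P.prod (m.prod m)) :=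
      (hg.1.comp_fst (ν := m)).comp_snd
    have h2 : AEStronglyMeasurable (fun z : Ω × (X × X) => g z.2.2) (P.prod (m.prod m)) :=
      (hg.1.comp_snd (μ := m)).comp_snd
    have h3 : Measurable fun z : Ω × (X × X) => φ z.1 z.2.1 :=
      hφ.comp (measurable_fst.prodMk measurable_snd.fst)
    have h4 : Measurable fun z : Ω × (X × X) => φ z.1 z.2.2 :=
      hφ.comp (measurable_fst.prodMk measurable_snd.snd)
    exact (h3.aestronglyMeasurable.mul h1).mul
      (RCLike.continuous_conj.comp_aestronglyMeasurable (h4.aestronglyMeasurable.mul h2))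
  have hint : Integrable (fun z : Ω × (X × X) =>
      φ z.1 z.2.1 * g z.2.1 * (starRingEnd ℂ) (φ z.1 z.2.2 * g z.2.2)) (P.prod (m.prod m)) := by
    have h0 : Integrable (fun z : X × X => ‖g z.1‖ * ‖g z.2‖) (m.prod m) :=
      hg.norm.mul_prod hg.norm
    have h1 : Integrable (fun z : Ω × (X × X) => ‖g z.2.1‖ * ‖g z.2.2‖) (P.prod (m.prod m)) := by
      simpa using (integrable_const (1 : ℝ) (μ := P)).mul_prod h0
    refine h1.mono' hmeas3 (ae_of_all _ fun z => ?_)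
    rw [norm_mul, norm_mul, RCLike.norm_conj, norm_mul]
    have a1 := hφ1 z.1 z.2.1
    have a2 := hφ1 z.1 z.2.2
    gcongr
    · exact mul_le_of_le_one_left (norm_nonneg _) a1
    · exact mul_le_of_le_one_left (norm_nonneg _) a2
  have hGG : ∀ ω, ∫ z : X × X, φ ω z.1 * g z.1 * (starRingEnd ℂ) (φ ω z.2 * g z.2) ∂(m.prod m)
      = ((‖G ω‖ ^ 2 : ℝ) : ℂ) := by
    intro ω
    rw [integral_prod_mul (fun x => φ ω x * g x) (fun x => (starRingEnd ℂ) (φ ω x * g x)),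
      integral_conj, Complex.mul_conj, Complex.normSq_eq_norm_sq]
  have hswap : ((∫ ω, ‖G ω‖ ^ 2 ∂P : ℝ) : ℂ) = ∫ z : X × X, ∫ ω,
      φ ω z.1 * g z.1 * (starRingEnd ℂ) (φ ω z.2 * g z.2) ∂P ∂(m.prod m) := by
    rw [← integral_complex_ofReal, ← integral_integral_swap (f := fun ω (z : X × X) =>
      φ ω z.1 * g z.1 * (starRingEnd ℂ) (φ ω z.2 * g z.2)) hint]
    exact integral_congr_ae (ae_of_all _ fun ω => (hGG ω).symm)
  have hGint : Integrable (fun ω => ‖G ω‖ ^ 2) P := by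
    have := hint.integral_prod_left
    simp only [hGG] at this
    exact this.re
  have hL : ∫⁻ ω, ‖G ω‖ₑ ^ 2 ∂P = ENNReal.ofReal (∫ ω, ‖G ω‖ ^ 2 ∂P) := by
    rw [ofReal_integral_eq_lintegral_ofReal hGint (ae_of_all _ fun ω => by positivity)]
    refine lintegral_congr fun ω => ?_
    rw [ENNReal.ofReal_pow (norm_nonneg _), ofReal_norm]
  have hKx : ∀ x, Measurable (K x) := fun x => hKm.comp (measurable_const.prodMk measurable_id)
  have hgm : AEMeasurable (fun x => ‖g x‖ₑ ^ 2) m := hg.1.enorm.pow_const 2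
  have hgm1 : AEMeasurable (fun z : X × X => ‖g z.1‖ₑ ^ 2 * K z.1 z.2) (m.prod m) :=
    ((hg.1.comp_fst (ν := m)).enorm.pow_const 2).mul hKm.aemeasurable
  have hgm2 : AEMeasurable (fun z : X × X => ‖g z.2‖ₑ ^ 2 * K z.1 z.2) (m.prod m) :=
    ((hg.1.comp_snd (μ := m)).enorm.pow_const 2).mul hKm.aemeasurable
  have hone : ∫⁻ z : X × X, ‖g z.1‖ₑ ^ 2 * K z.1 z.2 ∂(m.prod m) ≤
      C * ∫⁻ x, ‖g x‖ₑ ^ 2 ∂m := by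
    rw [lintegral_prod _ hgm1, ← lintegral_const_mul'' _ hgm]
    refine lintegral_mono fun x => ?_
    dsimp only
    rw [lintegral_const_mul _ (hKx _), mul_comm C]
    gcongr
    exact hC x
  have htwo : ∫⁻ z : X × X, ‖g z.2‖ₑ ^ 2 * K z.1 z.2 ∂(m.prod m) ≤
      C * ∫⁻ x, ‖g x‖ₑ ^ 2 ∂m := by
    rw [lintegral_prod_symm _ hgm2, ← lintegral_const_mul'' _ hgm]
    refine lintegral_mono fun y => ?_
    simp only [hKs _ y]
    rw [lintegral_const_mul _ (hKx _), mul_comm C]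
    gcongr
    exact hC y
  have hamgm : ∀ a b : ℝ≥0∞, 2 * (a * b) ≤ a ^ 2 + b ^ 2 := by
    intro a b
    by_cases ha : a = ⊤
    · simp [ha]
    by_cases hb : b = ⊤
    · simp [hb]
    lift a to NNReal using ha
    lift b to NNReal using hb
    have := two_mul_le_add_sq a b
    norm_cast
    rwa [← mul_assoc]
  have h2 : 2 * ∫⁻ ω, ‖G ω‖ₑ ^ 2 ∂P ≤ 2 * (C * ∫⁻ x, ‖g x‖ₑ ^ 2 ∂m) := by
    calc 2 * ∫⁻ ω, ‖G ω‖ₑ ^ 2 ∂P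
        = 2 * ‖((∫ ω, ‖G ω‖ ^ 2 ∂P : ℝ) : ℂ)‖ₑ := by
          rw [hL, ← ofReal_norm, Complex.norm_real, Real.norm_of_nonneg
            (integral_nonneg fun ω => by positivity)]
      _ ≤ 2 * ∫⁻ z : X × X, ‖g z.1‖ₑ * ‖g z.2‖ₑ * K z.1 z.2 ∂(m.prod m) := by
          rw [hswap]
          gcongr
          refine (enorm_integral_le_lintegral_enorm _).trans (lintegral_mono fun z => ?_)
          have : ∀ ω, φ ω z.1 * g z.1 * (starRingEnd ℂ) (φ ω z.2 * g z.2) =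
              (g z.1 * (starRingEnd ℂ) (g z.2)) * (φ ω z.1 * (starRingEnd ℂ) (φ ω z.2)) := by
            intro ω
            rw [map_mul]
            ring
          simp only [this]
          rw [integral_const_mul, enorm_mul, enorm_mul]
          gcongr
          · rw [← ofReal_norm, RCLike.norm_conj, ofReal_norm]
          · exact hK _ _
      _ = ∫⁻ z : X × X, 2 * (‖g z.1‖ₑ * ‖g z.2‖ₑ) * K z.1 z.2 ∂(m.prod m) := by
          rw [← lintegral_const_mul'']
          · simp only [mul_assoc]
          · exact ((hg.1.comp_fst (ν := m)).enorm.mul (hg.1.comp_snd (μ := m)).enorm).mul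
              hKm.aemeasurable
      _ ≤ ∫⁻ z : X × X, (‖g z.1‖ₑ ^ 2 * K z.1 z.2 + ‖g z.2‖ₑ ^ 2 * K z.1 z.2) ∂(m.prod m) := by
          refine lintegral_mono fun z => ?_
          rw [← add_mul]
          gcongr
          exact hamgm _ _
      _ ≤ C * ∫⁻ x, ‖g x‖ₑ ^ 2 ∂m + C * ∫⁻ x, ‖g x‖ₑ ^ 2 ∂m := by
          rw [lintegral_add_left' hgm1]
          exact add_le_add hone htwo
      _ = _ := (two_mul _).symm
  rwa [ENNReal.mul_le_mul_iff_right (by simp) (by simp)] at h2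

/-- Removal of a Gaussian-type convergence factor. -/
theorem lintegral_le_of_exp_weight {Ω : Type*} [MeasurableSpace Ω] {P : Measure Ω} {q : Ω → ℝ}
    (hq : Measurable q) {F : Ω → ℝ≥0∞} (hF : Measurable F) {C : ℝ≥0∞}
    (h : ∀ δ : ℝ, 0 < δ → ∫⁻ ω, ENNReal.ofReal (Real.exp (-δ * q ω)) * F ω ∂P ≤ C) :
    ∫⁻ ω, F ω ∂P ≤ C := by
  have hlim : ∀ ω, Tendsto (fun n : ℕ =>
      ENNReal.ofReal (Real.exp (-(1 / ((n : ℝ) + 1)) * q ω)) * F ω) atTop (𝓝 (F ω)) := by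
    intro ω
    have h0 : Tendsto (fun n : ℕ => Real.exp (-(1 / ((n : ℝ) + 1)) * q ω)) atTop (𝓝 1) := by
      have := ((tendsto_one_div_add_atTop_nhds_zero_nat (𝕜 := ℝ)).neg.mul_const (q ω)).rexp
      simpa using this
    have h1 := ENNReal.tendsto_ofReal h0
    have h2 := ENNReal.Tendsto.mul_const (b := F ω) h1 (Or.inl (by simp))
    simpa using h2
  calc ∫⁻ ω, F ω ∂P
      = ∫⁻ ω, liminf (fun n : ℕ =>
        ENNReal.ofReal (Real.exp (-(1 / ((n : ℝ) + 1)) * q ω)) * F ω) atTop ∂P :=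
        lintegral_congr fun ω => (hlim ω).liminf_eq.symm
    _ ≤ liminf (fun n : ℕ => ∫⁻ ω,
        ENNReal.ofReal (Real.exp (-(1 / ((n : ℝ) + 1)) * q ω)) * F ω ∂P) atTop :=
        lintegral_liminf_le fun n => by fun_prop
    _ ≤ C := by
        refine liminf_le_of_le (by isBoundedDefault) fun b hb => ?_
        obtain ⟨n, hn⟩ := hb.exists
        exact hn.trans (h _ (by positivity))

end Bessel

section Gaussian

variable {V : Type*} [NormedAddCommGroup V] [InnerProductSpace ℝ V] [FiniteDimensional ℝ V]
  [MeasurableSpace V] [BorelSpace V]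

/-- The Fourier transform of the Gaussian `e^{-δ|x|²}` on an `n`-dimensional space, as a function
of the norm of the frequency. -/
noncomputable def gaussFT (n : ℕ) (δ w : ℝ) : ℝ :=
  (Real.pi / δ) ^ ((n : ℝ) / 2) * Real.exp (-(4 * δ)⁻¹ * w ^ 2)

theorem gaussFT_nonneg (n : ℕ) {δ : ℝ} (hδ : 0 < δ) (w : ℝ) : 0 ≤ gaussFT n δ w := by
  unfold gaussFT; positivity

theorem measurable_gaussFT (n : ℕ) (δ : ℝ) : Measurable (gaussFT n δ) := by
  unfold gaussFT; fun_prop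

/-- The finite measure `e^{-δ|x|²} dx`. -/
noncomputable def gaussWeight (V : Type*) [NormedAddCommGroup V] [InnerProductSpace ℝ V]
    [FiniteDimensional ℝ V] [MeasurableSpace V] [BorelSpace V] (δ : ℝ) : Measure V :=
  volume.withDensity fun x => ENNReal.ofReal (Real.exp (-δ * ‖x‖ ^ 2))

theorem lintegral_gaussian {δ : ℝ} (hδ : 0 < δ) :
    ∫⁻ x : V, ENNReal.ofReal (Real.exp (-δ * ‖x‖ ^ 2)) =
      ENNReal.ofReal ((Real.pi / δ) ^ ((Module.finrank ℝ V : ℝ) / 2)) := by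
  rw [← GaussianFourier.integral_rexp_neg_mul_sq_norm hδ,
    ofReal_integral_eq_lintegral_ofReal _ (ae_of_all _ fun x => (Real.exp_pos _).le)]
  have := (GaussianFourier.integrable_cexp_neg_mul_sq_norm_add (V := V)
    (b := (δ : ℂ)) (by simpa using hδ) 0 0).re
  refine this.congr (ae_of_all _ fun x => ?_)
  have : (-(δ : ℂ) * (‖x‖ : ℂ) ^ 2 + 0 * ((inner ℝ (0 : V) x : ℝ) : ℂ)) =
    ((-δ * ‖x‖ ^ 2 : ℝ) : ℂ) := by push_cast; ring
  simp only [this]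
  rw [← Complex.ofReal_exp]
  rfl

theorem lintegral_gaussWeight (δ : ℝ) {F : V → ℝ≥0∞} (hF : Measurable F) :
    ∫⁻ x, F x ∂(gaussWeight V δ) =
      ∫⁻ x, ENNReal.ofReal (Real.exp (-δ * ‖x‖ ^ 2)) * F x := by
  unfold gaussWeight
  rw [lintegral_withDensity_eq_lintegral_mul₀ (by fun_prop) hF.aemeasurable]
  rfl

theorem isFiniteMeasure_gaussWeight {δ : ℝ} (hδ : 0 < δ) :
    IsFiniteMeasure (gaussWeight V δ) := by
  refine isFiniteMeasure_withDensity ?_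
  rw [lintegral_gaussian hδ]
  exact ENNReal.ofReal_ne_top

theorem integral_gaussWeight_cexp {δ : ℝ} (hδ : 0 < δ) (w : V) :
    ∫ x, Complex.exp (Complex.I * (inner ℝ x w : ℝ)) ∂(gaussWeight V δ) =
      (gaussFT (Module.finrank ℝ V) δ ‖w‖ : ℂ) := by
  unfold gaussWeight
  rw [integral_withDensity_eq_integral_toReal_smul (by fun_prop) (ae_of_all _ fun x => by simp)]
  have h := GaussianFourier.integral_cexp_neg_mul_sq_norm_add (V := V) (b := (δ : ℂ))
    (by simpa using hδ) Complex.I w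
  have h2 : ∀ x : V, (ENNReal.ofReal (Real.exp (-δ * ‖x‖ ^ 2))).toReal •
      Complex.exp (Complex.I * (inner ℝ x w : ℝ)) =
      Complex.exp (-(δ : ℂ) * (‖x‖ : ℂ) ^ 2 + Complex.I * ((inner ℝ w x : ℝ) : ℂ)) := by
    intro x
    rw [ENNReal.toReal_ofReal (Real.exp_pos _).le, Complex.exp_add, Complex.real_smul,
      real_inner_comm x w]
    push_cast
    rfl
  simp only [h2]
  rw [h]
  unfold gaussFT
  rw [Complex.ofReal_mul, Complex.ofReal_cpow (by positivity), Complex.I_sq]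
  push_cast
  congr 2
  field_simp

theorem lintegral_gaussFT_sub {δ : ℝ} (hδ : 0 < δ) (n : ℕ) (v : V) :
    ∫⁻ x : V, ENNReal.ofReal (gaussFT n δ ‖v - x‖) =
      ENNReal.ofReal ((Real.pi / δ) ^ ((n : ℝ) / 2) *
        (4 * Real.pi * δ) ^ ((Module.finrank ℝ V : ℝ) / 2)) := by
  rw [lintegral_sub_left_eq_self (fun y : V => ENNReal.ofReal (gaussFT n δ ‖y‖)) v]
  unfold gaussFT
  simp only [ENNReal.ofReal_mul (Real.rpow_nonneg (by positivity : 0 ≤ Real.pi / δ) _)]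
  rw [lintegral_const_mul _ (by fun_prop), lintegral_gaussian (by positivity : 0 < (4 * δ)⁻¹)]
  congr 4
  field_simp

/-- The `L²` bound for the Fourier transform of an integrable function. -/
theorem lintegral_enorm_fourier_sq_le {g : V → ℂ} (hg : Integrable g) :
    ∫⁻ x, ‖∫ ξ, Complex.exp (Complex.I * (inner ℝ x ξ : ℝ)) * g ξ‖ₑ ^ 2 ≤
      ENNReal.ofReal ((2 * Real.pi) ^ Module.finrank ℝ V) * ∫⁻ ξ, ‖g ξ‖ₑ ^ 2 := by
  have hmeas : Measurable fun x : V =>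
      ‖∫ ξ, Complex.exp (Complex.I * (inner ℝ x ξ : ℝ)) * g ξ‖ₑ ^ 2 := by
    have h1 : Continuous fun x : V =>
        ∫ ξ, Complex.exp (Complex.I * (inner ℝ x ξ : ℝ)) * g ξ := by
      refine continuous_of_dominated (bound := fun ξ => ‖g ξ‖) (fun x => ?_) (fun x => ?_)
        hg.norm (ae_of_all _ fun ξ => by fun_prop)
      · exact (Continuous.aestronglyMeasurable (by fun_prop)).mul hg.1
      · refine ae_of_all _ fun ξ => ?_
        rw [norm_mul, mul_comm Complex.I, Complex.norm_exp_ofReal_mul_I, one_mul]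
    exact h1.measurable.enorm.pow_const 2
  refine lintegral_le_of_exp_weight (q := fun x : V => ‖x‖ ^ 2) (by fun_prop) hmeas
    fun δ hδ => ?_
  have := isFiniteMeasure_gaussWeight (V := V) hδ
  have h := lintegral_enorm_integral_sq_le (gaussWeight V δ) (volume : Measure V)
    (fun x ξ => Complex.exp (Complex.I * (inner ℝ x ξ : ℝ)))
    (Continuous.measurable (by fun_prop))
    (fun x ξ => by rw [mul_comm Complex.I, Complex.norm_exp_ofReal_mul_I]) hg
    (fun x y => ENNReal.ofReal (gaussFT (Module.finrank ℝ V) δ ‖x - y‖))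
    (by
      have := measurable_gaussFT (Module.finrank ℝ V) δ
      fun_prop)
    (fun x y => by rw [norm_sub_rev]) (fun x y => ?_)
    (ENNReal.ofReal ((2 * Real.pi) ^ Module.finrank ℝ V)) (fun x => ?_)
  · rwa [lintegral_gaussWeight δ hmeas] at h
  · have : ∀ ω : V, Complex.exp (Complex.I * (inner ℝ ω x : ℝ)) *
        (starRingEnd ℂ) (Complex.exp (Complex.I * (inner ℝ ω y : ℝ))) =
        Complex.exp (Complex.I * (inner ℝ ω (x - y) : ℝ)) := by
      intro ω
      rw [← Complex.exp_conj, ← Complex.exp_add, inner_sub_right]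
      congr 1
      simp
      ring
    simp only [this]
    rw [integral_gaussWeight_cexp hδ, ← ofReal_norm, Complex.norm_real,
      Real.norm_of_nonneg (gaussFT_nonneg _ hδ _)]
  · rw [lintegral_gaussFT_sub hδ, ← Real.mul_rpow (by positivity) (by positivity)]
    apply le_of_eq
    congr 1
    have : Real.pi / δ * (4 * Real.pi * δ) = (2 * Real.pi) ^ (2 : ℝ) := by
      rw [Real.rpow_two]; field_simp; ring
    rw [this, ← Real.rpow_mul (by positivity), mul_div_cancel₀ _ two_ne_zero, Real.rpow_natCast]

end Gaussian

/-! ### Homogeneous distance functions -/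

theorem lintegral_comp_smul {V : Type*} [NormedAddCommGroup V] [NormedSpace ℝ V]
    [FiniteDimensional ℝ V] [MeasurableSpace V] [BorelSpace V] (μ : Measure V)
    [μ.IsAddHaarMeasure] (f : V → ℝ≥0∞) {r : ℝ} (hr : 0 < r) :
    ∫⁻ x, f (r • x) ∂μ = ENNReal.ofReal (r ^ Module.finrank ℝ V)⁻¹ * ∫⁻ x, f x ∂μ := by
  have h := lintegral_map_equiv (μ := μ) f (Homeomorph.smulOfNeZero r hr.ne').toMeasurableEquiv
  simp only [Homeomorph.toMeasurableEquiv_coe, Homeomorph.smulOfNeZero_apply] at h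
  rw [← h]
  change ∫⁻ a, f a ∂(Measure.map (fun x => r • x) μ) = _
  rw [Measure.map_addHaar_smul μ hr.ne', lintegral_smul_measure, abs_of_pos (by positivity),
    smul_eq_mul]

namespace IsHomogeneousDistance

variable {d : ℕ} {β : ℝ} {ρ : EuclideanSpace ℝ (Fin d) → ℝ}

theorem measurable (hρ : IsHomogeneousDistance β ρ) : Measurable ρ := by
  refine measurable_of_measurable_on_compl_singleton 0 ?_
  exact (hρ.smooth.continuousOn.domRestrict).measurable

theorem map_smul (hρ : IsHomogeneousDistance β ρ) {s : ℝ} (hs : 0 < s)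
    {ξ : EuclideanSpace ℝ (Fin d)} (hξ : ξ ≠ 0) : ρ (s • ξ) = s ^ β * ρ ξ := by
  have h := hρ.homogeneous (s ^ β) (Real.rpow_pos_of_pos hs _) ξ hξ
  rwa [← Real.rpow_mul hs.le, mul_one_div_cancel hρ.degree_pos.ne', Real.rpow_one] at h

theorem exists_bounds (hρ : IsHomogeneousDistance β ρ) (hd : 1 ≤ d) :
    ∃ c C : ℝ, 0 < c ∧ 0 < C ∧ ∀ ξ, ξ ≠ 0 → c * ‖ξ‖ ^ β ≤ ρ ξ ∧ ρ ξ ≤ C * ‖ξ‖ ^ β := by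
  have : Nonempty (Fin d) := ⟨⟨0, hd⟩⟩
  have hS : IsCompact (Metric.sphere (0 : EuclideanSpace ℝ (Fin d)) 1) := isCompact_sphere _ _
  have hSn : (Metric.sphere (0 : EuclideanSpace ℝ (Fin d)) 1).Nonempty :=
    NormedSpace.sphere_nonempty.2 zero_le_one
  have hne : ∀ x ∈ Metric.sphere (0 : EuclideanSpace ℝ (Fin d)) 1, x ≠ 0 := by
    rintro x hx rfl
    simp at hx
  have hcont : ContinuousOn ρ (Metric.sphere (0 : EuclideanSpace ℝ (Fin d)) 1) :=
    hρ.smooth.continuousOn.mono hne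
  obtain ⟨z, hz, hmin⟩ := hS.exists_isMinOn hSn hcont
  obtain ⟨y, hy, hmax⟩ := hS.exists_isMaxOn hSn hcont
  refine ⟨ρ z, ρ y, hρ.pos z (hne z hz), hρ.pos y (hne y hy), fun ξ hξ => ?_⟩
  have hn : 0 < ‖ξ‖ := norm_pos_iff.2 hξ
  have hu : ‖ξ‖⁻¹ • ξ ∈ Metric.sphere (0 : EuclideanSpace ℝ (Fin d)) 1 := by
    rw [mem_sphere_zero_iff_norm, norm_smul, norm_inv, norm_norm, inv_mul_cancel₀ hn.ne']
  have h1 : ρ ξ = ‖ξ‖ ^ β * ρ (‖ξ‖⁻¹ • ξ) := by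
    rw [← hρ.map_smul hn (hne _ hu), smul_smul, mul_inv_cancel₀ hn.ne', one_smul]
  rw [h1, mul_comm (ρ z), mul_comm (ρ y)]
  constructor
  · gcongr; exact hmin hu
  · gcongr; exact hmax hu

end IsHomogeneousDistance

/-- The closed shell `b ≤ ρ ≤ B`, without the origin. -/
def shell {d : ℕ} (ρ : EuclideanSpace ℝ (Fin d) → ℝ) (b B : ℝ) : Set (EuclideanSpace ℝ (Fin d)) :=
  {ξ | ξ ≠ 0 ∧ b ≤ ρ ξ ∧ ρ ξ ≤ B}

namespace IsHomogeneousDistance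

variable {d : ℕ} {β : ℝ} {ρ : EuclideanSpace ℝ (Fin d) → ℝ}

theorem measurableSet_shell (hρ : IsHomogeneousDistance β ρ) (b B : ℝ) :
    MeasurableSet (shell ρ b B) :=
  (measurableSet_singleton (0 : EuclideanSpace ℝ (Fin d))).compl.inter
    ((measurableSet_le measurable_const hρ.measurable).inter
      (measurableSet_le hρ.measurable measurable_const))

theorem exists_norm_le (hρ : IsHomogeneousDistance β ρ) (hd : 1 ≤ d) (B : ℝ) :
    ∃ M : ℝ, 0 < M ∧ ∀ ξ, ξ ≠ 0 → ρ ξ ≤ B → ‖ξ‖ ≤ M := by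
  obtain ⟨c, C, hc, hC, h⟩ := hρ.exists_bounds hd
  refine ⟨(max B 1 / c) ^ (1 / β), Real.rpow_pos_of_pos (by positivity) _, fun ξ hξ hB => ?_⟩
  have hβ := hρ.degree_pos
  have hn : 0 < ‖ξ‖ := norm_pos_iff.2 hξ
  have h2 : ‖ξ‖ ^ β ≤ max B 1 / c := by
    rw [le_div_iff₀ hc, mul_comm]
    exact ((h ξ hξ).1.trans hB).trans (le_max_left _ _)
  calc ‖ξ‖ = (‖ξ‖ ^ β) ^ (1 / β) := by
        rw [← Real.rpow_mul hn.le, mul_one_div_cancel hβ.ne', Real.rpow_one]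
    _ ≤ _ := Real.rpow_le_rpow (by positivity) h2 (by positivity)

theorem exists_le_norm (hρ : IsHomogeneousDistance β ρ) (hd : 1 ≤ d) {b : ℝ} (hb : 0 < b) :
    ∃ m : ℝ, 0 < m ∧ ∀ ξ, ξ ≠ 0 → b ≤ ρ ξ → m ≤ ‖ξ‖ := by
  obtain ⟨c, C, hc, hC, h⟩ := hρ.exists_bounds hd
  refine ⟨(b / C) ^ (1 / β), Real.rpow_pos_of_pos (by positivity) _, fun ξ hξ hB => ?_⟩
  have hβ := hρ.degree_pos
  have hn : 0 < ‖ξ‖ := norm_pos_iff.2 hξ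
  have h2 : b / C ≤ ‖ξ‖ ^ β := by
    rw [div_le_iff₀ hC, mul_comm]
    exact hB.trans (h ξ hξ).2
  calc (b / C) ^ (1 / β) ≤ (‖ξ‖ ^ β) ^ (1 / β) :=
        Real.rpow_le_rpow (by positivity) h2 (by positivity)
    _ = ‖ξ‖ := by
        rw [← Real.rpow_mul hn.le, mul_one_div_cancel hβ.ne', Real.rpow_one]

theorem isCompact_shell (hρ : IsHomogeneousDistance β ρ) (hd : 1 ≤ d) {b : ℝ} (hb : 0 < b)
    (B : ℝ) : IsCompact (shell ρ b B) := by
  obtain ⟨M, hM, hM'⟩ := hρ.exists_norm_le hd B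
  obtain ⟨m, hm, hm'⟩ := hρ.exists_le_norm hd hb
  have hK : IsCompact (Metric.closedBall (0 : EuclideanSpace ℝ (Fin d)) M ∩
      (Metric.ball 0 m)ᶜ) := (isCompact_closedBall _ _).inter_right Metric.isOpen_ball.isClosed_compl
  have hne : ∀ ξ ∈ Metric.closedBall (0 : EuclideanSpace ℝ (Fin d)) M ∩ (Metric.ball 0 m)ᶜ,
      ξ ≠ 0 := by
    rintro ξ ⟨-, h⟩ rfl
    exact h (by simpa using hm)
  have heq : shell ρ b B = (Metric.closedBall (0 : EuclideanSpace ℝ (Fin d)) M ∩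
      (Metric.ball 0 m)ᶜ) ∩ ρ ⁻¹' (Icc b B) := by
    ext ξ
    constructor
    · rintro ⟨h0, h1, h2⟩
      exact ⟨⟨by simpa using hM' ξ h0 h2, by simpa using hm' ξ h0 h1⟩, h1, h2⟩
    · rintro ⟨h, h1⟩
      exact ⟨hne ξ h, h1⟩
  rw [heq]
  exact hK.of_isClosed_subset ((hρ.smooth.continuousOn.mono hne).preimage_isClosed_of_isClosed
    hK.isClosed isClosed_Icc) inter_subset_left

/-- Averaging over dilations: the mass of a thin shell inside a bump at scale `η` is at most `η⁻¹`
times the product of the masses.  No polar coordinates are needed, because the dilation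
`(1 + u)^{1/β}` multiplies `ρ` by exactly `1 + u`. -/
theorem lintegral_shell_le (hρ : IsHomogeneousDistance β ρ) :
    ∃ C : ℝ, 0 < C ∧ ∀ (k : ℝ → ℝ≥0∞) (Γ Γ' : EuclideanSpace ℝ (Fin d) → ℝ≥0∞), Measurable k →
      Measurable Γ' → ∀ η : ℝ, 0 < η → η ≤ 1 →
      (∀ u ∈ Icc 0 η, ∀ ξ, (1 + u) ^ (1 / β) • ξ ∈ shell ρ (1 / 3) 3 →
        Γ ((1 + u) ^ (1 / β) • ξ) ≤ Γ' ξ) → ∀ v : ℝ,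
      ENNReal.ofReal η * ∫⁻ ξ in shell ρ (1 / 3) 3, k (v - ρ ξ) * Γ ξ ≤
        ENNReal.ofReal C * (∫⁻ y, k y) * ∫⁻ ξ, Γ' ξ := by
  have hβ := hρ.degree_pos
  have hρm := hρ.measurable
  refine ⟨((2 : ℝ) ^ (1 / β)) ^ d * 6, by positivity,
    fun k Γ Γ' hk hΓ' η hη hη1 hΓ v => ?_⟩
  set A := shell ρ (1 / 3) 3
  set f : EuclideanSpace ℝ (Fin d) → ℝ≥0∞ := A.indicator fun ξ => k (v - ρ ξ) * Γ ξ
  set F : ℝ → EuclideanSpace ℝ (Fin d) → ℝ≥0∞ := fun u ξ =>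
    {ξ | ξ ≠ 0 ∧ 1 / 6 ≤ ρ ξ}.indicator (fun ξ => k (v - (1 + u) * ρ ξ) * Γ' ξ) ξ
  have hA' : MeasurableSet {ξ : EuclideanSpace ℝ (Fin d) | ξ ≠ 0 ∧ 1 / 6 ≤ ρ ξ} :=
    (measurableSet_singleton (0 : EuclideanSpace ℝ (Fin d))).compl.inter
      (measurableSet_le measurable_const hρ.measurable)
  have hFm : Measurable (Function.uncurry F) := by
    have : Function.uncurry F = (Prod.snd ⁻¹' {ξ | ξ ≠ 0 ∧ 1 / 6 ≤ ρ ξ}).indicator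
        (fun z : ℝ × EuclideanSpace ℝ (Fin d) => k (v - (1 + z.1) * ρ z.2) * Γ' z.2) := by
      ext z
      simp only [Function.uncurry, F, indicator, mem_preimage]
    rw [this]
    exact Measurable.indicator (by fun_prop) (measurable_snd hA')
  have hJ : ∫⁻ ξ in A, k (v - ρ ξ) * Γ ξ = ∫⁻ ξ, f ξ :=
    (lintegral_indicator (hρ.measurableSet_shell _ _) _).symm
  have hstep : ∀ u ∈ Icc 0 η, ∫⁻ ξ, f ξ ≤
      ENNReal.ofReal (((2 : ℝ) ^ (1 / β)) ^ d) * ∫⁻ ξ, F u ξ := by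
    intro u hu
    have hu0 : 0 < 1 + u := by linarith [hu.1]
    set θ := (1 + u) ^ (1 / β)
    have hθ : 0 < θ := Real.rpow_pos_of_pos hu0 _
    have h1 := lintegral_comp_smul (volume : Measure (EuclideanSpace ℝ (Fin d))) f hθ
    have h2 : ∫⁻ ξ, f ξ = ENNReal.ofReal (θ ^ d) * ∫⁻ ξ, f (θ • ξ) := by
      rw [h1, ← mul_assoc, ← ENNReal.ofReal_mul (by positivity), finrank_euclideanSpace_fin,
        mul_inv_cancel₀ (by positivity)]
      simp
    rw [h2]
    have hθ2 : θ ≤ 2 ^ (1 / β) :=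
      Real.rpow_le_rpow hu0.le (by linarith [hu.2]) (by positivity)
    gcongr with ξ
    by_cases hmem : θ • ξ ∈ A
    · have hξ0 : ξ ≠ 0 := by
        rintro rfl
        exact hmem.1 (by simp)
      have hhom : ρ (θ • ξ) = (1 + u) * ρ ξ := hρ.homogeneous (1 + u) hu0 ξ hξ0
      have hlow : 1 / 6 ≤ ρ ξ := by
        have := hmem.2.1
        rw [hhom] at this
        have := hρ.pos ξ hξ0
        nlinarith [hu.2]
      have e1 : f (θ • ξ) = k (v - (1 + u) * ρ ξ) * Γ (θ • ξ) := by
        rw [← hhom]; exact indicator_of_mem hmem _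
      have e2 : F u ξ = k (v - (1 + u) * ρ ξ) * Γ' ξ := 
        indicator_of_mem (s := {ξ | ξ ≠ 0 ∧ 1 / 6 ≤ ρ ξ}) ⟨hξ0, hlow⟩ _
      rw [e1, e2]
      gcongr
      exact hΓ u hu ξ hmem
    · have : f (θ • ξ) = 0 := indicator_of_notMem hmem _
      rw [this]
      exact zero_le
  have hinner : ∀ ξ, ∫⁻ u in Icc 0 η, F u ξ ≤ 6 * (∫⁻ y, k y) * Γ' ξ := by
    intro ξ
    by_cases hξ : ξ ≠ 0 ∧ 1 / 6 ≤ ρ ξ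
    · have hF : ∀ u, F u ξ = k (v - (1 + u) * ρ ξ) * Γ' ξ := fun u =>
        indicator_of_mem (s := {ξ | ξ ≠ 0 ∧ 1 / 6 ≤ ρ ξ}) hξ _
      simp only [hF]
      have hpos : 0 < ρ ξ := by linarith [hξ.2]
      calc ∫⁻ u in Icc 0 η, k (v - (1 + u) * ρ ξ) * Γ' ξ
          ≤ ∫⁻ u, k (v - (1 + u) * ρ ξ) * Γ' ξ := setLIntegral_le_lintegral _ _
        _ = (∫⁻ u, k (v - (1 + u) * ρ ξ)) * Γ' ξ := lintegral_mul_const _ (by fun_prop)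
        _ ≤ 6 * (∫⁻ y, k y) * Γ' ξ := by
            gcongr
            have h1 := lintegral_comp_smul (volume : Measure ℝ)
              (fun y => k (v - ρ ξ - y)) hpos
            have h2 : ∀ u : ℝ, k (v - ρ ξ - ρ ξ • u) = k (v - (1 + u) * ρ ξ) := by
              intro u
              congr 1
              rw [smul_eq_mul]; ring
            simp only [h2] at h1
            rw [h1, lintegral_sub_left_eq_self, Module.finrank_self, pow_one]
            gcongr
            calc ENNReal.ofReal (ρ ξ)⁻¹ ≤ ENNReal.ofReal 6 := by
                  refine ENNReal.ofReal_le_ofReal ?_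
                  rw [inv_le_comm₀ hpos (by norm_num)]
                  linarith [hξ.2]
              _ = 6 := by norm_num
    · have hF : ∀ u, F u ξ = 0 := fun u =>
        indicator_of_notMem (s := {ξ | ξ ≠ 0 ∧ 1 / 6 ≤ ρ ξ}) hξ _
      simp [hF]
  rw [hJ]
  calc ENNReal.ofReal η * ∫⁻ ξ, f ξ = ∫⁻ u in Icc 0 η, ∫⁻ ξ, f ξ := by
        rw [setLIntegral_const, Real.volume_Icc, sub_zero, mul_comm]
    _ ≤ ∫⁻ u in Icc 0 η, ENNReal.ofReal (((2 : ℝ) ^ (1 / β)) ^ d) * ∫⁻ ξ, F u ξ :=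
        setLIntegral_mono' measurableSet_Icc hstep
    _ = ENNReal.ofReal (((2 : ℝ) ^ (1 / β)) ^ d) * ∫⁻ ξ, ∫⁻ u in Icc 0 η, F u ξ := by
        rw [lintegral_const_mul' _ _ ENNReal.ofReal_ne_top, lintegral_lintegral_swap]
        exact hFm.aemeasurable
    _ ≤ ENNReal.ofReal (((2 : ℝ) ^ (1 / β)) ^ d) * ∫⁻ ξ, 6 * (∫⁻ y, k y) * Γ' ξ := by
        gcongr with ξ
        exact hinner ξ
    _ = _ := by
        rw [lintegral_const_mul _ hΓ', ENNReal.ofReal_mul (by positivity)]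
        norm_num
        ring

end IsHomogeneousDistance

/-! ### Local smoothing -/

theorem gaussFT_neg (n : ℕ) (δ w : ℝ) : gaussFT n δ (-w) = gaussFT n δ w := by
  simp [gaussFT]

theorem gaussFT_abs (n : ℕ) (δ w : ℝ) : gaussFT n δ |w| = gaussFT n δ w := by
  simp [gaussFT]

theorem lintegral_gaussFT_one {δ : ℝ} (hδ : 0 < δ) :
    ∫⁻ y : ℝ, ENNReal.ofReal (gaussFT 1 δ y) = ENNReal.ofReal (2 * Real.pi) := by
  have h := lintegral_gaussFT_sub (V := ℝ) hδ 1 0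
  simp only [zero_sub, norm_neg, Real.norm_eq_abs, gaussFT_abs] at h
  rw [h, Module.finrank_self, ← Real.mul_rpow (by positivity) (by positivity)]
  congr 1
  have : Real.pi / δ * (4 * Real.pi * δ) = (2 * Real.pi) ^ (2 : ℝ) := by
    rw [Real.rpow_two]; field_simp; ring
  rw [this, ← Real.rpow_mul (by positivity)]
  norm_num

theorem integral_gaussWeight_real_cexp {δ : ℝ} (hδ : 0 < δ) (w : ℝ) :
    ∫ τ : ℝ, Complex.exp (Complex.I * ((-(τ * w) : ℝ) : ℂ)) ∂(gaussWeight ℝ δ) =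
      (gaussFT 1 δ w : ℂ) := by
  have h := integral_gaussWeight_cexp (V := ℝ) hδ (-w)
  rw [Module.finrank_self, Real.norm_eq_abs, gaussFT_abs, gaussFT_neg] at h
  rw [← h]
  congr 1 with τ
  congr 3
  simp [mul_comm]

theorem one_add_rpow_sub_one_le {α u : ℝ} (hα : 0 ≤ α) (hu : 0 ≤ u) (hu1 : u ≤ 1) :
    (1 + u) ^ α - 1 ≤ α * Real.exp α * u := by
  have h1 : (1 + u) ^ α ≤ Real.exp (α * u) := by
    rw [Real.rpow_def_of_pos (by linarith), mul_comm]
    gcongr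
    have := Real.log_le_sub_one_of_pos (show 0 < 1 + u by linarith)
    linarith
  have h2 : Real.exp (α * u) ≤ 1 + (α * u) * Real.exp (α * u) := by
    have := Real.add_one_le_exp (-(α * u))
    have h3 := mul_le_mul_of_nonneg_right this (Real.exp_pos (α * u)).le
    rw [← Real.exp_add] at h3
    simp at h3
    nlinarith
  have h3 : (α * u) * Real.exp (α * u) ≤ (α * u) * Real.exp α := by
    gcongr
    nlinarith
  nlinarith

section Kato

variable {d : ℕ} {β : ℝ} {ρ : EuclideanSpace ℝ (Fin d) → ℝ}

theorem norm_cexp_I_mul_ofReal (x : ℝ) : ‖Complex.exp (Complex.I * (x : ℂ))‖ = 1 := by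
  rw [mul_comm, Complex.norm_exp_ofReal_mul_I]

theorem cexp_I_mul_conj (a b : ℝ) : Complex.exp (Complex.I * (a : ℂ)) *
    (starRingEnd ℂ) (Complex.exp (Complex.I * (b : ℂ))) =
    Complex.exp (Complex.I * ((a - b : ℝ) : ℂ)) := by
  rw [← Complex.exp_conj, ← Complex.exp_add]
  congr 1
  simp
  ring

/-- At each fixed point, the evolution `e^{-iτρ(D)}` of a function with frequencies in a shell is
square integrable in `τ`. -/
theorem IsHomogeneousDistance.lintegral_time_le (hρ : IsHomogeneousDistance β ρ) (hd : 1 ≤ d) :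
    ∃ C : ℝ, 0 < C ∧ ∀ g : EuclideanSpace ℝ (Fin d) → ℂ,
      IntegrableOn g (shell ρ (1 / 3) 3) →
      ∫⁻ τ : ℝ, ‖∫ ξ in shell ρ (1 / 3) 3,
        Complex.exp (Complex.I * ((-(τ * ρ ξ) : ℝ) : ℂ)) * g ξ‖ₑ ^ 2 ≤
        ENNReal.ofReal C * ∫⁻ ξ in shell ρ (1 / 3) 3, ‖g ξ‖ₑ ^ 2 := by
  obtain ⟨C₀, hC₀, hgeo⟩ := hρ.lintegral_shell_le
  obtain ⟨M, hM, hM'⟩ := hρ.exists_norm_le hd 3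
  have hβ := hρ.degree_pos
  have hρm := hρ.measurable
  set B : ℝ := (volume (Metric.closedBall (0 : EuclideanSpace ℝ (Fin d)) M)).toReal
  have hBfin : volume (Metric.closedBall (0 : EuclideanSpace ℝ (Fin d)) M) ≠ ⊤ :=
    (isCompact_closedBall _ _).measure_lt_top.ne
  have hBpos : 0 < B := ENNReal.toReal_pos (Metric.measure_closedBall_pos _ _ hM).ne' hBfin
  refine ⟨C₀ * (2 * Real.pi) * B, by positivity, fun g hg => ?_⟩
  set A := shell ρ (1 / 3) 3
  have hcont : Continuous fun τ : ℝ => ∫ ξ in A,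
      Complex.exp (Complex.I * ((-(τ * ρ ξ) : ℝ) : ℂ)) * g ξ := by
    refine continuous_of_dominated (bound := fun ξ => ‖g ξ‖) (fun τ => ?_) (fun τ => ?_)
      hg.norm (ae_of_all _ fun ξ => by fun_prop)
    · exact (Measurable.aestronglyMeasurable (by fun_prop)).mul hg.1
    · refine ae_of_all _ fun ξ => ?_
      rw [norm_mul, norm_cexp_I_mul_ofReal, one_mul]
  have hmeas := hcont.measurable.enorm.pow_const 2
  refine lintegral_le_of_exp_weight (q := fun τ : ℝ => ‖τ‖ ^ 2) (by fun_prop) hmeas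
    fun δ hδ => ?_
  have := isFiniteMeasure_gaussWeight (V := ℝ) hδ
  have hgm := measurable_gaussFT 1 δ
  have h := lintegral_enorm_integral_sq_le (gaussWeight ℝ δ) (volume.restrict A)
    (fun τ ξ => Complex.exp (Complex.I * ((-(τ * ρ ξ) : ℝ) : ℂ)))
    (by unfold Function.uncurry; fun_prop)
    (fun τ ξ => (norm_cexp_I_mul_ofReal _).le) hg
    (fun x y => ENNReal.ofReal (gaussFT 1 δ (ρ x - ρ y)))
    (by unfold Function.uncurry; fun_prop)
    (fun x y => by rw [← gaussFT_neg, neg_sub]) (fun x y => ?_)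
    (ENNReal.ofReal (C₀ * (2 * Real.pi) * B)) (fun x => ?_)
  · rwa [lintegral_gaussWeight δ hmeas] at h
  · simp only [cexp_I_mul_conj]
    have : ∀ τ : ℝ, -(τ * ρ x) - -(τ * ρ y) = -(τ * (ρ x - ρ y)) := fun τ => by ring
    simp only [this]
    rw [integral_gaussWeight_real_cexp hδ, ← ofReal_norm, Complex.norm_real,
      Real.norm_of_nonneg (gaussFT_nonneg _ hδ _)]
  · have h1 := hgeo (fun v => ENNReal.ofReal (gaussFT 1 δ v)) (fun _ => 1)
      ((Metric.closedBall 0 M).indicator fun _ => 1) (by fun_prop)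
      (measurable_const.indicator Metric.isClosed_closedBall.measurableSet) 1 one_pos le_rfl
      (fun u hu ξ hξ => ?_) (ρ x)
    · simp only [ENNReal.ofReal_one, one_mul, mul_one] at h1
      refine h1.trans (le_of_eq ?_)
      rw [lintegral_gaussFT_one hδ, lintegral_indicator Metric.isClosed_closedBall.measurableSet,
        setLIntegral_one, ← ENNReal.ofReal_toReal hBfin, ← ENNReal.ofReal_mul (by positivity),
        ← ENNReal.ofReal_mul (by positivity)]
    · rw [indicator_of_mem]
      have h2 := hM' _ hξ.1 hξ.2.2
      have h3 : 1 ≤ (1 + u) ^ (1 / β) := Real.one_le_rpow (by linarith [hu.1]) (by positivity)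
      rw [norm_smul, Real.norm_of_nonneg (by linarith)] at h2
      simp only [mem_closedBall_zero_iff]
      nlinarith [norm_nonneg ξ]

/-- Local smoothing (Kato's inequality): on the ball of radius `r`, the evolution `e^{-iτρ(D)}` of
a function with frequencies in a shell has space-time `L²` norm `O(√r)`. -/
theorem IsHomogeneousDistance.lintegral_ball_time_le (hρ : IsHomogeneousDistance β ρ)
    (hd : 1 ≤ d) :
    ∃ C : ℝ, 0 < C ∧ ∀ g : EuclideanSpace ℝ (Fin d) → ℂ,
      IntegrableOn g (shell ρ (1 / 3) 3) → ∀ r : ℝ, 1 ≤ r →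
      ∫⁻ z : ℝ × EuclideanSpace ℝ (Fin d), ‖∫ ξ in shell ρ (1 / 3) 3,
        Complex.exp (Complex.I * ((inner ℝ z.2 ξ - z.1 * ρ ξ : ℝ) : ℂ)) * g ξ‖ₑ ^ 2
          ∂(volume.prod (volume.restrict (Metric.ball 0 r))) ≤
        ENNReal.ofReal (C * r) * ∫⁻ ξ in shell ρ (1 / 3) 3, ‖g ξ‖ₑ ^ 2 := by
  obtain ⟨C₀, hC₀, hgeo⟩ := hρ.lintegral_shell_le
  obtain ⟨M, hM, hM'⟩ := hρ.exists_norm_le hd 3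
  have hβ := hρ.degree_pos
  have hρm := hρ.measurable
  set α := 1 / β with hα
  have hα0 : 0 < α := by positivity
  set c : ℝ := (α * Real.exp α * M) ^ 2 / 4 with hc
  set G : ℝ := Real.exp c * 2 ^ ((d : ℝ) / 2) * (2 * Real.pi) ^ d with hG
  refine ⟨Real.exp 1 * (C₀ * (2 * Real.pi) * G), by positivity, fun g hg r hr => ?_⟩
  have hr0 : 0 < r := by linarith
  set A := shell ρ (1 / 3) 3
  set b : ℝ := (r ^ 2)⁻¹ with hb
  have hb0 : 0 < b := by positivity
  have hcont : Continuous fun z : ℝ × EuclideanSpace ℝ (Fin d) => ∫ ξ in A,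
      Complex.exp (Complex.I * ((inner ℝ z.2 ξ - z.1 * ρ ξ : ℝ) : ℂ)) * g ξ := by
    refine continuous_of_dominated (bound := fun ξ => ‖g ξ‖) (fun τ => ?_) (fun τ => ?_)
      hg.norm (ae_of_all _ fun ξ => by fun_prop)
    · exact (Measurable.aestronglyMeasurable (by fun_prop)).mul hg.1
    · refine ae_of_all _ fun ξ => ?_
      rw [norm_mul, norm_cexp_I_mul_ofReal, one_mul]
  have hmeas := hcont.measurable.enorm.pow_const 2
  refine lintegral_le_of_exp_weight
    (q := fun z : ℝ × EuclideanSpace ℝ (Fin d) => ‖z.1‖ ^ 2) (by fun_prop) hmeas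
    fun δ hδ => ?_
  have := isFiniteMeasure_gaussWeight (V := ℝ) hδ
  have := isFiniteMeasure_gaussWeight (V := EuclideanSpace ℝ (Fin d)) hb0
  have hgm := measurable_gaussFT 1 δ
  have hgm' := measurable_gaussFT d b
  have hgm'' := measurable_gaussFT d (2 * b)
  have h := lintegral_enorm_integral_sq_le
    ((gaussWeight ℝ δ).prod (gaussWeight (EuclideanSpace ℝ (Fin d)) b)) (volume.restrict A)
    (fun z ξ => Complex.exp (Complex.I * ((inner ℝ z.2 ξ - z.1 * ρ ξ : ℝ) : ℂ)))
    (by unfold Function.uncurry; fun_prop)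
    (fun τ ξ => (norm_cexp_I_mul_ofReal _).le) hg
    (fun x y => ENNReal.ofReal (gaussFT 1 δ (ρ x - ρ y)) * ENNReal.ofReal (gaussFT d b ‖x - y‖))
    (by unfold Function.uncurry; fun_prop)
    (fun x y => by rw [← gaussFT_neg, neg_sub, norm_sub_rev]) (fun x y => ?_)
    (ENNReal.ofReal ((C₀ * (2 * Real.pi) * G) * r)) (fun x => ?_)
  · set F : ℝ × EuclideanSpace ℝ (Fin d) → ℝ≥0∞ := fun z => ‖∫ ξ in A,
      Complex.exp (Complex.I * ((inner ℝ z.2 ξ - z.1 * ρ ξ : ℝ) : ℂ)) * g ξ‖ₑ ^ 2 with hF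
    have hFm : Measurable F := hmeas
    have hexp : ∀ x ∈ Metric.ball (0 : EuclideanSpace ℝ (Fin d)) r,
        1 ≤ ENNReal.ofReal (Real.exp 1) * ENNReal.ofReal (Real.exp (-b * ‖x‖ ^ 2)) := by
      intro x hx
      rw [← ENNReal.ofReal_mul (Real.exp_pos _).le, ← Real.exp_add]
      refine ENNReal.one_le_ofReal.2 (Real.one_le_exp ?_)
      have h1 : ‖x‖ ^ 2 ≤ r ^ 2 := by
        have := mem_ball_zero_iff.1 hx
        gcongr
      have h2 : b * ‖x‖ ^ 2 ≤ 1 := by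
        rw [hb, inv_mul_le_iff₀ (by positivity)]
        simpa using h1
      linarith
    calc ∫⁻ z, ENNReal.ofReal (Real.exp (-δ * ‖z.1‖ ^ 2)) * F z
          ∂(volume.prod (volume.restrict (Metric.ball 0 r)))
        = ∫⁻ x in Metric.ball 0 r, ∫⁻ τ : ℝ,
          ENNReal.ofReal (Real.exp (-δ * ‖τ‖ ^ 2)) * F (τ, x) := by
          rw [lintegral_prod_symm _ (by fun_prop)]
      _ ≤ ∫⁻ x in Metric.ball 0 r, ENNReal.ofReal (Real.exp 1) *
          (ENNReal.ofReal (Real.exp (-b * ‖x‖ ^ 2)) * ∫⁻ τ : ℝ,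
          ENNReal.ofReal (Real.exp (-δ * ‖τ‖ ^ 2)) * F (τ, x)) := by
          refine setLIntegral_mono' Metric.isOpen_ball.measurableSet fun x hx => ?_
          rw [← mul_assoc]
          exact le_mul_of_one_le_left zero_le (hexp x hx)
      _ ≤ ∫⁻ x, ENNReal.ofReal (Real.exp 1) *
          (ENNReal.ofReal (Real.exp (-b * ‖x‖ ^ 2)) * ∫⁻ τ : ℝ,
          ENNReal.ofReal (Real.exp (-δ * ‖τ‖ ^ 2)) * F (τ, x)) := setLIntegral_le_lintegral _ _
      _ = ENNReal.ofReal (Real.exp 1) * ∫⁻ z, F z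
          ∂((gaussWeight ℝ δ).prod (gaussWeight (EuclideanSpace ℝ (Fin d)) b)) := by
          rw [lintegral_const_mul' _ _ ENNReal.ofReal_ne_top,
            lintegral_prod_symm _ hFm.aemeasurable]
          have hin : ∀ x, ∫⁻ τ, F (τ, x) ∂(gaussWeight ℝ δ) = ∫⁻ τ : ℝ,
              ENNReal.ofReal (Real.exp (-δ * ‖τ‖ ^ 2)) * F (τ, x) := fun x =>
            lintegral_gaussWeight δ (by fun_prop)
          simp only [hin]
          rw [lintegral_gaussWeight b]
          exact Measurable.lintegral_prod_left' (f := fun z : ℝ × EuclideanSpace ℝ (Fin d) =>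
              ENNReal.ofReal (Real.exp (-δ * ‖z.1‖ ^ 2)) * F z) (by fun_prop)
      _ ≤ ENNReal.ofReal (Real.exp 1) * (ENNReal.ofReal ((C₀ * (2 * Real.pi) * G) * r) *
          ∫⁻ ξ in A, ‖g ξ‖ₑ ^ 2) := by gcongr
      _ = _ := by
          rw [← mul_assoc, ← ENNReal.ofReal_mul (Real.exp_pos _).le]
          congr 2
          ring
  · simp only [cexp_I_mul_conj]
    have : ∀ z : ℝ × EuclideanSpace ℝ (Fin d),
        Complex.exp (Complex.I * ((inner ℝ z.2 x - z.1 * ρ x - (inner ℝ z.2 y - z.1 * ρ y) : ℝ) : ℂ))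
        = Complex.exp (Complex.I * ((-(z.1 * (ρ x - ρ y)) : ℝ) : ℂ)) *
          Complex.exp (Complex.I * ((inner ℝ z.2 (x - y) : ℝ) : ℂ)) := by
      intro z
      rw [← Complex.exp_add, inner_sub_right]
      congr 1
      push_cast
      ring
    simp only [this]
    rw [integral_prod_mul (fun τ : ℝ => Complex.exp (Complex.I * ((-(τ * (ρ x - ρ y)) : ℝ) : ℂ)))
      (fun w : EuclideanSpace ℝ (Fin d) =>
        Complex.exp (Complex.I * ((inner ℝ w (x - y) : ℝ) : ℂ))),
      integral_gaussWeight_real_cexp hδ, integral_gaussWeight_cexp hb0, enorm_mul,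
      finrank_euclideanSpace_fin, ← ofReal_norm, ← ofReal_norm, Complex.norm_real,
      Complex.norm_real, Real.norm_of_nonneg (gaussFT_nonneg _ hδ _),
      Real.norm_of_nonneg (gaussFT_nonneg _ hb0 _)]
  · have h1 := hgeo (fun v => ENNReal.ofReal (gaussFT 1 δ v))
      (fun y => ENNReal.ofReal (gaussFT d b ‖x - y‖))
      (fun y => ENNReal.ofReal (Real.exp c * 2 ^ ((d : ℝ) / 2)) *
        ENNReal.ofReal (gaussFT d (2 * b) ‖x - y‖)) (by fun_prop) (by fun_prop) r⁻¹
      (by positivity) (inv_le_one_of_one_le₀ hr) (fun u hu ξ hξ => ?_) (ρ x)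
    · rw [lintegral_gaussFT_one hδ, lintegral_const_mul _ (by fun_prop),
        lintegral_gaussFT_sub (by positivity), finrank_euclideanSpace_fin,
        ← ENNReal.ofReal_mul (by positivity), ← ENNReal.ofReal_mul (by positivity),
        ← ENNReal.ofReal_mul (by positivity),
        ← Real.mul_rpow (by positivity) (by positivity)] at h1
      have h2 : Real.pi / (2 * b) * (4 * Real.pi * (2 * b)) = (2 * Real.pi) ^ (2 : ℝ) := by
        rw [Real.rpow_two]; field_simp; ring
      rw [h2, ← Real.rpow_mul (by positivity), mul_div_cancel₀ _ two_ne_zero,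
        Real.rpow_natCast, ← hG] at h1
      calc _ = ENNReal.ofReal r * (ENNReal.ofReal r⁻¹ * ∫⁻ y in A,
            ENNReal.ofReal (gaussFT 1 δ (ρ x - ρ y)) * ENNReal.ofReal (gaussFT d b ‖x - y‖)) := by
            rw [← mul_assoc, ← ENNReal.ofReal_mul hr0.le, mul_inv_cancel₀ hr0.ne',
              ENNReal.ofReal_one, one_mul]
        _ ≤ ENNReal.ofReal r * ENNReal.ofReal (C₀ * (2 * Real.pi) * G) := by gcongr
        _ = _ := by rw [← ENNReal.ofReal_mul hr0.le, mul_comm]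
    · have hu0 := hu.1
      have hu1 : u ≤ 1 := hu.2.trans (inv_le_one_of_one_le₀ hr)
      have h2 := hM' _ hξ.1 hξ.2.2
      set θ := (1 + u) ^ α
      have h3 : 1 ≤ θ := Real.one_le_rpow (by linarith) hα0.le
      have h4 : θ - 1 ≤ α * Real.exp α * u := one_add_rpow_sub_one_le hα0.le hu0 hu1
      have hξM : ‖ξ‖ ≤ M := by
        rw [norm_smul, Real.norm_of_nonneg (by linarith)] at h2
        nlinarith [norm_nonneg ξ]
      have h5 : ‖x - ξ‖ ≤ ‖x - θ • ξ‖ + α * Real.exp α * M / r := by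
        have e1 : x - ξ = (x - θ • ξ) + (θ - 1) • ξ := by rw [sub_smul, one_smul]; abel
        rw [e1]
        refine (norm_add_le _ _).trans ?_
        gcongr
        rw [norm_smul, Real.norm_of_nonneg (by linarith)]
        calc (θ - 1) * ‖ξ‖ ≤ (α * Real.exp α * r⁻¹) * M := by
              have : α * Real.exp α * u ≤ α * Real.exp α * r⁻¹ := by gcongr; exact hu.2
              gcongr
              exact h4.trans this
          _ = _ := by ring
      have h6 : ‖x - ξ‖ ^ 2 ≤ 2 * ‖x - θ • ξ‖ ^ 2 + 2 * (α * Real.exp α * M / r) ^ 2 := by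
        calc ‖x - ξ‖ ^ 2 ≤ (‖x - θ • ξ‖ + α * Real.exp α * M / r) ^ 2 := by gcongr
          _ ≤ _ := by nlinarith [sq_nonneg (‖x - θ • ξ‖ - α * Real.exp α * M / r)]
      rw [← ENNReal.ofReal_mul (by positivity)]
      refine ENNReal.ofReal_le_ofReal ?_
      unfold gaussFT
      have e2 : (Real.pi / b) ^ ((d : ℝ) / 2) =
          2 ^ ((d : ℝ) / 2) * (Real.pi / (2 * b)) ^ ((d : ℝ) / 2) := by
        rw [← Real.mul_rpow (by positivity) (by positivity)]
        congr 1
        field_simp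
      have e3 : Real.exp (-(4 * b)⁻¹ * ‖x - θ • ξ‖ ^ 2) ≤
          Real.exp c * Real.exp (-(4 * (2 * b))⁻¹ * ‖x - ξ‖ ^ 2) := by
        rw [← Real.exp_add]
        refine Real.exp_le_exp.2 ?_
        have e4 : (4 * b)⁻¹ = r ^ 2 / 4 := by rw [hb]; field_simp
        have e5 : (4 * (2 * b))⁻¹ = r ^ 2 / 8 := by rw [hb]; field_simp; norm_num
        rw [e4, e5]
        have e6 : r ^ 2 / 8 * (2 * (α * Real.exp α * M / r) ^ 2) = c := by
          rw [hc]; field_simp; ring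
        have e7 : r ^ 2 / 8 * ‖x - ξ‖ ^ 2 ≤ r ^ 2 / 8 *
            (2 * ‖x - θ • ξ‖ ^ 2 + 2 * (α * Real.exp α * M / r) ^ 2) := by gcongr
        nlinarith
      rw [e2]
      calc _ ≤ 2 ^ ((d : ℝ) / 2) * (Real.pi / (2 * b)) ^ ((d : ℝ) / 2) *
          (Real.exp c * Real.exp (-(4 * (2 * b))⁻¹ * ‖x - ξ‖ ^ 2)) := by gcongr
        _ = _ := by ring

end Kato

/-! ### Oscillatory integrals -/

section Amplitude

set_option linter.unusedSectionVars false

variable {V : Type*} [NormedAddCommGroup V] [InnerProductSpace ℝ V] [FiniteDimensional ℝ V]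
  [MeasurableSpace V] [BorelSpace V]

/-- The unnormalized inverse Fourier transform `∫ m(ξ) e^{i⟨x,ξ⟩} dξ`. -/
noncomputable def invFT (m : V → ℂ) (x : V) : ℂ :=
  ∫ ξ, m ξ * Complex.exp (Complex.I * (inner ℝ x ξ : ℝ))

/-- Smooth compactly supported amplitudes whose support lies in `K`. -/
structure IsAmplitude (K : Set V) (a : V → ℂ) : Prop where
  contDiff : ContDiff ℝ (⊤ : ℕ∞) a
  hasCompactSupport : HasCompactSupport a
  tsupport_subset : tsupport a ⊆ K

namespace IsAmplitude

variable {K : Set V} {a : V → ℂ}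

theorem integrable (ha : IsAmplitude K a) : Integrable a :=
  ha.contDiff.continuous.integrable_of_hasCompactSupport ha.hasCompactSupport

theorem fderiv_apply (ha : IsAmplitude K a) (v : V) : IsAmplitude K fun ξ => fderiv ℝ a ξ v where
  contDiff := (ha.contDiff.fderiv_right (m := (⊤ : ℕ∞)) (by simp)).clm_apply contDiff_const
  hasCompactSupport := ha.hasCompactSupport.fderiv_apply (𝕜 := ℝ) v
  tsupport_subset := (tsupport_fderiv_apply_subset ℝ v).trans ha.tsupport_subset

theorem mul_left (ha : IsAmplitude K a) {r : V → ℂ}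
    (hr : ∀ ξ ∈ K, ContDiffAt ℝ (⊤ : ℕ∞) r ξ) : IsAmplitude K fun ξ => r ξ * a ξ where
  contDiff := by
    refine contDiff_iff_contDiffAt.2 fun ξ => ?_
    by_cases hξ : ξ ∈ tsupport a
    · exact (hr ξ (ha.tsupport_subset hξ)).mul ha.contDiff.contDiffAt
    · refine contDiffAt_const (c := (0 : ℂ)).congr_of_eventuallyEq ?_
      filter_upwards [(isClosed_tsupport a).isOpen_compl.mem_nhds hξ] with η hη
      rw [image_eq_zero_of_notMem_tsupport hη, mul_zero]
  hasCompactSupport := ha.hasCompactSupport.mul_left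
  tsupport_subset := tsupport_mul_subset_right.trans ha.tsupport_subset

end IsAmplitude

theorem norm_invFT_le {m : V → ℂ} (x : V) : ‖invFT m x‖ ≤ ∫ ξ, ‖m ξ‖ := by
  unfold invFT
  refine (norm_integral_le_integral_norm _).trans (le_of_eq ?_)
  simp only [norm_mul, norm_cexp_I_mul_ofReal, mul_one]

theorem integrable_mul_cexp {m : V → ℂ} (hm : Integrable m) (x : V) :
    Integrable fun ξ => m ξ * Complex.exp (Complex.I * (inner ℝ x ξ : ℝ)) := by
  refine hm.norm.mono' (hm.1.mul (Continuous.aestronglyMeasurable (by fun_prop)))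
    (ae_of_all _ fun ξ => ?_)
  rw [norm_mul, norm_cexp_I_mul_ofReal, mul_one]

theorem invFT_add {m n : V → ℂ} (hm : Integrable m) (hn : Integrable n) (x : V) :
    invFT (fun ξ => m ξ + n ξ) x = invFT m x + invFT n x := by
  unfold invFT
  rw [← integral_add (integrable_mul_cexp hm x) (integrable_mul_cexp hn x)]
  simp only [add_mul]

theorem invFT_const_mul (c : ℂ) (m : V → ℂ) (x : V) :
    invFT (fun ξ => c * m ξ) x = c * invFT m x := by
  unfold invFT
  rw [← integral_const_mul]
  simp only [mul_assoc]

theorem continuous_invFT {m : V → ℂ} (hm : Integrable m) : Continuous (invFT m) := by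
  refine continuous_of_dominated (bound := fun ξ => ‖m ξ‖)
    (fun x => (integrable_mul_cexp hm x).1) (fun x => ae_of_all _ fun ξ => ?_)
    hm.norm (ae_of_all _ fun ξ => by fun_prop)
  rw [norm_mul, norm_cexp_I_mul_ofReal, mul_one]

/-- Integration by parts in the direction `v`. -/
theorem inner_mul_invFT {K : Set V} {u : V → ℂ} (hu : IsAmplitude K u) (x v : V) :
    ((inner ℝ x v : ℝ) : ℂ) * invFT u x = Complex.I * invFT (fun ξ => fderiv ℝ u ξ v) x := by
  have hu' := hu.fderiv_apply v
  have he : ∀ ξ, HasLineDerivAt ℝ (fun ξ => Complex.exp (Complex.I * (inner ℝ x ξ : ℝ)))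
      (Complex.exp (Complex.I * (inner ℝ x ξ : ℝ)) * (Complex.I * (inner ℝ x v : ℝ))) ξ v := by
    intro ξ
    have h1 : HasDerivAt (fun t : ℝ => (inner ℝ x (ξ + t • v) : ℝ)) (inner ℝ x v) 0 := by
      simp only [inner_add_right, inner_smul_right]
      simpa using ((hasDerivAt_id (0 : ℝ)).mul_const (inner ℝ x v)).const_add (inner ℝ x ξ)
    have h2 := (h1.ofReal_comp.const_mul Complex.I).cexp
    simpa [HasLineDerivAt] using h2
  have h := integral_bilinear_hasLineDerivAt_right_eq_neg_left_of_integrable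
    (B := ContinuousLinearMap.mul ℝ ℂ) (μ := (volume : Measure V)) (v := v)
    (f := fun ξ => Complex.exp (Complex.I * (inner ℝ x ξ : ℝ))) (g := u)
    (f' := fun ξ => Complex.exp (Complex.I * (inner ℝ x ξ : ℝ)) * (Complex.I * (inner ℝ x v : ℝ)))
    (g' := fun ξ => fderiv ℝ u ξ v) ?_ ?_ ?_ (fun ξ _ => he ξ)
    (fun ξ _ => ((hu.contDiff.differentiable (by simp)) ξ).hasFDerivAt.hasLineDerivAt v)
  · simp only [ContinuousLinearMap.mul_apply'] at h
    unfold invFT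
    have e1 : ∀ ξ, fderiv ℝ u ξ v * Complex.exp (Complex.I * (inner ℝ x ξ : ℝ)) =
      Complex.exp (Complex.I * (inner ℝ x ξ : ℝ)) * fderiv ℝ u ξ v := fun ξ => mul_comm _ _
    simp only [e1]
    rw [h]
    have e2 : ∀ ξ, Complex.exp (Complex.I * (inner ℝ x ξ : ℝ)) * (Complex.I * (inner ℝ x v : ℝ)) *
        u ξ = (Complex.I * (inner ℝ x v : ℝ)) *
        (u ξ * Complex.exp (Complex.I * (inner ℝ x ξ : ℝ))) := fun ξ => by ring
    simp only [e2]
    rw [integral_const_mul]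
    linear_combination (((inner ℝ x v : ℝ) : ℂ) *
      ∫ ξ, u ξ * Complex.exp (Complex.I * (inner ℝ x ξ : ℝ))) * Complex.I_mul_I
  · simp only [ContinuousLinearMap.mul_apply']
    have := (integrable_mul_cexp hu.integrable x).mul_const (Complex.I * (inner ℝ x v : ℝ))
    refine this.congr (ae_of_all _ fun ξ => ?_)
    dsimp only
    ring
  · simp only [ContinuousLinearMap.mul_apply']
    refine (integrable_mul_cexp hu'.integrable x).congr (ae_of_all _ fun ξ => ?_)
    dsimp only
    ring
  · simp only [ContinuousLinearMap.mul_apply']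
    refine (integrable_mul_cexp hu.integrable x).congr (ae_of_all _ fun ξ => ?_)
    dsimp only
    ring

/-- The Leibniz rule along a line for a product with an amplitude: the first factor needs to be
differentiable only on the support of the amplitude. -/
theorem fderiv_mul_amplitude {K : Set V} {a q : V → ℂ} (ha : IsAmplitude K a) {q' : V → ℂ} {v : V}
    (hq : ∀ ξ ∈ K, ContDiffAt ℝ (⊤ : ℕ∞) q ξ) (hq' : ∀ ξ ∈ K, HasLineDerivAt ℝ q (q' ξ) ξ v)
    (ξ : V) : fderiv ℝ (fun ξ => q ξ * a ξ) ξ v = q' ξ * a ξ + q ξ * fderiv ℝ a ξ v := by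
  by_cases hξ : ξ ∈ tsupport a
  · have hK := ha.tsupport_subset hξ
    have h1 : DifferentiableAt ℝ q ξ := (hq ξ hK).differentiableAt (by simp)
    have h2 : DifferentiableAt ℝ a ξ := ha.contDiff.differentiable (by simp) ξ
    have h3 : fderiv ℝ q ξ v = q' ξ := by
      rw [← (hq' ξ hK).lineDeriv, h1.lineDeriv_eq_fderiv]
    rw [fderiv_fun_mul h1 h2]
    simp [h3]
    ring
  · have h1 : a ξ = 0 := image_eq_zero_of_notMem_tsupport hξ
    have h2 : fderiv ℝ a ξ v = 0 :=
      image_eq_zero_of_notMem_tsupport (f := fun ξ => fderiv ℝ a ξ v)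
        fun h => hξ (tsupport_fderiv_apply_subset ℝ v h)
    have h3 : fderiv ℝ (fun ξ => q ξ * a ξ) ξ v = 0 :=
      image_eq_zero_of_notMem_tsupport (f := fun ξ => fderiv ℝ (fun ξ => q ξ * a ξ) ξ v)
        fun h => hξ (tsupport_mul_subset_right (tsupport_fderiv_apply_subset ℝ v h))
    rw [h1, h2, h3]
    simp

end Amplitude

theorem EuclideanSpace.exists_norm_le_mul_abs {d : ℕ} (hd : 1 ≤ d) (x : EuclideanSpace ℝ (Fin d)) :
    ∃ i, ‖x‖ ≤ d * |x i| := by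
  have : Nonempty (Fin d) := ⟨⟨0, hd⟩⟩
  obtain ⟨i, hi⟩ := Finite.exists_max fun i => |x i|
  refine ⟨i, ?_⟩
  rw [EuclideanSpace.norm_eq]
  refine Real.sqrt_le_iff.2 ⟨by positivity, ?_⟩
  calc ∑ j, ‖x j‖ ^ 2 ≤ ∑ _j : Fin d, |x i| ^ 2 := by
        refine Finset.sum_le_sum fun j _ => ?_
        rw [Real.norm_eq_abs]
        exact pow_le_pow_left₀ (abs_nonneg _) (hi j) 2
    _ = d * |x i| ^ 2 := by simp
    _ ≤ (d * |x i|) ^ 2 := by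
        rw [mul_pow]
        gcongr
        have : (1 : ℝ) ≤ d := by exact_mod_cast hd
        nlinarith

namespace IsHomogeneousDistance

variable {d : ℕ} {β : ℝ} {ρ : EuclideanSpace ℝ (Fin d) → ℝ}

theorem contDiffAt (hρ : IsHomogeneousDistance β ρ) {ξ : EuclideanSpace ℝ (Fin d)} (hξ : ξ ≠ 0) :
    ContDiffAt ℝ (⊤ : ℕ∞) ρ ξ :=
  hρ.smooth.contDiffAt (isOpen_compl_singleton.mem_nhds hξ)

theorem contDiffAt_fderiv (hρ : IsHomogeneousDistance β ρ) (v : EuclideanSpace ℝ (Fin d))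
    {ξ : EuclideanSpace ℝ (Fin d)} (hξ : ξ ≠ 0) :
    ContDiffAt ℝ (⊤ : ℕ∞) (fun ξ => fderiv ℝ ρ ξ v) ξ :=
  ((hρ.contDiffAt hξ).fderiv_right (m := (⊤ : ℕ∞)) (by simp)).clm_apply contDiffAt_const

theorem contDiffAt_fderiv_fderiv (hρ : IsHomogeneousDistance β ρ) (v : EuclideanSpace ℝ (Fin d))
    {ξ : EuclideanSpace ℝ (Fin d)} (hξ : ξ ≠ 0) :
    ContDiffAt ℝ (⊤ : ℕ∞) (fun ξ => fderiv ℝ (fun ξ => fderiv ℝ ρ ξ v) ξ v) ξ :=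
  ((hρ.contDiffAt_fderiv v hξ).fderiv_right (m := (⊤ : ℕ∞)) (by simp)).clm_apply contDiffAt_const

/-- Decay of the kernels of the smooth functions `g(ερ)` of the distance on an annulus, uniformly
in `ε ∈ [0, 1]`. -/
theorem exists_inner_pow_mul_invFT_le (hρ : IsHomogeneousDistance β ρ)
    {K : Set (EuclideanSpace ℝ (Fin d))} (hK : K ⊆ {0}ᶜ) (v : EuclideanSpace ℝ (Fin d)) (N : ℕ) :
    ∀ (g : ℝ → ℂ) (a : EuclideanSpace ℝ (Fin d) → ℂ), ContDiff ℝ (⊤ : ℕ∞) g → IsAmplitude K a →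
      ∃ C : ℝ, ∀ ε ∈ Icc (0 : ℝ) 1, ∀ x,
        |inner ℝ x v| ^ N * ‖invFT (fun ξ => g (ε * ρ ξ) * a ξ) x‖ ≤ C := by
  have hsm : ∀ (g : ℝ → ℂ), ContDiff ℝ (⊤ : ℕ∞) g → ∀ ε : ℝ, ∀ ξ ∈ K,
      ContDiffAt ℝ (⊤ : ℕ∞) (fun ξ => g (ε * ρ ξ)) ξ := fun g hg ε ξ hξ =>
    hg.contDiffAt.comp ξ (contDiffAt_const.mul (hρ.contDiffAt (hK hξ)))
  induction N with
  | zero =>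
    intro g a hg ha
    have hcont : ContinuousOn ρ (tsupport a) :=
      hρ.smooth.continuousOn.mono (ha.tsupport_subset.trans hK)
    obtain ⟨B, hB⟩ := (ha.hasCompactSupport.isCompact.image_of_continuousOn hcont).isBounded.exists_norm_le
    obtain ⟨G, hG⟩ := (isCompact_closedBall (0 : ℝ) B).exists_bound_of_continuousOn
      hg.continuous.continuousOn
    refine ⟨∫ ξ, G * ‖a ξ‖, fun ε hε x => ?_⟩
    rw [pow_zero, one_mul]
    refine (norm_invFT_le x).trans ?_
    refine integral_mono_of_nonneg (ae_of_all _ fun ξ => norm_nonneg _)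
      (ha.integrable.norm.const_mul _) (ae_of_all _ fun ξ => ?_)
    dsimp only
    rw [norm_mul]
    by_cases hξ : ξ ∈ tsupport a
    · gcongr
      refine hG _ ?_
      rw [mem_closedBall_zero_iff, norm_mul, Real.norm_of_nonneg hε.1]
      have := hB _ (mem_image_of_mem ρ hξ)
      nlinarith [norm_nonneg (ρ ξ), hε.2, hε.1]
    · simp [image_eq_zero_of_notMem_tsupport hξ]
  | succ N ih =>
    intro g a hg ha
    have hb : IsAmplitude K fun ξ => ((fderiv ℝ ρ ξ v : ℝ) : ℂ) * a ξ := ha.mul_left fun ξ hξ =>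
      Complex.ofRealCLM.contDiff.contDiffAt.comp ξ (hρ.contDiffAt_fderiv v (hK hξ))
    have hg' : ContDiff ℝ (⊤ : ℕ∞) (deriv g) :=
      ((contDiff_infty_iff_deriv (𝕜 := ℝ) (f := g)).1 hg).2
    obtain ⟨C₁, h₁⟩ := ih (deriv g) _ hg' hb
    obtain ⟨C₂, h₂⟩ := ih g _ hg (ha.fderiv_apply v)
    refine ⟨C₁ + C₂, fun ε hε x => ?_⟩
    have hline : ∀ ξ ∈ K, HasLineDerivAt ℝ (fun ξ => g (ε * ρ ξ))
        (deriv g (ε * ρ ξ) * (ε * (fderiv ℝ ρ ξ v : ℝ) : ℂ)) ξ v := by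
      intro ξ hξ
      have e1 := ((hρ.contDiffAt (hK hξ)).differentiableAt
        (by simp)).hasFDerivAt.hasLineDerivAt v
      have e2 : HasDerivAt (fun t : ℝ => ε * ρ (ξ + t • v)) (ε * fderiv ℝ ρ ξ v) 0 :=
        HasDerivAt.const_mul ε e1
      have e3 : HasDerivAt g (deriv g (ε * ρ ξ)) (ε * ρ (ξ + (0 : ℝ) • v)) := by
        simpa using ((hg.differentiable (by simp)) (ε * ρ ξ)).hasDerivAt
      have e4 := e3.scomp (0 : ℝ) e2
      rw [Complex.real_smul, mul_comm] at e4
      push_cast at e4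
      exact e4
    have hder := fderiv_mul_amplitude ha (hsm g hg ε) hline
    have hsplit : invFT (fun ξ => fderiv ℝ (fun ξ => g (ε * ρ ξ) * a ξ) ξ v) x =
        ε * invFT (fun ξ => deriv g (ε * ρ ξ) * (((fderiv ℝ ρ ξ v : ℝ) : ℂ) * a ξ)) x +
        invFT (fun ξ => g (ε * ρ ξ) * fderiv ℝ a ξ v) x := by
      rw [← invFT_const_mul, ← invFT_add ((hb.mul_left (hsm _ hg' ε)).integrable.const_mul _)
        ((ha.fderiv_apply v).mul_left (hsm g hg ε)).integrable]
      congr 1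
      ext ξ
      rw [hder ξ]
      ring
    have hibp := inner_mul_invFT (ha.mul_left (hsm g hg ε)) x v
    rw [hsplit] at hibp
    have hnorm := congrArg norm hibp
    rw [norm_mul, norm_mul, Complex.norm_I, one_mul, Complex.norm_real, Real.norm_eq_abs] at hnorm
    rw [pow_succ, mul_assoc, hnorm]
    have hε1 : ‖(ε : ℂ)‖ ≤ 1 := by
      rw [Complex.norm_real, Real.norm_of_nonneg hε.1]; exact hε.2
    calc _ ≤ |inner ℝ x v| ^ N *
          (‖invFT (fun ξ => deriv g (ε * ρ ξ) * (((fderiv ℝ ρ ξ v : ℝ) : ℂ) * a ξ)) x‖ +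
          ‖invFT (fun ξ => g (ε * ρ ξ) * fderiv ℝ a ξ v) x‖) := by
          gcongr
          refine (norm_add_le _ _).trans ?_
          gcongr
          rw [norm_mul]
          exact mul_le_of_le_one_left (norm_nonneg _) hε1
      _ ≤ C₁ + C₂ := by
          rw [mul_add]
          exact add_le_add (h₁ ε hε x) (h₂ ε hε x)

theorem exists_norm_pow_mul_invFT_le (hρ : IsHomogeneousDistance β ρ) (hd : 1 ≤ d)
    {K : Set (EuclideanSpace ℝ (Fin d))} (hK : K ⊆ {0}ᶜ) (N : ℕ)
    {g : ℝ → ℂ} {a : EuclideanSpace ℝ (Fin d) → ℂ} (hg : ContDiff ℝ (⊤ : ℕ∞) g)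
    (ha : IsAmplitude K a) :
    ∃ C : ℝ, 0 < C ∧ ∀ ε ∈ Icc (0 : ℝ) 1, ∀ x,
      ‖x‖ ^ N * ‖invFT (fun ξ => g (ε * ρ ξ) * a ξ) x‖ ≤ C := by
  choose C hC using fun i : Fin d => hρ.exists_inner_pow_mul_invFT_le hK
    (EuclideanSpace.single i (1 : ℝ)) N g a hg ha
  refine ⟨(d : ℝ) ^ N * ∑ i, |C i| + 1, by positivity, fun ε hε x => ?_⟩
  obtain ⟨i, hi⟩ := EuclideanSpace.exists_norm_le_mul_abs hd x
  have h := hC i ε hε x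
  rw [EuclideanSpace.inner_single_right] at h
  simp only [conj_trivial, one_mul] at h
  calc _ ≤ (d * |x i|) ^ N * ‖invFT (fun ξ => g (ε * ρ ξ) * a ξ) x‖ := by gcongr
    _ = d ^ N * (|x i| ^ N * ‖invFT (fun ξ => g (ε * ρ ξ) * a ξ) x‖) := by ring
    _ ≤ d ^ N * |C i| := by
        gcongr
        exact h.trans (le_abs_self _)
    _ ≤ d ^ N * ∑ i, |C i| := by
        gcongr
        exact Finset.single_le_sum (f := fun i => |C i|) (fun i _ => abs_nonneg _)
          (Finset.mem_univ i)
    _ ≤ _ := by linarith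

end IsHomogeneousDistance

namespace IsHomogeneousDistance

variable {d : ℕ} {β : ℝ} {ρ : EuclideanSpace ℝ (Fin d) → ℝ}

/-- Non-stationary phase in the direction `v`: the phase is `⟨x, ξ⟩ + i z (ρ(ξ) - b)` with
`z = θ ⟨x, v⟩` and `θ` small.  The amplitudes `a (i - θ ∂_v ρ)^{-m}` form a class that is stable
under integration by parts, which makes the induction on `N` close up. -/
theorem exists_inner_pow_mul_invFT_phase_le (hρ : IsHomogeneousDistance β ρ)
    {K : Set (EuclideanSpace ℝ (Fin d))} (hK : K ⊆ {0}ᶜ) (v : EuclideanSpace ℝ (Fin d))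
    {b L : ℝ} (hb : ∀ ξ ∈ K, b ≤ ρ ξ) (hL0 : 0 < L) (hL : ∀ ξ ∈ K, |fderiv ℝ ρ ξ v| ≤ L) (N : ℕ) :
    ∀ a : EuclideanSpace ℝ (Fin d) → ℂ, IsAmplitude K a → ∀ m : ℕ,
      ∃ C : ℝ, 0 ≤ C ∧ ∀ (x : EuclideanSpace ℝ (Fin d)) (θ : ℂ), 0 ≤ (θ * (inner ℝ x v : ℝ)).re →
        ‖θ‖ * L ≤ 1 / 2 →
        |inner ℝ x v| ^ N * ‖invFT (fun ξ =>
          Complex.exp (-(θ * (inner ℝ x v : ℝ)) * ((ρ ξ - b : ℝ) : ℂ)) *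
            (Complex.I - θ * (fderiv ℝ ρ ξ v : ℝ))⁻¹ ^ m * a ξ) x‖ ≤ C := by
  have hlow : ∀ θ : ℂ, ‖θ‖ * L ≤ 1 / 2 → ∀ ξ ∈ K,
      1 / 2 ≤ ‖Complex.I - θ * (fderiv ℝ ρ ξ v : ℝ)‖ := by
    intro θ hθ ξ hξ
    have h1 := norm_sub_norm_le Complex.I (θ * (fderiv ℝ ρ ξ v : ℝ))
    rw [Complex.norm_I, norm_mul, Complex.norm_real, Real.norm_eq_abs] at h1
    have h2 : ‖θ‖ * |fderiv ℝ ρ ξ v| ≤ ‖θ‖ * L := by gcongr; exact hL ξ hξ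
    linarith
  have hne : ∀ θ : ℂ, ‖θ‖ * L ≤ 1 / 2 → ∀ ξ ∈ K,
      Complex.I - θ * (fderiv ℝ ρ ξ v : ℝ) ≠ 0 := by
    intro θ hθ ξ hξ h0
    have := hlow θ hθ ξ hξ
    rw [h0, norm_zero] at this
    linarith
  have hsm : ∀ (z θ : ℂ), ‖θ‖ * L ≤ 1 / 2 → ∀ m : ℕ, ∀ ξ ∈ K, ContDiffAt ℝ (⊤ : ℕ∞)
      (fun ξ => Complex.exp (-z * ((ρ ξ - b : ℝ) : ℂ)) *
        (Complex.I - θ * (fderiv ℝ ρ ξ v : ℝ))⁻¹ ^ m) ξ := by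
    intro z θ hθ m ξ hξ
    have h1 : ContDiffAt ℝ (⊤ : ℕ∞) (fun ξ => ((ρ ξ - b : ℝ) : ℂ)) ξ :=
      Complex.ofRealCLM.contDiff.contDiffAt.comp ξ
        ((hρ.contDiffAt (hK hξ)).sub contDiffAt_const)
    have h2 : ContDiffAt ℝ (⊤ : ℕ∞) (fun ξ => ((fderiv ℝ ρ ξ v : ℝ) : ℂ)) ξ :=
      Complex.ofRealCLM.contDiff.contDiffAt.comp ξ (hρ.contDiffAt_fderiv v (hK hξ))
    exact (contDiffAt_const.mul h1).cexp.mul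
      (((contDiffAt_const.sub (contDiffAt_const.mul h2)).inv (hne θ hθ ξ hξ)).pow m)
  induction N with
  | zero =>
    intro a ha m
    refine ⟨∫ ξ, 2 ^ m * ‖a ξ‖, by positivity, fun x θ hre hθ => ?_⟩
    rw [pow_zero, one_mul]
    refine (norm_invFT_le x).trans ?_
    refine integral_mono_of_nonneg (ae_of_all _ fun ξ => norm_nonneg _)
      (ha.integrable.norm.const_mul _) (ae_of_all _ fun ξ => ?_)
    dsimp only
    rw [norm_mul]
    by_cases hξ : ξ ∈ tsupport a
    · have hξK := ha.tsupport_subset hξ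
      gcongr
      rw [norm_mul, norm_pow, norm_inv, Complex.norm_exp]
      have e1 : (-(θ * (inner ℝ x v : ℝ)) * ((ρ ξ - b : ℝ) : ℂ)).re =
          -((θ * (inner ℝ x v : ℝ)).re * (ρ ξ - b)) := by
        rw [Complex.re_mul_ofReal, Complex.neg_re]; ring
      have e2 : Real.exp (-(θ * (inner ℝ x v : ℝ)) * ((ρ ξ - b : ℝ) : ℂ)).re ≤ 1 := by
        rw [e1, Real.exp_le_one_iff]
        have := mul_nonneg hre (sub_nonneg.2 (hb ξ hξK))
        linarith
      have e3 : ‖Complex.I - θ * (fderiv ℝ ρ ξ v : ℝ)‖⁻¹ ≤ 2 := by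
        rw [inv_le_comm₀ (by linarith [hlow θ hθ ξ hξK]) two_pos]
        linarith [hlow θ hθ ξ hξK]
      calc _ ≤ 1 * (2 : ℝ) ^ m := by gcongr
        _ = 2 ^ m := one_mul _
    · simp [image_eq_zero_of_notMem_tsupport hξ]
  | succ N ih =>
    intro a ha m
    have ha₁ : IsAmplitude K fun ξ => ((fderiv ℝ ρ ξ v : ℝ) : ℂ) * a ξ :=
      ha.mul_left fun ξ hξ =>
        Complex.ofRealCLM.contDiff.contDiffAt.comp ξ (hρ.contDiffAt_fderiv v (hK hξ))
    have ha₂ : IsAmplitude K fun ξ =>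
        ((fderiv ℝ (fun ξ => fderiv ℝ ρ ξ v) ξ v : ℝ) : ℂ) * a ξ := ha.mul_left fun ξ hξ =>
      Complex.ofRealCLM.contDiff.contDiffAt.comp ξ (hρ.contDiffAt_fderiv_fderiv v (hK hξ))
    obtain ⟨C₁, hC₁, h₁⟩ := ih _ ha₂ (m + 2)
    obtain ⟨C₂, hC₂, h₂⟩ := ih _ (ha.fderiv_apply v) (m + 1)
    refine ⟨(m + 1) * (1 / (2 * L)) * C₁ + C₂, by positivity, fun x θ hre hθ => ?_⟩
    set z : ℂ := θ * (inner ℝ x v : ℝ) with hz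
    set q : ℕ → EuclideanSpace ℝ (Fin d) → ℂ := fun m ξ =>
      Complex.exp (-z * ((ρ ξ - b : ℝ) : ℂ)) * (Complex.I - θ * (fderiv ℝ ρ ξ v : ℝ))⁻¹ ^ m with hq
    have hline : ∀ ξ ∈ K, HasLineDerivAt ℝ (q (m + 1))
        (-z * (fderiv ℝ ρ ξ v : ℝ) * q (m + 1) ξ +
          (m + 1) * θ * (fderiv ℝ (fun ξ => fderiv ℝ ρ ξ v) ξ v : ℝ) * q (m + 2) ξ) ξ v := by
      intro ξ hξ
      have e1 : HasDerivAt (fun t : ℝ => ρ (ξ + t • v)) (fderiv ℝ ρ ξ v) 0 :=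
        ((hρ.contDiffAt (hK hξ)).differentiableAt (by simp)).hasFDerivAt.hasLineDerivAt v
      have e2 : HasDerivAt (fun t : ℝ => fderiv ℝ ρ (ξ + t • v) v)
          (fderiv ℝ (fun ξ => fderiv ℝ ρ ξ v) ξ v) 0 :=
        ((hρ.contDiffAt_fderiv v (hK hξ)).differentiableAt
          (by simp)).hasFDerivAt.hasLineDerivAt v
      have e3 := ((e1.sub_const b).ofReal_comp.const_mul (-z)).cexp
      have e4 := (e2.ofReal_comp.const_mul θ).const_sub Complex.I
      have e5 := (e4.fun_inv (by simpa using hne θ hθ ξ hξ)).fun_pow (m + 1)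
      have e6 := e3.fun_mul e5
      unfold HasLineDerivAt
      refine e6.congr_deriv ?_
      simp only [zero_smul, add_zero, hq]
      have hn := hne θ hθ ξ hξ
      push_cast
      rw [div_eq_mul_inv, ← inv_pow]
      ring
    have hder : ∀ ξ, fderiv ℝ (fun ξ => q (m + 1) ξ * a ξ) ξ v = _ :=
      fderiv_mul_amplitude ha (hsm z θ hθ (m + 1)) hline
    have hi1 : Integrable fun ξ => q (m + 1) ξ * (((fderiv ℝ ρ ξ v : ℝ) : ℂ) * a ξ) :=
      (ha₁.mul_left (hsm z θ hθ (m + 1))).integrable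
    have hi2 : Integrable fun ξ => q (m + 2) ξ *
        (((fderiv ℝ (fun ξ => fderiv ℝ ρ ξ v) ξ v : ℝ) : ℂ) * a ξ) :=
      (ha₂.mul_left (hsm z θ hθ (m + 2))).integrable
    have hi3 : Integrable fun ξ => q (m + 1) ξ * fderiv ℝ a ξ v :=
      ((ha.fderiv_apply v).mul_left (hsm z θ hθ (m + 1))).integrable
    have hi4 : Integrable fun ξ => q (m + 1) ξ * a ξ :=
      (ha.mul_left (hsm z θ hθ (m + 1))).integrable
    have hsplit : invFT (fun ξ => fderiv ℝ (fun ξ => q (m + 1) ξ * a ξ) ξ v) x =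
        -z * invFT (fun ξ => q (m + 1) ξ * (((fderiv ℝ ρ ξ v : ℝ) : ℂ) * a ξ)) x +
        ((m + 1) * θ * invFT (fun ξ => q (m + 2) ξ *
          (((fderiv ℝ (fun ξ => fderiv ℝ ρ ξ v) ξ v : ℝ) : ℂ) * a ξ)) x +
        invFT (fun ξ => q (m + 1) ξ * fderiv ℝ a ξ v) x) := by
      rw [← invFT_const_mul, ← invFT_const_mul, ← invFT_add (hi2.const_mul _) hi3,
        ← invFT_add (n := fun ξ => (m + 1) * θ * (q (m + 2) ξ *
          (((fderiv ℝ (fun ξ => fderiv ℝ ρ ξ v) ξ v : ℝ) : ℂ) * a ξ)) +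
          q (m + 1) ξ * fderiv ℝ a ξ v) (hi1.const_mul _) ((hi2.const_mul _).add hi3)]
      congr 1
      ext ξ
      rw [hder ξ]
      ring
    have hrec : invFT (fun ξ => q m ξ * a ξ) x = Complex.I * invFT (fun ξ => q (m + 1) ξ * a ξ) x +
        (-θ) * invFT (fun ξ => q (m + 1) ξ * (((fderiv ℝ ρ ξ v : ℝ) : ℂ) * a ξ)) x := by
      rw [← invFT_const_mul, ← invFT_const_mul, ← invFT_add (hi4.const_mul _) (hi1.const_mul _)]
      congr 1
      ext ξ
      by_cases hξ : ξ ∈ tsupport a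
      · have hn := hne θ hθ ξ (ha.tsupport_subset hξ)
        simp only [hq]
        have : (Complex.I - θ * (fderiv ℝ ρ ξ v : ℝ))⁻¹ ^ m =
            (Complex.I - θ * (fderiv ℝ ρ ξ v : ℝ))⁻¹ ^ (m + 1) *
            (Complex.I - θ * (fderiv ℝ ρ ξ v : ℝ)) := by
          rw [pow_succ, mul_assoc, inv_mul_cancel₀ hn, mul_one]
        rw [this]
        ring
      · simp [image_eq_zero_of_notMem_tsupport hξ]
    have hibp := inner_mul_invFT (ha.mul_left (hsm z θ hθ (m + 1))) x v
    change _ = Complex.I * invFT (fun ξ => fderiv ℝ (fun ξ => q (m + 1) ξ * a ξ) ξ v) x at hibp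
    change _ * invFT (fun ξ => q (m + 1) ξ * a ξ) x = _ at hibp
    rw [hsplit] at hibp
    have hfin : ((inner ℝ x v : ℝ) : ℂ) * invFT (fun ξ => q m ξ * a ξ) x =
        -((m + 1) * θ * invFT (fun ξ => q (m + 2) ξ *
          (((fderiv ℝ (fun ξ => fderiv ℝ ρ ξ v) ξ v : ℝ) : ℂ) * a ξ)) x +
        invFT (fun ξ => q (m + 1) ξ * fderiv ℝ a ξ v) x) := by
      rw [hrec]
      linear_combination Complex.I * hibp + (-z * invFT (fun ξ => q (m + 1) ξ *
        (((fderiv ℝ ρ ξ v : ℝ) : ℂ) * a ξ)) x +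
        ((m + 1) * θ * invFT (fun ξ => q (m + 2) ξ *
          (((fderiv ℝ (fun ξ => fderiv ℝ ρ ξ v) ξ v : ℝ) : ℂ) * a ξ)) x +
        invFT (fun ξ => q (m + 1) ξ * fderiv ℝ a ξ v) x)) * Complex.I_mul_I +
        invFT (fun ξ => q (m + 1) ξ * (((fderiv ℝ ρ ξ v : ℝ) : ℂ) * a ξ)) x * hz
    have hnorm := congrArg norm hfin
    rw [norm_mul, norm_neg, Complex.norm_real, Real.norm_eq_abs] at hnorm
    have hθ' : ‖θ‖ ≤ 1 / (2 * L) := by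
      rw [le_div_iff₀ (by positivity)]
      linarith
    change |inner ℝ x v| ^ (N + 1) * ‖invFT (fun ξ => q m ξ * a ξ) x‖ ≤ _
    rw [pow_succ, mul_assoc, hnorm]
    have hm1 : ‖(m + 1 : ℂ)‖ = m + 1 := by
      have : (m + 1 : ℂ) = ((m + 1 : ℝ) : ℂ) := by push_cast; rfl
      rw [this, Complex.norm_real, Real.norm_of_nonneg (by positivity)]
    calc _ ≤ |inner ℝ x v| ^ N * ((m + 1) * (1 / (2 * L)) * ‖invFT (fun ξ => q (m + 2) ξ *
          (((fderiv ℝ (fun ξ => fderiv ℝ ρ ξ v) ξ v : ℝ) : ℂ) * a ξ)) x‖ +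
          ‖invFT (fun ξ => q (m + 1) ξ * fderiv ℝ a ξ v) x‖) := by
          gcongr
          refine (norm_add_le _ _).trans ?_
          gcongr
          rw [norm_mul, norm_mul, hm1]
          gcongr
      _ = (m + 1) * (1 / (2 * L)) * (|inner ℝ x v| ^ N * ‖invFT (fun ξ => q (m + 2) ξ *
          (((fderiv ℝ (fun ξ => fderiv ℝ ρ ξ v) ξ v : ℝ) : ℂ) * a ξ)) x‖) +
          |inner ℝ x v| ^ N * ‖invFT (fun ξ => q (m + 1) ξ * fderiv ℝ a ξ v) x‖ := by ring
      _ ≤ _ := by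
          gcongr
          · exact h₁ x θ hre hθ
          · exact h₂ x θ hre hθ

/-- Finite speed of propagation: for `Re z ≥ 0` and `|z| ≤ c |x|` the kernel of
`a(D) e^{-z(ρ(D) - b)}` decays faster than any power of `|x|`. -/
theorem exists_invFT_phase_le (hρ : IsHomogeneousDistance β ρ) (hd : 1 ≤ d)
    {K : Set (EuclideanSpace ℝ (Fin d))} (hK : K ⊆ {0}ᶜ) (hKc : IsCompact K)
    {b : ℝ} (hb : ∀ ξ ∈ K, b ≤ ρ ξ) {a : EuclideanSpace ℝ (Fin d) → ℂ} (ha : IsAmplitude K a) :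
    ∃ c : ℝ, 0 < c ∧ ∀ N : ℕ, ∃ C : ℝ, 0 < C ∧ ∀ (x : EuclideanSpace ℝ (Fin d)) (z : ℂ),
      0 ≤ z.re → ‖z‖ ≤ c * ‖x‖ →
      ‖x‖ ^ N * ‖invFT (fun ξ => Complex.exp (-z * ((ρ ξ - b : ℝ) : ℂ)) * a ξ) x‖ ≤ C := by
  have hd0 : (0 : ℝ) < d := by exact_mod_cast hd
  have hder : ∀ i : Fin d, ∃ L, ∀ ξ ∈ K, ‖fderiv ℝ ρ ξ (EuclideanSpace.single i (1 : ℝ))‖ ≤ L :=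
    fun i => hKc.exists_bound_of_continuousOn fun ξ hξ =>
      (hρ.contDiffAt_fderiv _ (hK hξ)).continuousAt.continuousWithinAt
  choose L₀ hL₀ using hder
  set L : ℝ := ∑ i, |L₀ i| + 1 with hLdef
  have hLpos : 0 < L := by positivity
  have hL : ∀ i, ∀ ξ ∈ K, |fderiv ℝ ρ ξ (EuclideanSpace.single i (1 : ℝ))| ≤ L := by
    intro i ξ hξ
    have h1 := Finset.single_le_sum (f := fun i => |L₀ i|) (fun i _ => abs_nonneg _)
      (Finset.mem_univ i)
    have h2 := hL₀ i ξ hξ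
    rw [Real.norm_eq_abs] at h2
    have h3 := le_abs_self (L₀ i)
    linarith
  refine ⟨1 / (2 * d * L), by positivity, fun N => ?_⟩
  choose C hC0 hC using fun i : Fin d => hρ.exists_inner_pow_mul_invFT_phase_le hK
    (EuclideanSpace.single i (1 : ℝ)) hb hLpos (hL i) N a ha 0
  refine ⟨(d : ℝ) ^ N * ∑ i, C i + (0 : ℝ) ^ N * (∫ ξ, ‖a ξ‖) + 1, ?_, fun x z hre hz => ?_⟩
  · have : 0 ≤ ∑ i, C i := Finset.sum_nonneg fun i _ => hC0 i
    have : 0 ≤ ∫ ξ, ‖a ξ‖ := by positivity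
    positivity
  have hsum : 0 ≤ ∑ i, C i := Finset.sum_nonneg fun i _ => hC0 i
  have hint : 0 ≤ ∫ ξ, ‖a ξ‖ := by positivity
  rcases eq_or_ne x 0 with rfl | hx
  · have hz0 : z = 0 := by simpa using hz
    subst hz0
    have : ‖invFT (fun ξ => Complex.exp (-0 * ((ρ ξ - b : ℝ) : ℂ)) * a ξ) 0‖ ≤ ∫ ξ, ‖a ξ‖ := by
      refine (norm_invFT_le _).trans (le_of_eq ?_)
      simp
    rw [norm_zero]
    have h0 : (0 : ℝ) ≤ 0 ^ N := by positivity
    have := mul_le_mul_of_nonneg_left this h0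
    have h1 : 0 ≤ (d : ℝ) ^ N * ∑ i, C i := by positivity
    linarith
  obtain ⟨i, hi⟩ := EuclideanSpace.exists_norm_le_mul_abs hd x
  have hxi : x i ≠ 0 := by
    intro h0
    rw [h0, abs_zero, mul_zero] at hi
    exact hx (norm_le_zero_iff.1 hi)
  have hin : inner ℝ x (EuclideanSpace.single i (1 : ℝ)) = x i := by
    rw [EuclideanSpace.inner_single_right]
    simp
  have hxic : ((x i : ℝ) : ℂ) ≠ 0 := by exact_mod_cast hxi
  have hθz : z / (x i : ℝ) * ((inner ℝ x (EuclideanSpace.single i (1 : ℝ)) : ℝ) : ℂ) = z := by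
    rw [hin]
    exact div_mul_cancel₀ _ hxic
  have h := hC i x (z / (x i : ℝ)) (by rwa [hθz]) (by
    rw [norm_div, Complex.norm_real, Real.norm_eq_abs]
    have hp : 0 < |x i| := abs_pos.2 hxi
    rw [div_mul_eq_mul_div, div_le_iff₀ hp]
    calc ‖z‖ * L ≤ (1 / (2 * d * L) * (d * |x i|)) * L := by
          gcongr
          refine hz.trans ?_
          gcongr
      _ = 1 / 2 * |x i| := by field_simp)
  rw [hθz, hin] at h
  simp only [pow_zero, mul_one] at h
  calc _ ≤ (d * |x i|) ^ N *
        ‖invFT (fun ξ => Complex.exp (-z * ((ρ ξ - b : ℝ) : ℂ)) * a ξ) x‖ := by gcongr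
    _ = d ^ N * (|x i| ^ N *
        ‖invFT (fun ξ => Complex.exp (-z * ((ρ ξ - b : ℝ) : ℂ)) * a ξ) x‖) := by ring
    _ ≤ d ^ N * C i := by gcongr
    _ ≤ d ^ N * ∑ i, C i := by
        gcongr
        exact Finset.single_le_sum (fun i _ => hC0 i) (Finset.mem_univ i)
    _ ≤ _ := by
        have : 0 ≤ (0 : ℝ) ^ N * (∫ ξ, ‖a ξ‖) := by positivity
        linarith

end IsHomogeneousDistance

/-! ### Laplace representation of the multipliers -/

/-- The Gamma distribution of shape `γ` and rate `1`, for `γ > 0`. -/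
noncomputable def gammaMix (γ : ℝ) : Measure ℝ :=
  (volume.restrict (Ioi 0)).withDensity fun a =>
    ENNReal.ofReal (a ^ (γ - 1) * Real.exp (-a) / Real.Gamma γ)

theorem ae_gammaMix_pos (γ : ℝ) : ∀ᵐ a ∂gammaMix γ, 0 < a :=
  (withDensity_absolutelyContinuous _ _).ae_le (ae_restrict_mem measurableSet_Ioi)

theorem integral_gammaMix {E : Type*} [NormedAddCommGroup E] [NormedSpace ℝ E] {γ : ℝ} (hγ : 0 < γ)
    (f : ℝ → E) : ∫ a, f a ∂gammaMix γ =
      ∫ a in Ioi 0, (a ^ (γ - 1) * Real.exp (-a) / Real.Gamma γ) • f a := by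
  unfold gammaMix
  rw [integral_withDensity_eq_integral_toReal_smul (by fun_prop) (ae_of_all _ fun x => by simp)]
  refine setIntegral_congr_fun measurableSet_Ioi fun a ha => ?_
  have ha' : (0 : ℝ) < a := ha
  have := Real.Gamma_pos_of_pos hγ
  rw [ENNReal.toReal_ofReal (by positivity)]

theorem integral_gammaMix_exp {γ : ℝ} (hγ : 0 < γ) {L : ℝ} (hL : -1 < L) :
    ∫ a, Real.exp (-L * a) ∂gammaMix γ = (1 + L) ^ (-γ) := by
  have hG := Real.Gamma_pos_of_pos hγ
  have hL1 : 0 < 1 + L := by linarith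
  have h := Real.integral_rpow_mul_exp_neg_mul_Ioi hγ hL1
  rw [integral_gammaMix hγ]
  calc _ = ∫ a in Ioi 0, (Real.Gamma γ)⁻¹ * (a ^ (γ - 1) * Real.exp (-((1 + L) * a))) := by
        refine setIntegral_congr_fun measurableSet_Ioi fun a ha => ?_
        have : Real.exp (-((1 + L) * a)) = Real.exp (-a) * Real.exp (-L * a) := by
          rw [← Real.exp_add]; ring_nf
        rw [this, smul_eq_mul]
        ring
    _ = _ := by
        rw [integral_const_mul, h, one_div, Real.inv_rpow hL1.le, Real.rpow_neg hL1.le]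
        field_simp

theorem integrable_gammaMix_exp {γ : ℝ} (hγ : 0 < γ) {L : ℝ} (hL : -1 < L) :
    Integrable (fun a => Real.exp (-L * a)) (gammaMix γ) := by
  refine Integrable.of_integral_ne_zero ?_
  rw [integral_gammaMix_exp hγ hL]
  exact (Real.rpow_pos_of_pos (by linarith) _).ne'

theorem integral_gammaMix_cexp {γ : ℝ} (hγ : 0 < γ) {L : ℂ} (hL : -1 < L.re) :
    ∫ a : ℝ, Complex.exp (-L * a) ∂gammaMix γ = (1 + L) ^ (-γ : ℂ) := by
  have hsub : {z : ℂ | z.re < 1} ⊆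
      {z | z.re ∈ interior (ProbabilityTheory.integrableExpSet id (gammaMix γ))} := by
    intro z hz
    have : Iio (1 : ℝ) ⊆ ProbabilityTheory.integrableExpSet id (gammaMix γ) := by
      intro t ht
      have := integrable_gammaMix_exp hγ (L := -t) (by simpa using ht)
      simpa [ProbabilityTheory.integrableExpSet] using this
    exact interior_maximal this isOpen_Iio hz
  have hopen : IsOpen {z : ℂ | z.re < 1} := isOpen_lt Complex.continuous_re continuous_const
  have hf : AnalyticOnNhd ℂ (ProbabilityTheory.complexMGF id (gammaMix γ)) {z | z.re < 1} :=
    (ProbabilityTheory.differentiableOn_complexMGF.mono hsub).analyticOnNhd hopen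
  have hg : AnalyticOnNhd ℂ (fun z : ℂ => (1 - z) ^ (-γ : ℂ)) {z | z.re < 1} := by
    refine DifferentiableOn.analyticOnNhd (fun z hz => ?_) hopen
    have : 1 - z ∈ Complex.slitPlane := Or.inl (by simpa using hz)
    exact (((differentiableAt_const _).sub differentiableAt_id).cpow_const
      this).differentiableWithinAt
  have heq := hf.eqOn_of_preconnected_of_frequently_eq hg
    (convex_halfSpace_re_lt 1).isPreconnected (z₀ := 0) (by simp) ?_
  · have h := heq (show -L ∈ {z : ℂ | z.re < 1} by simp; linarith)
    simpa [ProbabilityTheory.complexMGF] using h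
  · have hreal : ∀ t : ℝ, t < 1 → ProbabilityTheory.complexMGF id (gammaMix γ) t =
        (1 - (t : ℂ)) ^ (-γ : ℂ) := by
      intro t ht
      have h1 := integral_gammaMix_exp hγ (L := -t) (by linarith)
      rw [ProbabilityTheory.complexMGF_ofReal, ProbabilityTheory.mgf]
      simp only [id_eq]
      rw [neg_neg] at h1
      rw [h1, Complex.ofReal_cpow (by linarith)]
      push_cast
      ring_nf
    rw [frequently_nhdsWithin_iff]
    have htend : Tendsto (fun n : ℕ => (((1 / ((n : ℝ) + 1) : ℝ)) : ℂ) * (1 / 2)) atTop (𝓝 0) := by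
      have h1 := (Complex.continuous_ofReal.tendsto 0).comp
        (tendsto_one_div_add_atTop_nhds_zero_nat (𝕜 := ℝ))
      simpa using h1.mul_const (1 / 2 : ℂ)
    refine htend.frequently (Frequently.of_forall fun n => ?_)
    have hpos : (0 : ℝ) < 1 / ((n : ℝ) + 1) := by positivity
    have hle : (1 : ℝ) / ((n : ℝ) + 1) ≤ 1 := by
      rw [div_le_one (by positivity)]; linarith [(Nat.cast_nonneg n : (0 : ℝ) ≤ n)]
    have hcast : (((1 / ((n : ℝ) + 1) : ℝ)) : ℂ) * (1 / 2) =
        ((1 / ((n : ℝ) + 1) * (1 / 2) : ℝ) : ℂ) := by push_cast; rfl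
    rw [hcast]
    refine ⟨hreal _ (by nlinarith), ?_⟩
    simp only [mem_compl_iff, mem_singleton_iff, Complex.ofReal_eq_zero]
    positivity

/-- Mixtures of exponentials: `(1 + L)^{-γ} = ∫ e^{-La} dν(a)` for some measure `ν` on `[0, ∞)`. -/
theorem exists_exp_mixture {γ : ℝ} (hγ : 0 ≤ γ) :
    ∃ ν : Measure ℝ, IsFiniteMeasure ν ∧ (∀ᵐ a ∂ν, 0 ≤ a) ∧ ∀ L : ℝ, -1 < L →
      Integrable (fun a => Real.exp (-L * a)) ν ∧
      ∫ a, Real.exp (-L * a) ∂ν = (1 + L) ^ (-γ) := by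
  rcases hγ.eq_or_lt with rfl | hγ
  · refine ⟨Measure.dirac 0, inferInstance, ?_, fun L hL => ⟨integrable_dirac (by simp), ?_⟩⟩
    · rw [ae_dirac_eq]
      simp
    · simp
  · refine ⟨gammaMix γ, ?_, (ae_gammaMix_pos γ).mono fun a ha => ha.le, fun L hL =>
      ⟨integrable_gammaMix_exp hγ hL, integral_gammaMix_exp hγ hL⟩⟩
    have := integrable_gammaMix_exp hγ (L := 0) (by norm_num)
    simp only [neg_zero, zero_mul, Real.exp_zero] at this
    exact (integrable_const_iff_isFiniteMeasure one_ne_zero).1 this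

/-- The truncated power `v_+^μ`. -/
noncomputable def posPow (μ v : ℝ) : ℝ := if 0 < v then v ^ μ else 0

theorem posPow_nonneg (μ v : ℝ) : 0 ≤ posPow μ v := by
  unfold posPow
  split_ifs with h
  · positivity
  · exact le_rfl

theorem continuous_posPow {μ : ℝ} (hμ : 0 < μ) : Continuous (posPow μ) := by
  have : posPow μ = fun v => (max v 0) ^ μ := by
    ext v
    unfold posPow
    split_ifs with h
    · rw [max_eq_left h.le]
    · rw [max_eq_right (not_lt.1 h), Real.zero_rpow hμ.ne']
  rw [this]
  exact (continuous_id.max continuous_const).rpow_const fun _ => Or.inr hμ.le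

theorem integral_rpow_mul_cexp_Ioi {μ : ℝ} (hμ : -1 < μ) {z : ℂ} (hz : 0 < z.re) :
    ∫ v in Ioi (0 : ℝ), ((v ^ μ : ℝ) : ℂ) * Complex.exp (-z * v) =
      Real.Gamma (μ + 1) * z ^ (-(μ + 1) : ℂ) := by
  have hγ : 0 < μ + 1 := by linarith
  have hG := Real.Gamma_pos_of_pos hγ
  have hGc : (Real.Gamma (μ + 1) : ℂ) ≠ 0 := by exact_mod_cast hG.ne'
  have h := integral_gammaMix_cexp hγ (L := z - 1) (by simpa using hz)
  rw [integral_gammaMix hγ] at h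
  have h2 : ∫ v in Ioi (0 : ℝ), ((v ^ μ : ℝ) : ℂ) * Complex.exp (-z * v) =
      Real.Gamma (μ + 1) * ∫ a in Ioi (0 : ℝ), (a ^ (μ + 1 - 1) * Real.exp (-a) /
        Real.Gamma (μ + 1)) • Complex.exp (-(z - 1) * a) := by
    rw [← integral_const_mul]
    refine setIntegral_congr_fun measurableSet_Ioi fun a _ => ?_
    have : Complex.exp (-z * a) = Complex.exp (-a) * Complex.exp (-(z - 1) * a) := by
      rw [← Complex.exp_add]; ring_nf
    rw [this, Complex.real_smul, add_sub_cancel_right]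
    push_cast
    field_simp
  rw [h2, h]
  push_cast
  ring_nf

theorem integrableOn_rpow_mul_exp {μ κ : ℝ} (hμ : -1 < μ) (hκ : 0 < κ) :
    IntegrableOn (fun v : ℝ => v ^ μ * Real.exp (-(κ * v))) (Ioi 0) := by
  refine Integrable.of_integral_ne_zero ?_
  have h := Real.integral_rpow_mul_exp_neg_mul_Ioi (a := μ + 1) (by linarith) hκ
  rw [add_sub_cancel_right] at h
  rw [h]
  have := Real.Gamma_pos_of_pos (show 0 < μ + 1 by linarith)
  positivity

theorem norm_cpow_vertical {μ κ : ℝ} (τ : ℝ) :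
    ‖((κ : ℂ) + τ * Complex.I) ^ (-(μ + 1) : ℂ)‖ = ‖(κ : ℂ) + τ * Complex.I‖ ^ (-(μ + 1)) := by
  have : (-(μ + 1) : ℂ) = ((-(μ + 1) : ℝ) : ℂ) := by push_cast; rfl
  rw [this, Complex.norm_cpow_real]

theorem mul_one_add_abs_le_norm_vertical {κ : ℝ} (hκ : 0 < κ) (τ : ℝ) :
    min κ 1 / 2 * (1 + |τ|) ≤ ‖(κ : ℂ) + τ * Complex.I‖ := by
  have h1 : |κ| ≤ ‖(κ : ℂ) + τ * Complex.I‖ := by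
    simpa using Complex.abs_re_le_norm ((κ : ℂ) + τ * Complex.I)
  have h2 : |τ| ≤ ‖(κ : ℂ) + τ * Complex.I‖ := by
    simpa using Complex.abs_im_le_norm ((κ : ℂ) + τ * Complex.I)
  rw [abs_of_pos hκ] at h1
  have h3 := min_le_left κ 1
  have h4 := min_le_right κ 1
  have h5 : 0 < min κ 1 := lt_min hκ one_pos
  nlinarith [abs_nonneg τ]

theorem continuous_cpow_vertical {κ : ℝ} (hκ : 0 < κ) (μ : ℝ) :
    Continuous fun τ : ℝ => ((κ : ℂ) + τ * Complex.I) ^ (-(μ + 1) : ℂ) := by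
  refine Continuous.cpow (by fun_prop) continuous_const fun τ => Or.inl ?_
  simpa using hκ

theorem integrable_one_add_abs_rpow {s : ℝ} (hs : 1 < s) :
    Integrable fun τ : ℝ => (1 + |τ|) ^ (-s) := by
  have := integrable_one_add_norm (E := ℝ) (μ := volume) (r := s) (by simpa using hs)
  simpa using this

theorem integrable_cpow_vertical {μ κ : ℝ} (hμ : 0 < μ) (hκ : 0 < κ) :
    Integrable fun τ : ℝ => ((κ : ℂ) + τ * Complex.I) ^ (-(μ + 1) : ℂ) := by
  refine ((integrable_one_add_abs_rpow (s := μ + 1) (by linarith)).const_mul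
    ((min κ 1 / 2) ^ (-(μ + 1)))).mono' (continuous_cpow_vertical hκ μ).aestronglyMeasurable
    (ae_of_all _ fun τ => ?_)
  have h5 : 0 < min κ 1 := lt_min hκ one_pos
  have h6 : 0 < 1 + |τ| := by positivity
  rw [norm_cpow_vertical, ← Real.mul_rpow (by positivity) h6.le]
  exact Real.rpow_le_rpow_of_nonpos (by positivity) (mul_one_add_abs_le_norm_vertical hκ τ)
    (by linarith)

/-- Laplace inversion of `v_+^μ` on the line `Re z = κ`. -/
theorem posPow_eq_integral {μ κ : ℝ} (hμ : 0 < μ) (hκ : 0 < κ) (v : ℝ) :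
    ∫ τ : ℝ, ((κ : ℂ) + τ * Complex.I) ^ (-(μ + 1) : ℂ) *
      Complex.exp (((κ : ℂ) + τ * Complex.I) * v) =
      ((2 * Real.pi / Real.Gamma (μ + 1) * posPow μ v : ℝ) : ℂ) := by
  have hG := Real.Gamma_pos_of_pos (show 0 < μ + 1 by linarith)
  have hGc : (Real.Gamma (μ + 1) : ℂ) ≠ 0 := by exact_mod_cast hG.ne'
  set u : ℝ → ℂ := fun v => ((posPow μ v * Real.exp (-(κ * v)) : ℝ) : ℂ) with hu
  have hind : (fun v => posPow μ v * Real.exp (-(κ * v))) =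
      (Ioi (0 : ℝ)).indicator fun v => v ^ μ * Real.exp (-(κ * v)) := by
    ext v
    by_cases h : 0 < v
    · simp [posPow, h]
    · simp [posPow, h]
  have hucont : Continuous u := by
    have := continuous_posPow hμ
    fun_prop
  have huint : Integrable u := by
    have : Integrable fun v => posPow μ v * Real.exp (-(κ * v)) := ?_
    · exact this.ofReal
    rw [hind, integrable_indicator_iff measurableSet_Ioi]
    exact integrableOn_rpow_mul_exp (by linarith) hκ
  have hF : ∀ w : ℝ, FourierTransform.fourier u w =
      Real.Gamma (μ + 1) * ((κ : ℂ) + ((2 * Real.pi * w : ℝ) : ℂ) * Complex.I) ^ (-(μ + 1) : ℂ) := by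
    intro w
    rw [Real.fourier_real_eq_integral_exp_smul,
      ← integral_rpow_mul_cexp_Ioi (by linarith) (by simpa using hκ),
      ← integral_indicator measurableSet_Ioi]
    congr 1 with v
    have h1 := congrFun hind v
    by_cases h : v ∈ Ioi (0 : ℝ)
    · rw [indicator_of_mem h] at h1 ⊢
      simp only [hu]
      rw [h1]
      push_cast
      rw [smul_eq_mul, mul_left_comm, ← Complex.exp_add]
      congr 2
      ring
    · rw [indicator_of_notMem h] at h1 ⊢
      simp only [hu]
      rw [h1]
      simp
  have hFi : Integrable (FourierTransform.fourier u) := by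
    have h1 := ((integrable_cpow_vertical hμ hκ).comp_mul_left'
      (show 2 * Real.pi ≠ 0 by positivity)).const_mul (Real.Gamma (μ + 1) : ℂ)
    exact h1.congr (ae_of_all _ fun w => (hF w).symm)
  have hinv := congrFun (hucont.fourierInv_fourier_eq huint hFi) v
  rw [Real.fourierInv_eq'] at hinv
  have hsub := Measure.integral_comp_mul_left (fun τ : ℝ =>
    ((κ : ℂ) + τ * Complex.I) ^ (-(μ + 1) : ℂ) * Complex.exp (τ * v * Complex.I)) (2 * Real.pi)
  have h2 : ∫ w : ℝ, Complex.exp (2 * Real.pi * (inner ℝ w v : ℝ) * Complex.I) •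
      FourierTransform.fourier u w = Real.Gamma (μ + 1) * ∫ w : ℝ,
        ((κ : ℂ) + ((2 * Real.pi * w : ℝ) : ℂ) * Complex.I) ^ (-(μ + 1) : ℂ) *
          Complex.exp (((2 * Real.pi * w : ℝ) : ℂ) * v * Complex.I) := by
    rw [← integral_const_mul]
    congr 1 with w
    rw [hF w, smul_eq_mul]
    have : (inner ℝ w v : ℝ) = w * v := by simp [mul_comm]
    rw [this]
    push_cast
    ring_nf
  have hpi : 0 < 2 * Real.pi := by positivity
  push_cast at hinv h2
  rw [h2] at hinv
  push_cast at hsub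
  rw [hsub, abs_of_pos (by positivity), Complex.real_smul] at hinv
  have h3 : ∫ τ : ℝ, ((κ : ℂ) + τ * Complex.I) ^ (-(μ + 1) : ℂ) *
      Complex.exp (((κ : ℂ) + τ * Complex.I) * v) = Complex.exp (κ * v) *
      ∫ τ : ℝ, ((κ : ℂ) + τ * Complex.I) ^ (-(μ + 1) : ℂ) * Complex.exp (τ * v * Complex.I) := by
    rw [← integral_const_mul]
    congr 1 with τ
    rw [mul_left_comm, ← Complex.exp_add]
    ring_nf
  have h4 : ∫ τ : ℝ, ((κ : ℂ) + τ * Complex.I) ^ (-(μ + 1) : ℂ) * Complex.exp (τ * v * Complex.I) =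
      2 * Real.pi / Real.Gamma (μ + 1) * u v := by
    rw [← hinv]
    have : (Real.pi : ℂ) ≠ 0 := by exact_mod_cast Real.pi_ne_zero
    generalize (∫ τ : ℝ, ((κ : ℂ) + τ * Complex.I) ^ (-(μ + 1) : ℂ) *
      Complex.exp (τ * v * Complex.I)) = J
    push_cast
    field_simp
  have h5 : Complex.exp (κ * v) * Complex.exp (-(κ * v)) = 1 := by
    rw [← Complex.exp_add, add_neg_cancel, Complex.exp_zero]
  rw [h3, h4]
  simp only [hu]
  push_cast
  linear_combination (2 * Real.pi / Real.Gamma (μ + 1) * (posPow μ v : ℂ)) * h5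

theorem Gamma_add_one_mul_rpow_eq {μ : ℝ} (hμ : 0 < μ) :
    Real.Gamma (μ + 1) * μ ^ (-(μ + 1)) = ∫ v in Ioi (0 : ℝ), v ^ μ * Real.exp (-(μ * v)) := by
  have h := Real.integral_rpow_mul_exp_neg_mul_Ioi (a := μ + 1) (by linarith) hμ
  rw [add_sub_cancel_right] at h
  rw [h, one_div, Real.inv_rpow hμ.le, Real.rpow_neg hμ.le, mul_comm]

theorem Gamma_add_one_mul_rpow_le {lam a : ℝ} (hlam : 0 < lam) (ha : 0 ≤ a) :
    Real.Gamma (lam + a + 1) * (lam + a) ^ (-(lam + a + 1)) ≤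
      Real.exp (-a) * (Real.Gamma (lam + 1) * lam ^ (-(lam + 1))) := by
  rw [Gamma_add_one_mul_rpow_eq hlam, Gamma_add_one_mul_rpow_eq (show 0 < lam + a by linarith),
    ← integral_const_mul]
  refine setIntegral_mono_on (integrableOn_rpow_mul_exp (by linarith) (by linarith))
    ((integrableOn_rpow_mul_exp (by linarith) hlam).const_mul _) measurableSet_Ioi fun v hv => ?_
  have hv : 0 < v := hv
  have h1 : v ≤ Real.exp (v - 1) := by linarith [Real.add_one_le_exp (v - 1)]
  have h2 : v ^ a ≤ Real.exp (a * (v - 1)) := by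
    calc v ^ a ≤ (Real.exp (v - 1)) ^ a := Real.rpow_le_rpow hv.le h1 ha
      _ = _ := by rw [← Real.exp_mul]; ring_nf
  rw [Real.rpow_add hv]
  calc v ^ lam * v ^ a * Real.exp (-((lam + a) * v))
      ≤ v ^ lam * Real.exp (a * (v - 1)) * Real.exp (-((lam + a) * v)) := by gcongr
    _ = _ := by
      have : Real.exp (a * (v - 1)) * Real.exp (-((lam + a) * v)) =
          Real.exp (-a) * Real.exp (-(lam * v)) := by
        rw [← Real.exp_add, ← Real.exp_add]; ring_nf
      linear_combination v ^ lam * this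

theorem sub_log_le_four_thirds {t : ℝ} (ht : t ∈ Icc (1 : ℝ) 2) : t - Real.log t ≤ 4 / 3 := by
  have h := strictConcaveOn_log_Ioi.concaveOn.2 (show (1 : ℝ) ∈ Ioi 0 by simp)
    (show (2 : ℝ) ∈ Ioi 0 by simp) (show 0 ≤ 2 - t by linarith [ht.2])
    (show 0 ≤ t - 1 by linarith [ht.1]) (by ring)
  simp only [smul_eq_mul, Real.log_one, mul_zero, zero_add] at h
  have h2 : (2 - t) * 1 + (t - 1) * 2 = t := by ring
  rw [h2] at h
  have := Real.log_two_gt_d9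
  nlinarith [ht.1, ht.2]

theorem rpow_le_mul_exp_quarter {x N : ℝ} (hx : 0 ≤ x) (hN : 0 < N) :
    x ^ N ≤ (4 * N) ^ N * Real.exp (x / 4) := by
  have h1 : x / (4 * N) ≤ Real.exp (x / (4 * N)) := by
    linarith [Real.add_one_le_exp (x / (4 * N))]
  have h2 : (x / (4 * N)) ^ N ≤ Real.exp (x / 4) := by
    calc (x / (4 * N)) ^ N ≤ (Real.exp (x / (4 * N))) ^ N :=
          Real.rpow_le_rpow (by positivity) h1 hN.le
      _ = _ := by rw [← Real.exp_mul]; congr 1; field_simp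
  calc x ^ N = (4 * N) ^ N * (x / (4 * N)) ^ N := by
        rw [← Real.mul_rpow (by positivity) (by positivity)]
        congr 1; field_simp
    _ ≤ _ := by gcongr

/-- `(1 - y/t)_+^{λ+a}` is a superposition of the exponentials `e^{-(λ+a+iτ)(y-1/3)}`.  The line of
integration `Re z = λ + a` depends on `a`, which keeps the coefficients under control uniformly in
`a` up to the factor `e^{a/4}`. -/
theorem exists_laplace_coeff {lam : ℝ} (hlam : 0 < lam) :
    ∃ C > 0, ∀ a, 0 ≤ a → ∀ t ∈ Icc (1 : ℝ) 2, ∃ c : ℝ → ℂ, Continuous c ∧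
      (∀ τ, ‖c τ‖ ≤ C * Real.exp (a / 4) * (1 + |τ|) ^ (-(lam + 1 + min a 1))) ∧
      ∀ y : ℝ, ((posPow (lam + a) (1 - y / t) : ℝ) : ℂ) =
        ∫ τ, c τ * Complex.exp (-(((lam + a : ℝ) : ℂ) + τ * Complex.I) * ((y - 1 / 3 : ℝ) : ℂ)) := by
  set κ := min lam 1 / 2 with hκ
  have hκ0 : 0 < κ := by have := lt_min hlam one_pos; positivity
  have hκ1 : κ ≤ 1 := by have := min_le_right lam 1; linarith
  have hG0 := Real.Gamma_pos_of_pos (show 0 < lam + 1 by linarith)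
  refine ⟨Real.Gamma (lam + 1) * lam ^ (-(lam + 1)) * Real.exp lam *
    ((4 * (lam + 2)) ^ (lam + 2) * Real.exp ((1 + lam) / 4)) * κ ^ (-(lam + 2)), by positivity,
    fun a ha t ht => ?_⟩
  have ht0 : 0 < t := by linarith [ht.1]
  set m := lam + a with hm
  have hm0 : 0 < m := by linarith
  have hG := Real.Gamma_pos_of_pos (show 0 < m + 1 by linarith)
  refine ⟨fun τ => ((t ^ (-m) * (Real.Gamma (m + 1) / (2 * Real.pi)) : ℝ) : ℂ) *
    (((m : ℂ) + τ * Complex.I) ^ (-(m + 1) : ℂ) *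
      Complex.exp (((m : ℂ) + τ * Complex.I) * ((t - 1 / 3 : ℝ) : ℂ))), ?_, ?_, ?_⟩
  · exact continuous_const.mul ((continuous_cpow_vertical hm0 m).mul (by fun_prop))
  · intro τ
    have hzlow : κ * (1 + |τ|) ≤ ‖(m : ℂ) + τ * Complex.I‖ := by
      refine le_trans ?_ (mul_one_add_abs_le_norm_vertical hm0 τ)
      have : min lam 1 ≤ min m 1 := min_le_min_right _ (by linarith)
      rw [hκ]
      gcongr
    have hmz : m ≤ ‖(m : ℂ) + τ * Complex.I‖ := by
      have := Complex.abs_re_le_norm ((m : ℂ) + τ * Complex.I)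
      simp only [Complex.add_re, Complex.ofReal_re, Complex.mul_re, Complex.I_re, mul_zero,
        Complex.ofReal_im, Complex.I_im, zero_mul, sub_zero, add_zero] at this
      exact (le_abs_self m).trans this
    set r := ‖(m : ℂ) + τ * Complex.I‖ with hr
    have hr0 : 0 < r := lt_of_lt_of_le hm0 hmz
    have hT : 0 < 1 + |τ| := by positivity
    rw [norm_mul, norm_mul, norm_cpow_vertical, Complex.norm_exp, Complex.norm_real,
      Real.norm_of_nonneg (by positivity)]
    have hre : (((m : ℂ) + τ * Complex.I) * ((t - 1 / 3 : ℝ) : ℂ)).re = m * (t - 1 / 3) := by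
      simp
    rw [hre, ← hr]
    set N := lam + 1 + min a 1 with hN
    have hN2 : N ≤ lam + 2 := by have := min_le_right a 1; linarith
    have hN0 : 0 < N := by have : 0 ≤ min a 1 := le_min ha zero_le_one; linarith
    have hNm : N ≤ m + 1 := by have := min_le_left a 1; linarith
    -- the exponential factors cancel because `t - 1/3 - log t ≤ 1`
    have e1 : t ^ (-m) * Real.exp (m * (t - 1 / 3)) ≤ Real.exp m := by
      rw [Real.rpow_def_of_pos ht0, ← Real.exp_add]
      refine Real.exp_le_exp.2 ?_
      have := sub_log_le_four_thirds ht
      nlinarith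
    have e2 := Gamma_add_one_mul_rpow_le hlam ha
    rw [← hm] at e2
    have e3 : r ^ (-(m + 1)) = m ^ (-(m + 1)) * (m / r) ^ (m + 1) := by
      rw [Real.div_rpow hm0.le hr0.le, Real.rpow_neg hm0.le, Real.rpow_neg hr0.le]
      have := Real.rpow_pos_of_pos hm0 (m + 1)
      field_simp
    have e4 : (m / r) ^ (m + 1) ≤ (m / r) ^ N :=
      Real.rpow_le_rpow_of_exponent_ge (by positivity) ((div_le_one hr0).2 hmz) hNm
    have e5 : (m / r) ^ N ≤ ((4 * (lam + 2)) ^ (lam + 2) * Real.exp ((1 + lam) / 4)) *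
        κ ^ (-(lam + 2)) * Real.exp (a / 4) * (1 + |τ|) ^ (-N) := by
      have f1 : (m / r) ^ N ≤ (m * (κ * (1 + |τ|))⁻¹) ^ N := by
        refine Real.rpow_le_rpow (by positivity) ?_ hN0.le
        rw [div_eq_mul_inv]
        gcongr
      have f2 : m ^ N ≤ (4 * (lam + 2)) ^ (lam + 2) * Real.exp ((1 + lam) / 4) *
          Real.exp (a / 4) := by
        calc m ^ N ≤ (1 + m) ^ N := Real.rpow_le_rpow hm0.le (by linarith) hN0.le
          _ ≤ (1 + m) ^ (lam + 2) := Real.rpow_le_rpow_of_exponent_le (by linarith) hN2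
          _ ≤ (4 * (lam + 2)) ^ (lam + 2) * Real.exp ((1 + m) / 4) :=
              rpow_le_mul_exp_quarter (by linarith) (by linarith)
          _ = _ := by rw [mul_assoc, ← Real.exp_add]; congr 2; rw [hm]; ring
      have f3 : κ ^ (-N) ≤ κ ^ (-(lam + 2)) :=
        Real.rpow_le_rpow_of_exponent_ge hκ0 hκ1 (by linarith)
      calc (m / r) ^ N ≤ (m * (κ * (1 + |τ|))⁻¹) ^ N := f1
        _ = m ^ N * κ ^ (-N) * (1 + |τ|) ^ (-N) := by
            rw [Real.mul_rpow hm0.le (by positivity), Real.inv_rpow (by positivity),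
              Real.mul_rpow hκ0.le hT.le, Real.rpow_neg hκ0.le, Real.rpow_neg hT.le, mul_inv,
              mul_assoc]
        _ ≤ ((4 * (lam + 2)) ^ (lam + 2) * Real.exp ((1 + lam) / 4) *
          Real.exp (a / 4)) * κ ^ (-(lam + 2)) * (1 + |τ|) ^ (-N) := by gcongr
        _ = _ := by ring
    have hpi : Real.Gamma (m + 1) / (2 * Real.pi) ≤ Real.Gamma (m + 1) :=
      div_le_self hG.le (by linarith [Real.two_le_pi])
    calc t ^ (-m) * (Real.Gamma (m + 1) / (2 * Real.pi)) *
          (r ^ (-(m + 1)) * Real.exp (m * (t - 1 / 3)))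
        ≤ t ^ (-m) * Real.Gamma (m + 1) * (r ^ (-(m + 1)) * Real.exp (m * (t - 1 / 3))) := by
          gcongr
      _ = (t ^ (-m) * Real.exp (m * (t - 1 / 3))) * (Real.Gamma (m + 1) * m ^ (-(m + 1))) *
          (m / r) ^ (m + 1) := by rw [e3]; ring
      _ ≤ Real.exp m * (Real.exp (-a) * (Real.Gamma (lam + 1) * lam ^ (-(lam + 1)))) *
          (((4 * (lam + 2)) ^ (lam + 2) * Real.exp ((1 + lam) / 4)) *
        κ ^ (-(lam + 2)) * Real.exp (a / 4) * (1 + |τ|) ^ (-N)) := by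
          have := e4.trans e5
          gcongr
      _ = _ := by
          have : Real.exp m * Real.exp (-a) = Real.exp lam := by
            rw [← Real.exp_add]; congr 1; rw [hm]; ring
          rw [← this]
          ring
  · intro y
    have h := posPow_eq_integral hm0 hm0 (t - y)
    have hpos : posPow m (1 - y / t) = t ^ (-m) * posPow m (t - y) := by
      have : 1 - y / t = (t - y) / t := by field_simp
      unfold posPow
      by_cases hy : 0 < t - y
      · rw [if_pos hy, if_pos (by rw [this]; positivity), this, Real.div_rpow hy.le ht0.le,
          Real.rpow_neg ht0.le, div_eq_inv_mul]
      · rw [if_neg hy, if_neg, mul_zero]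
        rw [this, not_lt]
        exact div_nonpos_of_nonpos_of_nonneg (not_lt.1 hy) ht0.le
    have hpi := Real.pi_pos
    have h2 : ((posPow m (1 - y / t) : ℝ) : ℂ) =
        ((t ^ (-m) * (Real.Gamma (m + 1) / (2 * Real.pi)) : ℝ) : ℂ) *
          ((2 * Real.pi / Real.Gamma (m + 1) * posPow m (t - y) : ℝ) : ℂ) := by
      rw [← Complex.ofReal_mul, hpos]
      congr 1
      field_simp
    rw [h2, ← h, ← integral_const_mul]
    congr 1 with τ
    simp only [mul_assoc]
    rw [← Complex.exp_add]
    congr 3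
    push_cast
    ring

/-! ### Frequency cutoffs and the low-frequency kernel -/

/-- A smooth cutoff equal to `1` on `(-∞, 1/3]` and to `0` on `[1/2, ∞)`. -/
noncomputable def cutLow (r : ℝ) : ℝ := 1 - Real.smoothTransition (6 * r - 2)

/-- A smooth cutoff equal to `0` off `(1/3, 3)` and to `1` on `[1/2, 2]`. -/
noncomputable def cutMid (r : ℝ) : ℝ := (1 - cutLow r) * (1 - Real.smoothTransition (r - 2))

theorem contDiff_cutLow : ContDiff ℝ (⊤ : ℕ∞) cutLow :=
  contDiff_const.sub (Real.smoothTransition.contDiff.comp (by fun_prop))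

theorem contDiff_cutMid : ContDiff ℝ (⊤ : ℕ∞) cutMid :=
  (contDiff_const.sub contDiff_cutLow).mul
    (contDiff_const.sub (Real.smoothTransition.contDiff.comp (by fun_prop)))

theorem cutLow_eq_one {r : ℝ} (hr : r ≤ 1 / 3) : cutLow r = 1 := by
  rw [cutLow, Real.smoothTransition.zero_of_nonpos (by linarith), sub_zero]

theorem cutLow_eq_zero {r : ℝ} (hr : 1 / 2 ≤ r) : cutLow r = 0 := by
  rw [cutLow, Real.smoothTransition.one_of_one_le (by linarith), sub_self]

theorem cutLow_nonneg (r : ℝ) : 0 ≤ cutLow r := sub_nonneg.2 (Real.smoothTransition.le_one _)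

theorem cutLow_le_one (r : ℝ) : cutLow r ≤ 1 :=
  sub_le_self _ (Real.smoothTransition.nonneg _)

theorem cutMid_nonneg (r : ℝ) : 0 ≤ cutMid r :=
  mul_nonneg (sub_nonneg.2 (cutLow_le_one r)) (sub_nonneg.2 (Real.smoothTransition.le_one _))

theorem cutMid_le_one (r : ℝ) : cutMid r ≤ 1 :=
  mul_le_one₀ (sub_le_self _ (cutLow_nonneg r)) (sub_nonneg.2 (Real.smoothTransition.le_one _))
    (sub_le_self _ (Real.smoothTransition.nonneg _))

theorem mem_Icc_of_cutMid_ne_zero {r : ℝ} (hr : cutMid r ≠ 0) : r ∈ Icc (1 / 3 : ℝ) 3 := by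
  by_contra h
  refine hr ?_
  rw [mem_Icc, not_and_or, not_le, not_le] at h
  rcases h with h | h
  · rw [cutMid, cutLow_eq_one h.le, sub_self, zero_mul]
  · rw [cutMid, Real.smoothTransition.one_of_one_le (by linarith), sub_self, mul_zero]

theorem cutLow_add_cutMid {r : ℝ} (hr : r ≤ 2) : cutLow r + cutMid r = 1 := by
  rw [cutMid, Real.smoothTransition.zero_of_nonpos (by linarith)]
  ring

theorem IsHomogeneousDistance.isAmplitude_comp {d : ℕ} {β : ℝ}
    {ρ : EuclideanSpace ℝ (Fin d) → ℝ} (hρ : IsHomogeneousDistance β ρ) (hd : 1 ≤ d) {b B : ℝ}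
    (hb : 0 < b) {ψ : ℝ → ℂ} (hψ : ContDiff ℝ (⊤ : ℕ∞) ψ) (hs : ∀ r, ψ r ≠ 0 → r ∈ Icc b B) :
    IsAmplitude (shell ρ b B) fun ξ => if ξ = 0 then 0 else ψ (ρ ξ) := by
  have hK := hρ.isCompact_shell hd hb B
  have hsupp : Function.support (fun ξ => if ξ = 0 then 0 else ψ (ρ ξ)) ⊆ shell ρ b B := by
    intro ξ hξ
    rw [Function.mem_support] at hξ
    by_cases h0 : ξ = 0
    · simp [h0] at hξ
    · rw [if_neg h0] at hξ
      exact ⟨h0, hs _ hξ⟩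
  have hts : tsupport (fun ξ => if ξ = 0 then 0 else ψ (ρ ξ)) ⊆ shell ρ b B :=
    closure_minimal hsupp hK.isClosed
  refine ⟨contDiff_iff_contDiffAt.2 fun ξ => ?_, hK.of_isClosed_subset isClosed_closure hts, hts⟩
  by_cases h0 : ξ = 0
  · have : ξ ∉ tsupport (fun ξ => if ξ = 0 then 0 else ψ (ρ ξ)) := fun h => (hts h).1 h0
    exact contDiffAt_const.congr_of_eventuallyEq (notMem_tsupport_iff_eventuallyEq.1 this)
  · have : (fun ξ => if ξ = 0 then 0 else ψ (ρ ξ)) =ᶠ[𝓝 ξ] fun ξ => ψ (ρ ξ) := by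
      filter_upwards [isOpen_compl_singleton.mem_nhds h0] with η hη
      exact if_neg hη
    exact (hψ.contDiffAt.comp ξ (hρ.contDiffAt h0)).congr_of_eventuallyEq this

/-- A bounded function whose increments dominate `min u u⁻¹` along geometric sequences. -/
noncomputable def stepPotential (u : ℝ) : ℝ := if u ≤ 1 then u else 2 - u⁻¹

theorem stepPotential_le {u : ℝ} (hu : 0 ≤ u) : stepPotential u ≤ 2 := by
  unfold stepPotential
  split_ifs with h
  · linarith
  · linarith [inv_nonneg.2 hu]

theorem stepPotential_nonneg {u : ℝ} (hu : 0 ≤ u) : 0 ≤ stepPotential u := by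
  unfold stepPotential
  split_ifs with h
  · exact hu
  · linarith [inv_le_one_of_one_le₀ (not_le.1 h).le]

theorem mul_min_add_stepPotential_le {r u : ℝ} (hr : 0 < r) (hr1 : r < 1) (hu : 0 < u) :
    (1 - r) * min u u⁻¹ + stepPotential (u * r) ≤ stepPotential u := by
  have h6 : u * u⁻¹ = 1 := mul_inv_cancel₀ hu.ne'
  have hi := inv_pos.2 hu
  unfold stepPotential
  split_ifs with h1 h2 h2
  · nlinarith [min_le_left u u⁻¹]
  · have h3 : u⁻¹ ≤ 1 := inv_le_one_of_one_le₀ (by linarith)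
    have h5 : (1 - r) * min u u⁻¹ ≤ (1 - r) * u⁻¹ := by
      have := min_le_right u u⁻¹
      gcongr
    nlinarith [mul_nonneg (sub_nonneg.2 h1) hi.le, mul_nonneg (sub_nonneg.2 h3) hr.le]
  · nlinarith
  · have h4 := min_le_right u u⁻¹
    have h7 : 1 ≤ r⁻¹ := (one_le_inv₀ hr).2 hr1.le
    have h8 : 1 - r ≤ r⁻¹ - 1 := by
      have : r * r⁻¹ = 1 := mul_inv_cancel₀ hr.ne'
      nlinarith
    have h9 : (1 - r) * min u u⁻¹ ≤ (r⁻¹ - 1) * u⁻¹ :=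
      mul_le_mul h8 h4 (le_min hu.le hi.le) (by linarith)
    rw [mul_inv]
    linarith

theorem tsum_min_geometric_le {r w : ℝ} (hr : 0 < r) (hr1 : r < 1) (hw : 0 < w) :
    ∑' k : ℕ, ENNReal.ofReal (min (w * r ^ k) (w * r ^ k)⁻¹) ≤ ENNReal.ofReal (2 / (1 - r)) := by
  have h1 : 0 < 1 - r := by linarith
  have hsum : ∀ n : ℕ, (1 - r) * ∑ k ∈ Finset.range n, min (w * r ^ k) (w * r ^ k)⁻¹ +
      stepPotential (w * r ^ n) ≤ stepPotential w := by
    intro n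
    induction n with
    | zero => simp
    | succ n ih =>
      have := mul_min_add_stepPotential_le hr hr1 (show 0 < w * r ^ n by positivity)
      rw [Finset.sum_range_succ, mul_add, pow_succ, ← mul_assoc w]
      linarith
  refine ENNReal.tsum_le_of_sum_range_le fun n => ?_
  rw [← ENNReal.ofReal_sum_of_nonneg fun k _ => le_min (by positivity) (by positivity)]
  refine ENNReal.ofReal_le_ofReal ?_
  rw [le_div_iff₀ h1]
  have := stepPotential_nonneg (show 0 ≤ w * r ^ n by positivity)
  linarith [hsum n, stepPotential_le hw.le]

theorem integral_comp_smul_of_pos {d : ℕ} (f : EuclideanSpace ℝ (Fin d) → ℂ) {r : ℝ} (hr : 0 < r) :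
    ∫ ξ, f (r • ξ) = ((r ^ d)⁻¹ : ℝ) * ∫ ξ, f ξ := by
  rw [Measure.integral_comp_smul, finrank_euclideanSpace_fin, abs_of_pos (by positivity),
    Complex.real_smul]

namespace IsHomogeneousDistance

variable {d : ℕ} {β : ℝ} {ρ : EuclideanSpace ℝ (Fin d) → ℝ}

theorem ae_ne_zero (hd : 1 ≤ d) : ∀ᵐ ξ : EuclideanSpace ℝ (Fin d), ξ ≠ 0 := by
  have : Nonempty (Fin d) := ⟨⟨0, hd⟩⟩
  simp [ae_iff]

theorem integrable_of_support (hρ : IsHomogeneousDistance β ρ) (hd : 1 ≤ d) {B G : ℝ}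
    {m : EuclideanSpace ℝ (Fin d) → ℂ} (hm : AEStronglyMeasurable m) (hG : ∀ᵐ ξ, ‖m ξ‖ ≤ G)
    (hs : ∀ ξ, ξ ≠ 0 → B < ρ ξ → m ξ = 0) : Integrable m := by
  obtain ⟨M, hM, hM'⟩ := hρ.exists_norm_le hd B
  have hI : Integrable ((Metric.closedBall (0 : EuclideanSpace ℝ (Fin d)) M).indicator
      fun _ => G) :=
    (integrable_indicator_iff Metric.isClosed_closedBall.measurableSet).2
      (integrableOn_const (isCompact_closedBall _ _).measure_lt_top.ne)
  refine hI.mono' hm ?_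
  filter_upwards [ae_ne_zero hd, hG] with ξ hξ hg
  by_cases h : ρ ξ ≤ B
  · rwa [indicator_of_mem (by simpa using hM' ξ hξ h)]
  · rw [hs ξ hξ (not_le.1 h), norm_zero]
    exact indicator_nonneg (fun _ _ => (norm_nonneg _).trans hg) _

/-- The kernel of a smooth function of `ρ`, cut off to low frequencies, is `O(|x|^{-d})` even though
`ρ` is not smooth at the origin: dyadic pieces of the multiplier are rescaled copies of one smooth
amplitude. -/
theorem exists_invFT_low_le (hρ : IsHomogeneousDistance β ρ) (hd : 1 ≤ d) {g : ℝ → ℂ}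
    (hg : ContDiff ℝ (⊤ : ℕ∞) g) {G : ℝ} (hG : ∀ r, ‖g r‖ ≤ G) :
    ∃ C > 0, ∀ ε ∈ Icc (0 : ℝ) 1, ∀ x : EuclideanSpace ℝ (Fin d),
      ‖x‖ ^ d * ‖invFT (fun ξ => g (ε * ρ ξ) * (cutLow (ρ ξ) : ℂ)) x‖ ≤ C := by
  have hβ := hρ.degree_pos
  have hρm := hρ.measurable
  have hG0 : 0 ≤ G := (norm_nonneg _).trans (hG 0)
  have h2β : (1 : ℝ) ≤ 2 ^ β := Real.one_le_rpow (by norm_num) hβ.le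
  set ψ : ℝ → ℂ := fun r => ((cutLow r - cutLow (2 ^ β * r) : ℝ) : ℂ) with hψ
  have hψs : ContDiff ℝ (⊤ : ℕ∞) ψ :=
    Complex.ofRealCLM.contDiff.comp (contDiff_cutLow.sub (contDiff_cutLow.comp (by fun_prop)))
  have hψsupp : ∀ r, ψ r ≠ 0 → r ∈ Icc ((2 ^ β)⁻¹ / 3 : ℝ) (1 / 2) := by
    intro r hr
    by_contra h
    refine hr ?_
    rw [mem_Icc, not_and_or, not_le, not_le] at h
    simp only [hψ]
    rcases h with h | h
    · have h1 : 2 ^ β * r ≤ 1 / 3 := by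
        have : 2 ^ β * r ≤ 2 ^ β * ((2 ^ β)⁻¹ / 3) := by gcongr
        refine this.trans (le_of_eq ?_)
        field_simp
      have h2 : r ≤ 1 / 3 := by
        have : ((2 : ℝ) ^ β)⁻¹ ≤ 1 := inv_le_one_of_one_le₀ h2β
        linarith
      rw [cutLow_eq_one h1, cutLow_eq_one h2, sub_self, Complex.ofReal_zero]
    · have : 1 / 2 ≤ 2 ^ β * r := by nlinarith
      rw [cutLow_eq_zero this, cutLow_eq_zero h.le, sub_self, Complex.ofReal_zero]
  have hamp := hρ.isAmplitude_comp hd (by positivity) hψs hψsupp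
  obtain ⟨C₀, hC₀, h₀⟩ := hρ.exists_norm_pow_mul_invFT_le hd (fun ξ hξ => hξ.1) 0 hg hamp
  obtain ⟨C₁, hC₁, h₁⟩ := hρ.exists_norm_pow_mul_invFT_le hd (fun ξ hξ => hξ.1) (d + 1) hg hamp
  set W : ℝ → EuclideanSpace ℝ (Fin d) → ℂ := fun ε x =>
    invFT (fun ξ => g (ε * ρ ξ) * (cutLow (ρ ξ) : ℂ)) x with hW
  have hint : ∀ ε s, 1 ≤ s → Integrable fun ξ => g (ε * ρ ξ) * (cutLow (s * ρ ξ) : ℂ) := by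
    intro ε s hs
    refine hρ.integrable_of_support hd (B := 1 / 2) (G := G) ?_ (ae_of_all _ fun ξ => ?_) ?_
    · have := hg.continuous.measurable
      have := contDiff_cutLow.continuous.measurable
      exact Measurable.aestronglyMeasurable (by fun_prop)
    · rw [norm_mul, Complex.norm_real, Real.norm_of_nonneg (cutLow_nonneg _)]
      exact (mul_le_mul (hG _) (cutLow_le_one _) (cutLow_nonneg _) hG0).trans_eq (mul_one G)
    · intro ξ hξ h
      have : 1 / 2 ≤ s * ρ ξ := by nlinarith
      rw [cutLow_eq_zero this, Complex.ofReal_zero, mul_zero]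
  have hint1 : ∀ ε, Integrable fun ξ => g (ε * ρ ξ) * (cutLow (ρ ξ) : ℂ) := by
    intro ε
    simpa using hint ε 1 le_rfl
  obtain ⟨C₂, hC₂, h₂⟩ : ∃ C₂ : ℝ, 0 ≤ C₂ ∧ ∀ ε x, ‖W ε x‖ ≤ C₂ := by
    have hI : Integrable fun ξ => (cutLow (ρ ξ) : ℂ) := by
      refine hρ.integrable_of_support hd (B := 1 / 2) (G := 1) ?_ (ae_of_all _ fun ξ => ?_) ?_
      · have := contDiff_cutLow.continuous.measurable
        exact Measurable.aestronglyMeasurable (by fun_prop)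
      · rw [Complex.norm_real, Real.norm_of_nonneg (cutLow_nonneg _)]
        exact cutLow_le_one _
      · intro ξ hξ h
        rw [cutLow_eq_zero h.le, Complex.ofReal_zero]
    refine ⟨∫ ξ, G * ‖(cutLow (ρ ξ) : ℂ)‖, integral_nonneg fun ξ => by positivity, fun ε x =>
      (norm_invFT_le x).trans (integral_mono (hint1 ε).norm (hI.norm.const_mul G) fun ξ => ?_)⟩
    simp only [norm_mul]
    gcongr
    exact hG _
  have hstep : ∀ ε x, W ε x = invFT (fun ξ => g (ε * ρ ξ) * if ξ = 0 then 0 else ψ (ρ ξ)) x +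
      (((2 : ℝ) ^ d)⁻¹ : ℝ) * W (ε * (2 ^ β)⁻¹) ((2 : ℝ)⁻¹ • x) := by
    intro ε x
    have hsub : (((2 : ℝ) ^ d)⁻¹ : ℝ) * W (ε * (2 ^ β)⁻¹) ((2 : ℝ)⁻¹ • x) =
        invFT (fun ξ => g (ε * ρ ξ) * (cutLow (2 ^ β * ρ ξ) : ℂ)) x := by
      simp only [hW, invFT]
      rw [← integral_comp_smul_of_pos _ two_pos]
      refine integral_congr_ae ?_
      filter_upwards [ae_ne_zero hd] with ξ hξ
      rw [hρ.map_smul two_pos hξ, inner_smul_left, inner_smul_right]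
      have : (2 : ℝ) ^ β ≠ 0 := by positivity
      simp only [conj_trivial]
      rw [inv_mul_cancel_left₀ two_ne_zero, ← mul_assoc, mul_assoc ε, inv_mul_cancel₀ this, mul_one]
    rw [hsub, ← invFT_add ((hint1 ε).sub (hint ε _ h2β) |>.congr ?_) (hint ε _ h2β)]
    · simp only [hW, invFT]
      refine integral_congr_ae ?_
      filter_upwards [ae_ne_zero hd] with ξ hξ
      simp only [hψ, if_neg hξ]
      push_cast
      ring
    · filter_upwards [ae_ne_zero hd] with ξ hξ
      simp only [hψ, if_neg hξ, Pi.sub_apply]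
      push_cast
      ring
  have hpiece : ∀ ε ∈ Icc (0 : ℝ) 1, ∀ x : EuclideanSpace ℝ (Fin d), x ≠ 0 →
      ‖x‖ ^ d * ‖invFT (fun ξ => g (ε * ρ ξ) * if ξ = 0 then 0 else ψ (ρ ξ)) x‖ ≤
        (C₀ + C₁) * min ‖x‖ ‖x‖⁻¹ := by
    intro ε hε x hx
    have hx0 : 0 < ‖x‖ := norm_pos_iff.2 hx
    have a0 := h₀ ε hε x
    have a1 := h₁ ε hε x
    rw [pow_zero, one_mul] at a0
    rw [mul_min_of_nonneg _ _ (by positivity)]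
    generalize ‖invFT (fun ξ => g (ε * ρ ξ) * if ξ = 0 then 0 else ψ (ρ ξ)) x‖ = w at a0 a1
    rw [pow_succ] at a1
    have a1' : ‖x‖ ^ d * w ≤ C₁ * ‖x‖⁻¹ := by
      rw [← div_eq_mul_inv, le_div_iff₀ hx0]
      linarith
    refine le_min ?_ (a1'.trans (by gcongr; linarith))
    rcases le_total ‖x‖ 1 with h | h
    · calc ‖x‖ ^ d * w ≤ ‖x‖ ^ d * C₀ := by gcongr
        _ ≤ ‖x‖ * C₀ := by gcongr; exact pow_le_of_le_one hx0.le h (by omega)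
        _ ≤ _ := by nlinarith
    · have : ‖x‖⁻¹ ≤ ‖x‖ := (inv_le_one_of_one_le₀ h).trans h
      calc ‖x‖ ^ d * w ≤ C₁ * ‖x‖⁻¹ := a1'
        _ ≤ C₁ * ‖x‖ := by gcongr
        _ ≤ _ := by nlinarith
  have hind : ∀ M : ℕ, ∀ ε ∈ Icc (0 : ℝ) 1, ∀ x : EuclideanSpace ℝ (Fin d), x ≠ 0 →
      ‖x‖ ^ d * ‖W ε x‖ ≤ (C₀ + C₁) * (2 * stepPotential ‖x‖) +
        (‖x‖ / 2 ^ M) ^ d * C₂ := by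
    intro M
    induction M with
    | zero =>
      intro ε hε x hx
      have hp := stepPotential_nonneg (norm_nonneg x)
      rw [pow_zero, div_one]
      have := h₂ ε x
      have h3 : ‖x‖ ^ d * ‖W ε x‖ ≤ ‖x‖ ^ d * C₂ := by gcongr
      nlinarith
    | succ M ih =>
      intro ε hε x hx
      have hε' : ε * (2 ^ β)⁻¹ ∈ Icc (0 : ℝ) 1 :=
        ⟨mul_nonneg hε.1 (by positivity), mul_le_one₀ hε.2 (by positivity)
          (inv_le_one_of_one_le₀ h2β)⟩
      have hx' : (2 : ℝ)⁻¹ • x ≠ 0 := by simpa using hx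
      have hn : ‖(2 : ℝ)⁻¹ • x‖ = ‖x‖ / 2 := by
        rw [norm_smul, Real.norm_of_nonneg (by norm_num)]; ring
      have h1 := ih _ hε' _ hx'
      rw [hn] at h1
      have h2 := hpiece ε hε x hx
      have h3 := mul_min_add_stepPotential_le (r := 1 / 2) (by norm_num) (by norm_num)
        (norm_pos_iff.2 hx)
      rw [mul_one_div] at h3
      have h4 : ‖W ε x‖ ≤ ‖invFT (fun ξ => g (ε * ρ ξ) * if ξ = 0 then 0 else ψ (ρ ξ)) x‖ +
          (2 ^ d)⁻¹ * ‖W (ε * (2 ^ β)⁻¹) ((2 : ℝ)⁻¹ • x)‖ := by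
        rw [hstep]
        refine (norm_add_le _ _).trans (le_of_eq ?_)
        rw [norm_mul, Complex.norm_real, Real.norm_of_nonneg (by positivity)]
      calc ‖x‖ ^ d * ‖W ε x‖ ≤ ‖x‖ ^ d *
            (‖invFT (fun ξ => g (ε * ρ ξ) * if ξ = 0 then 0 else ψ (ρ ξ)) x‖ +
            (2 ^ d)⁻¹ * ‖W (ε * (2 ^ β)⁻¹) ((2 : ℝ)⁻¹ • x)‖) := by gcongr
        _ = ‖x‖ ^ d * ‖invFT (fun ξ => g (ε * ρ ξ) * if ξ = 0 then 0 else ψ (ρ ξ)) x‖ +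
            (‖x‖ / 2) ^ d * ‖W (ε * (2 ^ β)⁻¹) ((2 : ℝ)⁻¹ • x)‖ := by rw [div_pow]; ring
        _ ≤ (C₀ + C₁) * min ‖x‖ ‖x‖⁻¹ + ((C₀ + C₁) * (2 * stepPotential (‖x‖ / 2)) +
            (‖x‖ / 2 / 2 ^ M) ^ d * C₂) := add_le_add h2 h1
        _ = (C₀ + C₁) * (min ‖x‖ ‖x‖⁻¹ + 2 * stepPotential (‖x‖ / 2)) +
            (‖x‖ / 2 ^ (M + 1)) ^ d * C₂ := by
            rw [div_div, ← pow_succ']; ring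
        _ ≤ _ := by
            gcongr
            linarith
  refine ⟨(C₀ + C₁) * 4, by positivity, fun ε hε x => ?_⟩
  by_cases hx : x = 0
  · rw [hx, norm_zero, zero_pow (by omega), zero_mul]
    positivity
  have hlim : Tendsto (fun M : ℕ => (C₀ + C₁) * 4 + (‖x‖ / 2 ^ M) ^ d * C₂) atTop
      (𝓝 ((C₀ + C₁) * 4 + 0 ^ d * C₂)) := by
    have : Tendsto (fun M : ℕ => ‖x‖ / (2 : ℝ) ^ M) atTop (𝓝 0) :=
      tendsto_const_nhds.div_atTop (tendsto_pow_atTop_atTop_of_one_lt (by norm_num))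
    exact ((this.pow d).mul_const C₂).const_add _
  rw [zero_pow (by omega), zero_mul, add_zero] at hlim
  refine ge_of_tendsto' hlim fun M => (hind M ε hε x hx).trans ?_
  gcongr
  linarith [stepPotential_le (norm_nonneg x)]

end IsHomogeneousDistance

theorem one_le_one_sub_log {v : ℝ} (h0 : 0 < v) (h1 : v ≤ 1) : 1 ≤ 1 - Real.log v := by
  linarith [Real.log_nonpos h0.le h1]

theorem hlog_eq {lam γ r : ℝ} (hr : r < 1) :
    hlog lam γ r = (1 - r) ^ lam / (1 - Real.log (1 - r)) ^ γ := by
  rw [hlog, if_pos hr, one_div, Real.log_inv, ← sub_eq_add_neg]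

theorem contDiffAt_hlog (lam γ : ℝ) {r : ℝ} (hr : r ∈ Ioo (-1 : ℝ) 1) :
    ContDiffAt ℝ (⊤ : ℕ∞) (hlog lam γ) r := by
  have h1 : (0 : ℝ) < 1 - r := by linarith [hr.2]
  have h2 : 0 < 1 - Real.log (1 - r) := by
    have : Real.log (1 - r) ≤ Real.log 2 := Real.log_le_log h1 (by linarith [hr.1])
    linarith [Real.log_two_lt_d9]
  have heq : hlog lam γ =ᶠ[𝓝 r] fun r => (1 - r) ^ lam / (1 - Real.log (1 - r)) ^ γ := by
    filter_upwards [isOpen_Iio.mem_nhds hr.2] with s hs using hlog_eq hs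
  refine ContDiffAt.congr_of_eventuallyEq ?_ heq
  have hs : ContDiffAt ℝ (⊤ : ℕ∞) (fun r : ℝ => 1 - r) r := by fun_prop
  have hl : ContDiffAt ℝ (⊤ : ℕ∞) (fun r : ℝ => 1 - Real.log (1 - r)) r :=
    contDiffAt_const.sub (hs.log h1.ne')
  exact (hs.rpow_const_of_ne h1.ne').div (hl.rpow_const_of_ne h2.ne')
    (Real.rpow_pos_of_pos h2 _).ne'

/-- A smooth compactly supported function which agrees with `hlog` on `[0, 1/2]`. -/
theorem exists_smooth_eq_hlog (lam γ : ℝ) : ∃ g : ℝ → ℝ, ContDiff ℝ (⊤ : ℕ∞) g ∧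
    HasCompactSupport g ∧ ∀ r ∈ Icc (0 : ℝ) (1 / 2), g r = hlog lam γ r := by
  set w : ℝ → ℝ := fun r =>
    Real.smoothTransition (2 + 4 * r) * (1 - Real.smoothTransition (4 * r - 2)) with hw
  have hws : ContDiff ℝ (⊤ : ℕ∞) w :=
    (Real.smoothTransition.contDiff.comp (by fun_prop)).mul
      (contDiff_const.sub (Real.smoothTransition.contDiff.comp (by fun_prop)))
  have hsupp : Function.support (fun r => w r * hlog lam γ r) ⊆ Icc (-1 / 2) (3 / 4) := by
    intro r hr
    by_contra h
    refine hr ?_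
    rw [mem_Icc, not_and_or, not_le, not_le] at h
    simp only [hw]
    rcases h with h | h
    · rw [Real.smoothTransition.zero_of_nonpos (by linarith)]
      simp
    · rw [Real.smoothTransition.one_of_one_le (x := 4 * r - 2) (by linarith)]
      simp
  have hts : tsupport (fun r => w r * hlog lam γ r) ⊆ Icc (-1 / 2) (3 / 4) :=
    closure_minimal hsupp isClosed_Icc
  refine ⟨fun r => w r * hlog lam γ r, contDiff_iff_contDiffAt.2 fun r => ?_,
    isCompact_Icc.of_isClosed_subset isClosed_closure hts, fun r hr => ?_⟩
  · by_cases hr : r ∈ Ioo (-1 : ℝ) 1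
    · exact hws.contDiffAt.mul (contDiffAt_hlog lam γ hr)
    · have : r ∉ tsupport (fun r => w r * hlog lam γ r) := fun h => hr
        ⟨by linarith [(hts h).1], by linarith [(hts h).2]⟩
      exact contDiffAt_const.congr_of_eventuallyEq (notMem_tsupport_iff_eventuallyEq.1 this)
  · simp only [hw]
    rw [Real.smoothTransition.one_of_one_le (x := 2 + 4 * r) (by linarith [hr.1]),
      Real.smoothTransition.zero_of_nonpos (x := 4 * r - 2) (by linarith [hr.2])]
    ring

/-! ### The high-frequency part as a superposition of wave packets -/

theorem lintegral_mul_sq_le {Ω : Type*} [MeasurableSpace Ω] {μ : Measure Ω} {f g : Ω → ℝ≥0∞}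
    (hf : AEMeasurable f μ) (hg : AEMeasurable g μ) :
    (∫⁻ x, f x * g x ∂μ) ^ 2 ≤ (∫⁻ x, f x ^ 2 ∂μ) * ∫⁻ x, g x ^ 2 ∂μ := by
  have h := ENNReal.lintegral_mul_le_Lp_mul_Lq μ Real.HolderConjugate.two_two hf hg
  simp only [Pi.mul_apply, ENNReal.rpow_two] at h
  have hsq : ∀ a : ℝ≥0∞, (a ^ (1 / 2 : ℝ)) ^ 2 = a := by
    intro a
    rw [← ENNReal.rpow_two, ← ENNReal.rpow_mul]
    norm_num
  calc (∫⁻ x, f x * g x ∂μ) ^ 2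
      ≤ ((∫⁻ x, f x ^ 2 ∂μ) ^ (1 / 2 : ℝ) * (∫⁻ x, g x ^ 2 ∂μ) ^ (1 / 2 : ℝ)) ^ 2 := by gcongr
    _ = _ := by rw [mul_pow, hsq, hsq]

theorem lintegral_mul_sq_le' {Ω : Type*} [MeasurableSpace Ω] {μ : Measure Ω} {w g : Ω → ℝ≥0∞}
    (hw : AEMeasurable w μ) (hg : AEMeasurable g μ) :
    (∫⁻ x, w x * g x ∂μ) ^ 2 ≤ (∫⁻ x, w x ∂μ) * ∫⁻ x, w x * g x ^ 2 ∂μ := by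
  have hsq : ∀ a : ℝ≥0∞, (a ^ (1 / 2 : ℝ)) * (a ^ (1 / 2 : ℝ)) = a := by
    intro a
    rw [← ENNReal.rpow_add_of_nonneg _ _ (by norm_num) (by norm_num)]
    norm_num
  have h := lintegral_mul_sq_le (μ := μ) (f := fun x => w x ^ (1 / 2 : ℝ))
    (g := fun x => w x ^ (1 / 2 : ℝ) * g x) (hw.pow_const _) ((hw.pow_const _).mul hg)
  simp only [mul_pow, ← mul_assoc, hsq] at h
  simpa only [sq, hsq] using h

/-- A finite measure on `[0, ∞)` whose Laplace transform is `L ↦ (1 + L)^{-γ}`. -/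
structure IsExpMixture (γ : ℝ) (ν : Measure ℝ) : Prop where
  finite : IsFiniteMeasure ν
  nonneg : ∀ᵐ a ∂ν, 0 ≤ a
  integrable : ∀ L : ℝ, -1 < L → Integrable (fun a => Real.exp (-L * a)) ν
  integral_eq : ∀ L : ℝ, -1 < L → ∫ a, Real.exp (-L * a) ∂ν = (1 + L) ^ (-γ)

theorem exists_isExpMixture {γ : ℝ} (hγ : 0 ≤ γ) : ∃ ν, IsExpMixture γ ν := by
  obtain ⟨ν, h1, h2, h3⟩ := exists_exp_mixture hγ
  exact ⟨ν, h1, h2, fun L hL => (h3 L hL).1, fun L hL => (h3 L hL).2⟩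

theorem measurable_posPow : Measurable fun z : ℝ × ℝ => posPow z.1 z.2 := by
  unfold posPow
  exact Measurable.ite (measurableSet_lt measurable_const measurable_snd)
    (measurable_snd.pow measurable_fst) measurable_const

theorem posPow_le_one {μ v : ℝ} (hμ : 0 ≤ μ) (hv : v ≤ 1) : posPow μ v ≤ 1 := by
  unfold posPow
  split_ifs with h
  · exact Real.rpow_le_one h.le hv hμ
  · exact zero_le_one

theorem IsExpMixture.hlog_eq {γ : ℝ} {ν : Measure ℝ} (hν : IsExpMixture γ ν) (lam : ℝ) {y : ℝ}
    (hy : 0 ≤ y) : hlog lam γ y = ∫ a, posPow (lam + a) (1 - y) ∂ν := by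
  by_cases h : y < 1
  · have hv : 0 < 1 - y := by linarith
    have hL : 0 ≤ -Real.log (1 - y) := neg_nonneg.2 (Real.log_nonpos hv.le (by linarith))
    rw [_root_.hlog_eq h, sub_eq_add_neg 1 (Real.log _), div_eq_mul_inv,
      ← Real.rpow_neg (by linarith), ← hν.integral_eq _ (by linarith), ← integral_const_mul]
    congr 1 with a
    rw [posPow, if_pos hv, Real.rpow_add hv, neg_neg, Real.rpow_def_of_pos hv a]
  · have : ∀ a, posPow (lam + a) (1 - y) = 0 := fun a => if_neg (by linarith)
    simp [hlog, h, this]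

/-- The wave packet `∫ e^{-z(ρ(ξ) - 1/3)} G(ξ) e^{i⟨x,ξ⟩} dξ`. -/
noncomputable def phaseFT {d : ℕ} (ρ : EuclideanSpace ℝ (Fin d) → ℝ)
    (G : EuclideanSpace ℝ (Fin d) → ℂ) (z : ℂ) (x : EuclideanSpace ℝ (Fin d)) : ℂ :=
  invFT (fun ξ => Complex.exp (-z * ((ρ ξ - 1 / 3 : ℝ) : ℂ)) * G ξ) x

theorem measurable_phaseFT {d : ℕ} {ρ : EuclideanSpace ℝ (Fin d) → ℝ}
    {G : EuclideanSpace ℝ (Fin d) → ℂ} (hρ : Measurable ρ) (hG : Measurable G) :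
    Measurable fun w : ℂ × EuclideanSpace ℝ (Fin d) => phaseFT ρ G w.1 w.2 := by
  unfold phaseFT invFT
  refine StronglyMeasurable.measurable (StronglyMeasurable.integral_prod_right'
    (f := fun w : (ℂ × EuclideanSpace ℝ (Fin d)) × EuclideanSpace ℝ (Fin d) =>
      Complex.exp (-w.1.1 * ((ρ w.2 - 1 / 3 : ℝ) : ℂ)) * G w.2 *
        Complex.exp (Complex.I * (inner ℝ w.1.2 w.2 : ℝ))) ?_)
  refine Measurable.stronglyMeasurable ?_
  have : Measurable fun w : (ℂ × EuclideanSpace ℝ (Fin d)) × EuclideanSpace ℝ (Fin d) =>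
      (inner ℝ w.1.2 w.2 : ℝ) := by fun_prop
  fun_prop

theorem norm_cexp_neg_mul_le_one {z : ℂ} (hz : 0 ≤ z.re) {u : ℝ} (hu : 0 ≤ u) :
    ‖Complex.exp (-z * (u : ℂ))‖ ≤ 1 := by
  rw [Complex.norm_exp]
  refine Real.exp_le_one_iff.2 ?_
  have : (-z * (u : ℂ)).re = -(z.re * u) := by simp
  rw [this]
  exact neg_nonpos.2 (mul_nonneg hz hu)

section Packets

variable {d : ℕ} {β : ℝ} {ρ : EuclideanSpace ℝ (Fin d) → ℝ} {G : EuclideanSpace ℝ (Fin d) → ℂ}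

theorem norm_cexp_mul_le (hs : ∀ ξ, G ξ ≠ 0 → ξ ∈ shell ρ (1 / 3) 3) {z : ℂ} (hz : 0 ≤ z.re)
    (ξ : EuclideanSpace ℝ (Fin d)) :
    ‖Complex.exp (-z * ((ρ ξ - 1 / 3 : ℝ) : ℂ)) * G ξ‖ ≤ ‖G ξ‖ := by
  by_cases h : G ξ = 0
  · simp [h]
  · rw [norm_mul]
    refine mul_le_of_le_one_left (norm_nonneg _) (norm_cexp_neg_mul_le_one hz ?_)
    linarith [(hs ξ h).2.1]

theorem integrable_phase (hρ : Measurable ρ) (hG : Integrable G)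
    (hs : ∀ ξ, G ξ ≠ 0 → ξ ∈ shell ρ (1 / 3) 3) {z : ℂ} (hz : 0 ≤ z.re) :
    Integrable fun ξ => Complex.exp (-z * ((ρ ξ - 1 / 3 : ℝ) : ℂ)) * G ξ := by
  refine hG.norm.mono' (AEStronglyMeasurable.mul ?_ hG.1)
    (ae_of_all _ fun ξ => norm_cexp_mul_le hs hz ξ)
  exact Measurable.aestronglyMeasurable (by fun_prop)

/-- Plancherel bound for wave packets. -/
theorem lintegral_phaseFT_sq_le (hρ : Measurable ρ) (hG : Integrable G)
    (hs : ∀ ξ, G ξ ≠ 0 → ξ ∈ shell ρ (1 / 3) 3) {z : ℂ} (hz : 0 ≤ z.re) :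
    ∫⁻ x, ‖phaseFT ρ G z x‖ₑ ^ 2 ≤ ENNReal.ofReal ((2 * Real.pi) ^ d) * ∫⁻ ξ, ‖G ξ‖ₑ ^ 2 := by
  have h := lintegral_enorm_fourier_sq_le (integrable_phase hρ hG hs hz)
  rw [finrank_euclideanSpace_fin] at h
  simp only [phaseFT, invFT]
  simp_rw [mul_comm _ (Complex.exp (Complex.I * _))]
  refine h.trans ?_
  gcongr with ξ
  exact enorm_le_iff_norm_le.2 (norm_cexp_mul_le hs hz ξ)

theorem cexp_vertical_split (μ τ r : ℝ) : Complex.exp (-((μ : ℂ) + τ * Complex.I) *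
    ((r - 1 / 3 : ℝ) : ℂ)) = Complex.exp (Complex.I * ((τ / 3 : ℝ) : ℂ)) *
      (Complex.exp (Complex.I * ((-(τ * r) : ℝ) : ℂ)) * Complex.exp (-(μ : ℂ) *
      ((r - 1 / 3 : ℝ) : ℂ))) := by
  rw [← Complex.exp_add, ← Complex.exp_add]
  congr 1
  push_cast
  ring

theorem cexp_inner_sub_split (u v : ℝ) : Complex.exp (Complex.I * ((u - v : ℝ) : ℂ)) =
    Complex.exp (Complex.I * ((-v : ℝ) : ℂ)) * Complex.exp (Complex.I * (u : ℂ)) := by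
  rw [← Complex.exp_add]
  congr 1
  push_cast
  ring

theorem phaseFT_eq_setIntegral (hρ : IsHomogeneousDistance β ρ)
    (hs : ∀ ξ, G ξ ≠ 0 → ξ ∈ shell ρ (1 / 3) 3) (μ τ : ℝ) (x : EuclideanSpace ℝ (Fin d)) :
    phaseFT ρ G ((μ : ℂ) + τ * Complex.I) x = Complex.exp (Complex.I * ((τ / 3 : ℝ) : ℂ)) *
      ∫ ξ in shell ρ (1 / 3) 3, Complex.exp (Complex.I * ((inner ℝ x ξ - τ * ρ ξ : ℝ) : ℂ)) *
        (Complex.exp (-(μ : ℂ) * ((ρ ξ - 1 / 3 : ℝ) : ℂ)) * G ξ) := by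
  rw [← integral_const_mul, phaseFT, invFT, ← integral_indicator (hρ.measurableSet_shell _ _)]
  congr 1 with ξ
  by_cases h : ξ ∈ shell ρ (1 / 3) 3
  · rw [indicator_of_mem h, cexp_vertical_split]
    rw [cexp_inner_sub_split]
    ring
  · have h0 : G ξ = 0 := by
      by_contra h0
      exact h (hs ξ h0)
    rw [indicator_of_notMem h, h0, mul_zero, zero_mul]

theorem IsHomogeneousDistance.exists_phaseFT_bounds (hρ : IsHomogeneousDistance β ρ)
    (hd : 1 ≤ d) : ∃ C > 0, ∀ G : EuclideanSpace ℝ (Fin d) → ℂ, Integrable G →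
      (∀ ξ, G ξ ≠ 0 → ξ ∈ shell ρ (1 / 3) 3) → ∀ μ : ℝ, 0 ≤ μ →
      (∀ x, ∫⁻ τ : ℝ, ‖phaseFT ρ G ((μ : ℂ) + τ * Complex.I) x‖ₑ ^ 2 ≤
        ENNReal.ofReal C * ∫⁻ ξ, ‖G ξ‖ₑ ^ 2) ∧
      ∀ r : ℝ, 1 ≤ r → ∫⁻ z : ℝ × EuclideanSpace ℝ (Fin d),
        ‖phaseFT ρ G ((μ : ℂ) + z.1 * Complex.I) z.2‖ₑ ^ 2
          ∂(volume.prod (volume.restrict (Metric.ball 0 r))) ≤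
        ENNReal.ofReal (C * r) * ∫⁻ ξ, ‖G ξ‖ₑ ^ 2 := by
  obtain ⟨C₁, hC₁, h₁⟩ := hρ.lintegral_time_le hd
  obtain ⟨C₂, hC₂, h₂⟩ := hρ.lintegral_ball_time_le hd
  refine ⟨C₁ + C₂, by positivity, fun G hG hs μ hμ => ⟨fun x => ?_, fun r hr => ?_⟩⟩
  · have hint := integrable_phase hρ.measurable hG hs (z := (μ : ℂ)) (by simpa using hμ)
    have h := h₁ (fun ξ => Complex.exp (Complex.I * (inner ℝ x ξ : ℝ)) *
      (Complex.exp (-(μ : ℂ) * ((ρ ξ - 1 / 3 : ℝ) : ℂ)) * G ξ))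
      ((integrable_mul_cexp hint x).congr (ae_of_all _ fun ξ => mul_comm _ _)).integrableOn
    calc _ = ∫⁻ τ : ℝ, ‖∫ ξ in shell ρ (1 / 3) 3,
        Complex.exp (Complex.I * ((-(τ * ρ ξ) : ℝ) : ℂ)) *
          (Complex.exp (Complex.I * (inner ℝ x ξ : ℝ)) *
            (Complex.exp (-(μ : ℂ) * ((ρ ξ - 1 / 3 : ℝ) : ℂ)) * G ξ))‖ₑ ^ 2 := by
          congr 1 with τ
          rw [phaseFT_eq_setIntegral hρ hs, enorm_mul]
          have h1 : ‖Complex.exp (Complex.I * ((τ / 3 : ℝ) : ℂ))‖ₑ = 1 := by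
            rw [← ofReal_norm, norm_cexp_I_mul_ofReal, ENNReal.ofReal_one]
          rw [h1, one_mul]
          congr 3 with ξ
          rw [cexp_inner_sub_split, mul_assoc]
      _ ≤ _ := h
      _ ≤ ENNReal.ofReal C₁ * ∫⁻ ξ in shell ρ (1 / 3) 3, ‖G ξ‖ₑ ^ 2 := by
          gcongr with ξ
          rw [enorm_mul, ← ofReal_norm, norm_cexp_I_mul_ofReal, ENNReal.ofReal_one,
            one_mul]
          exact enorm_le_iff_norm_le.2 (norm_cexp_mul_le hs (by simpa using hμ) ξ)
      _ ≤ _ := by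
          gcongr
          · linarith
          · exact Measure.restrict_le_self
  · have hint := integrable_phase hρ.measurable hG hs (z := (μ : ℂ)) (by simpa using hμ)
    have h := h₂ _ hint.integrableOn r hr
    calc _ = ∫⁻ z : ℝ × EuclideanSpace ℝ (Fin d), ‖∫ ξ in shell ρ (1 / 3) 3,
        Complex.exp (Complex.I * ((inner ℝ z.2 ξ - z.1 * ρ ξ : ℝ) : ℂ)) *
          (Complex.exp (-(μ : ℂ) * ((ρ ξ - 1 / 3 : ℝ) : ℂ)) * G ξ)‖ₑ ^ 2
          ∂(volume.prod (volume.restrict (Metric.ball 0 r))) := by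
          congr 1 with z
          rw [phaseFT_eq_setIntegral hρ hs, enorm_mul]
          have h1 : ‖Complex.exp (Complex.I * ((z.1 / 3 : ℝ) : ℂ))‖ₑ = 1 := by
            rw [← ofReal_norm, norm_cexp_I_mul_ofReal, ENNReal.ofReal_one]
          rw [h1, one_mul]
      _ ≤ _ := h
      _ ≤ ENNReal.ofReal (C₂ * r) * ∫⁻ ξ in shell ρ (1 / 3) 3, ‖G ξ‖ₑ ^ 2 := by
          gcongr with ξ
          exact enorm_le_iff_norm_le.2 (norm_cexp_mul_le hs (by simpa using hμ) ξ)
      _ ≤ _ := by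
          gcongr
          · linarith
          · exact Measure.restrict_le_self

theorem integrable_prod_mul_phase (hρ : Measurable ρ) (hG : Integrable G)
    (hs : ∀ ξ, G ξ ≠ 0 → ξ ∈ shell ρ (1 / 3) 3) {c : ℝ → ℂ} (hc : Integrable c) {μ : ℝ}
    (hμ : 0 ≤ μ) (x : EuclideanSpace ℝ (Fin d)) :
    Integrable (fun w : ℝ × EuclideanSpace ℝ (Fin d) => c w.1 *
      (Complex.exp (-((μ : ℂ) + w.1 * Complex.I) * ((ρ w.2 - 1 / 3 : ℝ) : ℂ)) * G w.2 *
        Complex.exp (Complex.I * (inner ℝ x w.2 : ℝ)))) (volume.prod volume) := by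
  have h0 := hc.mul_prod hG
  refine h0.norm.mono' ?_ (ae_of_all _ fun w => ?_)
  · have h1 : AEStronglyMeasurable (fun w : ℝ × EuclideanSpace ℝ (Fin d) =>
        Complex.exp (-((μ : ℂ) + w.1 * Complex.I) * ((ρ w.2 - 1 / 3 : ℝ) : ℂ)) *
        Complex.exp (Complex.I * (inner ℝ x w.2 : ℝ))) (volume.prod volume) := by
      refine Measurable.aestronglyMeasurable ?_
      have : Measurable fun w : ℝ × EuclideanSpace ℝ (Fin d) => (inner ℝ x w.2 : ℝ) := by fun_prop
      fun_prop
    refine (h1.mul h0.1).congr (ae_of_all _ fun w => ?_)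
    simp only [Pi.mul_apply]
    ring
  · rw [norm_mul, norm_mul, norm_cexp_I_mul_ofReal, mul_one, norm_mul (c w.1) (G w.2)]
    gcongr
    exact norm_cexp_mul_le hs (by simpa using hμ) _

/-- For every `t ∈ [1, 2]`, the high-frequency part of the mean is dominated by one and the same
superposition of wave packets. -/
theorem exists_enorm_invFT_hlog_le {lam γ : ℝ} (hlam : 0 < lam) {ν : Measure ℝ}
    (hν : IsExpMixture γ ν) : ∃ C > 0, ∀ {d : ℕ} {ρ : EuclideanSpace ℝ (Fin d) → ℝ},
      Measurable ρ → ∀ G : EuclideanSpace ℝ (Fin d) → ℂ, Integrable G →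
      (∀ ξ, G ξ ≠ 0 → ξ ∈ shell ρ (1 / 3) 3) → ∀ t ∈ Icc (1 : ℝ) 2, ∀ x,
      ‖invFT (fun ξ => (hlog lam γ (ρ ξ / t) : ℂ) * G ξ) x‖ₑ ≤ ENNReal.ofReal C *
        ∫⁻ a, (∫⁻ τ : ℝ, ENNReal.ofReal (Real.exp (a / 4) *
          (1 + |τ|) ^ (-(lam + 1 + min a 1))) *
          ‖phaseFT ρ G (((lam + a : ℝ) : ℂ) + τ * Complex.I) x‖ₑ) ∂ν := by
  obtain ⟨C, hC, hrep⟩ := exists_laplace_coeff hlam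
  refine ⟨C, hC, fun {d ρ} hρ G hG hs t ht x => ?_⟩
  have := hν.finite
  have ht0 : 0 < t := by linarith [ht.1]
  have hρ0 : ∀ ξ, G ξ ≠ 0 → 0 ≤ ρ ξ := fun ξ h => by linarith [(hs ξ h).2.1]
  -- the mixture in `a`
  have hmix : invFT (fun ξ => (hlog lam γ (ρ ξ / t) : ℂ) * G ξ) x =
      ∫ a, invFT (fun ξ => (posPow (lam + a) (1 - ρ ξ / t) : ℂ) * G ξ) x ∂ν := by
    unfold invFT
    rw [integral_integral_swap]
    · congr 1 with ξ
      simp_rw [mul_assoc]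
      rw [integral_mul_const, integral_complex_ofReal]
      by_cases h : G ξ = 0
      · simp [h]
      · rw [hν.hlog_eq lam (div_nonneg (hρ0 ξ h) ht0.le)]
    · have h0 : Integrable (fun w : ℝ × EuclideanSpace ℝ (Fin d) => (1 : ℂ) * G w.2)
          (ν.prod volume) := (integrable_const (1 : ℂ)).mul_prod hG
      have hae : ∀ᵐ w ∂(ν.prod (volume : Measure (EuclideanSpace ℝ (Fin d)))), 0 ≤ w.1 :=
        Measure.quasiMeasurePreserving_fst.ae hν.nonneg
      refine h0.norm.mono' ?_ ?_
      · have h1 : AEStronglyMeasurable (fun w : ℝ × EuclideanSpace ℝ (Fin d) =>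
            (posPow (lam + w.1) (1 - ρ w.2 / t) : ℂ) *
            Complex.exp (Complex.I * (inner ℝ x w.2 : ℝ))) (ν.prod volume) := by
          refine Measurable.aestronglyMeasurable ?_
          have h2 : Measurable fun w : ℝ × EuclideanSpace ℝ (Fin d) => (inner ℝ x w.2 : ℝ) := by
            fun_prop
          have h3 : Measurable fun w : ℝ × EuclideanSpace ℝ (Fin d) =>
              posPow (lam + w.1) (1 - ρ w.2 / t) :=
            measurable_posPow.comp (f := fun w : ℝ × EuclideanSpace ℝ (Fin d) =>
              (lam + w.1, 1 - ρ w.2 / t)) (by fun_prop)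
          fun_prop
        refine (h1.mul h0.1).congr (ae_of_all _ fun w => ?_)
        simp only [Pi.mul_apply, Function.uncurry]
        ring
      · filter_upwards [hae] with w hw
        rw [Function.uncurry, norm_mul, norm_mul, norm_cexp_I_mul_ofReal, mul_one, one_mul]
        by_cases h : G w.2 = 0
        · simp [h]
        · refine mul_le_of_le_one_left (norm_nonneg _) ?_
          rw [Complex.norm_real, Real.norm_of_nonneg (posPow_nonneg _ _)]
          have : 0 ≤ ρ w.2 / t := div_nonneg (hρ0 _ h) ht0.le
          exact posPow_le_one (by linarith) (by linarith)
  rw [hmix, ← lintegral_const_mul']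
  swap
  · exact ENNReal.ofReal_ne_top
  refine le_trans (enorm_integral_le_lintegral_enorm _) ?_
  refine lintegral_mono_ae ?_
  filter_upwards [hν.nonneg] with a ha
  obtain ⟨c, hc, hcb, hceq⟩ := hrep a ha t ht
  have hm : 0 ≤ min a 1 := le_min ha zero_le_one
  have hcint : Integrable c := by
    refine ((integrable_one_add_abs_rpow (s := lam + 1 + min a 1) (by linarith)).const_mul
      (C * Real.exp (a / 4))).mono' hc.aestronglyMeasurable (ae_of_all _ fun τ => hcb τ)
  have hprod := integrable_prod_mul_phase hρ hG hs hcint (μ := lam + a) (by linarith) x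
  have hswap : invFT (fun ξ => (posPow (lam + a) (1 - ρ ξ / t) : ℂ) * G ξ) x =
      ∫ τ, c τ * phaseFT ρ G (((lam + a : ℝ) : ℂ) + τ * Complex.I) x := by
    simp only [phaseFT, invFT, ← integral_const_mul]
    rw [integral_integral_swap hprod]
    congr 1 with ξ
    rw [hceq, ← integral_mul_const, ← integral_mul_const]
    congr 1 with τ
    ring
  rw [hswap, ← lintegral_const_mul' _ _ ENNReal.ofReal_ne_top]
  refine (enorm_integral_le_lintegral_enorm _).trans (lintegral_mono fun τ => ?_)
  rw [enorm_mul, ← mul_assoc, ← ENNReal.ofReal_mul hC.le, ← ofReal_norm (c τ),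
    ← mul_assoc]
  gcongr
  exact hcb τ

end Packets

/-! ### Decomposition of the means of an integrable function -/

section Decomposition

variable {d : ℕ} {β : ℝ} {ρ : EuclideanSpace ℝ (Fin d) → ℝ}

/-- The Fourier transform `F̂(ξ) = ∫ F(y) e^{-i⟨y,ξ⟩} dy`. -/
noncomputable def ft (F : EuclideanSpace ℝ (Fin d) → ℂ) (ξ : EuclideanSpace ℝ (Fin d)) : ℂ :=
  ∫ y, F y * Complex.exp (-Complex.I * (inner ℝ y ξ : ℝ))

theorem ft_eq_invFT (F : EuclideanSpace ℝ (Fin d) → ℂ) (ξ : EuclideanSpace ℝ (Fin d)) :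
    ft F ξ = invFT F (-ξ) := by
  unfold ft invFT
  congr 1 with y
  rw [inner_neg_left, real_inner_comm]
  push_cast
  ring_nf

theorem continuous_ft {F : EuclideanSpace ℝ (Fin d) → ℂ} (hF : Integrable F) :
    Continuous (ft F) := by
  have : ft F = fun ξ => invFT F (-ξ) := funext (ft_eq_invFT F)
  rw [this]
  exact (continuous_invFT hF).comp continuous_neg

theorem norm_ft_le {F : EuclideanSpace ℝ (Fin d) → ℂ} (ξ : EuclideanSpace ℝ (Fin d)) :
    ‖ft F ξ‖ ≤ ∫ y, ‖F y‖ := by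
  rw [ft_eq_invFT]
  exact norm_invFT_le _

theorem lintegral_ft_sq_le {F : EuclideanSpace ℝ (Fin d) → ℂ} (hF : Integrable F) :
    ∫⁻ ξ, ‖ft F ξ‖ₑ ^ 2 ≤ ENNReal.ofReal ((2 * Real.pi) ^ d) * ∫⁻ y, ‖F y‖ₑ ^ 2 := by
  have h := lintegral_enorm_fourier_sq_le hF
  rw [finrank_euclideanSpace_fin] at h
  refine le_trans (le_of_eq ?_) h
  rw [← lintegral_neg_eq_self]
  simp only [ft_eq_invFT, neg_neg, invFT]
  simp_rw [mul_comm (Complex.exp (Complex.I * _))]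

theorem lintegral_invFT_sq_le {m : EuclideanSpace ℝ (Fin d) → ℂ} (hm : Integrable m) :
    ∫⁻ x, ‖invFT m x‖ₑ ^ 2 ≤ ENNReal.ofReal ((2 * Real.pi) ^ d) * ∫⁻ ξ, ‖m ξ‖ₑ ^ 2 := by
  have h := lintegral_enorm_fourier_sq_le hm
  rw [finrank_euclideanSpace_fin] at h
  simp only [invFT]
  simp_rw [mul_comm _ (Complex.exp (Complex.I * _))]
  exact h

theorem integrable_mul_ft {m F : EuclideanSpace ℝ (Fin d) → ℂ} (hm : Integrable m)
    (hF : Integrable F) : Integrable fun ξ => m ξ * ft F ξ :=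
  hm.mul_bdd (continuous_ft hF).aestronglyMeasurable (ae_of_all _ norm_ft_le)

theorem invFT_mul_ft {m F : EuclideanSpace ℝ (Fin d) → ℂ} (hm : Integrable m) (hF : Integrable F)
    (x : EuclideanSpace ℝ (Fin d)) :
    invFT (fun ξ => m ξ * ft F ξ) x = ∫ y, F y * invFT m (x - y) := by
  have hprod := hF.mul_prod hm
  have hI : Integrable (fun z : EuclideanSpace ℝ (Fin d) × EuclideanSpace ℝ (Fin d) =>
      Complex.exp (Complex.I * (inner ℝ (x - z.1) z.2 : ℝ)) * (F z.1 * m z.2))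
      (volume.prod volume) := by
    refine hprod.bdd_mul (c := 1) (Continuous.aestronglyMeasurable (by fun_prop))
      (ae_of_all _ fun z => ?_)
    rw [norm_cexp_I_mul_ofReal]
  have hswap := integral_integral_swap (f := fun y ξ =>
      Complex.exp (Complex.I * (inner ℝ (x - y) ξ : ℝ)) * (F y * m ξ)) hI
  have hR : ∫ y, F y * invFT m (x - y) = ∫ y, ∫ ξ,
      Complex.exp (Complex.I * (inner ℝ (x - y) ξ : ℝ)) * (F y * m ξ) := by
    congr 1 with y
    rw [invFT, ← integral_const_mul]
    congr 1 with ξ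
    ring
  rw [hR, hswap, invFT]
  congr 1 with ξ
  rw [ft, ← integral_const_mul, ← integral_mul_const]
  congr 1 with y
  have he : Complex.exp (Complex.I * (inner ℝ (x - y) ξ : ℝ)) =
      Complex.exp (-Complex.I * (inner ℝ y ξ : ℝ)) *
        Complex.exp (Complex.I * (inner ℝ x ξ : ℝ)) := by
    rw [← Complex.exp_add, inner_sub_left]
    congr 1
    push_cast
    ring
  rw [he]
  ring

/-- The smooth cutoff `cutMid ∘ ρ` to the shell `1/3 ≤ ρ ≤ 3`, set to `0` at the origin, where `ρ`
is unspecified. -/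
noncomputable def midAmp (ρ : EuclideanSpace ℝ (Fin d) → ℝ) (ξ : EuclideanSpace ℝ (Fin d)) : ℂ :=
  if ξ = 0 then 0 else (cutMid (ρ ξ) : ℂ)

theorem IsHomogeneousDistance.isAmplitude_midAmp (hρ : IsHomogeneousDistance β ρ) (hd : 1 ≤ d) :
    IsAmplitude (shell ρ (1 / 3) 3) (midAmp ρ) :=
  hρ.isAmplitude_comp hd (by norm_num) (ψ := fun r => (cutMid r : ℂ))
    (Complex.ofRealCLM.contDiff.comp contDiff_cutMid) fun _ hr =>
      mem_Icc_of_cutMid_ne_zero (by simpa using hr)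

theorem mem_shell_of_midAmp_ne_zero {ξ : EuclideanSpace ℝ (Fin d)} (h : midAmp ρ ξ ≠ 0) :
    ξ ∈ shell ρ (1 / 3) 3 := by
  unfold midAmp at h
  by_cases h0 : ξ = 0
  · simp [h0] at h
  · rw [if_neg h0] at h
    exact ⟨h0, mem_Icc_of_cutMid_ne_zero (by simpa using h)⟩

theorem norm_midAmp_le_one (ξ : EuclideanSpace ℝ (Fin d)) : ‖midAmp ρ ξ‖ ≤ 1 := by
  unfold midAmp
  split_ifs
  · simp
  · rw [Complex.norm_real, Real.norm_of_nonneg (cutMid_nonneg _)]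
    exact cutMid_le_one _

/-- The part of `F̂` in the shell `1/3 ≤ ρ ≤ 3`. -/
noncomputable def shellFT (ρ : EuclideanSpace ℝ (Fin d) → ℝ) (F : EuclideanSpace ℝ (Fin d) → ℂ)
    (ξ : EuclideanSpace ℝ (Fin d)) : ℂ := midAmp ρ ξ * ft F ξ

theorem shellFT_support {F : EuclideanSpace ℝ (Fin d) → ℂ} {ξ : EuclideanSpace ℝ (Fin d)}
    (h : shellFT ρ F ξ ≠ 0) : ξ ∈ shell ρ (1 / 3) 3 :=
  mem_shell_of_midAmp_ne_zero (left_ne_zero_of_mul h)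

theorem IsHomogeneousDistance.integrable_shellFT (hρ : IsHomogeneousDistance β ρ) (hd : 1 ≤ d)
    {F : EuclideanSpace ℝ (Fin d) → ℂ} (hF : Integrable F) : Integrable (shellFT ρ F) :=
  integrable_mul_ft (hρ.isAmplitude_midAmp hd).integrable hF

theorem IsHomogeneousDistance.measurable_shellFT (hρ : IsHomogeneousDistance β ρ) (hd : 1 ≤ d)
    {F : EuclideanSpace ℝ (Fin d) → ℂ} (hF : Integrable F) : Measurable (shellFT ρ F) :=
  ((hρ.isAmplitude_midAmp hd).contDiff.continuous.mul (continuous_ft hF)).measurable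

theorem enorm_shellFT_le (F : EuclideanSpace ℝ (Fin d) → ℂ) (ξ : EuclideanSpace ℝ (Fin d)) :
    ‖shellFT ρ F ξ‖ₑ ≤ ‖ft F ξ‖ₑ := by
  refine enorm_le_iff_norm_le.2 ?_
  rw [shellFT, norm_mul]
  exact mul_le_of_le_one_left (norm_nonneg _) (norm_midAmp_le_one ξ)

theorem measurable_hlog (lam γ : ℝ) : Measurable (hlog lam γ) := by
  unfold hlog
  refine Measurable.ite measurableSet_Iio ?_ measurable_const
  fun_prop

theorem abs_hlog_le_one {lam γ r : ℝ} (hlam : 0 ≤ lam) (hγ : 0 ≤ γ) (hr : 0 ≤ r) :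
    |hlog lam γ r| ≤ 1 := by
  by_cases h : r < 1
  · have h1 : 0 < 1 - r := by linarith
    have h2 := one_le_one_sub_log h1 (by linarith)
    rw [hlog_eq h, abs_of_nonneg (by positivity)]
    refine (div_le_one (by positivity)).2 ?_
    exact (Real.rpow_le_one h1.le (by linarith) hlam).trans (Real.one_le_rpow h2 hγ)
  · simp [hlog, h]

namespace IsHomogeneousDistance

theorem integrable_hlog_mul (hρ : IsHomogeneousDistance β ρ) (hd : 1 ≤ d) {lam γ t : ℝ}
    (hlam : 0 ≤ lam) (hγ : 0 ≤ γ) (ht : 0 < t) {m : EuclideanSpace ℝ (Fin d) → ℂ}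
    (hm : Integrable m) : Integrable fun ξ => (hlog lam γ (ρ ξ / t) : ℂ) * m ξ := by
  refine hm.bdd_mul (c := 1) ?_ ?_
  · have := hρ.measurable
    have := measurable_hlog lam γ
    exact Measurable.aestronglyMeasurable (by fun_prop)
  · filter_upwards [ae_ne_zero hd] with ξ hξ
    rw [Complex.norm_real]
    exact abs_hlog_le_one hlam hγ (div_pos (hρ.pos ξ hξ) ht).le

theorem integrable_cutLow (hρ : IsHomogeneousDistance β ρ) (hd : 1 ≤ d) :
    Integrable fun ξ => (cutLow (ρ ξ) : ℂ) := by
  refine hρ.integrable_of_support hd (B := 1 / 2) (G := 1) ?_ (ae_of_all _ fun ξ => ?_) ?_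
  · have := contDiff_cutLow.continuous.measurable
    have := hρ.measurable
    exact Measurable.aestronglyMeasurable (by fun_prop)
  · rw [Complex.norm_real, Real.norm_of_nonneg (cutLow_nonneg _)]
    exact cutLow_le_one _
  · intro ξ hξ h
    rw [cutLow_eq_zero h.le, Complex.ofReal_zero]

theorem rieszMean_eq_low_add_high (hρ : IsHomogeneousDistance β ρ) (hd : 1 ≤ d) {lam γ t : ℝ}
    (hlam : 0 ≤ lam) (hγ : 0 ≤ γ) (ht : t ∈ Icc (1 : ℝ) 2) {F : EuclideanSpace ℝ (Fin d) → ℂ}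
    (hF : Integrable F) (x : EuclideanSpace ℝ (Fin d)) :
    rieszMean ρ lam γ t F x = ((2 * Real.pi) ^ d : ℝ)⁻¹ *
      (invFT (fun ξ => (hlog lam γ (ρ ξ / t) : ℂ) * (cutLow (ρ ξ) : ℂ) * ft F ξ) x +
        invFT (fun ξ => (hlog lam γ (ρ ξ / t) : ℂ) * shellFT ρ F ξ) x) := by
  have ht0 : 0 < t := by linarith [ht.1]
  rw [hρ.rieszMean_eq_multiplier hd hlam hγ ht0 hF, ← invFT_add
    (integrable_mul_ft (hρ.integrable_hlog_mul hd hlam hγ ht0 (hρ.integrable_cutLow hd)) hF)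
    (hρ.integrable_hlog_mul hd hlam hγ ht0 (hρ.integrable_shellFT hd hF))]
  congr 1
  refine integral_congr_ae ?_
  filter_upwards [ae_ne_zero hd] with ξ hξ
  change _ * ft F ξ * _ = _
  simp only [shellFT, midAmp, if_neg hξ]
  by_cases h : ρ ξ ≤ 2
  · have h1 : (cutLow (ρ ξ) : ℂ) + (cutMid (ρ ξ) : ℂ) = 1 := by
      exact_mod_cast cutLow_add_cutMid h
    linear_combination (-(hlog lam γ (ρ ξ / t) : ℂ) * ft F ξ *
      Complex.exp (Complex.I * (inner ℝ x ξ : ℝ))) * h1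
  · have : hlog lam γ (ρ ξ / t) = 0 := by
      refine if_neg ?_
      rw [not_lt, le_div_iff₀ ht0]
      linarith [ht.2]
    simp [this]

end IsHomogeneousDistance

end Decomposition

/-! ### Means of functions supported far away, on unit scale -/

/-- The decay rate `D^{-λ-1/2} (1 + log D)^{-γ}`. -/
noncomputable def farWeight (lam γ D : ℝ) : ℝ := D ^ (-(lam + 1 / 2)) * (1 + Real.log D) ^ (-γ)

theorem IsExpMixture.exists_lintegral_exp_mul_rpow_le {γ : ℝ} (hγ : 0 ≤ γ) {ν : Measure ℝ}
    (hν : IsExpMixture γ ν) : ∃ C > 0, ∀ D : ℝ, 1 ≤ D →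
      ∫⁻ a, ENNReal.ofReal (Real.exp (a / 4) * D ^ (-min a 1)) ∂ν ≤
        ENNReal.ofReal (C * (1 + Real.log D) ^ (-γ)) := by
  have := hν.finite
  refine ⟨2 ^ γ + (4 * (γ + 1)) ^ (γ + 1) * Real.exp 1 * 2 ^ γ, by positivity, fun D hD => ?_⟩
  have hD0 : 0 < D := by linarith
  have hlog : 0 ≤ Real.log D := Real.log_nonneg hD
  have hi1 := hν.integrable (Real.log D - 1 / 2) (by linarith)
  have hi2 := (hν.integrable (-1 / 2) (by norm_num)).const_mul D⁻¹
  have hint : Integrable (fun a => Real.exp (-(Real.log D - 1 / 2) * a) +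
      D⁻¹ * Real.exp (-(-1 / 2) * a)) ν := hi1.add hi2
  have hbound : ∀ᵐ a ∂ν, ENNReal.ofReal (Real.exp (a / 4) * D ^ (-min a 1)) ≤
      ENNReal.ofReal (Real.exp (-(Real.log D - 1 / 2) * a) + D⁻¹ * Real.exp (-(-1 / 2) * a)) := by
    filter_upwards [hν.nonneg] with a ha
    refine ENNReal.ofReal_le_ofReal ?_
    have e1 : Real.exp (a / 4) ≤ Real.exp (a / 2) := Real.exp_le_exp.2 (by linarith)
    rcases le_total a 1 with h | h
    · rw [min_eq_left h]
      have e2 : Real.exp (-(Real.log D - 1 / 2) * a) = Real.exp (a / 2) * D ^ (-a) := by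
        rw [Real.rpow_def_of_pos hD0, ← Real.exp_add]
        ring_nf
      rw [e2]
      have : 0 ≤ D⁻¹ * Real.exp (-(-1 / 2) * a) := by positivity
      have : Real.exp (a / 4) * D ^ (-a) ≤ Real.exp (a / 2) * D ^ (-a) := by gcongr
      linarith
    · rw [min_eq_right h, Real.rpow_neg_one, mul_comm]
      have e2 : Real.exp (-(-1 / 2) * a) = Real.exp (a / 2) := by ring_nf
      rw [e2]
      have : D⁻¹ * Real.exp (a / 4) ≤ D⁻¹ * Real.exp (a / 2) := by gcongr
      linarith [Real.exp_pos (-(Real.log D - 1 / 2) * a)]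
  refine (lintegral_mono_ae hbound).trans ?_
  rw [← ofReal_integral_eq_lintegral_ofReal hint (ae_of_all _ fun a => by positivity)]
  refine ENNReal.ofReal_le_ofReal ?_
  rw [integral_add hi1 hi2, integral_const_mul, hν.integral_eq _ (by linarith),
    hν.integral_eq _ (by norm_num), add_mul]
  have hl1 : 0 < 1 + Real.log D := by linarith
  refine add_le_add ?_ ?_
  · have h1 : (1 + Real.log D) / 2 ≤ 1 + (Real.log D - 1 / 2) := by linarith
    calc (1 + (Real.log D - 1 / 2)) ^ (-γ) ≤ ((1 + Real.log D) / 2) ^ (-γ) :=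
          Real.rpow_le_rpow_of_nonpos (by positivity) h1 (by linarith)
      _ = _ := by
          rw [div_eq_mul_inv, Real.mul_rpow hl1.le (by norm_num), Real.inv_rpow (by norm_num),
            Real.rpow_neg (by norm_num : (0 : ℝ) ≤ 2), inv_inv, mul_comm]
  · have h1 : (1 + Real.log D) ^ γ ≤ (4 * (γ + 1)) ^ (γ + 1) * (Real.exp 1 * D) := by
      calc (1 + Real.log D) ^ γ ≤ (1 + Real.log D) ^ (γ + 1) :=
            Real.rpow_le_rpow_of_exponent_le (by linarith) (by linarith)
        _ ≤ (4 * (γ + 1)) ^ (γ + 1) * Real.exp ((1 + Real.log D) / 4) :=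
            rpow_le_mul_exp_quarter hl1.le (by linarith)
        _ ≤ (4 * (γ + 1)) ^ (γ + 1) * Real.exp (1 + Real.log D) := by
            gcongr; linarith
        _ = _ := by rw [Real.exp_add, Real.exp_log hD0]
    have h2 : ((1 : ℝ) + -1 / 2) ^ (-γ) = 2 ^ γ := by
      rw [show (1 : ℝ) + -1 / 2 = 2⁻¹ by norm_num, Real.inv_rpow (by norm_num),
        Real.rpow_neg (by norm_num), inv_inv]
    rw [h2, Real.rpow_neg hl1.le]
    have h3 := Real.rpow_pos_of_pos hl1 γ
    rw [← div_eq_mul_inv, le_div_iff₀ h3, inv_mul_eq_div, div_mul_eq_mul_div, div_le_iff₀ hD0]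
    calc 2 ^ γ * (1 + Real.log D) ^ γ ≤ 2 ^ γ * ((4 * (γ + 1)) ^ (γ + 1) * (Real.exp 1 * D)) := by
          gcongr
      _ = _ := by ring

theorem lintegral_abs_gt_rpow_le {s δ : ℝ} (hs : 1 < s) (hδ : 0 < δ) :
    ∫⁻ τ in {τ : ℝ | δ < |τ|}, ENNReal.ofReal ((1 + |τ|) ^ (-s)) ≤
      ENNReal.ofReal (2 / (s - 1) * δ ^ (1 - s)) := by
  have hI : IntegrableOn (fun τ : ℝ => τ ^ (-s)) (Ioi δ) :=
    integrableOn_Ioi_rpow_of_lt (by linarith) hδ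
  have hhalf : ∫⁻ τ in Ioi δ, ENNReal.ofReal ((1 + |τ|) ^ (-s)) ≤
      ENNReal.ofReal (1 / (s - 1) * δ ^ (1 - s)) := by
    calc _ ≤ ∫⁻ τ in Ioi δ, ENNReal.ofReal (τ ^ (-s)) := by
          refine setLIntegral_mono' measurableSet_Ioi fun τ hτ => ENNReal.ofReal_le_ofReal ?_
          have hτ0 : 0 < τ := hδ.trans hτ
          exact Real.rpow_le_rpow_of_nonpos hτ0 (by rw [abs_of_pos hτ0]; linarith) (by linarith)
      _ = ENNReal.ofReal (∫ τ in Ioi δ, τ ^ (-s)) := by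
          rw [ofReal_integral_eq_lintegral_ofReal hI]
          filter_upwards [ae_restrict_mem measurableSet_Ioi] with τ hτ
          exact Real.rpow_nonneg (hδ.trans hτ).le _
      _ = _ := by
          rw [integral_Ioi_rpow_of_lt (by linarith) hδ]
          congr 1
          rw [show -s + 1 = 1 - s by ring, show (1 : ℝ) - s = -(s - 1) by ring]
          have : s - 1 ≠ 0 := by linarith
          field_simp
  have hset : {τ : ℝ | δ < |τ|} = Ioi δ ∪ Iio (-δ) := by
    ext τ
    simp only [mem_ofPred_eq, lt_abs, mem_union, mem_Ioi, mem_Iio]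
    constructor <;> rintro (h | h) <;> [left; right; left; right] <;> linarith
  have hneg : ∫⁻ τ in Iio (-δ), ENNReal.ofReal ((1 + |τ|) ^ (-s)) =
      ∫⁻ τ in Ioi δ, ENNReal.ofReal ((1 + |τ|) ^ (-s)) := by
    rw [← lintegral_indicator measurableSet_Iio, ← lintegral_indicator measurableSet_Ioi,
      ← lintegral_neg_eq_self]
    congr 1 with τ
    simp only [indicator, mem_Iio, mem_Ioi, neg_lt_neg_iff, abs_neg]
  rw [hset]
  refine (lintegral_union_le _ _ _).trans ?_
  rw [hneg]
  refine (add_le_add hhalf hhalf).trans (le_of_eq ?_)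
  have : 0 < s - 1 := by linarith
  rw [← ENNReal.ofReal_add (by positivity) (by positivity)]
  congr 1
  ring

section Far

variable {d : ℕ} {β : ℝ} {ρ : EuclideanSpace ℝ (Fin d) → ℝ}

theorem IsHomogeneousDistance.exists_norm_invFT_midAmp_le (hρ : IsHomogeneousDistance β ρ)
    (hd : 1 ≤ d) {lam : ℝ} (hlam : 0 < lam) : ∃ c ∈ Ioc (0 : ℝ) 1, ∃ B > 0, ∀ D a τ : ℝ, 1 ≤ D →
      0 ≤ a → |τ| ≤ c * D → ∀ x : EuclideanSpace ℝ (Fin d), D / 2 ≤ ‖x‖ →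
      ‖invFT (fun ξ => Complex.exp (-(((lam + a : ℝ) : ℂ) + τ * Complex.I) *
        ((ρ ξ - 1 / 3 : ℝ) : ℂ)) * midAmp ρ ξ) x‖ ≤ B * Real.exp (a / 4) * (D ^ d)⁻¹ := by
  have hamp := hρ.isAmplitude_midAmp hd
  obtain ⟨c, hc, hcN⟩ := hρ.exists_invFT_phase_le hd (fun ξ hξ => hξ.1)
    (hρ.isCompact_shell hd (by norm_num) 3) (fun ξ hξ => hξ.2.1) hamp
  obtain ⟨C, hC, hphase⟩ := hcN d
  set A := ∫ ξ, ‖midAmp ρ ξ‖ with hA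
  have hA0 : 0 ≤ A := integral_nonneg fun _ => norm_nonneg _
  set M := (4 * (d : ℝ)) ^ (d : ℝ) * Real.exp (lam / 4) with hM
  have hdpos : (0 : ℝ) < d := by exact_mod_cast hd
  have hM0 : 0 < M := by positivity
  refine ⟨min 1 (c / 4), ⟨by positivity, min_le_left _ _⟩, C * 2 ^ d + A * ((4 / c) ^ d * M),
    by positivity, fun D a τ hD ha hτ x hx => ?_⟩
  have hD0 : 0 < D := by linarith
  have hexp : 1 ≤ Real.exp (a / 4) := Real.one_le_exp (by positivity)
  set z : ℂ := ((lam + a : ℝ) : ℂ) + τ * Complex.I with hz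
  have hzre : z.re = lam + a := by simp [hz]
  have hz0 : 0 ≤ z.re := by rw [hzre]; linarith
  have hτ' : |τ| ≤ c / 4 * D := hτ.trans (by gcongr; exact min_le_right _ _)
  by_cases h : lam + a ≤ c / 4 * D
  · have hzn : ‖z‖ ≤ c * ‖x‖ := by
      calc ‖z‖ ≤ |lam + a| + |τ| := by
            rw [hz]
            refine (norm_add_le _ _).trans (le_of_eq ?_)
            rw [norm_mul, Complex.norm_real, Complex.norm_real, Complex.norm_I, mul_one]
            rfl
        _ ≤ c / 4 * D + c / 4 * D := by
            rw [abs_of_nonneg (by linarith)]; gcongr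
        _ = c * (D / 2) := by ring
        _ ≤ _ := by gcongr
    have h1 := hphase x z hz0 hzn
    have h2 : (D / 2) ^ d * ‖invFT (fun ξ => Complex.exp (-z *
        ((ρ ξ - 1 / 3 : ℝ) : ℂ)) * midAmp ρ ξ) x‖ ≤ C := le_trans (by gcongr) h1
    rw [← div_eq_mul_inv, le_div_iff₀ (by positivity)]
    rw [div_pow, div_mul_eq_mul_div, div_le_iff₀ (by positivity)] at h2
    calc _ ≤ C * 2 ^ d := by rw [mul_comm]; exact h2
      _ ≤ (C * 2 ^ d + A * ((4 / c) ^ d * M)) * 1 := by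
          rw [mul_one]; exact le_add_of_nonneg_right (by positivity)
      _ ≤ _ := by gcongr
  · have h1 : ‖invFT (fun ξ => Complex.exp (-z *
        ((ρ ξ - 1 / 3 : ℝ) : ℂ)) * midAmp ρ ξ) x‖ ≤ A := by
      refine (norm_invFT_le x).trans (integral_mono
        (integrable_phase hρ.measurable hamp.integrable
          (fun ξ h => mem_shell_of_midAmp_ne_zero h) hz0).norm hamp.integrable.norm fun ξ => ?_)
      exact norm_cexp_mul_le (fun ξ h => mem_shell_of_midAmp_ne_zero h) hz0 ξ
    have h2 : D ^ d ≤ (4 / c) ^ d * (M * Real.exp (a / 4)) := by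
      have h3 : D ≤ 4 / c * (lam + a) := by
        rw [div_mul_eq_mul_div, le_div_iff₀ hc]
        linarith
      have h4 : (lam + a) ^ d ≤ M * Real.exp (a / 4) := by
        have := rpow_le_mul_exp_quarter (x := lam + a) (by linarith) hdpos
        rw [Real.rpow_natCast] at this
        refine this.trans (le_of_eq ?_)
        rw [hM, mul_assoc, ← Real.exp_add]
        ring_nf
      calc D ^ d ≤ (4 / c * (lam + a)) ^ d := by gcongr
        _ = (4 / c) ^ d * (lam + a) ^ d := mul_pow _ _ _
        _ ≤ _ := by gcongr
    rw [← div_eq_mul_inv, le_div_iff₀ (by positivity)]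
    calc _ ≤ A * ((4 / c) ^ d * (M * Real.exp (a / 4))) := by gcongr
      _ = A * ((4 / c) ^ d * M) * Real.exp (a / 4) := by ring
      _ ≤ _ := by
          gcongr
          exact le_add_of_nonneg_left (by positivity)

end Far

section Far

variable {d : ℕ} {β : ℝ} {ρ : EuclideanSpace ℝ (Fin d) → ℝ}

theorem enorm_integral_mul_le {X : Type*} [MeasurableSpace X] {μ : Measure X} {F k : X → ℂ} {B : ℝ}
    (h : ∀ y, F y ≠ 0 → ‖k y‖ ≤ B) :
    ‖∫ y, F y * k y ∂μ‖ₑ ≤ ENNReal.ofReal B * ∫⁻ y, ‖F y‖ₑ ∂μ := by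
  rw [← lintegral_const_mul' _ _ ENNReal.ofReal_ne_top]
  refine (enorm_integral_le_lintegral_enorm _).trans (lintegral_mono fun y => ?_)
  by_cases h0 : F y = 0
  · simp [h0]
  · rw [enorm_mul, mul_comm, ← ofReal_norm (k y)]
    gcongr
    exact h y h0

theorem IsHomogeneousDistance.exists_invFT_hlog_cutLow_le (hρ : IsHomogeneousDistance β ρ)
    (hd : 1 ≤ d) (lam γ : ℝ) : ∃ C > 0, ∀ t ∈ Icc (1 : ℝ) 2, ∀ x : EuclideanSpace ℝ (Fin d),
      ‖x‖ ^ d * ‖invFT (fun ξ => (hlog lam γ (ρ ξ / t) : ℂ) * (cutLow (ρ ξ) : ℂ)) x‖ ≤ C := by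
  obtain ⟨g, hg, hgc, hgeq⟩ := exists_smooth_eq_hlog lam γ
  obtain ⟨G, hG⟩ := hgc.exists_bound_of_continuous hg.continuous
  obtain ⟨C, hC, h⟩ := hρ.exists_invFT_low_le hd (g := fun r => (g r : ℂ))
    (Complex.ofRealCLM.contDiff.comp hg) (G := G) (fun r => by simpa using hG r)
  refine ⟨C, hC, fun t ht x => ?_⟩
  have ht0 : 0 < t := by linarith [ht.1]
  have hε : 1 / t ∈ Icc (0 : ℝ) 1 := ⟨by positivity, by rw [div_le_one ht0]; exact ht.1⟩
  have heq : invFT (fun ξ => (hlog lam γ (ρ ξ / t) : ℂ) * (cutLow (ρ ξ) : ℂ)) x =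
      invFT (fun ξ => (g (1 / t * ρ ξ) : ℂ) * (cutLow (ρ ξ) : ℂ)) x := by
    refine integral_congr_ae ?_
    filter_upwards [ae_ne_zero hd] with ξ hξ
    by_cases hr : ρ ξ ≤ 1 / 2
    · have h0 := hρ.pos ξ hξ
      have : 1 / t * ρ ξ ≤ 1 / 2 := by nlinarith [hε.2]
      rw [hgeq _ ⟨by positivity, this⟩]
      congr 4
      ring
    · simp [cutLow_eq_zero (not_le.1 hr).le]
  rw [heq]
  exact h _ hε x

theorem sub_norm_ge_half {E : Type*} [NormedAddCommGroup E] {D : ℝ} {x y : E} (hx : ‖x‖ ≤ D / 2)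
    (hy : D ≤ ‖y‖) : D / 2 ≤ ‖x - y‖ := by
  have := norm_sub_norm_le y x
  rw [norm_sub_rev] at this
  linarith

/-- The superposition of wave packets at times `|τ| > δ`. -/
noncomputable def packetTail (ρ : EuclideanSpace ℝ (Fin d) → ℝ) (lam : ℝ) (ν : Measure ℝ)
    (G : EuclideanSpace ℝ (Fin d) → ℂ) (δ D : ℝ) (x : EuclideanSpace ℝ (Fin d)) : ℝ≥0∞ :=
  ∫⁻ a, ENNReal.ofReal (Real.exp (a / 4) * D ^ (-min a 1)) *
    (∫⁻ τ in {τ : ℝ | δ < |τ|}, ENNReal.ofReal ((1 + |τ|) ^ (-(lam + 1))) *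
      ‖phaseFT ρ G (((lam + a : ℝ) : ℂ) + τ * Complex.I) x‖ₑ) ∂ν

theorem measurable_enorm_phaseFT_vertical (hρ : Measurable ρ) {G : EuclideanSpace ℝ (Fin d) → ℂ}
    (hG : Measurable G) (lam : ℝ) : Measurable fun w : (ℝ × EuclideanSpace ℝ (Fin d)) × ℝ =>
      ‖phaseFT ρ G (((lam + w.1.1 : ℝ) : ℂ) + w.2 * Complex.I) w.1.2‖ₑ :=
  ((measurable_phaseFT hρ hG).comp (f := fun w : (ℝ × EuclideanSpace ℝ (Fin d)) × ℝ =>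
    (((lam + w.1.1 : ℝ) : ℂ) + w.2 * Complex.I, w.1.2)) (by fun_prop)).enorm

theorem measurable_enorm_phaseFT_time (hρ : Measurable ρ) {G : EuclideanSpace ℝ (Fin d) → ℂ}
    (hG : Measurable G) (μ : ℝ) (x : EuclideanSpace ℝ (Fin d)) :
    Measurable fun τ : ℝ => ‖phaseFT ρ G ((μ : ℂ) + τ * Complex.I) x‖ₑ :=
  ((measurable_phaseFT hρ hG).comp (f := fun τ : ℝ => ((μ : ℂ) + τ * Complex.I, x))
    (by fun_prop)).enorm

theorem measurable_packetTail_inner (hρ : Measurable ρ) {G : EuclideanSpace ℝ (Fin d) → ℂ}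
    (hG : Measurable G) (lam δ : ℝ) : Measurable fun w : ℝ × EuclideanSpace ℝ (Fin d) =>
      ∫⁻ τ in {τ : ℝ | δ < |τ|}, ENNReal.ofReal ((1 + |τ|) ^ (-(lam + 1))) *
      ‖phaseFT ρ G (((lam + w.1 : ℝ) : ℂ) + τ * Complex.I) w.2‖ₑ := by
  have h := measurable_enorm_phaseFT_vertical hρ hG lam
  have hw : Measurable fun w : (ℝ × EuclideanSpace ℝ (Fin d)) × ℝ =>
      ENNReal.ofReal ((1 + |w.2|) ^ (-(lam + 1))) := by fun_prop
  exact (hw.mul h).lintegral_prod_right' (ν := volume.restrict {τ : ℝ | δ < |τ|})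

theorem measurable_packetTail (hρ : Measurable ρ) {ν : Measure ℝ} [SFinite ν]
    {G : EuclideanSpace ℝ (Fin d) → ℂ} (hG : Measurable G) (lam δ D : ℝ) :
    Measurable (packetTail ρ lam ν G δ D) := by
  have h := (measurable_packetTail_inner hρ hG lam δ).comp
    (measurable_swap (α := EuclideanSpace ℝ (Fin d)) (β := ℝ))
  have hw : Measurable fun z : EuclideanSpace ℝ (Fin d) × ℝ =>
      ENNReal.ofReal (Real.exp (z.2 / 4) * D ^ (-min z.2 1)) := by fun_prop
  exact (hw.mul h).lintegral_prod_right' (ν := ν)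

/-- Cauchy-Schwarz in `τ` and in `a`. -/
theorem packetTail_sq_le (hρ : Measurable ρ) {ν : Measure ℝ} [SFinite ν]
    {G : EuclideanSpace ℝ (Fin d) → ℂ} (hG : Measurable G) {lam δ : ℝ} (hlam : 0 < lam)
    (hδ : 0 < δ) (D : ℝ) (x : EuclideanSpace ℝ (Fin d)) :
    packetTail ρ lam ν G δ D x ^ 2 ≤
      (∫⁻ a, ENNReal.ofReal (Real.exp (a / 4) * D ^ (-min a 1)) ∂ν) *
      (ENNReal.ofReal (2 / (2 * lam + 2 - 1) * δ ^ (-(2 * lam + 1))) *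
      ∫⁻ a, ENNReal.ofReal (Real.exp (a / 4) * D ^ (-min a 1)) *
        (∫⁻ τ : ℝ, ‖phaseFT ρ G (((lam + a : ℝ) : ℂ) + τ * Complex.I) x‖ₑ ^ 2) ∂ν) := by
  have hm := (measurable_packetTail_inner hρ hG lam δ).comp
    (f := fun a : ℝ => (a, x)) (by fun_prop)
  refine (lintegral_mul_sq_le' (Measurable.aemeasurable (by fun_prop)) hm.aemeasurable).trans ?_
  refine mul_le_mul_right ?_ _
  rw [← lintegral_const_mul' _ _ ENNReal.ofReal_ne_top]
  refine lintegral_mono fun a => ?_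
  rw [mul_left_comm]
  refine mul_le_mul_right ?_ _
  refine (lintegral_mul_sq_le (Measurable.aemeasurable (by fun_prop))
    (measurable_enorm_phaseFT_time hρ hG _ x).aemeasurable).trans (mul_le_mul' ?_
      (setLIntegral_le_lintegral _ _))
  have h1 : ∀ τ : ℝ, ENNReal.ofReal ((1 + |τ|) ^ (-(lam + 1))) ^ 2 =
      ENNReal.ofReal ((1 + |τ|) ^ (-(2 * lam + 2))) := by
    intro τ
    rw [← ENNReal.ofReal_pow (by positivity), ← Real.rpow_natCast, ← Real.rpow_mul
      (by positivity)]
    congr 2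
    push_cast
    ring
  simp_rw [h1]
  refine (lintegral_abs_gt_rpow_le (by linarith) hδ).trans (le_of_eq ?_)
  rw [show 1 - (2 * lam + 2) = -(2 * lam + 1) by ring]

theorem farWeight_sq (lam γ : ℝ) {D : ℝ} (hD : 0 < D) :
    farWeight lam γ D ^ 2 = D ^ (-(2 * lam + 1)) * ((1 + Real.log D) ^ (-γ)) ^ 2 := by
  rw [farWeight, mul_pow, ← Real.rpow_natCast (D ^ _), ← Real.rpow_mul hD.le]
  congr 2
  push_cast
  ring

theorem IsHomogeneousDistance.exists_packetTail_sq_le (hρ : IsHomogeneousDistance β ρ)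
    (hd : 1 ≤ d) {lam γ c : ℝ} (hlam : 0 < lam) (hγ : 0 ≤ γ) {ν : Measure ℝ}
    (hν : IsExpMixture γ ν) (hc : 0 < c) : ∃ C > 0, ∀ D : ℝ, 1 ≤ D →
      ∀ G : EuclideanSpace ℝ (Fin d) → ℂ, Measurable G → Integrable G →
      (∀ ξ, G ξ ≠ 0 → ξ ∈ shell ρ (1 / 3) 3) →
      (∀ x, packetTail ρ lam ν G (c * D) D x ^ 2 ≤
        ENNReal.ofReal (C * farWeight lam γ D ^ 2) * ∫⁻ ξ, ‖G ξ‖ₑ ^ 2) ∧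
      ∀ r : ℝ, 1 ≤ r → ∫⁻ x in Metric.ball 0 r, packetTail ρ lam ν G (c * D) D x ^ 2 ≤
        ENNReal.ofReal (C * r * farWeight lam γ D ^ 2) * ∫⁻ ξ, ‖G ξ‖ₑ ^ 2 := by
  have hνf := hν.finite
  obtain ⟨Cw, hCw, hw⟩ := hν.exists_lintegral_exp_mul_rpow_le hγ
  obtain ⟨Cp, hCp, hp⟩ := hρ.exists_phaseFT_bounds hd
  set T := 2 / (2 * lam + 2 - 1) * c ^ (-(2 * lam + 1)) with hT
  have hT0 : 0 < T := mul_pos (div_pos two_pos (by linarith)) (Real.rpow_pos_of_pos hc _)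
  refine ⟨Cw ^ 2 * T * Cp, by positivity, fun D hD G hGm hGi hGs => ?_⟩
  have hD0 : 0 < D := by linarith
  have hl0 : 0 < 1 + Real.log D := by linarith [Real.log_nonneg hD]
  have hW := hw D hD
  have hwm : Measurable fun a : ℝ => ENNReal.ofReal (Real.exp (a / 4) * D ^ (-min a 1)) := by
    fun_prop
  have hTD : 2 / (2 * lam + 2 - 1) * (c * D) ^ (-(2 * lam + 1)) =
      T * D ^ (-(2 * lam + 1)) := by
    rw [Real.mul_rpow hc.le hD0.le, hT]; ring
  have hcomb : ∀ R : ℝ, 0 ≤ R → ENNReal.ofReal (Cw * (1 + Real.log D) ^ (-γ)) *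
      (ENNReal.ofReal (2 / (2 * lam + 2 - 1) * (c * D) ^ (-(2 * lam + 1))) *
        (ENNReal.ofReal (Cw * (1 + Real.log D) ^ (-γ)) *
          (ENNReal.ofReal R * ∫⁻ ξ, ‖G ξ‖ₑ ^ 2))) =
      ENNReal.ofReal (Cw ^ 2 * T * R * farWeight lam γ D ^ 2) * ∫⁻ ξ, ‖G ξ‖ₑ ^ 2 := by
    intro R hR
    rw [hTD, ← mul_assoc, ← mul_assoc, ← mul_assoc, ← ENNReal.ofReal_mul (by positivity),
      ← ENNReal.ofReal_mul (by positivity), ← ENNReal.ofReal_mul (by positivity),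
      farWeight_sq _ _ hD0]
    congr 2
    ring
  refine ⟨fun x => ?_, fun r hr => ?_⟩
  · refine (packetTail_sq_le hρ.measurable hGm hlam (mul_pos hc hD0) D x).trans ?_
    rw [← hcomb Cp hCp.le]
    refine mul_le_mul' hW (mul_le_mul_right ?_ _)
    calc _ ≤ ∫⁻ a, ENNReal.ofReal (Real.exp (a / 4) * D ^ (-min a 1)) *
          (ENNReal.ofReal Cp * ∫⁻ ξ, ‖G ξ‖ₑ ^ 2) ∂ν := by
          refine lintegral_mono_ae ?_
          filter_upwards [hν.nonneg] with a ha
          exact mul_le_mul_right ((hp G hGi hGs (lam + a) (by linarith)).1 x) _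
      _ ≤ _ := by
          rw [lintegral_mul_const _ hwm]
          exact mul_le_mul_left hW _
  · have hAm : Measurable fun w : EuclideanSpace ℝ (Fin d) × ℝ =>
        ENNReal.ofReal (Real.exp (w.2 / 4) * D ^ (-min w.2 1)) *
        ∫⁻ τ : ℝ, ‖phaseFT ρ G (((lam + w.2 : ℝ) : ℂ) + τ * Complex.I) w.1‖ₑ ^ 2 := by
      have h := (measurable_enorm_phaseFT_vertical hρ.measurable hGm lam).pow_const 2
      have h2 := (h.lintegral_prod_right' (ν := volume)).comp
        (measurable_swap (α := EuclideanSpace ℝ (Fin d)) (β := ℝ))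
      have hw : Measurable fun z : EuclideanSpace ℝ (Fin d) × ℝ =>
        ENNReal.ofReal (Real.exp (z.2 / 4) * D ^ (-min z.2 1)) := by fun_prop
      exact hw.mul h2
    calc _ ≤ ∫⁻ x in Metric.ball 0 r,
          (∫⁻ a, ENNReal.ofReal (Real.exp (a / 4) * D ^ (-min a 1)) ∂ν) *
          (ENNReal.ofReal (2 / (2 * lam + 2 - 1) * (c * D) ^ (-(2 * lam + 1))) *
          ∫⁻ a, ENNReal.ofReal (Real.exp (a / 4) * D ^ (-min a 1)) *
          (∫⁻ τ : ℝ, ‖phaseFT ρ G (((lam + a : ℝ) : ℂ) + τ * Complex.I) x‖ₑ ^ 2) ∂ν) :=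
          lintegral_mono fun x => packetTail_sq_le hρ.measurable hGm hlam (mul_pos hc hD0) D x
      _ = (∫⁻ a, ENNReal.ofReal (Real.exp (a / 4) * D ^ (-min a 1)) ∂ν) *
          (ENNReal.ofReal (2 / (2 * lam + 2 - 1) * (c * D) ^ (-(2 * lam + 1))) *
          ∫⁻ a, ENNReal.ofReal (Real.exp (a / 4) * D ^ (-min a 1)) *
          (∫⁻ x in Metric.ball 0 r, ∫⁻ τ : ℝ,
            ‖phaseFT ρ G (((lam + a : ℝ) : ℂ) + τ * Complex.I) x‖ₑ ^ 2) ∂ν) := by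
          rw [lintegral_const_mul _ (Measurable.const_mul hAm.lintegral_prod_right' _),
            lintegral_const_mul _ hAm.lintegral_prod_right',
            lintegral_lintegral_swap hAm.aemeasurable]
          congr 3 with a
          dsimp only
          rw [lintegral_const_mul' _ _ ENNReal.ofReal_ne_top]
      _ ≤ _ := by
          rw [show Cw ^ 2 * T * Cp * r = Cw ^ 2 * T * (Cp * r) by ring,
            ← hcomb (Cp * r) (by positivity)]
          refine mul_le_mul' hW (mul_le_mul_right ?_ _)
          calc _ ≤ ∫⁻ a, ENNReal.ofReal (Real.exp (a / 4) * D ^ (-min a 1)) *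
                (ENNReal.ofReal (Cp * r) * ∫⁻ ξ, ‖G ξ‖ₑ ^ 2) ∂ν := by
                refine lintegral_mono_ae ?_
                filter_upwards [hν.nonneg] with a ha
                refine mul_le_mul_right (le_trans (le_of_eq ?_)
                  ((hp G hGi hGs (lam + a) (by linarith)).2 r hr)) _
                rw [lintegral_prod_symm]
                refine Measurable.aemeasurable ?_
                exact ((measurable_phaseFT hρ.measurable hGm).comp
                  (f := fun w : ℝ × EuclideanSpace ℝ (Fin d) =>
                  (((lam + a : ℝ) : ℂ) + w.1 * Complex.I, w.2)) (by fun_prop)).enorm.pow_const 2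
            _ ≤ _ := by
                rw [lintegral_mul_const _ hwm]
                exact mul_le_mul_left hW _

/-- Wave packets at small times do not reach the region `|x| ≤ D/2`. -/
theorem enorm_phaseFT_shellFT_le (hρ : IsHomogeneousDistance β ρ) (hd : 1 ≤ d) {B D : ℝ} {z : ℂ}
    (hz : 0 ≤ z.re) (hB : ∀ x : EuclideanSpace ℝ (Fin d), D / 2 ≤ ‖x‖ →
      ‖invFT (fun ξ => Complex.exp (-z * ((ρ ξ - 1 / 3 : ℝ) : ℂ)) * midAmp ρ ξ) x‖ ≤ B)
    {F : EuclideanSpace ℝ (Fin d) → ℂ} (hF : Integrable F) (hsupp : ∀ y, ‖y‖ < D → F y = 0)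
    {x : EuclideanSpace ℝ (Fin d)} (hx : ‖x‖ ≤ D / 2) :
    ‖phaseFT ρ (shellFT ρ F) z x‖ₑ ≤ ENNReal.ofReal B * ∫⁻ y, ‖F y‖ₑ := by
  have hmi := integrable_phase hρ.measurable (hρ.isAmplitude_midAmp hd).integrable
    (fun ξ h => mem_shell_of_midAmp_ne_zero h) hz
  have heq : phaseFT ρ (shellFT ρ F) z x = ∫ y, F y * invFT (fun ξ => Complex.exp
      (-z * ((ρ ξ - 1 / 3 : ℝ) : ℂ)) * midAmp ρ ξ) (x - y) := by
    rw [← invFT_mul_ft hmi hF]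
    simp only [phaseFT, shellFT, mul_assoc]
  rw [heq]
  exact enorm_integral_mul_le fun y hy =>
    hB _ (sub_norm_ge_half hx (not_lt.1 fun h => hy (hsupp y h)))

theorem IsHomogeneousDistance.enorm_low_le (hρ : IsHomogeneousDistance β ρ) (hd : 1 ≤ d)
    {lam γ t C D : ℝ} (hlam : 0 ≤ lam) (hγ : 0 ≤ γ) (ht : 0 < t) (hD : 0 < D)
    (hC : ∀ x : EuclideanSpace ℝ (Fin d),
      ‖x‖ ^ d * ‖invFT (fun ξ => (hlog lam γ (ρ ξ / t) : ℂ) * (cutLow (ρ ξ) : ℂ)) x‖ ≤ C)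
    {F : EuclideanSpace ℝ (Fin d) → ℂ} (hF : Integrable F) (hsupp : ∀ y, ‖y‖ < D → F y = 0)
    {x : EuclideanSpace ℝ (Fin d)} (hx : ‖x‖ ≤ D / 2) :
    ‖invFT (fun ξ => (hlog lam γ (ρ ξ / t) : ℂ) * (cutLow (ρ ξ) : ℂ) * ft F ξ) x‖ₑ ≤
        ENNReal.ofReal (C * 2 ^ d * (D ^ d)⁻¹) * ∫⁻ y, ‖F y‖ₑ := by
  rw [invFT_mul_ft (hρ.integrable_hlog_mul hd hlam hγ ht (hρ.integrable_cutLow hd)) hF]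
  refine enorm_integral_mul_le fun y hy => ?_
  have hxy := sub_norm_ge_half hx (not_lt.1 fun h => hy (hsupp y h))
  have h2 : (D / 2) ^ d * ‖invFT (fun ξ => (hlog lam γ (ρ ξ / t) : ℂ) * (cutLow (ρ ξ) : ℂ))
      (x - y)‖ ≤ C := le_trans (by gcongr) (hC (x - y))
  rw [← div_eq_mul_inv, le_div_iff₀ (by positivity)]
  rw [div_pow, div_mul_eq_mul_div, div_le_iff₀ (by positivity)] at h2
  linarith

theorem rpow_neg_min_le {c D τ a : ℝ} (hc : c ∈ Ioc (0 : ℝ) 1) (hD : 0 < D) (ha : 0 ≤ a)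
    (hτ : c * D < |τ|) : (1 + |τ|) ^ (-min a 1) ≤ c⁻¹ * D ^ (-min a 1) := by
  have hc0 := hc.1
  have hm : 0 ≤ min a 1 := le_min ha zero_le_one
  calc (1 + |τ|) ^ (-min a 1) ≤ (c * D) ^ (-min a 1) :=
        Real.rpow_le_rpow_of_nonpos (by positivity) (by linarith) (by linarith)
    _ = c ^ (-min a 1) * D ^ (-min a 1) := Real.mul_rpow hc0.le hD.le
    _ ≤ c ^ (-1 : ℝ) * D ^ (-min a 1) := by
        refine mul_le_mul_of_nonneg_right ?_ (by positivity)
        exact Real.rpow_le_rpow_of_exponent_ge hc0 hc.2 (by linarith [min_le_right a 1])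
    _ = _ := by rw [Real.rpow_neg_one]

/-- Splitting the wave packets at time `|τ| = c D`. -/
theorem lintegral_packets_le (hρ : Measurable ρ) {lam c D P : ℝ} {ν : Measure ℝ} [SFinite ν]
    (hν : ∀ᵐ a ∂ν, 0 ≤ a) (hc : c ∈ Ioc (0 : ℝ) 1) (hD : 0 < D) (hP : 0 ≤ P)
    {G : EuclideanSpace ℝ (Fin d) → ℂ} (hG : Measurable G) {N : ℝ≥0∞}
    {x : EuclideanSpace ℝ (Fin d)}
    (hnear : ∀ a τ : ℝ, 0 ≤ a → |τ| ≤ c * D →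
      ‖phaseFT ρ G (((lam + a : ℝ) : ℂ) + τ * Complex.I) x‖ₑ ≤
        ENNReal.ofReal (P * Real.exp (a / 4)) * N) :
    ∫⁻ a, (∫⁻ τ : ℝ, ENNReal.ofReal (Real.exp (a / 4) * (1 + |τ|) ^ (-(lam + 1 + min a 1))) *
        ‖phaseFT ρ G (((lam + a : ℝ) : ℂ) + τ * Complex.I) x‖ₑ) ∂ν ≤
      (∫⁻ a, ENNReal.ofReal (Real.exp (-(-1 / 2) * a)) ∂ν) *
        (ENNReal.ofReal P * N * ∫⁻ τ : ℝ, ENNReal.ofReal ((1 + |τ|) ^ (-(lam + 1)))) +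
      ENNReal.ofReal c⁻¹ * packetTail ρ lam ν G (c * D) D x := by
  have hSm : MeasurableSet {τ : ℝ | c * D < |τ|} := measurableSet_lt measurable_const (by fun_prop)
  have hum : Measurable fun τ : ℝ => ENNReal.ofReal ((1 + |τ|) ^ (-(lam + 1))) := by fun_prop
  have hV := fun a : ℝ => measurable_enorm_phaseFT_time hρ hG (lam + a) x
  have hT : packetTail ρ lam ν G (c * D) D x =
    ∫⁻ a, ENNReal.ofReal (Real.exp (a / 4) * D ^ (-min a 1)) *
    (∫⁻ τ in {τ : ℝ | c * D < |τ|}, ENNReal.ofReal ((1 + |τ|) ^ (-(lam + 1))) *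
      ‖phaseFT ρ G (((lam + a : ℝ) : ℂ) + τ * Complex.I) x‖ₑ) ∂ν := rfl
  rw [hT, ← lintegral_const_mul' _ _ ENNReal.ofReal_ne_top,
    ← lintegral_mul_const _ (by fun_prop), ← lintegral_add_left (by fun_prop)]
  refine lintegral_mono_ae ?_
  filter_upwards [hν] with a ha
  have hm : 0 ≤ min a 1 := le_min ha zero_le_one
  rw [← lintegral_add_compl _ hSm, add_comm]
  refine add_le_add ?_ ?_
  · rw [← mul_assoc, ← lintegral_const_mul _ hum]
    refine le_trans (setLIntegral_mono' hSm.compl fun τ hτ => ?_) (setLIntegral_le_lintegral _ _)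
    have hτ' : |τ| ≤ c * D := not_lt.1 hτ
    refine (mul_le_mul_right (hnear a τ ha hτ') _).trans ?_
    have h1 : Real.exp (a / 4) * (1 + |τ|) ^ (-(lam + 1 + min a 1)) ≤
        Real.exp (a / 4) * (1 + |τ|) ^ (-(lam + 1)) := by
      gcongr ?_ * ?_
      exact Real.rpow_le_rpow_of_exponent_le (by linarith [abs_nonneg τ]) (by linarith)
    refine (mul_le_mul_left (ENNReal.ofReal_le_ofReal h1) _).trans (le_of_eq ?_)
    have h2 : Real.exp (-(-1 / 2) * a) = Real.exp (a / 4) * Real.exp (a / 4) := by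
      rw [← Real.exp_add]; ring_nf
    rw [h2, ENNReal.ofReal_mul (by positivity), ENNReal.ofReal_mul hP,
      ENNReal.ofReal_mul (by positivity)]
    ring
  · have h0 : Measurable fun τ : ℝ => ENNReal.ofReal ((1 + |τ|) ^ (-(lam + 1))) *
      ‖phaseFT ρ G (((lam + a : ℝ) : ℂ) + τ * Complex.I) x‖ₑ := hum.mul (hV a)
    rw [← lintegral_const_mul _ h0, ← lintegral_const_mul _ (h0.const_mul _)]
    refine setLIntegral_mono' hSm fun τ hτ => ?_
    rw [← mul_assoc, ← mul_assoc, ← ENNReal.ofReal_mul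
      (inv_nonneg.2 hc.1.le), ← ENNReal.ofReal_mul (mul_nonneg (inv_nonneg.2 hc.1.le)
        (by positivity))]
    refine mul_le_mul_left (ENNReal.ofReal_le_ofReal ?_) _
    have h1 := rpow_neg_min_le hc hD ha hτ
    have h2 : (1 + |τ|) ^ (-(lam + 1 + min a 1)) =
        (1 + |τ|) ^ (-(lam + 1)) * (1 + |τ|) ^ (-min a 1) := by
      rw [← Real.rpow_add (by positivity)]
      ring_nf
    rw [h2]
    calc _ ≤ Real.exp (a / 4) * ((1 + |τ|) ^ (-(lam + 1)) * (c⁻¹ * D ^ (-min a 1))) := by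
          gcongr
      _ = _ := by ring

/-- Means `S_t F`, `t ∈ [1, 2]`, of a function `F` supported in `|y| ≥ D`, on the ball
`|x| ≤ D/2`.  Finite propagation speed (up to rapidly decreasing tails) leaves only wave packets at
times `|τ| ≳ D`, where the coefficients are small; the `L²` bounds for these in `τ` at a fixed point
and in `(x, τ)` on a ball then give the two bounds for `Q`. -/
theorem IsHomogeneousDistance.exists_far_unit_bound (hρ : IsHomogeneousDistance β ρ) (hd : 1 ≤ d)
    {lam γ : ℝ} (hlam : 0 < lam) (hγ : 0 ≤ γ) : ∃ C > 0, ∀ D : ℝ, 1 ≤ D →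
      ∀ F : EuclideanSpace ℝ (Fin d) → ℂ, Integrable F → (∀ y, ‖y‖ < D → F y = 0) →
      ∃ Q : EuclideanSpace ℝ (Fin d) → ℝ≥0∞, Measurable Q ∧
        (∀ t ∈ Icc (1 : ℝ) 2, ∀ x, ‖x‖ ≤ D / 2 → ‖rieszMean ρ lam γ t F x‖ₑ ≤
          ENNReal.ofReal (C * (D ^ d)⁻¹) * (∫⁻ y, ‖F y‖ₑ) + Q x) ∧
        (∀ x, Q x ^ 2 ≤ ENNReal.ofReal (C * farWeight lam γ D ^ 2) * ∫⁻ y, ‖F y‖ₑ ^ 2) ∧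
        ∀ r : ℝ, 1 ≤ r → ∫⁻ x in Metric.ball 0 r, Q x ^ 2 ≤
          ENNReal.ofReal (C * r * farWeight lam γ D ^ 2) * ∫⁻ y, ‖F y‖ₑ ^ 2 := by
  obtain ⟨ν, hν⟩ := exists_isExpMixture hγ
  have hνf := hν.finite
  obtain ⟨CL, hCL, hlow⟩ := hρ.exists_invFT_hlog_cutLow_le hd lam γ
  obtain ⟨Ch, hCh, hhigh⟩ := exists_enorm_invFT_hlog_le hlam hν
  obtain ⟨c, hc, B, hB, hnear⟩ := hρ.exists_norm_invFT_midAmp_le hd hlam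
  obtain ⟨Ct, hCt, htail⟩ := hρ.exists_packetTail_sq_le hd hlam hγ hν hc.1
  have hc0 := hc.1
  set J := ∫ τ : ℝ, (1 + |τ|) ^ (-(lam + 1)) with hJ
  have hJi := integrable_one_add_abs_rpow (s := lam + 1) (by linarith)
  have hJ0 : 0 ≤ J := integral_nonneg fun τ => by positivity
  have hJl : ∫⁻ τ : ℝ, ENNReal.ofReal ((1 + |τ|) ^ (-(lam + 1))) = ENNReal.ofReal J :=
    (ofReal_integral_eq_lintegral_ofReal hJi (ae_of_all _ fun τ => by positivity)).symm
  set M := ∫ a, Real.exp (-(-1 / 2) * a) ∂ν with hM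
  have hMi := hν.integrable (-1 / 2) (by norm_num)
  have hM0 : 0 ≤ M := integral_nonneg fun a => by positivity
  have hMl : ∫⁻ a, ENNReal.ofReal (Real.exp (-(-1 / 2) * a)) ∂ν = ENNReal.ofReal M :=
    (ofReal_integral_eq_lintegral_ofReal hMi (ae_of_all _ fun τ => by positivity)).symm
  set K := Ch * c⁻¹ with hK
  have hK0 : 0 < K := by positivity
  set C1 := CL * 2 ^ d + Ch * (M * (B * J)) with hC1
  set C2 := K ^ 2 * (Ct * (2 * Real.pi) ^ d) with hC2
  have hC10 : 0 < C1 := by positivity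
  have hC20 : 0 < C2 := by positivity
  refine ⟨C1 + C2, by positivity, fun D hD F hF hsupp => ?_⟩
  have hD0 : 0 < D := by linarith
  have hGi := hρ.integrable_shellFT hd hF
  have hGm := hρ.measurable_shellFT hd hF
  have hGs : ∀ ξ, shellFT ρ F ξ ≠ 0 → ξ ∈ shell ρ (1 / 3) 3 := fun ξ h => shellFT_support h
  have hG2 : ∫⁻ ξ, ‖shellFT ρ F ξ‖ₑ ^ 2 ≤
      ENNReal.ofReal ((2 * Real.pi) ^ d) * ∫⁻ y, ‖F y‖ₑ ^ 2 := by
    refine le_trans ?_ (lintegral_ft_sq_le hF)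
    gcongr with ξ
    exact enorm_shellFT_le F ξ
  obtain ⟨htail1, htail2⟩ := htail D hD _ hGm hGi hGs
  refine ⟨fun x => ENNReal.ofReal K * packetTail ρ lam ν (shellFT ρ F) (c * D) D x,
    (measurable_packetTail hρ.measurable hGm _ _ _).const_mul _, fun t ht x hx => ?_,
    fun x => ?_, fun r hr => ?_⟩
  · have ht0 : 0 < t := by linarith [ht.1]
    rw [hρ.rieszMean_eq_low_add_high hd hlam.le hγ ht hF]
    have hpi : ‖((((2 * Real.pi) ^ d : ℝ)⁻¹ : ℝ) : ℂ)‖ₑ ≤ 1 := by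
      rw [← enorm_one (G := ℂ)]
      refine enorm_le_iff_norm_le.2 ?_
      rw [Complex.norm_real, norm_one, Real.norm_of_nonneg (by positivity)]
      exact inv_le_one_of_one_le₀ (one_le_pow₀ (by linarith [Real.two_le_pi]))
    rw [enorm_mul]
    refine (mul_le_of_le_one_left' hpi).trans ((enorm_add_le _ _).trans ?_)
    have hL := hρ.enorm_low_le hd hlam.le hγ ht0 hD0 (hlow t ht) hF hsupp hx
    have hH := hhigh hρ.measurable _ hGi hGs t ht x
    have hsplit := lintegral_packets_le (lam := lam) hρ.measurable hν.nonneg hc hD0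
      (P := B * (D ^ d)⁻¹) (by positivity) hGm (N := ∫⁻ y, ‖F y‖ₑ) (x := x) fun a τ ha hτ => by
        refine (enorm_phaseFT_shellFT_le hρ hd ?_ (hnear D a τ hD ha hτ) hF hsupp hx).trans ?_
        · simp only [Complex.add_re, Complex.ofReal_re, Complex.mul_re, Complex.I_re,
            mul_zero, Complex.ofReal_im, Complex.I_im, zero_mul, sub_zero, add_zero]
          linarith
        · exact mul_le_mul_left (ENNReal.ofReal_le_ofReal (le_of_eq (by ring))) _
    rw [hJl, hMl] at hsplit
    have hH' := hH.trans (mul_le_mul_right hsplit _)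
    refine (add_le_add hL hH').trans ?_
    have e1 : ENNReal.ofReal Ch * (ENNReal.ofReal M * (ENNReal.ofReal (B * (D ^ d)⁻¹) *
        (∫⁻ y, ‖F y‖ₑ) * ENNReal.ofReal J) + ENNReal.ofReal c⁻¹ *
          packetTail ρ lam ν (shellFT ρ F) (c * D) D x) =
        ENNReal.ofReal (Ch * (M * (B * J)) * (D ^ d)⁻¹) * (∫⁻ y, ‖F y‖ₑ) +
          ENNReal.ofReal K * packetTail ρ lam ν (shellFT ρ F) (c * D) D x := by
      have e2 : Ch * (M * (B * J)) * (D ^ d)⁻¹ = Ch * (M * ((B * (D ^ d)⁻¹) * J)) := by ring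
      rw [e2, hK, ENNReal.ofReal_mul hCh.le, ENNReal.ofReal_mul hCh.le, ENNReal.ofReal_mul hM0,
        ENNReal.ofReal_mul (p := B * (D ^ d)⁻¹) (by positivity)]
      ring
    rw [e1, ← add_assoc, ← add_mul, ← ENNReal.ofReal_add (by positivity) (by positivity),
      ← add_mul]
    refine add_le_add (mul_le_mul_left (ENNReal.ofReal_le_ofReal ?_) _) le_rfl
    refine mul_le_mul_of_nonneg_right ?_ (by positivity)
    linarith
  · rw [mul_pow, ← ENNReal.ofReal_pow hK0.le]
    refine (mul_le_mul_right ((htail1 x).trans (mul_le_mul_right hG2 _)) _).trans ?_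
    rw [← mul_assoc, ← mul_assoc, ← ENNReal.ofReal_mul (by positivity),
      ← ENNReal.ofReal_mul (by positivity)]
    refine mul_le_mul_left (ENNReal.ofReal_le_ofReal ?_) _
    have : 0 ≤ C1 * farWeight lam γ D ^ 2 := by positivity
    calc _ = C2 * farWeight lam γ D ^ 2 := by rw [hC2]; ring
      _ ≤ _ := by linarith
  · simp_rw [mul_pow]
    rw [lintegral_const_mul' _ _ (by simp), ← ENNReal.ofReal_pow hK0.le]
    refine (mul_le_mul_right ((htail2 r hr).trans (mul_le_mul_right hG2 _)) _).trans ?_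
    rw [← mul_assoc, ← mul_assoc, ← ENNReal.ofReal_mul (by positivity),
      ← ENNReal.ofReal_mul (by positivity)]
    refine mul_le_mul_left (ENNReal.ofReal_le_ofReal ?_) _
    have : 0 ≤ C1 * r * farWeight lam γ D ^ 2 := by positivity
    calc _ = C2 * r * farWeight lam γ D ^ 2 := by rw [hC2]; ring
      _ ≤ _ := by linarith

end Far

/-! ### Lorentz functions on dyadic annuli -/

section Lorentz

variable {X : Type*} [MeasurableSpace X] {μ : Measure X} {f : X → ℂ}

theorem antitone_measure_lt_norm (μ : Measure X) (f : X → ℂ) :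
    Antitone fun s : ℝ => μ {x | s < ‖f x‖} := fun _ _ h =>
  measure_mono fun _ hx => lt_of_le_of_lt h hx

/-- The embedding `L^{2,1} ⊆ L²`. -/
theorem lintegral_enorm_sq_le_distribution (hf : AEStronglyMeasurable f μ) :
    ∫⁻ x, ‖f x‖ₑ ^ 2 ∂μ ≤
      2 * (∫⁻ s in Ioi (0 : ℝ), μ {x | s < ‖f x‖} ^ (1 / 2 : ℝ)) ^ 2 := by
  set m : ℝ → ℝ≥0∞ := fun s => μ {x | s < ‖f x‖} with hm
  have hanti : Antitone m := antitone_measure_lt_norm μ f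
  have hmm : Measurable fun s => m s ^ (1 / 2 : ℝ) := hanti.measurable.pow_const _
  set N := ∫⁻ s in Ioi (0 : ℝ), m s ^ (1 / 2 : ℝ) with hN
  have h := lintegral_rpow_eq_lintegral_meas_lt_mul μ (f := fun x => ‖f x‖)
    (ae_of_all _ fun x => norm_nonneg _) hf.norm.aemeasurable two_pos
  have h1 : ∫⁻ x, ‖f x‖ₑ ^ 2 ∂μ = ∫⁻ x, ENNReal.ofReal (‖f x‖ ^ (2 : ℝ)) ∂μ := by
    congr 1 with x
    rw [Real.rpow_two, ENNReal.ofReal_pow (norm_nonneg _), ofReal_norm]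
  rw [h1, h, ENNReal.ofReal_ofNat]
  refine mul_le_mul_right ?_ _
  have hsq : ∀ a : ℝ≥0∞, (a ^ (1 / 2 : ℝ)) * (a ^ (1 / 2 : ℝ)) = a := by
    intro a
    rw [← ENNReal.rpow_add_of_nonneg _ _ (by norm_num) (by norm_num)]
    norm_num
  calc _ ≤ ∫⁻ t in Ioi (0 : ℝ), m t ^ (1 / 2 : ℝ) * N := by
        refine setLIntegral_mono' measurableSet_Ioi fun t ht => ?_
        have h2 : m t ^ (1 / 2 : ℝ) * ENNReal.ofReal t ≤ N := by
          calc m t ^ (1 / 2 : ℝ) * ENNReal.ofReal t = ∫⁻ _ in Ioc 0 t, m t ^ (1 / 2 : ℝ) := by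
                rw [setLIntegral_const, Real.volume_Ioc, sub_zero]
            _ ≤ ∫⁻ s in Ioc 0 t, m s ^ (1 / 2 : ℝ) :=
                setLIntegral_mono' measurableSet_Ioc fun s hs =>
                  ENNReal.rpow_le_rpow (hanti hs.2) (by norm_num)
            _ ≤ N := lintegral_mono_set Ioc_subset_Ioi_self
        rw [show (2 : ℝ) - 1 = 1 by norm_num, Real.rpow_one]
        change m t * _ ≤ _
        calc m t * ENNReal.ofReal t =
              m t ^ (1 / 2 : ℝ) * (m t ^ (1 / 2 : ℝ) * ENNReal.ofReal t) := by
              rw [← mul_assoc, hsq]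
          _ ≤ _ := mul_le_mul_right h2 _
    _ = N ^ 2 := by rw [lintegral_mul_const _ hmm, sq]

theorem MemLorentz.lintegral_lt_top {p : ℝ} {q : ℝ≥0∞} (hp : 0 < p) (hq : 1 ≤ q) (hq' : q ≠ ⊤)
    (hf : MemLorentz f p q μ) : ∫⁻ s in Ioi (0 : ℝ),
      (ENNReal.ofReal s * μ {x | s < ‖f x‖} ^ (1 / p)) ^ q.toReal / ENNReal.ofReal s < ⊤ := by
  have h := hf.2
  have hQ : 0 < q.toReal := ENNReal.toReal_pos (by positivity) hq'
  rw [eLorentzNorm, if_neg hq', ENNReal.rpow_lt_top_iff_of_pos (by positivity)] at h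
  exact ENNReal.lt_top_of_mul_ne_top_right h.ne (by simpa using hp)

theorem MemLorentz.exists_weak_type {p : ℝ} {q : ℝ≥0∞} (hp : 0 < p) (hq : 1 ≤ q)
    (hf : MemLorentz f p q μ) : ∃ A : ℝ≥0∞, A ≠ ⊤ ∧ ∀ s : ℝ, 0 < s →
      ENNReal.ofReal s * μ {x | s < ‖f x‖} ^ (1 / p) ≤ A := by
  by_cases hq' : q = ⊤
  · refine ⟨eLorentzNorm f p q μ, hf.2.ne, fun s hs => ?_⟩
    rw [eLorentzNorm, if_pos hq']
    exact le_iSup₂ (f := fun (s : ℝ) (_ : 0 < s) =>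
      ENNReal.ofReal s * μ {x | s < ‖f x‖} ^ (1 / p)) s hs
  have hI := hf.lintegral_lt_top hp hq hq'
  have hQ : 0 < q.toReal := ENNReal.toReal_pos (by positivity) hq'
  set I := ∫⁻ s in Ioi (0 : ℝ),
      (ENNReal.ofReal s * μ {x | s < ‖f x‖} ^ (1 / p)) ^ q.toReal / ENNReal.ofReal s with hIdef
  refine ⟨2 * (2 * I) ^ (1 / q.toReal), ?_, fun s hs => ?_⟩
  · refine ENNReal.mul_ne_top (by simp) (ENNReal.rpow_ne_top_of_nonneg (by positivity) ?_)
    exact ENNReal.mul_ne_top (by simp) hI.ne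
  set b := ENNReal.ofReal (s / 2) * μ {x | s < ‖f x‖} ^ (1 / p) with hb
  have h1 : b ^ q.toReal / 2 ≤ I := by
    calc b ^ q.toReal / 2 = ∫⁻ _ in Ioc (s / 2) s, b ^ q.toReal / ENNReal.ofReal s := by
          rw [setLIntegral_const, Real.volume_Ioc, div_eq_mul_inv, div_eq_mul_inv, mul_assoc]
          congr 1
          rw [← ENNReal.ofReal_inv_of_pos hs, ← ENNReal.ofReal_mul (by positivity),
            ← ENNReal.ofReal_ofNat 2, ← ENNReal.ofReal_inv_of_pos two_pos]
          congr 1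
          field_simp
          ring
      _ ≤ ∫⁻ σ in Ioc (s / 2) s,
          (ENNReal.ofReal σ * μ {x | σ < ‖f x‖} ^ (1 / p)) ^ q.toReal / ENNReal.ofReal σ := by
          refine setLIntegral_mono' measurableSet_Ioc fun σ hσ => ?_
          have e1 := antitone_measure_lt_norm μ f hσ.2
          dsimp only at e1
          refine ENNReal.div_le_div (ENNReal.rpow_le_rpow (mul_le_mul' ?_ ?_) hQ.le) ?_
          · exact ENNReal.ofReal_le_ofReal hσ.1.le
          · exact ENNReal.rpow_le_rpow e1 (by positivity)
          · exact ENNReal.ofReal_le_ofReal hσ.2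
      _ ≤ I := lintegral_mono_set fun σ hσ => lt_trans (by positivity) hσ.1
  have h2 : b ≤ (2 * I) ^ (1 / q.toReal) := by
    rw [one_div, ENNReal.le_rpow_inv_iff hQ, mul_comm]
    exact (ENNReal.div_le_iff (by simp) (by simp)).1 h1
  calc _ = 2 * b := by
        rw [hb, ← mul_assoc, ← ENNReal.ofReal_ofNat 2, ← ENNReal.ofReal_mul two_pos.le]
        congr 2
        ring
    _ ≤ _ := mul_le_mul_right h2 _

theorem lintegral_one_sub_log_rpow_lt_top {κ : ℝ} (hκ : 1 < κ) :
    ∫⁻ s in Ioo (0 : ℝ) 1, ENNReal.ofReal ((1 - Real.log s) ^ (-κ)) / ENNReal.ofReal s < ⊤ := by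
  have himg : (fun u : ℝ => Real.exp (-u)) '' Ioi 0 = Ioo 0 1 := by
    ext s
    constructor
    · rintro ⟨u, hu, rfl⟩
      exact ⟨Real.exp_pos _, Real.exp_lt_one_iff.2 (neg_lt_zero.2 hu)⟩
    · intro hs
      refine ⟨-Real.log s, ?_, ?_⟩
      · exact neg_pos.2 (Real.log_neg hs.1 hs.2)
      · simp [Real.exp_log hs.1]
  have hinj : InjOn (fun u : ℝ => Real.exp (-u)) (Ioi 0) := fun a _ b _ h =>
    neg_injective (Real.exp_injective h)
  have hder : ∀ u ∈ Ioi (0 : ℝ), HasDerivWithinAt (fun u : ℝ => Real.exp (-u)) (-Real.exp (-u))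
      (Ioi 0) u := by
    intro u _
    have := (hasDerivAt_neg u).exp
    simpa using this.hasDerivWithinAt
  rw [← himg, lintegral_image_eq_lintegral_abs_deriv_mul measurableSet_Ioi hder hinj]
  have hI := integrable_one_add_abs_rpow hκ
  calc _ ≤ ∫⁻ u in Ioi (0 : ℝ), ENNReal.ofReal ((1 + |u|) ^ (-κ)) := by
        refine setLIntegral_mono' measurableSet_Ioi fun u hu => ?_
        have hu0 : 0 < u := hu
        rw [Real.log_exp, sub_neg_eq_add, abs_neg, abs_of_pos (Real.exp_pos _), abs_of_pos hu0,
          ENNReal.mul_div_cancel (by simpa using Real.exp_pos _) ENNReal.ofReal_ne_top]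
    _ ≤ ∫⁻ u : ℝ, ENNReal.ofReal ((1 + |u|) ^ (-κ)) := setLIntegral_le_lintegral _ _
    _ < ⊤ := by
        rw [← ofReal_integral_eq_lintegral_ofReal hI (ae_of_all _ fun u => by positivity)]
        exact ENNReal.ofReal_lt_top

/-- Hölder's inequality: the condition relating `γ` and `q` says that `(1 + log (1/s))^{-γ}` is in
the space dual to `L^q((0,1), ds/s)`. -/
theorem MemLorentz.lintegral_mul_log_lt_top {p γ : ℝ} {q : ℝ≥0∞} (hp : 0 < p)
    (hqγ : (1 < q ∧ 1 - (1 / q).toReal < γ) ∨ (q = 1 ∧ 0 ≤ γ)) (hf : MemLorentz f p q μ) :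
    ∫⁻ s in Ioo (0 : ℝ) 1, μ {x | s < ‖f x‖} ^ (1 / p) *
      ENNReal.ofReal ((1 - Real.log s) ^ (-γ)) < ⊤ := by
  have hq1 : 1 ≤ q := by
    rcases hqγ with h | h
    · exact h.1.le
    · exact h.1.ge
  set φ : ℝ → ℝ≥0∞ := fun s => ENNReal.ofReal s * μ {x | s < ‖f x‖} ^ (1 / p) with hφ
  have hm := (antitone_measure_lt_norm μ f).measurable
  have hφm : Measurable φ := ENNReal.measurable_ofReal.mul (hm.pow_const _)
  set L : ℝ → ℝ≥0∞ := fun s => ENNReal.ofReal ((1 - Real.log s) ^ (-γ)) with hL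
  have hLm : Measurable L := by fun_prop
  have hφs : ∀ s ∈ Ioo (0 : ℝ) 1, μ {x | s < ‖f x‖} ^ (1 / p) * L s =
      φ s * L s / ENNReal.ofReal s := by
    intro s hs
    simp only [hφ]
    rw [mul_assoc, mul_comm, ENNReal.mul_div_right_comm, ENNReal.div_self (by simpa using hs.1)
      ENNReal.ofReal_ne_top, one_mul, mul_comm]
  rw [setLIntegral_congr_fun measurableSet_Ioo hφs]
  have hsub : Ioo (0 : ℝ) 1 ⊆ Ioi 0 := fun s hs => hs.1
  rcases hqγ with ⟨h1, hγ⟩ | ⟨h1, hγ⟩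
  · by_cases hq' : q = ⊤
    · obtain ⟨A, hA, hw⟩ := hf.exists_weak_type hp hq1
      rw [hq'] at hγ
      simp only [ENNReal.div_top, ENNReal.toReal_zero, sub_zero] at hγ
      calc _ ≤ ∫⁻ s in Ioo (0 : ℝ) 1, A * (L s / ENNReal.ofReal s) := by
            refine setLIntegral_mono' measurableSet_Ioo fun s hs => ?_
            rw [mul_div_assoc]
            exact mul_le_mul_left (hw s hs.1) _
        _ = A * ∫⁻ s in Ioo (0 : ℝ) 1, L s / ENNReal.ofReal s := lintegral_const_mul' _ _ hA
        _ < ⊤ := ENNReal.mul_lt_top hA.lt_top (lintegral_one_sub_log_rpow_lt_top hγ)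
    · have hQ : 1 < q.toReal := by
        rw [← ENNReal.toReal_one]
        exact (ENNReal.toReal_lt_toReal ENNReal.one_ne_top hq').2 h1
      have hconj := Real.HolderConjugate.conjExponent hQ
      set Q := q.toReal with hQdef
      set Q' := Real.conjExponent Q with hQ'
      have hγQ : 1 < γ * Q' := by
        have e1 : (1 / q).toReal = Q⁻¹ := by rw [one_div, ENNReal.toReal_inv]
        have e2 := hconj.inv_add_inv_eq_one
        rw [e1] at hγ
        have e3 : Q'⁻¹ < γ := by linarith
        have e4 := hconj.symm.pos
        rwa [inv_lt_iff_one_lt_mul₀ e4] at e3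
      calc _ ≤ ∫⁻ s in Ioo (0 : ℝ) 1, (φ s ^ Q / ENNReal.ofReal s +
            ENNReal.ofReal ((1 - Real.log s) ^ (-(γ * Q'))) / ENNReal.ofReal s) := by
            refine setLIntegral_mono' measurableSet_Ioo fun s hs => ?_
            rw [← ENNReal.add_div]
            refine ENNReal.div_le_div_right ?_ _
            refine (ENNReal.young_inequality _ _ hconj).trans ?_
            have hl : 0 < 1 - Real.log s := by linarith [Real.log_neg hs.1 hs.2]
            have hLQ : L s ^ Q' = ENNReal.ofReal ((1 - Real.log s) ^ (-(γ * Q'))) := by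
              simp only [hL]
              rw [ENNReal.ofReal_rpow_of_pos (by positivity), ← Real.rpow_mul hl.le, neg_mul]
            rw [hLQ]
            refine add_le_add (ENNReal.div_le_of_le_mul ?_) (ENNReal.div_le_of_le_mul ?_)
            · refine le_mul_of_one_le_right' ?_
              rw [← ENNReal.ofReal_one]
              exact ENNReal.ofReal_le_ofReal hconj.lt.le
            · refine le_mul_of_one_le_right' ?_
              rw [← ENNReal.ofReal_one]
              exact ENNReal.ofReal_le_ofReal hconj.symm.lt.le
        _ = (∫⁻ s in Ioo (0 : ℝ) 1, φ s ^ Q / ENNReal.ofReal s) + ∫⁻ s in Ioo (0 : ℝ) 1,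
            ENNReal.ofReal ((1 - Real.log s) ^ (-(γ * Q'))) / ENNReal.ofReal s :=
            lintegral_add_left ((hφm.pow_const _).div ENNReal.measurable_ofReal) _
        _ < ⊤ := ENNReal.add_lt_top.2 ⟨(lintegral_mono_set hsub).trans_lt
            (hf.lintegral_lt_top hp hq1 hq'), lintegral_one_sub_log_rpow_lt_top hγQ⟩
  · have h2 := hf.lintegral_lt_top hp hq1 (by rw [h1]; exact ENNReal.one_ne_top)
    rw [h1, ENNReal.toReal_one] at h2
    simp only [ENNReal.rpow_one] at h2
    refine lt_of_le_of_lt ?_ h2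
    refine le_trans (setLIntegral_mono' measurableSet_Ioo fun s hs => ?_)
      (lintegral_mono_set hsub)
    refine ENNReal.div_le_div_right (mul_le_of_le_one_right' ?_) _
    simp only [hL]
    rw [← ENNReal.ofReal_one]
    refine ENNReal.ofReal_le_ofReal (Real.rpow_le_one_of_one_le_of_nonpos ?_ (by linarith))
    linarith [Real.log_neg hs.1 hs.2]

theorem MemLorentz.lintegral_Ici_sqrt_lt_top {p : ℝ} {q : ℝ≥0∞} (hp : 2 < p) (hq : 1 ≤ q)
    (hf : MemLorentz f p q μ) :
    ∫⁻ s in Ici (1 : ℝ), μ {x | s < ‖f x‖} ^ (1 / 2 : ℝ) < ⊤ := by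
  obtain ⟨A, hA, hw⟩ := hf.exists_weak_type (by linarith) hq
  have hI : IntegrableOn (fun s : ℝ => s ^ (-(p / 2))) (Ici 1) :=
    (integrableOn_Ici_iff_integrableOn_Ioi).2 (integrableOn_Ioi_rpow_of_lt (by linarith) one_pos)
  calc _ ≤ ∫⁻ s in Ici (1 : ℝ), A ^ (p / 2) * ENNReal.ofReal (s ^ (-(p / 2))) := by
        refine setLIntegral_mono' measurableSet_Ici fun s hs => ?_
        have hs0 : 0 < s := lt_of_lt_of_le one_pos hs
        have h1 : μ {x | s < ‖f x‖} ^ (1 / p) ≤ A * ENNReal.ofReal s⁻¹ := by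
          rw [ENNReal.ofReal_inv_of_pos hs0, ← div_eq_mul_inv, ENNReal.le_div_iff_mul_le
            (Or.inl (by simpa using hs0)) (Or.inl ENNReal.ofReal_ne_top), mul_comm]
          exact hw s hs0
        calc μ {x | s < ‖f x‖} ^ (1 / 2 : ℝ) = (μ {x | s < ‖f x‖} ^ (1 / p)) ^ (p / 2) := by
              rw [← ENNReal.rpow_mul]; congr 1; field_simp
          _ ≤ (A * ENNReal.ofReal s⁻¹) ^ (p / 2) := ENNReal.rpow_le_rpow h1 (by linarith)
          _ = _ := by
              rw [ENNReal.mul_rpow_of_nonneg _ _ (by linarith), ENNReal.ofReal_rpow_of_pos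
                (by positivity), Real.inv_rpow hs0.le, Real.rpow_neg hs0.le]
    _ = A ^ (p / 2) * ∫⁻ s in Ici (1 : ℝ), ENNReal.ofReal (s ^ (-(p / 2))) :=
        lintegral_const_mul' _ _ (ENNReal.rpow_ne_top_of_nonneg (by linarith) hA)
    _ < ⊤ := ENNReal.mul_lt_top (ENNReal.rpow_lt_top_of_nonneg (by linarith) hA)
        hI.lintegral_lt_top

end Lorentz

theorem rpow_neg_mul_min_rpow_half_le {a b u v : ℝ} (ha : 0 < a) (hb : 0 < b)
    (hab : a + b = 1 / 2) (hu : 0 < u) (hv : 0 < v) :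
    v ^ (-a) * min u v ^ (1 / 2 : ℝ) ≤
      u ^ b * min (u ^ (min a b) * v ^ (-min a b)) (u ^ (min a b) * v ^ (-min a b))⁻¹ := by
  set α := min a b with hα
  have hα0 : 0 < α := lt_min ha hb
  have hw : u ^ α * v ^ (-α) = (u / v) ^ α := by
    rw [Real.div_rpow hu.le hv.le, Real.rpow_neg hv.le, div_eq_mul_inv]
  rw [hw]
  rcases le_total u v with h | h
  · have h1 : u / v ≤ 1 := (div_le_one hv).2 h
    have h2 : (u / v) ^ α ≤ 1 := Real.rpow_le_one (by positivity) h1 hα0.le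
    rw [min_eq_left h, min_eq_left (h2.trans ((one_le_inv₀ (by positivity)).2 h2)), ← hab,
      Real.rpow_add hu]
    calc v ^ (-a) * (u ^ a * u ^ b) = u ^ b * (u / v) ^ a := by
          rw [Real.div_rpow hu.le hv.le, Real.rpow_neg hv.le]; ring
      _ ≤ _ := by
          gcongr ?_ * ?_
          exact Real.rpow_le_rpow_of_exponent_ge (by positivity) h1 (min_le_left _ _)
  · have h1 : v / u ≤ 1 := (div_le_one hu).2 h
    have h2 : 1 ≤ (u / v) ^ α := Real.one_le_rpow ((one_le_div hv).2 h) hα0.le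
    rw [min_eq_right h, min_eq_right ((inv_le_one_of_one_le₀ h2).trans h2), ← hab,
      Real.rpow_add hv, ← mul_assoc, ← Real.rpow_add hv, neg_add_cancel, Real.rpow_zero, one_mul,
      ← Real.inv_rpow (by positivity), inv_div]
    calc v ^ b = u ^ b * (v / u) ^ b := by
          rw [← Real.mul_rpow hu.le (by positivity)]
          congr 1
          field_simp
      _ ≤ _ := by
          gcongr ?_ * ?_
          exact Real.rpow_le_rpow_of_exponent_ge (by positivity) h1 (min_le_right _ _)

theorem two_rpow_mul_eq_pow (x : ℝ) (k : ℕ) : (2 : ℝ) ^ (k * x) = (2 ^ x) ^ k := by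
  rw [mul_comm, Real.rpow_mul two_pos.le, Real.rpow_natCast]

/-- The two regimes of the sum over dyadic annuli at height `s`. -/
theorem annular_term_le {n p γ V u s : ℝ} (hn : 0 < n) (hp : 2 < p) (hγ : 0 ≤ γ) (hV : 1 ≤ V)
    (hu : 0 < u) (hs : s ∈ Ioo (0 : ℝ) 1) (k : ℕ) :
    (1 + (k : ℝ)) ^ (-γ) * 2 ^ (-(k * (n * (1 / 2 - 1 / p)))) *
      min u (V * 2 ^ (k * n)) ^ (1 / 2 : ℝ) ≤
    V ^ (1 / 2 : ℝ) * (s ^ (-(1 / 2) : ℝ) * min (s ^ (-(1 / 2) : ℝ) * (2 ^ (-(n * (1 / p)))) ^ k)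
        (s ^ (-(1 / 2) : ℝ) * (2 ^ (-(n * (1 / p)))) ^ k)⁻¹ +
      (1 + 2 * (n / p)) ^ γ * (u ^ (1 / p) * (1 - Real.log s) ^ (-γ)) *
        min (u ^ (min (1 / 2 - 1 / p) (1 / p)) * (2 ^ (-(n * min (1 / 2 - 1 / p) (1 / p)))) ^ k)
          (u ^ (min (1 / 2 - 1 / p) (1 / p)) *
            (2 ^ (-(n * min (1 / 2 - 1 / p) (1 / p)))) ^ k)⁻¹) := by
  have hp0 : 0 < p := by linarith
  have hs0 := hs.1
  have ha : 0 < 1 / 2 - 1 / p := by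
    rw [sub_pos]
    exact one_div_lt_one_div_of_lt two_pos hp
  have hb : 0 < 1 / p := by positivity
  set a := 1 / 2 - 1 / p with hadef
  set b := 1 / p with hbdef
  set α := min a b with hα
  set v : ℝ := 2 ^ (k * n) with hv
  have hv0 : 0 < v := by positivity
  have hpow : ∀ x : ℝ, ((2 : ℝ) ^ (-(n * x))) ^ k = v ^ (-x) := by
    intro x
    rw [← two_rpow_mul_eq_pow, hv, ← Real.rpow_mul two_pos.le]
    congr 1
    ring
  have hk : (2 : ℝ) ^ (-(k * (n * a))) = v ^ (-a) := by
    rw [hv, ← Real.rpow_mul two_pos.le]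
    congr 1
    ring
  rw [hpow, hpow, hk]
  set Y := s ^ (-(1 / 2) : ℝ) with hY
  have hY0 : 0 < Y := by positivity
  have hl : 0 < 1 - Real.log s := by linarith [Real.log_neg hs.1 hs.2]
  have hk1 : 0 < 1 + (k : ℝ) := by positivity
  have hV0 : 0 < V := by linarith
  have hmin : min u (V * v) ≤ V * min u v := by
    rw [mul_min_of_nonneg _ _ hV0.le]
    exact min_le_min_right _ (by nlinarith)
  have hγ1 : (1 + (k : ℝ)) ^ (-γ) ≤ 1 :=
    Real.rpow_le_one_of_one_le_of_nonpos (by linarith [(Nat.cast_nonneg k : (0 : ℝ) ≤ k)])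
      (by linarith)
  have hmin0 : 0 < min u (V * v) := lt_min hu (by positivity)
  have hminv0 : 0 < min u v := lt_min hu hv0
  have hm1 : 0 ≤ min (Y * v ^ (-b)) (Y * v ^ (-b))⁻¹ := le_min (by positivity) (by positivity)
  have hm2 : 0 ≤ min (u ^ α * v ^ (-α)) (u ^ α * v ^ (-α))⁻¹ :=
    le_min (by positivity) (by positivity)
  have hsqrt : min u (V * v) ^ (1 / 2 : ℝ) ≤ V ^ (1 / 2 : ℝ) * min u v ^ (1 / 2 : ℝ) := by
    rw [← Real.mul_rpow hV0.le hminv0.le]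
    exact Real.rpow_le_rpow hmin0.le hmin (by norm_num)
  -- If `2^{kn/p} ≤ s^{-1/2}`, the volume bound suffices. Otherwise `k` is at least a multiple of
  -- `log (1/s)`, and the factor `(1 + k)^{-γ}` is exchanged for `(1 - log s)^{-γ}`.
  by_cases h : v ^ b ≤ Y
  · have h1 : 1 ≤ Y * v ^ (-b) := by
      rw [Real.rpow_neg hv0.le, ← div_eq_mul_inv, one_le_div (by positivity)]
      exact h
    have h2 : v ^ (-a) * min u v ^ (1 / 2 : ℝ) ≤ v ^ b := by
      calc v ^ (-a) * min u v ^ (1 / 2 : ℝ) ≤ v ^ (-a) * v ^ (1 / 2 : ℝ) := by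
            gcongr ?_ * ?_
            exact Real.rpow_le_rpow hminv0.le (min_le_right _ _) (by norm_num)
        _ = v ^ b := by
            rw [← Real.rpow_add hv0]
            congr 1
            rw [hadef]
            ring
    calc _ ≤ 1 * v ^ (-a) * (V ^ (1 / 2 : ℝ) * min u v ^ (1 / 2 : ℝ)) := by gcongr
      _ = V ^ (1 / 2 : ℝ) * (v ^ (-a) * min u v ^ (1 / 2 : ℝ)) := by ring
      _ ≤ V ^ (1 / 2 : ℝ) * v ^ b := by gcongr
      _ = V ^ (1 / 2 : ℝ) * (Y * min (Y * v ^ (-b)) (Y * v ^ (-b))⁻¹) := by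
          rw [min_eq_right ((inv_le_one_of_one_le₀ h1).trans h1), Real.rpow_neg hv0.le]
          field_simp
      _ ≤ _ := by
          gcongr ?_ * ?_
          exact le_add_of_nonneg_right (by positivity)
  · have h1 : -Real.log s ≤ 2 * (n / p) * k := by
      have h2 := Real.log_lt_log hY0 (not_le.1 h)
      rw [hY, Real.log_rpow hs0, Real.log_rpow hv0, hv, Real.log_rpow two_pos, hbdef] at h2
      have h3 : 1 / p * (k * n * Real.log 2) ≤ 1 / p * (k * n * 1) := by
        have := Real.log_two_lt_d9
        gcongr
        linarith
      have h4 : 1 / p * (k * n * 1) = n / p * k := by ring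
      linarith
    have h2 : (1 - Real.log s) / (1 + 2 * (n / p)) ≤ 1 + k := by
      rw [div_le_iff₀ (by positivity)]
      have : 0 ≤ 2 * (n / p) := by positivity
      nlinarith [(Nat.cast_nonneg k : (0 : ℝ) ≤ k)]
    have h3 : (1 + (k : ℝ)) ^ (-γ) ≤ (1 + 2 * (n / p)) ^ γ * (1 - Real.log s) ^ (-γ) := by
      calc (1 + (k : ℝ)) ^ (-γ) ≤ ((1 - Real.log s) / (1 + 2 * (n / p))) ^ (-γ) :=
            Real.rpow_le_rpow_of_nonpos (by positivity) h2 (by linarith)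
        _ = _ := by
            rw [Real.div_rpow hl.le (by positivity), Real.rpow_neg (by positivity) γ,
              Real.rpow_neg (by positivity) γ]
            field_simp
    have h4 := rpow_neg_mul_min_rpow_half_le ha hb (by rw [hadef, hbdef]; ring) hu hv0
    calc _ ≤ ((1 + 2 * (n / p)) ^ γ * (1 - Real.log s) ^ (-γ)) * v ^ (-a) *
          (V ^ (1 / 2 : ℝ) * min u v ^ (1 / 2 : ℝ)) := by gcongr
      _ = V ^ (1 / 2 : ℝ) * ((1 + 2 * (n / p)) ^ γ * (1 - Real.log s) ^ (-γ) *
          (v ^ (-a) * min u v ^ (1 / 2 : ℝ))) := by ring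
      _ ≤ V ^ (1 / 2 : ℝ) * ((1 + 2 * (n / p)) ^ γ * (1 - Real.log s) ^ (-γ) *
          (u ^ b * min (u ^ α * v ^ (-α)) (u ^ α * v ^ (-α))⁻¹)) := by gcongr
      _ = V ^ (1 / 2 : ℝ) * ((1 + 2 * (n / p)) ^ γ * (u ^ b * (1 - Real.log s) ^ (-γ)) *
          min (u ^ α * v ^ (-α)) (u ^ α * v ^ (-α))⁻¹) := by ring
      _ ≤ _ := by
          gcongr ?_ * ?_
          exact le_add_of_nonneg_left (by positivity)

section LorentzAnnuli

variable {d : ℕ} {f : EuclideanSpace ℝ (Fin d) → ℂ} {p γ : ℝ} {q : ℝ≥0∞}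

/-- The dyadic annulus `2^k ≤ |y| < 2^{k+1}`. -/
def annulus (d k : ℕ) : Set (EuclideanSpace ℝ (Fin d)) := {y | 2 ^ k ≤ ‖y‖ ∧ ‖y‖ < 2 ^ (k + 1)}

theorem measurableSet_annulus (d k : ℕ) : MeasurableSet (annulus d k) :=
  (measurableSet_le measurable_const measurable_norm).inter
    (measurableSet_lt measurable_norm measurable_const)

theorem volume_ball_eq (hd : 1 ≤ d) {r : ℝ} (hr : 0 ≤ r) :
    volume (Metric.ball (0 : EuclideanSpace ℝ (Fin d)) r) = ENNReal.ofReal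
      (r ^ d * (volume (Metric.ball (0 : EuclideanSpace ℝ (Fin d)) 1)).toReal) := by
  have : Nonempty (Fin d) := ⟨⟨0, hd⟩⟩
  rw [Measure.addHaar_ball _ _ hr, finrank_euclideanSpace_fin, ENNReal.ofReal_mul (by positivity),
    ENNReal.ofReal_toReal measure_ball_lt_top.ne]

theorem exists_volume_annulus_le (hd : 1 ≤ d) : ∃ V : ℝ, 1 ≤ V ∧ ∀ k : ℕ,
    volume (annulus d k) ≤ ENNReal.ofReal (V * 2 ^ (k * (d : ℝ))) := by
  set v := (volume (Metric.ball (0 : EuclideanSpace ℝ (Fin d)) 1)).toReal with hv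
  refine ⟨max 1 (2 ^ d * v), le_max_left _ _, fun k => ?_⟩
  calc volume (annulus d k) ≤ volume (Metric.ball (0 : EuclideanSpace ℝ (Fin d)) (2 ^ (k + 1))) :=
        measure_mono fun y hy => by simpa using hy.2
    _ = ENNReal.ofReal ((2 ^ d * v) * 2 ^ (k * (d : ℝ))) := by
        rw [volume_ball_eq hd (by positivity)]
        congr 1
        rw [two_rpow_mul_eq_pow, Real.rpow_natCast]
        ring
    _ ≤ _ := by
        refine ENNReal.ofReal_le_ofReal ?_
        gcongr
        exact le_max_right _ _

theorem MemLorentz.measure_lt_top (hp : 0 < p) (hq : 1 ≤ q) (hf : MemLorentz f p q volume) {s : ℝ}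
    (hs : 0 < s) : volume {x | s < ‖f x‖} < ⊤ := by
  obtain ⟨A, hA, hw⟩ := hf.exists_weak_type hp hq
  have h1 : volume {x | s < ‖f x‖} ^ (1 / p) < ⊤ :=
    ENNReal.lt_top_of_mul_ne_top_right ((hw s hs).trans_lt hA.lt_top).ne (by simpa using hs)
  rwa [ENNReal.rpow_lt_top_iff_of_pos (by positivity)] at h1

theorem tsum_ofReal_geometric_ne_top {r : ℝ} (hr : 0 ≤ r) (hr1 : r < 1) :
    ∑' k : ℕ, ENNReal.ofReal (r ^ k) ≠ ⊤ := by
  simp_rw [ENNReal.ofReal_pow hr]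
  rw [ENNReal.tsum_geometric]
  refine ENNReal.inv_ne_top.2 ?_
  rw [← ENNReal.ofReal_one]
  exact (tsub_pos_of_lt (by simpa using hr1)).ne'

theorem lintegral_Ioo_rpow_neg_half_lt_top :
    ∫⁻ s in Ioo (0 : ℝ) 1, ENNReal.ofReal (s ^ (-(1 / 2) : ℝ)) < ⊤ :=
  ((intervalIntegral.integrableOn_Ioo_rpow_iff one_pos).2 (by norm_num)).lintegral_lt_top

/-- After summation over the annuli, the integrand is at most a multiple of
`s^{-1/2} + μ(s)^{1/p} (1 - log s)^{-γ}` for `s < 1`, integrable by Hölder's inequality and the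
hypothesis on `q, γ`, and at most a multiple of `μ(s)^{1/2}` for `s ≥ 1`; here `μ` is the
distribution function of `f`. -/
theorem MemLorentz.lintegral_sum_min_lt_top (hd : 1 ≤ d) (hp : 2 < p)
    (hqγ : (1 < q ∧ 1 - (1 / q).toReal < γ) ∨ (q = 1 ∧ 0 ≤ γ)) (hq : 1 ≤ q) (hγ : 0 ≤ γ)
    (hf : MemLorentz f p q volume) {V : ℝ} (hV : 1 ≤ V) :
    ∫⁻ s in Ioi (0 : ℝ), ∑' k : ℕ,
      ENNReal.ofReal ((1 + (k : ℝ)) ^ (-γ) * 2 ^ (-(k * (d * (1 / 2 - 1 / p))))) *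
        min (volume {x | s < ‖f x‖}) (ENNReal.ofReal (V * 2 ^ (k * (d : ℝ)))) ^ (1 / 2 : ℝ) < ⊤ := by
  have hn : (0 : ℝ) < d := by exact_mod_cast hd
  have hp0 : 0 < p := by linarith
  have ha : 0 < 1 / 2 - 1 / p := by
    rw [sub_pos]
    exact one_div_lt_one_div_of_lt two_pos hp
  have hb : 0 < 1 / p := by positivity
  have hlt : ∀ x : ℝ, 0 < x → (2 : ℝ) ^ (-(d * x)) < 1 := fun x hx =>
    Real.rpow_lt_one_of_one_lt_of_neg (by norm_num) (by have := mul_pos hn hx; linarith)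
  set m : ℝ → ℝ≥0∞ := fun s => volume {x | s < ‖f x‖} with hm
  have hanti : Antitone m := antitone_measure_lt_norm volume f
  set Ψ : ℝ → ℝ≥0∞ := fun s => ∑' k : ℕ,
      ENNReal.ofReal ((1 + (k : ℝ)) ^ (-γ) * 2 ^ (-(k * (d * (1 / 2 - 1 / p))))) *
        min (m s) (ENNReal.ofReal (V * 2 ^ (k * (d : ℝ)))) ^ (1 / 2 : ℝ) with hΨ
  have hcover : Ioi (0 : ℝ) ⊆ Ioo 0 1 ∪ Ici 1 := by
    intro s hs
    rcases lt_or_ge s 1 with h | h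
    · exact Or.inl ⟨hs, h⟩
    · exact Or.inr h
  refine (lintegral_mono_set hcover).trans_lt ((lintegral_union_le _ _ _).trans_lt
    (ENNReal.add_lt_top.2 ⟨?_, ?_⟩))
  · set S1 : ℝ := 2 / (1 - 2 ^ (-(d * (1 / p)))) with hS1
    set S2 : ℝ := 2 / (1 - 2 ^ (-(d * min (1 / 2 - 1 / p) (1 / p)))) with hS2
    have hbound : ∀ s ∈ Ioo (0 : ℝ) 1, Ψ s ≤ ENNReal.ofReal (V ^ (1 / 2 : ℝ)) *
        (ENNReal.ofReal S1 * ENNReal.ofReal (s ^ (-(1 / 2) : ℝ)) +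
          ENNReal.ofReal ((1 + 2 * (d / p)) ^ γ) * ENNReal.ofReal S2 *
          (m s ^ (1 / p) * ENNReal.ofReal ((1 - Real.log s) ^ (-γ)))) := by
      intro s hs
      have hl : 0 < 1 - Real.log s := by linarith [Real.log_neg hs.1 hs.2]
      have hs0 := hs.1
      have hmt : m s ≠ ⊤ := (hf.measure_lt_top hp0 hq hs.1).ne
      by_cases h0 : m s = 0
      · have : Ψ s = 0 := by
          simp only [hΨ, h0, zero_min]
          simp
        rw [this]
        exact zero_le
      set u := (m s).toReal with hu
      have hu0 : 0 < u := ENNReal.toReal_pos h0 hmt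
      have hmu : m s = ENNReal.ofReal u := (ENNReal.ofReal_toReal hmt).symm
      set w2 := u ^ (min (1 / 2 - 1 / p) (1 / p)) with hw2
      set w1 := s ^ (-(1 / 2) : ℝ) with hw1
      have hw20 : 0 < w2 := by positivity
      have hw10 : 0 < w1 := by positivity
      set r1 : ℝ := 2 ^ (-(d * (1 / p))) with hr1
      set r2 : ℝ := 2 ^ (-(d * min (1 / 2 - 1 / p) (1 / p))) with hr2
      have hr10 : 0 < r1 := by positivity
      have hr20 : 0 < r2 := by positivity
      set B := (1 + 2 * (d / p)) ^ γ * (u ^ (1 / p) * (1 - Real.log s) ^ (-γ)) with hB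
      have hB0 : 0 ≤ B := by positivity
      have hterm : ∀ k : ℕ, ENNReal.ofReal ((1 + (k : ℝ)) ^ (-γ) *
          2 ^ (-(k * (d * (1 / 2 - 1 / p))))) *
          min (m s) (ENNReal.ofReal (V * 2 ^ (k * (d : ℝ)))) ^ (1 / 2 : ℝ) ≤
          ENNReal.ofReal (V ^ (1 / 2 : ℝ)) *
          (ENNReal.ofReal w1 * ENNReal.ofReal (min (w1 * r1 ^ k) (w1 * r1 ^ k)⁻¹) +
          ENNReal.ofReal B * ENNReal.ofReal (min (w2 * r2 ^ k) (w2 * r2 ^ k)⁻¹)) := by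
        intro k
        have h := annular_term_le hn hp hγ hV hu0 hs k
        have e1 : 0 ≤ min (w1 * r1 ^ k) (w1 * r1 ^ k)⁻¹ := le_min (by positivity) (by positivity)
        have e2 : 0 ≤ min (w2 * r2 ^ k) (w2 * r2 ^ k)⁻¹ := le_min (by positivity) (by positivity)
        have e3 : 0 < min u (V * 2 ^ (k * (d : ℝ))) := lt_min hu0 (by positivity)
        rw [← ENNReal.ofReal_mul hw10.le, ← ENNReal.ofReal_mul hB0,
          ← ENNReal.ofReal_add (by positivity) (by positivity),
          ← ENNReal.ofReal_mul (by positivity), hmu, ← ENNReal.ofReal_min,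
          ENNReal.ofReal_rpow_of_pos e3, ← ENNReal.ofReal_mul (by positivity)]
        exact ENNReal.ofReal_le_ofReal h
      calc Ψ s ≤ ∑' k : ℕ, ENNReal.ofReal (V ^ (1 / 2 : ℝ)) *
          (ENNReal.ofReal w1 * ENNReal.ofReal (min (w1 * r1 ^ k) (w1 * r1 ^ k)⁻¹) +
          ENNReal.ofReal B * ENNReal.ofReal (min (w2 * r2 ^ k) (w2 * r2 ^ k)⁻¹)) :=
            ENNReal.tsum_le_tsum hterm
        _ = ENNReal.ofReal (V ^ (1 / 2 : ℝ)) * (ENNReal.ofReal w1 *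
            ∑' k : ℕ, ENNReal.ofReal (min (w1 * r1 ^ k) (w1 * r1 ^ k)⁻¹) + ENNReal.ofReal B *
            ∑' k : ℕ, ENNReal.ofReal (min (w2 * r2 ^ k) (w2 * r2 ^ k)⁻¹)) := by
            rw [ENNReal.tsum_mul_left, ENNReal.tsum_add, ENNReal.tsum_mul_left,
              ENNReal.tsum_mul_left]
        _ ≤ ENNReal.ofReal (V ^ (1 / 2 : ℝ)) * (ENNReal.ofReal w1 * ENNReal.ofReal S1 +
            ENNReal.ofReal B * ENNReal.ofReal S2) := by
            refine mul_le_mul_right (add_le_add (mul_le_mul_right ?_ _) (mul_le_mul_right ?_ _)) _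
            · exact tsum_min_geometric_le hr10 (hlt _ hb) hw10
            · exact tsum_min_geometric_le hr20 (hlt _ (lt_min ha hb)) hw20
        _ = _ := by
            rw [hB, ENNReal.ofReal_mul (by positivity), ENNReal.ofReal_mul (by positivity), hmu,
              ENNReal.ofReal_rpow_of_pos hu0]
            ring
    refine (setLIntegral_mono' measurableSet_Ioo hbound).trans_lt ?_
    rw [lintegral_const_mul' _ _ ENNReal.ofReal_ne_top]
    refine ENNReal.mul_lt_top ENNReal.ofReal_lt_top ?_
    rw [lintegral_add_left (by fun_prop), lintegral_const_mul' _ _ ENNReal.ofReal_ne_top,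
      lintegral_const_mul' _ _ (ENNReal.mul_ne_top ENNReal.ofReal_ne_top ENNReal.ofReal_ne_top)]
    exact ENNReal.add_lt_top.2 ⟨ENNReal.mul_lt_top ENNReal.ofReal_lt_top
      lintegral_Ioo_rpow_neg_half_lt_top, ENNReal.mul_lt_top
      (ENNReal.mul_lt_top ENNReal.ofReal_lt_top ENNReal.ofReal_lt_top)
      (hf.lintegral_mul_log_lt_top hp0 hqγ)⟩
  · set r : ℝ := 2 ^ (-(d * (1 / 2 - 1 / p))) with hr
    have hbound : ∀ s ∈ Ici (1 : ℝ), Ψ s ≤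
        (∑' k : ℕ, ENNReal.ofReal (r ^ k)) * m s ^ (1 / 2 : ℝ) := by
      intro s _
      rw [← ENNReal.tsum_mul_right]
      refine ENNReal.tsum_le_tsum fun k => mul_le_mul' (ENNReal.ofReal_le_ofReal ?_)
        (ENNReal.rpow_le_rpow (min_le_left _ _) (by norm_num))
      have e1 : (1 + (k : ℝ)) ^ (-γ) ≤ 1 :=
        Real.rpow_le_one_of_one_le_of_nonpos (by linarith [(Nat.cast_nonneg k : (0 : ℝ) ≤ k)])
          (by linarith)
      rw [hr, ← two_rpow_mul_eq_pow, mul_neg]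
      exact mul_le_of_le_one_left (by positivity) e1
    refine (setLIntegral_mono' measurableSet_Ici hbound).trans_lt ?_
    have hne := tsum_ofReal_geometric_ne_top (r := r) (by positivity) (hlt _ ha)
    rw [lintegral_const_mul' _ _ hne]
    exact ENNReal.mul_lt_top hne.lt_top (hf.lintegral_Ici_sqrt_lt_top hp hq)

/-- The summability over dyadic annuli for which the hypothesis on `q, γ` is needed: the `L²` norm
over each annulus is bounded by the integral of the square root of the distribution function. -/
theorem MemLorentz.tsum_annuli_lt_top (hd : 1 ≤ d) (hp : 2 < p)
    (hqγ : (1 < q ∧ 1 - (1 / q).toReal < γ) ∨ (q = 1 ∧ 0 ≤ γ)) (hq : 1 ≤ q) (hγ : 0 ≤ γ)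
    (hf : MemLorentz f p q volume) :
    ∑' k : ℕ, ENNReal.ofReal ((1 + (k : ℝ)) ^ (-γ) * 2 ^ (-(k * (d * (1 / 2 - 1 / p))))) *
      (∫⁻ y in annulus d k, ‖f y‖ₑ ^ 2) ^ (1 / 2 : ℝ) < ⊤ := by
  obtain ⟨V, hV, hvol⟩ := exists_volume_annulus_le hd
  have hfin := hf.lintegral_sum_min_lt_top hd hp hqγ hq hγ hV
  have hanti := antitone_measure_lt_norm volume f
  rw [lintegral_tsum] at hfin
  swap
  · intro k
    exact ((hanti.measurable.min measurable_const).pow_const _).const_mul _ |>.aemeasurable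
  have key : ∀ k : ℕ, (∫⁻ y in annulus d k, ‖f y‖ₑ ^ 2) ^ (1 / 2 : ℝ) ≤ (2 : ℝ≥0∞) ^ (1 / 2 : ℝ) *
      ∫⁻ s in Ioi (0 : ℝ), min (volume {x | s < ‖f x‖})
        (ENNReal.ofReal (V * 2 ^ (k * (d : ℝ)))) ^ (1 / 2 : ℝ) := by
    intro k
    have h := lintegral_enorm_sq_le_distribution (μ := volume.restrict (annulus d k)) hf.1.restrict
    calc _ ≤ (2 * (∫⁻ s in Ioi (0 : ℝ),
          volume.restrict (annulus d k) {x | s < ‖f x‖} ^ (1 / 2 : ℝ)) ^ 2) ^ (1 / 2 : ℝ) :=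
          ENNReal.rpow_le_rpow h (by norm_num)
      _ = 2 ^ (1 / 2 : ℝ) * ∫⁻ s in Ioi (0 : ℝ),
          volume.restrict (annulus d k) {x | s < ‖f x‖} ^ (1 / 2 : ℝ) := by
          rw [ENNReal.mul_rpow_of_nonneg _ _ (by norm_num), ← ENNReal.rpow_two, ← ENNReal.rpow_mul]
          norm_num
      _ ≤ _ := by
          refine mul_le_mul_right (lintegral_mono fun s => ENNReal.rpow_le_rpow
            (le_min (Measure.restrict_apply_le _ _) ?_) (by norm_num)) _
          calc _ ≤ volume.restrict (annulus d k) univ := measure_mono (subset_univ _)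
            _ = volume (annulus d k) := Measure.restrict_apply_univ _
            _ ≤ _ := hvol k
  refine lt_of_le_of_lt (ENNReal.tsum_le_tsum fun k => mul_le_mul_right (key k) _) ?_
  simp_rw [mul_left_comm _ ((2 : ℝ≥0∞) ^ (1 / 2 : ℝ))]
  rw [ENNReal.tsum_mul_left]
  refine ENNReal.mul_lt_top (ENNReal.rpow_lt_top_of_nonneg (by norm_num) (by simp)) ?_
  refine lt_of_le_of_lt (ENNReal.tsum_le_tsum fun k => le_of_eq ?_) hfin
  rw [lintegral_const_mul' _ _ ENNReal.ofReal_ne_top]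

theorem MemLorentz.lintegral_sq_lt_top (hp : 2 < p) (hq : 1 ≤ q) (hf : MemLorentz f p q volume)
    {A : Set (EuclideanSpace ℝ (Fin d))} (hA : volume A ≠ ⊤) : ∫⁻ y in A, ‖f y‖ₑ ^ 2 < ⊤ := by
  refine (lintegral_enorm_sq_le_distribution hf.1.restrict).trans_lt
    (ENNReal.mul_lt_top (by simp) (ENNReal.pow_lt_top ?_))
  have hcover : Ioi (0 : ℝ) ⊆ Ioo 0 1 ∪ Ici 1 := by
    intro s hs
    rcases lt_or_ge s 1 with h | h
    · exact Or.inl ⟨hs, h⟩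
    · exact Or.inr h
  refine (lintegral_mono_set hcover).trans_lt ((lintegral_union_le _ _ _).trans_lt
    (ENNReal.add_lt_top.2 ⟨?_, ?_⟩))
  · calc _ ≤ ∫⁻ _ in Ioo (0 : ℝ) 1, volume A ^ (1 / 2 : ℝ) := by
          refine lintegral_mono fun s => ENNReal.rpow_le_rpow ?_ (by norm_num)
          calc _ ≤ volume.restrict A univ := measure_mono (subset_univ _)
            _ = volume A := Measure.restrict_apply_univ _
      _ < ⊤ := by
          rw [setLIntegral_const, Real.volume_Ioo]
          exact ENNReal.mul_lt_top (ENNReal.rpow_lt_top_of_nonneg (by norm_num) hA) (by simp)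
  · refine lt_of_le_of_lt (lintegral_mono fun s => ENNReal.rpow_le_rpow
      (Measure.restrict_apply_le _ _) (by norm_num)) (hf.lintegral_Ici_sqrt_lt_top hp hq)

end LorentzAnnuli

/-! ### Dilations -/

section Scaling

variable {d : ℕ} {β : ℝ} {ρ : EuclideanSpace ℝ (Fin d) → ℝ}

theorem IsHomogeneousDistance.rieszKernel_scale (hρ : IsHomogeneousDistance β ρ) (hd : 1 ≤ d)
    (lam γ t : ℝ) {s : ℝ} (hs : 0 < s) (x : EuclideanSpace ℝ (Fin d)) :
    rieszKernel ρ lam γ (s ^ β * t) x = (s ^ d : ℝ) * rieszKernel ρ lam γ t (s • x) := by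
  have h := integral_comp_smul_of_pos (fun ξ : EuclideanSpace ℝ (Fin d) =>
    (hlog lam γ (ρ ξ / (s ^ β * t)) : ℂ) * Complex.exp (Complex.I * (inner ℝ x ξ : ℝ))) hs
  have h2 : ∫ ξ : EuclideanSpace ℝ (Fin d), (hlog lam γ (ρ (s • ξ) / (s ^ β * t)) : ℂ) *
      Complex.exp (Complex.I * (inner ℝ x (s • ξ) : ℝ)) =
      ∫ ξ : EuclideanSpace ℝ (Fin d), (hlog lam γ (ρ ξ / t) : ℂ) *
      Complex.exp (Complex.I * (inner ℝ (s • x) ξ : ℝ)) := by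
    refine integral_congr_ae ?_
    filter_upwards [ae_ne_zero hd] with ξ hξ
    rw [hρ.map_smul hs hξ, mul_div_mul_left _ _ (Real.rpow_pos_of_pos hs β).ne',
      inner_smul_right, inner_smul_left]
    simp
  rw [h2] at h
  unfold rieszKernel
  rw [h]
  have : (s : ℂ) ≠ 0 := by exact_mod_cast hs.ne'
  push_cast
  field_simp

theorem IsHomogeneousDistance.rieszMean_scale (hρ : IsHomogeneousDistance β ρ) (hd : 1 ≤ d)
    (lam γ t : ℝ) {s : ℝ} (hs : 0 < s) (F : EuclideanSpace ℝ (Fin d) → ℂ)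
    (x : EuclideanSpace ℝ (Fin d)) :
    rieszMean ρ lam γ (s ^ β * t) F x =
      rieszMean ρ lam γ t (fun z => F (s⁻¹ • z)) (s • x) := by
  have h := integral_comp_smul_of_pos (fun z : EuclideanSpace ℝ (Fin d) =>
    rieszKernel ρ lam γ t (s • x - z) * F (s⁻¹ • z)) hs
  have hsc : (s : ℂ) ≠ 0 := by exact_mod_cast hs.ne'
  have h2 : rieszMean ρ lam γ (s ^ β * t) F x = (s ^ d : ℝ) * ∫ y,
      rieszKernel ρ lam γ t (s • x - s • y) * F (s⁻¹ • s • y) := by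
    rw [← integral_const_mul]
    unfold rieszMean
    congr 1 with y
    rw [hρ.rieszKernel_scale hd lam γ t hs, smul_sub, inv_smul_smul₀ hs.ne', mul_assoc]
  rw [h2, h, ← mul_assoc, rieszMean]
  push_cast
  rw [mul_inv_cancel₀ (pow_ne_zero _ hsc), one_mul]

theorem farWeight_le {lam γ s : ℝ} (hγ : 0 ≤ γ) (hs : 0 < s) {k : ℕ} (hk : 1 ≤ s ^ 2 * 2 ^ k) :
    1 ≤ s * 2 ^ k ∧ farWeight lam γ (s * 2 ^ k) ≤
      4 ^ γ * ((s * 2 ^ k) ^ (-(lam + 1 / 2)) * (1 + (k : ℝ)) ^ (-γ)) := by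
  have h2k : (1 : ℝ) ≤ 2 ^ k := one_le_pow₀ (by norm_num)
  have hD2 : (2 : ℝ) ^ k ≤ (s * 2 ^ k) ^ 2 := by
    calc (2 : ℝ) ^ k = 1 * 2 ^ k := by ring
      _ ≤ (s ^ 2 * 2 ^ k) * 2 ^ k := by gcongr
      _ = _ := by ring
  have hD0 : 0 < s * 2 ^ k := by positivity
  have hD : 1 ≤ s * 2 ^ k := by nlinarith
  refine ⟨hD, ?_⟩
  have hlog : (k : ℝ) * Real.log 2 ≤ 2 * Real.log (s * 2 ^ k) := by
    have := Real.log_le_log (by positivity) hD2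
    rw [Real.log_pow, Real.log_pow] at this
    exact_mod_cast this
  have hk0 : (0 : ℝ) ≤ k := Nat.cast_nonneg k
  have h1 : (1 + (k : ℝ)) / 4 ≤ 1 + Real.log (s * 2 ^ k) := by
    have := Real.log_two_gt_d9
    nlinarith
  have h2 : (1 + Real.log (s * 2 ^ k)) ^ (-γ) ≤ 4 ^ γ * (1 + (k : ℝ)) ^ (-γ) := by
    calc (1 + Real.log (s * 2 ^ k)) ^ (-γ) ≤ ((1 + (k : ℝ)) / 4) ^ (-γ) :=
          Real.rpow_le_rpow_of_nonpos (by positivity) h1 (by linarith)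
      _ = _ := by
          rw [Real.div_rpow (by positivity) (by norm_num),
            Real.rpow_neg (show (0 : ℝ) ≤ 4 by norm_num) γ, div_inv_eq_mul, mul_comm]
  rw [farWeight]
  calc _ ≤ (s * 2 ^ k) ^ (-(lam + 1 / 2)) * (4 ^ γ * (1 + (k : ℝ)) ^ (-γ)) := by gcongr
    _ = _ := by ring

theorem lintegral_ball_comp_smul {h : EuclideanSpace ℝ (Fin d) → ℝ≥0∞} {s R : ℝ} (hs : 0 < s) :
    ∫⁻ x in Metric.ball 0 R, h (s • x) =
      ENNReal.ofReal (s ^ d)⁻¹ * ∫⁻ x in Metric.ball 0 (s * R), h x := by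
  have := lintegral_comp_smul volume ((Metric.ball 0 (s * R)).indicator h) hs
  rw [lintegral_indicator Metric.isOpen_ball.measurableSet, finrank_euclideanSpace_fin] at this
  rw [← this, ← lintegral_indicator Metric.isOpen_ball.measurableSet]
  congr 1 with x
  have : s • x ∈ Metric.ball (0 : EuclideanSpace ℝ (Fin d)) (s * R) ↔
      x ∈ Metric.ball (0 : EuclideanSpace ℝ (Fin d)) R := by
    simp [norm_smul, abs_of_pos hs, mul_lt_mul_iff_right₀ hs]
  by_cases hx : x ∈ Metric.ball (0 : EuclideanSpace ℝ (Fin d)) R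
  · rw [indicator_of_mem hx, indicator_of_mem (this.2 hx)]
  · rw [indicator_of_notMem hx, indicator_of_notMem (this.not.2 hx)]

/-- Rescaled form of the bounds for functions supported in `|y| ≥ 2^k`. -/
theorem IsHomogeneousDistance.exists_far_bound (hρ : IsHomogeneousDistance β ρ) (hd : 1 ≤ d)
    {lam γ : ℝ} (hlam : 0 < lam) (hγ : 0 ≤ γ) : ∃ C > 0, ∀ s : ℝ, 0 < s → ∀ k : ℕ,
      1 ≤ s ^ 2 * 2 ^ k → ∀ F : EuclideanSpace ℝ (Fin d) → ℂ, Integrable F →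
      (∀ y, ‖y‖ < 2 ^ k → F y = 0) →
      ∃ Q : EuclideanSpace ℝ (Fin d) → ℝ≥0∞, Measurable Q ∧
        (∀ t ∈ Icc (1 : ℝ) 2, ∀ x, ‖x‖ ≤ 2 ^ k / 2 → ‖rieszMean ρ lam γ (s ^ β * t) F x‖ₑ ≤
          ENNReal.ofReal (C * ((2 ^ k) ^ d)⁻¹) * (∫⁻ y, ‖F y‖ₑ) + Q x) ∧
        (∀ x, Q x ^ 2 ≤ ENNReal.ofReal (C * s ^ d *
          ((s * 2 ^ k) ^ (-(lam + 1 / 2)) * (1 + (k : ℝ)) ^ (-γ)) ^ 2) * ∫⁻ y, ‖F y‖ₑ ^ 2) ∧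
        ∀ R : ℝ, 1 ≤ s * R → ∫⁻ x in Metric.ball 0 R, Q x ^ 2 ≤
          ENNReal.ofReal (C * (s * R) *
          ((s * 2 ^ k) ^ (-(lam + 1 / 2)) * (1 + (k : ℝ)) ^ (-γ)) ^ 2) * ∫⁻ y, ‖F y‖ₑ ^ 2 := by
  obtain ⟨C, hC, h⟩ := hρ.exists_far_unit_bound hd hlam hγ
  have h4 : (1 : ℝ) ≤ 4 ^ γ := Real.one_le_rpow (by norm_num) hγ
  refine ⟨C * (4 ^ γ) ^ 2, by positivity, fun s hs k hk F hF hsupp => ?_⟩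
  obtain ⟨hD, hfar⟩ := farWeight_le (lam := lam) hγ hs hk
  have hfar0 : 0 ≤ farWeight lam γ (s * 2 ^ k) :=
    mul_nonneg (by positivity) (Real.rpow_nonneg (by linarith [Real.log_nonneg hD]) _)
  set W := (s * 2 ^ k) ^ (-(lam + 1 / 2)) * (1 + (k : ℝ)) ^ (-γ) with hW
  have hfar2 : farWeight lam γ (s * 2 ^ k) ^ 2 ≤ (4 ^ γ) ^ 2 * W ^ 2 := by
    rw [← mul_pow]
    exact pow_le_pow_left₀ hfar0 hfar 2
  have hint : ∀ g : EuclideanSpace ℝ (Fin d) → ℝ≥0∞, ∫⁻ z, g (s⁻¹ • z) =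
      ENNReal.ofReal (s ^ d) * ∫⁻ y, g y := by
    intro g
    rw [lintegral_comp_smul volume g (inv_pos.2 hs), finrank_euclideanSpace_fin, inv_pow, inv_inv]
  have hC1 : C ≤ C * (4 ^ γ) ^ 2 := le_mul_of_one_le_right hC.le (one_le_pow₀ h4)
  have hss : ENNReal.ofReal (s ^ d)⁻¹ * ENNReal.ofReal (s ^ d) = 1 := by
    rw [← ENNReal.ofReal_mul (by positivity), inv_mul_cancel₀ (by positivity), ENNReal.ofReal_one]
  obtain ⟨Q, hQm, hQ1, hQ2, hQ3⟩ := h (s * 2 ^ k) hD (fun z => F (s⁻¹ • z))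
    (hF.comp_smul (inv_ne_zero hs.ne')) (fun z hz => hsupp _ (by
      rw [norm_smul, norm_inv, Real.norm_of_nonneg hs.le, inv_mul_lt_iff₀ hs]
      exact hz))
  refine ⟨fun x => Q (s • x), hQm.comp (measurable_const_smul s), fun t ht x hx => ?_, fun x => ?_,
    fun R hR => ?_⟩
  · rw [hρ.rieszMean_scale hd lam γ t hs]
    have hx' : ‖s • x‖ ≤ s * 2 ^ k / 2 := by
      rw [norm_smul, Real.norm_of_nonneg hs.le, mul_div_assoc]
      gcongr
    refine (hQ1 t ht _ hx').trans (add_le_add ?_ le_rfl)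
    rw [hint fun y => ‖F y‖ₑ, ← mul_assoc, ← ENNReal.ofReal_mul (by positivity)]
    refine mul_le_mul_left (ENNReal.ofReal_le_ofReal ?_) _
    calc C * ((s * 2 ^ k) ^ d)⁻¹ * s ^ d = C * ((2 ^ k) ^ d)⁻¹ := by
          rw [mul_pow]; field_simp
      _ ≤ _ := by gcongr
  · refine (hQ2 (s • x)).trans ?_
    rw [hint fun y => ‖F y‖ₑ ^ 2, ← mul_assoc, ← ENNReal.ofReal_mul (by positivity)]
    refine mul_le_mul_left (ENNReal.ofReal_le_ofReal ?_) _
    calc C * farWeight lam γ (s * 2 ^ k) ^ 2 * s ^ d ≤ C * ((4 ^ γ) ^ 2 * W ^ 2) * s ^ d := by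
          gcongr
      _ = _ := by ring
  · rw [lintegral_ball_comp_smul (h := fun x => Q x ^ 2) hs]
    refine (mul_le_mul_right (hQ3 (s * R) hR) _).trans ?_
    rw [hint fun y => ‖F y‖ₑ ^ 2]
    calc _ = (ENNReal.ofReal (s ^ d)⁻¹ * ENNReal.ofReal (s ^ d)) *
          (ENNReal.ofReal (C * (s * R) * farWeight lam γ (s * 2 ^ k) ^ 2) *
            ∫⁻ y, ‖F y‖ₑ ^ 2) := by ring
      _ ≤ _ := by
          rw [hss, one_mul]
          refine mul_le_mul_left (ENNReal.ofReal_le_ofReal ?_) _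
          calc C * (s * R) * farWeight lam γ (s * 2 ^ k) ^ 2 ≤
                C * (s * R) * ((4 ^ γ) ^ 2 * W ^ 2) := by gcongr
            _ = _ := by ring

end Scaling

/-! ### Dyadic pieces of functions in the critical Lorentz class -/

theorem ENNReal.le_rpow_half_of_sq_le {a b : ℝ≥0∞} (h : a ^ 2 ≤ b) : a ≤ b ^ (1 / 2 : ℝ) := by
  calc a = (a ^ 2) ^ (1 / 2 : ℝ) := by
        rw [← ENNReal.rpow_two, ← ENNReal.rpow_mul]; norm_num
    _ ≤ _ := ENNReal.rpow_le_rpow h (by norm_num)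

theorem ENNReal.le_of_sq_le_ofReal_mul {a M : ℝ≥0∞} {A S : ℝ} (hA : 0 ≤ A) (hS : 0 ≤ S)
    (h : a ^ 2 ≤ ENNReal.ofReal (A * S ^ 2) * M) :
    a ≤ ENNReal.ofReal (A ^ (1 / 2 : ℝ) * S) * M ^ (1 / 2 : ℝ) := by
  refine (ENNReal.le_rpow_half_of_sq_le h).trans (le_of_eq ?_)
  rw [ENNReal.mul_rpow_of_nonneg _ _ (by norm_num),
    ENNReal.ofReal_rpow_of_nonneg (by positivity) (by norm_num),
    Real.mul_rpow hA (by positivity), ← Real.rpow_natCast, ← Real.rpow_mul hS]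
  norm_num

theorem exists_rpow_le_mul_exp {γ b : ℝ} (hγ : 0 ≤ γ) (hb : 0 < b) :
    ∃ C > 0, ∀ x : ℝ, 1 ≤ x → x ^ γ ≤ C * Real.exp (b * x) := by
  refine ⟨(4 * b) ^ (-(γ + 1)) * (4 * (γ + 1)) ^ (γ + 1), by positivity, fun x hx => ?_⟩
  have h := rpow_le_mul_exp_quarter (x := 4 * b * x) (N := γ + 1) (by positivity) (by positivity)
  rw [Real.mul_rpow (by positivity) (by linarith)] at h
  have h0 : 0 < (4 * b) ^ (γ + 1) := by positivity
  calc x ^ γ ≤ x ^ (γ + 1) := Real.rpow_le_rpow_of_exponent_le hx (by linarith)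
    _ = (4 * b) ^ (-(γ + 1)) * ((4 * b) ^ (γ + 1) * x ^ (γ + 1)) := by
        rw [Real.rpow_neg (by positivity)]; field_simp
    _ ≤ (4 * b) ^ (-(γ + 1)) * ((4 * (γ + 1)) ^ (γ + 1) * Real.exp (4 * b * x / 4)) := by gcongr
    _ = _ := by
        rw [← mul_assoc, show 4 * b * x / 4 = b * x by ring]

/-- The weight `(1+k)^{-γ} 2^{-kd(1/2-1/p)}` of the annulus `2^k ≤ |y| < 2^{k+1}`; functions in the
Lorentz space of the theorem are summable against it in the sense of
`MemLorentz.tsum_annuli_lt_top`. -/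
noncomputable def annulusWeight (d : ℕ) (p γ : ℝ) (k : ℕ) : ℝ :=
  (1 + (k : ℝ)) ^ (-γ) * 2 ^ (-(k * (d * (1 / 2 - 1 / p))))

section Annuli

variable {d : ℕ} {p γ : ℝ}

theorem annulusWeight_pos (d : ℕ) (p γ : ℝ) (k : ℕ) : 0 < annulusWeight d p γ k := by
  unfold annulusWeight; positivity

theorem setLIntegral_le_sqrt_mul_sqrt {X : Type*} [MeasurableSpace X] {μ : Measure X} {A : Set X}
    {g : X → ℝ≥0∞} (hg : AEMeasurable g μ) :
    ∫⁻ y in A, g y ∂μ ≤ (∫⁻ y in A, g y ^ 2 ∂μ) ^ (1 / 2 : ℝ) * μ A ^ (1 / 2 : ℝ) := by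
  rw [← ENNReal.mul_rpow_of_nonneg _ _ (by norm_num)]
  refine ENNReal.le_rpow_half_of_sq_le ?_
  have := lintegral_mul_sq_le (μ := μ.restrict A) (f := g) (g := fun _ => 1) hg.restrict
    aemeasurable_const
  simpa using this

theorem lintegral_eq_setLIntegral_of_eq_zero {X : Type*} [MeasurableSpace X] {μ : Measure X}
    {A : Set X} (hA : MeasurableSet A) {g : X → ℝ≥0∞} (h : ∀ y, y ∉ A → g y = 0) :
    ∫⁻ y, g y ∂μ = ∫⁻ y in A, g y ∂μ := by
  rw [← lintegral_indicator hA]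
  congr 1 with y
  by_cases hy : y ∈ A
  · rw [indicator_of_mem hy]
  · rw [indicator_of_notMem hy, h y hy]

theorem exists_annulus_average_le (hd : 1 ≤ d) (hp : 2 < p) (hγ : 0 ≤ γ) :
    ∃ C > 0, ∀ k : ℕ, ∀ F : EuclideanSpace ℝ (Fin d) → ℂ, AEStronglyMeasurable F →
      (∀ y, y ∉ annulus d k → F y = 0) →
      ENNReal.ofReal ((2 ^ k) ^ d)⁻¹ * ∫⁻ y, ‖F y‖ₑ ≤
        ENNReal.ofReal (C * annulusWeight d p γ k) * (∫⁻ y, ‖F y‖ₑ ^ 2) ^ (1 / 2 : ℝ) := by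
  obtain ⟨V, hV, hvol⟩ := exists_volume_annulus_le hd
  have hn : (0 : ℝ) < d := by exact_mod_cast hd
  have hb : 0 < d / p * Real.log 2 := by
    have := Real.log_pos one_lt_two
    positivity
  obtain ⟨C, hC, hCb⟩ := exists_rpow_le_mul_exp hγ hb
  set D := V ^ (1 / 2 : ℝ) * (C * Real.exp (d / p * Real.log 2)) with hD
  refine ⟨D, by positivity, fun k F hF hsupp => ?_⟩
  have hA := measurableSet_annulus d k
  rw [lintegral_eq_setLIntegral_of_eq_zero hA (g := fun y => ‖F y‖ₑ) fun y hy => by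
      simp [hsupp y hy],
    lintegral_eq_setLIntegral_of_eq_zero hA (g := fun y => ‖F y‖ₑ ^ 2) fun y hy => by
      simp [hsupp y hy]]
  have h1 : volume (annulus d k) ^ (1 / 2 : ℝ) ≤
      ENNReal.ofReal (V ^ (1 / 2 : ℝ) * 2 ^ (k * (d : ℝ) / 2)) := by
    refine (ENNReal.rpow_le_rpow (hvol k) (by norm_num)).trans (le_of_eq ?_)
    rw [ENNReal.ofReal_rpow_of_nonneg (by positivity) (by norm_num),
      Real.mul_rpow (by positivity) (by positivity), ← Real.rpow_mul (by norm_num)]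
    congr 3
    ring
  have hk : (1 + (k : ℝ)) ^ γ ≤ C * Real.exp (d / p * Real.log 2) * 2 ^ (k * (d / p)) := by
    refine (hCb (1 + k) (by simp)).trans (le_of_eq ?_)
    rw [Real.rpow_def_of_pos two_pos, mul_assoc C, ← Real.exp_add]
    congr 2
    ring
  have hreal : ((2 : ℝ) ^ k) ^ d = 2 ^ (k * (d : ℝ)) := by
    rw [Real.rpow_mul (by norm_num), Real.rpow_natCast, Real.rpow_natCast]
  refine (mul_le_mul_right ((setLIntegral_le_sqrt_mul_sqrt hF.enorm).trans
    (mul_le_mul_right h1 _)) _).trans ?_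
  rw [mul_left_comm, ← ENNReal.ofReal_mul (by positivity), mul_comm]
  refine mul_le_mul_left (ENNReal.ofReal_le_ofReal ?_) _
  have hkp : (0 : ℝ) < 1 + k := by positivity
  rw [annulusWeight, hreal, Real.rpow_neg hkp.le]
  have e1 : (2 : ℝ) ^ (-(k * (d * (1 / 2 - 1 / p)))) =
      (2 ^ (k * (d : ℝ)))⁻¹ * 2 ^ (k * (d : ℝ) / 2) * 2 ^ (k * (d / p)) := by
    rw [← Real.rpow_neg (by norm_num), ← Real.rpow_add two_pos, ← Real.rpow_add two_pos]
    congr 1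
    field_simp
    ring
  rw [e1, hD]
  have h0 : (0 : ℝ) < (1 + k) ^ γ := by positivity
  calc _ = V ^ (1 / 2 : ℝ) * ((1 + (k : ℝ)) ^ γ * ((1 + (k : ℝ)) ^ γ)⁻¹) *
        ((2 ^ (k * (d : ℝ)))⁻¹ * 2 ^ (k * (d : ℝ) / 2)) := by
        rw [mul_inv_cancel₀ h0.ne']; ring
    _ ≤ V ^ (1 / 2 : ℝ) * ((C * Real.exp (d / p * Real.log 2) * 2 ^ (k * (d / p))) *
        ((1 + (k : ℝ)) ^ γ)⁻¹) * ((2 ^ (k * (d : ℝ)))⁻¹ * 2 ^ (k * (d : ℝ) / 2)) := by gcongr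
    _ = _ := by ring

/-- The bounds for a function living on one dyadic annulus, with constants that match the
summability of `MemLorentz.tsum_annuli_lt_top`. -/
theorem IsHomogeneousDistance.exists_annulus_bound {β : ℝ} {ρ : EuclideanSpace ℝ (Fin d) → ℝ}
    (hρ : IsHomogeneousDistance β ρ) (hd : 1 ≤ d) (hp : 2 < p) {lam : ℝ}
    (hcrit : lam + 1 / 2 = d * (1 / 2 - 1 / p)) (hlam : 0 < lam) (hγ : 0 ≤ γ) :
    ∃ C > 0, ∀ s : ℝ, 0 < s → ∀ k : ℕ, 1 ≤ s ^ 2 * 2 ^ k →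
      ∀ F : EuclideanSpace ℝ (Fin d) → ℂ, AEStronglyMeasurable F →
      (∀ y, y ∉ annulus d k → F y = 0) → ∫⁻ y, ‖F y‖ₑ ^ 2 ≠ ⊤ → Integrable F ∧
      ∃ Q : EuclideanSpace ℝ (Fin d) → ℝ≥0∞, Measurable Q ∧
        (∀ t ∈ Icc (1 : ℝ) 2, ∀ x, ‖x‖ ≤ 2 ^ k / 2 → ‖rieszMean ρ lam γ (s ^ β * t) F x‖ₑ ≤
          ENNReal.ofReal (C * annulusWeight d p γ k) * (∫⁻ y, ‖F y‖ₑ ^ 2) ^ (1 / 2 : ℝ) + Q x) ∧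
        (∀ x, Q x ≤ ENNReal.ofReal ((C * s ^ d) ^ (1 / 2 : ℝ) * s ^ (-(lam + 1 / 2))) *
          (ENNReal.ofReal (annulusWeight d p γ k) * (∫⁻ y, ‖F y‖ₑ ^ 2) ^ (1 / 2 : ℝ))) ∧
        ∀ R : ℝ, 1 ≤ s * R → ∫⁻ x in Metric.ball 0 R, Q x ≤
          ENNReal.ofReal ((C * (s * R)) ^ (1 / 2 : ℝ) * s ^ (-(lam + 1 / 2))) *
            volume (Metric.ball (0 : EuclideanSpace ℝ (Fin d)) R) ^ (1 / 2 : ℝ) *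
          (ENNReal.ofReal (annulusWeight d p γ k) * (∫⁻ y, ‖F y‖ₑ ^ 2) ^ (1 / 2 : ℝ)) := by
  obtain ⟨C₁, hC₁, h₁⟩ := hρ.exists_far_bound hd hlam hγ
  obtain ⟨C₂, hC₂, h₂⟩ := exists_annulus_average_le hd hp hγ
  refine ⟨C₁ + C₁ * C₂, by positivity, fun s hs k hk F hF hsupp hF2 => ?_⟩
  have hC₁C : C₁ ≤ C₁ + C₁ * C₂ := le_add_of_nonneg_right (by positivity)
  have hw := annulusWeight_pos d p γ k
  have hint : Integrable F := by
    refine ⟨hF, ?_⟩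
    rw [HasFiniteIntegral]
    have h := (h₂ k F hF hsupp).trans_lt (ENNReal.mul_lt_top ENNReal.ofReal_lt_top
      (ENNReal.rpow_lt_top_of_nonneg (by norm_num) hF2))
    exact ENNReal.lt_top_of_mul_ne_top_right h.ne
      (ENNReal.ofReal_pos.2 (by positivity)).ne'
  refine ⟨hint, ?_⟩
  obtain ⟨Q, hQm, hQ1, hQ2, hQ3⟩ := h₁ s hs k hk F hint fun y hy => hsupp y fun h =>
    not_lt_of_ge h.1 hy
  have hW : (s * 2 ^ k) ^ (-(lam + 1 / 2)) * (1 + (k : ℝ)) ^ (-γ) =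
      s ^ (-(lam + 1 / 2)) * annulusWeight d p γ k := by
    rw [annulusWeight, Real.mul_rpow hs.le (by positivity), hcrit, ← Real.rpow_natCast 2 k,
      ← Real.rpow_mul (by norm_num), mul_neg]
    ring
  have hS : 0 ≤ s ^ (-(lam + 1 / 2)) * annulusWeight d p γ k := by positivity
  rw [hW] at hQ2 hQ3
  refine ⟨Q, hQm, fun t ht x hx => (hQ1 t ht x hx).trans (add_le_add ?_ le_rfl), fun x => ?_,
    fun R hR => ?_⟩
  · rw [ENNReal.ofReal_mul hC₁.le, mul_assoc]
    refine (mul_le_mul_right (h₂ k F hF hsupp) _).trans ?_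
    rw [← mul_assoc, ← ENNReal.ofReal_mul hC₁.le, ← mul_assoc]
    gcongr
    linarith
  · refine (ENNReal.le_of_sq_le_ofReal_mul (by positivity) hS (hQ2 x)).trans ?_
    rw [← mul_assoc, ← mul_assoc, ENNReal.ofReal_mul (p := _ * _) (by positivity)]
    gcongr
  · refine (setLIntegral_le_sqrt_mul_sqrt hQm.aemeasurable).trans ?_
    have hR0 : 0 ≤ s * R := by linarith
    calc _ ≤ ENNReal.ofReal ((C₁ * (s * R)) ^ (1 / 2 : ℝ) *
          (s ^ (-(lam + 1 / 2)) * annulusWeight d p γ k)) * (∫⁻ y, ‖F y‖ₑ ^ 2) ^ (1 / 2 : ℝ) *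
          volume (Metric.ball (0 : EuclideanSpace ℝ (Fin d)) R) ^ (1 / 2 : ℝ) := by
          refine mul_le_mul_left (ENNReal.le_of_sq_le_ofReal_mul (by positivity) hS ?_) _
          refine le_trans (le_of_eq ?_) (hQ3 R hR)
          rw [← ENNReal.rpow_two, ← ENNReal.rpow_mul]
          norm_num
      _ ≤ ENNReal.ofReal (((C₁ + C₁ * C₂) * (s * R)) ^ (1 / 2 : ℝ) *
          (s ^ (-(lam + 1 / 2)) * annulusWeight d p γ k)) * (∫⁻ y, ‖F y‖ₑ ^ 2) ^ (1 / 2 : ℝ) *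
          volume (Metric.ball (0 : EuclideanSpace ℝ (Fin d)) R) ^ (1 / 2 : ℝ) := by gcongr
      _ = _ := by
          rw [← mul_assoc (_ ^ (1 / 2 : ℝ)), ENNReal.ofReal_mul (p := _ * _) (by positivity)]
          ring

end Annuli

/-! ### Contribution of the far part -/

section FarSum

variable {d : ℕ} {β : ℝ} {ρ : EuclideanSpace ℝ (Fin d) → ℝ} {p γ lam : ℝ}
  {f : EuclideanSpace ℝ (Fin d) → ℂ}

theorem disjoint_annulus {j k : ℕ} (h : j ≠ k) : Disjoint (annulus d j) (annulus d k) := by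
  rw [Set.disjoint_left]
  rintro y ⟨h1, h2⟩ ⟨h3, h4⟩
  rcases lt_or_gt_of_ne h with h | h
  · exact absurd (h2.trans_le ((pow_le_pow_right₀ one_le_two h).trans h3)) (lt_irrefl _)
  · exact absurd (h4.trans_le ((pow_le_pow_right₀ one_le_two h).trans h1)) (lt_irrefl _)

theorem iUnion_annulus (d k₀ : ℕ) : ⋃ k, annulus d (k + k₀) = {y | 2 ^ k₀ ≤ ‖y‖} := by
  ext y
  simp only [mem_iUnion, mem_ofPred_eq]
  constructor
  · rintro ⟨k, hk⟩
    exact (pow_le_pow_right₀ one_le_two (Nat.le_add_left _ _)).trans hk.1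
  · intro h
    have h1 : (1 : ℝ) ≤ ‖y‖ := (one_le_pow₀ one_le_two).trans h
    obtain ⟨n, hn1, hn2⟩ := exists_nat_pow_near h1 one_lt_two
    have : k₀ < n + 1 := (pow_lt_pow_iff_right₀ one_lt_two).1 (h.trans_lt hn2)
    refine ⟨n - k₀, ?_⟩
    rw [Nat.sub_add_cancel (by omega)]
    exact ⟨hn1, hn2⟩

theorem IsHomogeneousDistance.continuous_rieszKernel (hρ : IsHomogeneousDistance β ρ) (hd : 1 ≤ d)
    (hlam : 0 ≤ lam) (hγ : 0 ≤ γ) {t : ℝ} (ht : 0 < t) : Continuous (rieszKernel ρ lam γ t) :=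
  continuous_const.mul
    (continuous_invFT (hρ.integrable_multiplier hd hlam hγ ht).ofReal)

theorem exists_norm_rieszKernel_le (ρ : EuclideanSpace ℝ (Fin d) → ℝ) (lam γ t : ℝ) :
    ∃ C, ∀ x, ‖rieszKernel ρ lam γ t x‖ ≤ C := by
  refine ⟨‖((((2 * Real.pi) ^ d : ℝ)⁻¹ : ℝ) : ℂ)‖ * ∫ ξ, ‖(hlog lam γ (ρ ξ / t) : ℂ)‖, fun x => ?_⟩
  unfold rieszKernel
  rw [norm_mul]
  have h := norm_invFT_le (m := fun ξ => (hlog lam γ (ρ ξ / t) : ℂ)) x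
  exact (mul_le_mul_of_nonneg_left h (norm_nonneg _)).trans_eq (by push_cast; rfl)

theorem IsHomogeneousDistance.integrable_rieszKernel_mul (hρ : IsHomogeneousDistance β ρ)
    (hd : 1 ≤ d) (hlam : 0 ≤ lam) (hγ : 0 ≤ γ) {t : ℝ} (ht : 0 < t)
    {F : EuclideanSpace ℝ (Fin d) → ℂ} (hF : Integrable F) (x : EuclideanSpace ℝ (Fin d)) :
    Integrable fun y => rieszKernel ρ lam γ t (x - y) * F y := by
  obtain ⟨C, hC⟩ := exists_norm_rieszKernel_le ρ lam γ t
  exact hF.bdd_mul ((hρ.continuous_rieszKernel hd hlam hγ ht).comp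
    (continuous_const.sub continuous_id)).aestronglyMeasurable (ae_of_all _ fun y => hC (x - y))

theorem sq_tsum_annuli_ne_top (hsum : ∑' k, ENNReal.ofReal (annulusWeight d p γ k) *
      (∫⁻ y in annulus d k, ‖f y‖ₑ ^ 2) ^ (1 / 2 : ℝ) ≠ ⊤) (k : ℕ) :
    ∫⁻ y in annulus d k, ‖f y‖ₑ ^ 2 ≠ ⊤ := by
  have h := ENNReal.ne_top_of_tsum_ne_top hsum k
  have h2 := ENNReal.lt_top_of_mul_ne_top_right h
    (ENNReal.ofReal_pos.2 (annulusWeight_pos d p γ k)).ne'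
  rw [ENNReal.rpow_lt_top_iff_of_pos (by norm_num)] at h2
  exact h2.ne

/-- Absolute convergence of the convolution on a far annulus, by duality: multiplying `f` by a
unimodular function turns the absolute integral into a Riesz mean. -/
theorem IsHomogeneousDistance.integrableOn_far (hρ : IsHomogeneousDistance β ρ)
    (hd : 1 ≤ d) (hp : 2 < p) (hcrit : lam + 1 / 2 = d * (1 / 2 - 1 / p)) (hlam : 0 < lam)
    (hγ : 0 ≤ γ) (hf : AEStronglyMeasurable f)
    (hsum : ∑' k, ENNReal.ofReal (annulusWeight d p γ k) *
      (∫⁻ y in annulus d k, ‖f y‖ₑ ^ 2) ^ (1 / 2 : ℝ) ≠ ⊤)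
    {t : ℝ} (ht : 0 < t) (x : EuclideanSpace ℝ (Fin d)) {k₀ : ℕ}
    (hk₀ : 1 ≤ (t ^ (1 / β)) ^ 2 * 2 ^ k₀) (hx : ‖x‖ ≤ 2 ^ k₀ / 2) :
    IntegrableOn (fun y => rieszKernel ρ lam γ t (x - y) * f y) {y | 2 ^ k₀ ≤ ‖y‖} := by
  obtain ⟨C, hC, h⟩ := hρ.exists_annulus_bound hd hp hcrit hlam hγ
  set s := t ^ (1 / β) with hs
  have hs0 : 0 < s := by positivity
  have hst : s ^ β * 1 = t := by
    rw [hs, ← Real.rpow_mul ht.le, one_div_mul_cancel hρ.degree_pos.ne', Real.rpow_one, mul_one]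
  set w : EuclideanSpace ℝ (Fin d) → ℂ := fun y => rieszKernel ρ lam γ t (x - y) * f y with hw
  have hKc : Continuous fun y => rieszKernel ρ lam γ t (x - y) :=
    (hρ.continuous_rieszKernel hd hlam.le hγ ht).comp (continuous_const.sub continuous_id)
  have hwm : AEStronglyMeasurable w := hKc.aestronglyMeasurable.mul hf
  refine ⟨hwm.restrict, ?_⟩
  set B := ENNReal.ofReal C +
    ENNReal.ofReal ((C * s ^ d) ^ (1 / 2 : ℝ) * s ^ (-(lam + 1 / 2))) with hB
  have key : ∀ k, k₀ ≤ k → ∫⁻ y in annulus d k, ‖w y‖ₑ ≤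
      B * (ENNReal.ofReal (annulusWeight d p γ k) *
        (∫⁻ y in annulus d k, ‖f y‖ₑ ^ 2) ^ (1 / 2 : ℝ)) := by
    intro k hk
    have hpk : (2 : ℝ) ^ k₀ ≤ 2 ^ k := pow_le_pow_right₀ one_le_two hk
    have hA := measurableSet_annulus d k
    -- The unimodular factor `conj w / |w|` turns `w * F` into `|w f|` on the annulus, so that the
    -- mean of `F` is the integral of `|w f|`; its junk value `0` where `w = 0` is harmless.
    set F : EuclideanSpace ℝ (Fin d) → ℂ :=
      (annulus d k).indicator fun y => starRingEnd ℂ (w y) / (‖w y‖ : ℂ) * f y with hF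
    have hFm : AEStronglyMeasurable F := by
      refine AEStronglyMeasurable.indicator ?_ hA
      have h1 : AEMeasurable w := hwm.aemeasurable
      refine AEStronglyMeasurable.mul (AEMeasurable.aestronglyMeasurable ?_) hf
      exact ((Complex.continuous_conj.measurable.comp_aemeasurable h1).div
        (Complex.measurable_ofReal.comp_aemeasurable h1.norm))
    have hFle : ∀ y, ‖F y‖ₑ ≤ (annulus d k).indicator (fun y => ‖f y‖ₑ) y := by
      intro y
      by_cases hy : y ∈ annulus d k
      · rw [hF, indicator_of_mem hy, indicator_of_mem hy, enorm_mul]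
        refine mul_le_of_le_one_left' ?_
        rw [← ofReal_norm, ENNReal.ofReal_le_one, norm_div, RCLike.norm_conj, Complex.norm_real,
          norm_norm]
        exact div_self_le_one _
      · rw [hF, indicator_of_notMem hy]
        simp
    have hF2 : ∫⁻ y, ‖F y‖ₑ ^ 2 ≤ ∫⁻ y in annulus d k, ‖f y‖ₑ ^ 2 := by
      rw [← lintegral_indicator hA]
      refine lintegral_mono fun y => ?_
      refine (pow_le_pow_left' (hFle y) 2).trans (le_of_eq ?_)
      by_cases hy : y ∈ annulus d k
      · rw [indicator_of_mem hy, indicator_of_mem hy]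
      · rw [indicator_of_notMem hy, indicator_of_notMem hy]; simp
    have hkk : 1 ≤ s ^ 2 * 2 ^ k := hk₀.trans (by gcongr)
    obtain ⟨hFi, Q, -, hQ1, hQ2, -⟩ := h s hs0 k hkk F hFm
      (fun y hy => indicator_of_notMem hy _)
      (ne_top_of_le_ne_top (sq_tsum_annuli_ne_top hsum k) hF2)
    have hmain := hQ1 1 ⟨le_rfl, one_le_two⟩ x (hx.trans (by gcongr))
    rw [hst] at hmain
    have hKF : ∀ y, rieszKernel ρ lam γ t (x - y) * F y =
        (annulus d k).indicator (fun y => ((‖w y‖ : ℝ) : ℂ)) y := by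
      intro y
      by_cases hy : y ∈ annulus d k
      · rw [hF, indicator_of_mem hy, indicator_of_mem hy]
        have h1 : rieszKernel ρ lam γ t (x - y) * (starRingEnd ℂ (w y) / (‖w y‖ : ℂ) * f y) =
            w y * starRingEnd ℂ (w y) / (‖w y‖ : ℂ) := by
          rw [hw]; ring
        rw [h1, Complex.mul_conj']
        by_cases h0 : (‖w y‖ : ℂ) = 0
        · simp [h0]
        · field_simp
      · rw [hF, indicator_of_notMem hy, indicator_of_notMem hy, mul_zero]
    have hI := hρ.integrable_rieszKernel_mul hd hlam.le hγ ht hFi x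
    have e1 : ∫⁻ y in annulus d k, ‖w y‖ₑ = ‖rieszMean ρ lam γ t F x‖ₑ := by
      have hval : rieszMean ρ lam γ t F x =
          ((∫ y, (annulus d k).indicator (fun y => ‖w y‖) y : ℝ) : ℂ) := by
        rw [← integral_complex_ofReal]
        unfold rieszMean
        congr 1 with y
        rw [hKF]
        by_cases hy : y ∈ annulus d k
        · rw [indicator_of_mem hy, indicator_of_mem hy]
        · rw [indicator_of_notMem hy, indicator_of_notMem hy, Complex.ofReal_zero]
      have hint : Integrable ((annulus d k).indicator fun y => ‖w y‖) := by
        refine hI.norm.congr (ae_of_all _ fun y => ?_)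
        dsimp only
        rw [hKF]
        by_cases hy : y ∈ annulus d k
        · rw [indicator_of_mem hy, indicator_of_mem hy]; simp
        · rw [indicator_of_notMem hy, indicator_of_notMem hy]; simp
      have h0 : ∀ y, 0 ≤ (annulus d k).indicator (fun y => ‖w y‖) y :=
        indicator_nonneg fun y _ => norm_nonneg _
      rw [hval, ← ofReal_norm, Complex.norm_real, Real.norm_of_nonneg (integral_nonneg h0),
        ofReal_integral_eq_lintegral_ofReal hint (ae_of_all _ h0), ← lintegral_indicator hA]
      congr 1 with y
      by_cases hy : y ∈ annulus d k
      · rw [indicator_of_mem hy, indicator_of_mem hy, ofReal_norm]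
      · rw [indicator_of_notMem hy, indicator_of_notMem hy, ENNReal.ofReal_zero]
    have hN : (∫⁻ y, ‖F y‖ₑ ^ 2) ^ (1 / 2 : ℝ) ≤
        (∫⁻ y in annulus d k, ‖f y‖ₑ ^ 2) ^ (1 / 2 : ℝ) := ENNReal.rpow_le_rpow hF2 (by norm_num)
    rw [e1]
    refine hmain.trans ((add_le_add le_rfl (hQ2 x)).trans ?_)
    rw [ENNReal.ofReal_mul hC.le, mul_assoc, ← add_mul]
    gcongr
  rw [HasFiniteIntegral, ← iUnion_annulus, lintegral_iUnion
    (fun k => measurableSet_annulus d _) (fun i j hij => disjoint_annulus (by omega))]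
  refine lt_of_le_of_lt (ENNReal.tsum_le_tsum fun k => key (k + k₀) (Nat.le_add_left _ _)) ?_
  rw [ENNReal.tsum_mul_left]
  refine ENNReal.mul_lt_top (by simp [hB]) (lt_of_le_of_lt ?_ hsum.lt_top)
  exact ENNReal.tsum_comp_le_tsum_of_injective (add_left_injective k₀) _

theorem integrableOn_of_sq {A : Set (EuclideanSpace ℝ (Fin d))} (hA : volume A ≠ ⊤)
    (hf : AEStronglyMeasurable f) (h2 : ∫⁻ y in A, ‖f y‖ₑ ^ 2 ≠ ⊤) : IntegrableOn f A := by
  refine ⟨hf.restrict, (setLIntegral_le_sqrt_mul_sqrt hf.enorm).trans_lt ?_⟩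
  exact ENNReal.mul_lt_top (ENNReal.rpow_lt_top_of_nonneg (by norm_num) h2)
    (ENNReal.rpow_lt_top_of_nonneg (by norm_num) hA)

theorem IsHomogeneousDistance.integrable_rieszKernel_mul_of_annuli
    (hρ : IsHomogeneousDistance β ρ) (hd : 1 ≤ d) (hp : 2 < p)
    (hcrit : lam + 1 / 2 = d * (1 / 2 - 1 / p)) (hlam : 0 < lam) (hγ : 0 ≤ γ)
    (hf : AEStronglyMeasurable f)
    (hsum : ∑' k, ENNReal.ofReal (annulusWeight d p γ k) *
      (∫⁻ y in annulus d k, ‖f y‖ₑ ^ 2) ^ (1 / 2 : ℝ) ≠ ⊤)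
    (hloc : ∀ r : ℝ, ∫⁻ y in Metric.ball 0 r, ‖f y‖ₑ ^ 2 ≠ ⊤)
    {t : ℝ} (ht : 0 < t) (x : EuclideanSpace ℝ (Fin d)) :
    Integrable fun y => rieszKernel ρ lam γ t (x - y) * f y := by
  have hs0 : 0 < (t ^ (1 / β)) ^ 2 := by positivity
  obtain ⟨k₁, hk₁⟩ := pow_unbounded_of_one_lt ((t ^ (1 / β)) ^ 2)⁻¹ (one_lt_two (α := ℝ))
  obtain ⟨k₂, hk₂⟩ := pow_unbounded_of_one_lt (2 * ‖x‖) (one_lt_two (α := ℝ))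
  have h1 : (2 : ℝ) ^ k₁ ≤ 2 ^ max k₁ k₂ := pow_le_pow_right₀ one_le_two (le_max_left _ _)
  have h2 : (2 : ℝ) ^ k₂ ≤ 2 ^ max k₁ k₂ := pow_le_pow_right₀ one_le_two (le_max_right _ _)
  set k₀ := max k₁ k₂
  have hfar := hρ.integrableOn_far hd hp hcrit hlam hγ hf hsum ht x (k₀ := k₀)
    (by
      rw [inv_lt_iff_one_lt_mul₀ hs0] at hk₁
      exact hk₁.le.trans (by rw [mul_comm]; gcongr)) (by linarith)
  have hnear : IntegrableOn (fun y => rieszKernel ρ lam γ t (x - y) * f y)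
      (Metric.ball 0 (2 ^ k₀)) := by
    have hi := (integrableOn_of_sq measure_ball_lt_top.ne hf (hloc (2 ^ k₀))).integrable_indicator
      Metric.isOpen_ball.measurableSet
    have := hρ.integrable_rieszKernel_mul hd hlam.le hγ ht hi x
    refine (this.integrableOn (s := Metric.ball 0 (2 ^ k₀))).congr_fun (fun y hy => ?_)
      Metric.isOpen_ball.measurableSet
    dsimp only
    rw [indicator_of_mem hy]
  have hu : Metric.ball (0 : EuclideanSpace ℝ (Fin d)) (2 ^ k₀) ∪ {y | 2 ^ k₀ ≤ ‖y‖} = univ := by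
    ext y
    simp [lt_or_ge]
  rw [← integrableOn_univ, ← hu]
  exact hnear.union hfar

theorem rieszMean_indicator {S : Set (EuclideanSpace ℝ (Fin d))} (hS : MeasurableSet S) (t : ℝ)
    (x : EuclideanSpace ℝ (Fin d)) : rieszMean ρ lam γ t (S.indicator f) x =
      ∫ y in S, rieszKernel ρ lam γ t (x - y) * f y := by
  rw [← integral_indicator hS, rieszMean]
  congr 1 with y
  by_cases hy : y ∈ S
  · rw [indicator_of_mem hy, indicator_of_mem hy]
  · rw [indicator_of_notMem hy, indicator_of_notMem hy, mul_zero]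

theorem exists_two_pow_mul_eq {t : ℝ} (ht : 1 ≤ t) : ∃ i : ℕ, ∃ u ∈ Icc (1 : ℝ) 2,
    t = 2 ^ i * u := by
  obtain ⟨n, hn1, hn2⟩ := exists_nat_pow_near ht one_lt_two
  have h : (0 : ℝ) < 2 ^ n := by positivity
  refine ⟨n, t / 2 ^ n, ⟨(one_le_div h).2 hn1, (div_le_iff₀ h).2 ?_⟩, by field_simp⟩
  rw [← pow_succ']
  exact hn2.le

/-- A property of the dyadic blocks `2^i ≤ t ≤ 2^{i+1}` valid for all large `i` holds for all
large `t`. -/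
theorem eventually_atTop_of_dyadic {P : ℝ → Prop}
    (h : ∀ᶠ i : ℕ in atTop, ∀ u ∈ Icc (1 : ℝ) 2, P (2 ^ i * u)) : ∀ᶠ t in atTop, P t := by
  obtain ⟨n, hn⟩ := eventually_atTop.1 h
  filter_upwards [eventually_ge_atTop (2 ^ (n + 1) : ℝ)] with t ht
  obtain ⟨i, u, hu, rfl⟩ := exists_two_pow_mul_eq ((one_le_pow₀ one_le_two).trans ht)
  refine hn i ?_ u hu
  have h1 : (2 : ℝ) ^ (n + 1) ≤ 2 ^ (i + 1) := by
    rw [pow_succ _ i]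
    exact ht.trans (mul_le_mul_of_nonneg_left hu.2 (by positivity))
  have := (pow_le_pow_iff_right₀ one_lt_two).1 h1
  omega

theorem tendsto_zero_of_lintegral_tsum {X : Type*} [MeasurableSpace X] {μ : Measure X}
    {g : ℕ → X → ℝ≥0∞} (hg : ∀ i, Measurable (g i)) (h : ∑' i, ∫⁻ x, g i x ∂μ ≠ ⊤) :
    ∀ᵐ x ∂μ, Tendsto (fun i => g i x) atTop (𝓝 0) := by
  rw [← lintegral_tsum fun i => (hg i).aemeasurable] at h
  filter_upwards [ae_lt_top (Measurable.tsum hg) h] with x hx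
  exact ENNReal.tendsto_atTop_zero_of_tsum_ne_top hx.ne

/-- The means of the part of `f` far from the origin are eventually small, almost everywhere on a
fixed ball. -/
theorem IsHomogeneousDistance.exists_far_mean_small
    (hρ : IsHomogeneousDistance β ρ) (hd : 1 ≤ d) (hp : 2 < p)
    (hcrit : lam + 1 / 2 = d * (1 / 2 - 1 / p)) (hlam : 0 < lam) (hγ : 0 ≤ γ)
    (hf : AEStronglyMeasurable f)
    (hsum : ∑' k, ENNReal.ofReal (annulusWeight d p γ k) *
      (∫⁻ y in annulus d k, ‖f y‖ₑ ^ 2) ^ (1 / 2 : ℝ) ≠ ⊤)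
    {R : ℝ} (hR : 1 ≤ R) {ε : ℝ≥0∞} (hε : 0 < ε) :
    ∃ k₀ : ℕ, R ≤ 2 ^ k₀ ∧ ∀ᵐ x, ‖x‖ < R → ∀ᶠ t in atTop,
      ‖rieszMean ρ lam γ t ({y | 2 ^ k₀ ≤ ‖y‖}.indicator f) x‖ₑ ≤ ε := by
  obtain ⟨C, hC, h⟩ := hρ.exists_annulus_bound hd hp hcrit hlam hγ
  have hβ := hρ.degree_pos
  set s : ℕ → ℝ := fun i => (2 ^ i : ℝ) ^ (1 / β) with hs
  have hs1 : ∀ i, 1 ≤ s i := fun i =>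
    Real.one_le_rpow (one_le_pow₀ one_le_two) (by positivity)
  have hs0 : ∀ i, 0 < s i := fun i => zero_lt_one.trans_le (hs1 i)
  have hsβ : ∀ i, s i ^ β = 2 ^ i := fun i => by
    rw [hs, ← Real.rpow_mul (by positivity), one_div_mul_cancel hβ.ne', Real.rpow_one]
  have hsk : ∀ i k, 1 ≤ s i ^ 2 * 2 ^ k := fun i k =>
    one_le_mul_of_one_le_of_one_le (one_le_pow₀ (hs1 i)) (one_le_pow₀ one_le_two)
  have hA := measurableSet_annulus d
  set F : ℕ → EuclideanSpace ℝ (Fin d) → ℂ := fun k => (annulus d k).indicator f with hF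
  have hFm : ∀ k, AEStronglyMeasurable (F k) := fun k => hf.indicator (hA k)
  have hF0 : ∀ k y, y ∉ annulus d k → F k y = 0 := fun k y hy => indicator_of_notMem hy _
  have hF2 : ∀ k, ∫⁻ y, ‖F k y‖ₑ ^ 2 = ∫⁻ y in annulus d k, ‖f y‖ₑ ^ 2 := by
    intro k
    rw [lintegral_eq_setLIntegral_of_eq_zero (hA k) (g := fun y => ‖F k y‖ₑ ^ 2) fun y hy => by
      simp [hF0 k y hy]]
    refine setLIntegral_congr_fun (hA k) fun y hy => ?_
    simp only [hF, indicator_of_mem hy]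
  have hF2t : ∀ k, ∫⁻ y, ‖F k y‖ₑ ^ 2 ≠ ⊤ := fun k => by
    rw [hF2]; exact sq_tsum_annuli_ne_top hsum k
  have hex := fun i k => (h (s i) (hs0 i) k (hsk i k) (F k) (hFm k) (hF0 k) (hF2t k)).2
  choose Q hQm hQ1 hQ2 hQ3 using hex
  set b : ℕ → ℝ≥0∞ := fun k => ENNReal.ofReal (annulusWeight d p γ k) *
    (∫⁻ y in annulus d k, ‖f y‖ₑ ^ 2) ^ (1 / 2 : ℝ) with hb
  -- the exceptional functions `Q i k` are summable over `i` and `k` on the ball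
  have hQsum : ∑' i, ∫⁻ x in Metric.ball 0 R, ∑' k, Q i k x ≠ ⊤ := by
    set r : ℝ := (2 : ℝ) ^ (-(lam / β)) with hr
    have hr1 : r < 1 := Real.rpow_lt_one_of_one_lt_of_neg one_lt_two
      (by have := div_pos hlam hβ; linarith)
    set v := volume (Metric.ball (0 : EuclideanSpace ℝ (Fin d)) R) ^ (1 / 2 : ℝ) with hv
    have hvt : v ≠ ⊤ := (ENNReal.rpow_lt_top_of_nonneg (by norm_num) measure_ball_lt_top.ne).ne
    have hi : ∀ i, ∫⁻ x in Metric.ball 0 R, ∑' k, Q i k x ≤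
        ENNReal.ofReal (r ^ i) * (ENNReal.ofReal ((C * R) ^ (1 / 2 : ℝ)) * v * ∑' k, b k) := by
      intro i
      rw [lintegral_tsum fun k => (hQm i k).aemeasurable, ← mul_assoc, ← ENNReal.tsum_mul_left]
      refine ENNReal.tsum_le_tsum fun k => ?_
      have h3 := hQ3 i k R (one_le_mul_of_one_le_of_one_le (hs1 i) hR)
      rw [hF2] at h3
      refine h3.trans (le_of_eq ?_)
      -- The dilation of the ball costs `s^{1/2}`, the weight gains `s^{-(λ+1/2)}`: together `s^{-λ}`,
      -- which is geometric in `i`.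
      have e : (C * (s i * R)) ^ (1 / 2 : ℝ) * s i ^ (-(lam + 1 / 2)) =
          r ^ i * (C * R) ^ (1 / 2 : ℝ) := by
        have e1 : C * (s i * R) = s i * (C * R) := by ring
        have e2 : s i ^ (1 / 2 : ℝ) * s i ^ (-(lam + 1 / 2)) = r ^ i := by
          rw [← Real.rpow_add (hs0 i), show s i = (2 ^ i : ℝ) ^ (1 / β) from rfl,
            ← Real.rpow_natCast 2 i,
            ← Real.rpow_mul (by norm_num), ← Real.rpow_mul (by norm_num), hr,
            ← Real.rpow_natCast, ← Real.rpow_mul (by norm_num)]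
          congr 1
          ring
        rw [e1, Real.mul_rpow (hs0 i).le (by positivity), ← e2]
        ring
      rw [e, ENNReal.ofReal_mul (by positivity)]
      ring
    refine ne_top_of_le_ne_top ?_ (ENNReal.tsum_le_tsum hi)
    rw [ENNReal.tsum_mul_right]
    exact ENNReal.mul_ne_top (tsum_ofReal_geometric_ne_top (by positivity) hr1)
      (ENNReal.mul_ne_top (ENNReal.mul_ne_top ENNReal.ofReal_ne_top hvt) hsum)
  have hzero := tendsto_zero_of_lintegral_tsum
    (fun i => Measurable.tsum (hQm i)) hQsum
  -- choice of the cut-off radius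
  have hε2 : 0 < ε / 2 := ENNReal.half_pos hε.ne'
  have htail : Tendsto (fun k₀ => ∑' k, ENNReal.ofReal C * b (k + k₀)) atTop (𝓝 0) :=
    ENNReal.tendsto_sum_nat_add (fun k => ENNReal.ofReal C * b k) (by
      rw [ENNReal.tsum_mul_left]
      exact ENNReal.mul_ne_top ENNReal.ofReal_ne_top hsum)
  obtain ⟨k₀, hk₀, hkR⟩ := ((htail.eventually (ge_mem_nhds hε2)).and
    ((tendsto_pow_atTop_atTop_of_one_lt (one_lt_two (α := ℝ))).eventually_ge_atTop
      (2 * R))).exists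
  refine ⟨k₀, by linarith, ?_⟩
  have hS : MeasurableSet {y : EuclideanSpace ℝ (Fin d) | 2 ^ k₀ ≤ ‖y‖} :=
    measurableSet_le measurable_const measurable_norm
  rw [ae_restrict_iff' Metric.isOpen_ball.measurableSet] at hzero
  filter_upwards [hzero] with x hx hxR
  have hx0 := hx (by simpa using hxR)
  refine eventually_atTop_of_dyadic ?_
  filter_upwards [hx0.eventually (ge_mem_nhds hε2)] with i hi u hu
  have hu0 : 0 < u := zero_lt_one.trans_le hu.1
  have ht0 : (0 : ℝ) < 2 ^ i * u := by positivity
  have hxk : ∀ k, k₀ ≤ k → ‖x‖ ≤ 2 ^ k / 2 := fun k hk => by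
    have : (2 : ℝ) ^ k₀ ≤ 2 ^ k := pow_le_pow_right₀ one_le_two hk
    linarith
  have hint := hρ.integrableOn_far hd hp hcrit hlam hγ hf hsum ht0 x (k₀ := k₀)
    (one_le_mul_of_one_le_of_one_le (one_le_pow₀ (Real.one_le_rpow
      (one_le_mul_of_one_le_of_one_le (one_le_pow₀ one_le_two) hu.1) (by positivity)))
      (one_le_pow₀ one_le_two)) (hxk k₀ le_rfl)
  rw [← iUnion_annulus] at hint
  rw [rieszMean_indicator hS, ← iUnion_annulus,
    ← (hasSum_integral_iUnion (fun k => hA (k + k₀))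
      (fun i j hij => disjoint_annulus (by omega)) hint).tsum_eq]
  refine enorm_tsum_le_tsum_enorm.trans ?_
  calc _ ≤ ∑' k, (ENNReal.ofReal C * b (k + k₀) + Q i (k + k₀) x) := by
        refine ENNReal.tsum_le_tsum fun k => ?_
        rw [← rieszMean_indicator (hA _)]
        have h1 := hQ1 i (k + k₀) u hu x (hxk _ (Nat.le_add_left _ _))
        rwa [hsβ, hF2, ENNReal.ofReal_mul hC.le, mul_assoc] at h1
    _ = ∑' k, ENNReal.ofReal C * b (k + k₀) + ∑' k, Q i (k + k₀) x := ENNReal.tsum_add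
    _ ≤ ε / 2 + ε / 2 := by
        refine add_le_add hk₀ (le_trans ?_ hi)
        exact ENNReal.tsum_comp_le_tsum_of_injective (add_left_injective k₀) _
    _ = ε := ENNReal.add_halves ε

end FarSum

/-! ### A mollifier and its Fourier transform -/

section Mollifier

variable {d : ℕ}

/-- A smooth bump at the origin, equal to `1` on the unit ball and supported in the ball of
radius `2`, dilated by the factor `s⁻¹`. -/
noncomputable def dilatedBump (d : ℕ) (s : ℝ) (hs : 0 < s) :
    ContDiffBump (0 : EuclideanSpace ℝ (Fin d)) where
  rIn := s⁻¹
  rOut := 2 * s⁻¹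
  rIn_pos := inv_pos.2 hs
  rIn_lt_rOut := by have := inv_pos.2 hs; linarith

/-- A smooth nonnegative function of integral one supported in the ball of radius `2`. -/
noncomputable def mollifier (d : ℕ) (x : EuclideanSpace ℝ (Fin d)) : ℂ :=
  ((dilatedBump d 1 one_pos).normed volume x : ℝ)

theorem contDiff_mollifier : ContDiff ℝ (⊤ : ℕ∞) (mollifier d) :=
  Complex.ofRealCLM.contDiff.comp (dilatedBump d 1 one_pos).contDiff_normed

theorem hasCompactSupport_mollifier : HasCompactSupport (mollifier d) :=
  (dilatedBump d 1 one_pos).hasCompactSupport_normed.comp_left Complex.ofReal_zero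

theorem integrable_mollifier : Integrable (mollifier d) :=
  contDiff_mollifier.continuous.integrable_of_hasCompactSupport hasCompactSupport_mollifier

theorem integral_mollifier : ∫ x, mollifier d x = 1 := by
  unfold mollifier
  rw [integral_complex_ofReal, ContDiffBump.integral_normed, Complex.ofReal_one]

theorem mollifier_eq_zero {x : EuclideanSpace ℝ (Fin d)} (hx : 2 ≤ ‖x‖) : mollifier d x = 0 := by
  have h : x ∉ Function.support ((dilatedBump d 1 one_pos).normed volume) := by
    rw [ContDiffBump.support_normed_eq]
    simpa [dilatedBump] using hx
  rw [mollifier, Function.notMem_support.1 h, Complex.ofReal_zero]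

theorem norm_mollifier (x : EuclideanSpace ℝ (Fin d)) :
    ‖mollifier d x‖ = (dilatedBump d 1 one_pos).normed volume x := by
  rw [mollifier, Complex.norm_real, Real.norm_of_nonneg (ContDiffBump.nonneg_normed _ _)]

theorem norm_ft_mollifier_sub_one_le (ξ : EuclideanSpace ℝ (Fin d)) :
    ‖ft (mollifier d) ξ - 1‖ ≤ 2 * ‖ξ‖ := by
  have hI : Integrable fun y => mollifier d y * Complex.exp (-Complex.I * (inner ℝ y ξ : ℝ)) := by
    refine integrable_mollifier.mul_bdd (c := 1) ?_ (ae_of_all _ fun y => ?_)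
    · exact Continuous.aestronglyMeasurable (by fun_prop)
    · rw [mul_comm, mul_neg, ← neg_mul, ← Complex.ofReal_neg, Complex.norm_exp_ofReal_mul_I]
  have hone : ft (mollifier d) ξ - 1 =
      ∫ y, mollifier d y * (Complex.exp (-Complex.I * (inner ℝ y ξ : ℝ)) - 1) := by
    simp_rw [mul_sub, mul_one]
    rw [integral_sub hI integrable_mollifier, integral_mollifier, ft]
  have hb : ∀ y, ‖mollifier d y * (Complex.exp (-Complex.I * (inner ℝ y ξ : ℝ)) - 1)‖ ≤
      (dilatedBump d 1 one_pos).normed volume y * (2 * ‖ξ‖) := by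
    intro y
    rw [norm_mul, norm_mollifier]
    by_cases hy : 2 ≤ ‖y‖
    · have := mollifier_eq_zero hy
      rw [← norm_mollifier, this]
      simp
    · refine mul_le_mul_of_nonneg_left ?_ (ContDiffBump.nonneg_normed _ _)
      have e : -Complex.I * ((inner ℝ y ξ : ℝ) : ℂ) = Complex.I * ((-inner ℝ y ξ : ℝ) : ℂ) := by
        push_cast; ring
      rw [e]
      refine (Real.norm_exp_I_mul_ofReal_sub_one_le).trans ?_
      rw [norm_neg]
      refine (norm_inner_le_norm y ξ).trans ?_
      have := not_le.1 hy
      gcongr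
  rw [hone]
  refine (norm_integral_le_of_norm_le
    ((ContDiffBump.integrable_normed _).mul_const _) (ae_of_all _ hb)).trans (le_of_eq ?_)
  rw [integral_mul_const, ContDiffBump.integral_normed, one_mul]

open FourierTransform in
theorem ft_eq_fourier (F : EuclideanSpace ℝ (Fin d) → ℂ) (ξ : EuclideanSpace ℝ (Fin d)) :
    ft F ξ = 𝓕 F ((2 * Real.pi)⁻¹ • ξ) := by
  rw [ft, Real.fourier_eq']
  congr 1 with y
  rw [smul_eq_mul, mul_comm, inner_smul_right]
  congr 2
  have := Real.pi_ne_zero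
  push_cast
  field_simp

open FourierTransform in
theorem ft_mollifier_eq (ξ : EuclideanSpace ℝ (Fin d)) : ft (mollifier d) ξ =
    (𝓕 (hasCompactSupport_mollifier.toSchwartzMap contDiff_mollifier) :
      SchwartzMap (EuclideanSpace ℝ (Fin d)) ℂ) ((2 * Real.pi)⁻¹ • ξ) := by
  rw [ft_eq_fourier, SchwartzMap.fourier_coe]
  rfl

theorem exists_norm_mul_ft_mollifier_le (d : ℕ) : ∃ C > 0, ∀ ξ : EuclideanSpace ℝ (Fin d),
    ‖ξ‖ * ‖ft (mollifier d) ξ‖ ≤ C := by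
  obtain ⟨C, hC, h⟩ := (FourierTransform.fourier
    (hasCompactSupport_mollifier.toSchwartzMap contDiff_mollifier) :
      SchwartzMap (EuclideanSpace ℝ (Fin d)) ℂ).decay 1 0
  have hpi := Real.pi_pos
  refine ⟨2 * Real.pi * C, by positivity, fun ξ => ?_⟩
  have h1 := h ((2 * Real.pi)⁻¹ • ξ)
  rw [norm_iteratedFDeriv_zero, ← ft_mollifier_eq, pow_one, norm_smul, norm_inv,
    Real.norm_of_nonneg (by positivity), mul_assoc, inv_mul_le_iff₀ (by positivity)] at h1
  exact h1

theorem integrable_ft_mollifier : Integrable (ft (mollifier d)) := by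
  have h := (FourierTransform.fourier
    (hasCompactSupport_mollifier.toSchwartzMap contDiff_mollifier) :
      SchwartzMap (EuclideanSpace ℝ (Fin d)) ℂ).integrable (μ := volume)
  have h2 := h.comp_smul (R := (2 * Real.pi)⁻¹) (by have := Real.pi_pos; positivity)
  exact h2.congr (ae_of_all _ fun ξ => (ft_mollifier_eq ξ).symm)

open FourierTransform in
theorem invFT_ft_mollifier (x : EuclideanSpace ℝ (Fin d)) :
    invFT (ft (mollifier d)) x = ((2 * Real.pi) ^ d : ℝ) * mollifier d x := by
  have hpi := Real.pi_pos
  have h2 : (0 : ℝ) < 2 * Real.pi := by positivity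
  have hi : Integrable (𝓕 (mollifier d)) := by
    have := (integrable_ft_mollifier (d := d)).comp_smul (R := 2 * Real.pi) h2.ne'
    refine this.congr (ae_of_all _ fun ξ => ?_)
    dsimp only
    rw [ft_eq_fourier, inv_smul_smul₀ h2.ne']
  have hinv := congrFun (contDiff_mollifier.continuous.fourierInv_fourier_eq
    (integrable_mollifier (d := d)) hi) x
  rw [Real.fourierInv_eq'] at hinv
  have hs := integral_comp_smul_of_pos (d := d)
    (fun ξ => ft (mollifier d) ξ * Complex.exp (Complex.I * (inner ℝ x ξ : ℝ))) h2
  rw [invFT]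
  have e : (∫ v, Complex.exp (((2 * Real.pi * inner ℝ v x : ℝ) : ℂ) * Complex.I) •
      𝓕 (mollifier d) v) = ∫ ξ, ft (mollifier d) ((2 * Real.pi) • ξ) *
        Complex.exp (Complex.I * (inner ℝ x ((2 * Real.pi) • ξ) : ℝ)) := by
    congr 1 with ξ
    rw [ft_eq_fourier, inv_smul_smul₀ h2.ne', inner_smul_right, real_inner_comm, smul_eq_mul,
      mul_comm, mul_comm Complex.I]
  rw [← hinv, e, hs, ← mul_assoc]
  push_cast
  rw [mul_inv_cancel₀ (by simp [Real.pi_ne_zero]), one_mul]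

theorem normed_dilatedBump (s : ℝ) (hs : 0 < s) (x : EuclideanSpace ℝ (Fin d)) :
    (dilatedBump d s hs).normed volume x =
      s ^ d * (dilatedBump d 1 one_pos).normed volume (s • x) := by
  have hcoe : ∀ x, dilatedBump d s hs x = dilatedBump d 1 one_pos (s • x) := by
    intro x
    rw [ContDiffBump.apply, ContDiffBump.apply]
    simp only [dilatedBump, inv_inv, sub_zero, inv_one, one_smul, mul_one, div_one]
    rw [mul_div_assoc, div_self (inv_ne_zero hs.ne'), mul_one]
  rw [ContDiffBump.normed_def, ContDiffBump.normed_def, hcoe]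
  simp_rw [hcoe]
  have := Measure.integral_comp_smul (volume : Measure (EuclideanSpace ℝ (Fin d)))
    (fun y => dilatedBump d 1 one_pos y) s
  rw [this, finrank_euclideanSpace_fin, abs_of_pos (by positivity), smul_eq_mul]
  field_simp

/-- Averages against the dilates of the mollifier converge almost everywhere. -/
theorem ae_tendsto_mollify {F : EuclideanSpace ℝ (Fin d) → ℂ} (hF : Integrable F) {s : ℕ → ℝ}
    (hs : ∀ i, 0 < s i) (hlim : Tendsto s atTop atTop) :
    ∀ᵐ x, Tendsto (fun i => ∫ y, F ((s i)⁻¹ • y) * mollifier d (s i • x - y)) atTop (𝓝 (F x)) := by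
  have h := ContDiffBump.ae_convolution_tendsto_right_of_locallyIntegrable
    (μ := (volume : Measure (EuclideanSpace ℝ (Fin d)))) (φ := fun i => dilatedBump d (s i) (hs i))
    (l := atTop) (K := 2) (g := F)
    (by
      have := (tendsto_inv_atTop_zero.comp hlim).const_mul 2
      simpa [dilatedBump] using this)
    (Eventually.of_forall fun i => le_of_eq rfl) hF.locallyIntegrable
  filter_upwards [h] with x hx
  refine hx.congr fun i => ?_
  have h1 := integral_comp_smul_of_pos (d := d)
    (fun y => F ((s i)⁻¹ • y) * mollifier d (s i • x - y)) (hs i)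
  simp_rw [inv_smul_smul₀ (hs i).ne'] at h1
  have hsd : (((s i) ^ d : ℝ) : ℂ) ≠ 0 := by
    have := (hs i).ne'
    exact_mod_cast pow_ne_zero d this
  have h2 : ∫ y, F ((s i)⁻¹ • y) * mollifier d (s i • x - y) = ((s i) ^ d : ℝ) *
      ∫ y, F y * mollifier d (s i • x - s i • y) := by
    rw [h1, ← mul_assoc]
    push_cast at hsd ⊢
    rw [mul_inv_cancel₀ hsd, one_mul]
  rw [h2, convolution_eq_swap, ← integral_const_mul]
  congr 1 with y
  rw [ContinuousLinearMap.lsmul_apply, normed_dilatedBump, Complex.real_smul, mollifier, smul_sub]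
  push_cast
  ring

end Mollifier

/-! ### Square functions over dyadic scales -/

section SquareFunction

variable {d : ℕ} {β : ℝ} {ρ : EuclideanSpace ℝ (Fin d) → ℝ}

theorem ft_comp_inv_smul (F : EuclideanSpace ℝ (Fin d) → ℂ) {s : ℝ} (hs : 0 < s)
    (ξ : EuclideanSpace ℝ (Fin d)) :
    ft (fun z => F (s⁻¹ • z)) ξ = (s ^ d : ℝ) * ft F (s • ξ) := by
  have h := integral_comp_smul_of_pos (d := d)
    (fun y => F (s⁻¹ • y) * Complex.exp (-Complex.I * (inner ℝ y ξ : ℝ))) hs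
  simp_rw [inv_smul_smul₀ hs.ne', real_inner_smul_left] at h
  unfold ft
  simp_rw [real_inner_smul_right]
  rw [h, ← mul_assoc]
  have hsc : (s : ℂ) ≠ 0 := by exact_mod_cast hs.ne'
  push_cast
  rw [mul_inv_cancel₀ (pow_ne_zero _ hsc), one_mul]

theorem lintegral_mul_ft_comp_inv_smul (F : EuclideanSpace ℝ (Fin d) → ℂ) {s : ℝ} (hs : 0 < s)
    (w : EuclideanSpace ℝ (Fin d) → ℝ≥0∞) :
    ENNReal.ofReal (s ^ d)⁻¹ * ∫⁻ ξ, w ξ * ‖ft (fun z => F (s⁻¹ • z)) ξ‖ₑ ^ 2 =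
      ∫⁻ ξ, w (s⁻¹ • ξ) * ‖ft F ξ‖ₑ ^ 2 := by
  have h := lintegral_comp_smul volume (fun ξ => w (s⁻¹ • ξ) * ‖ft F ξ‖ₑ ^ 2) hs
  rw [finrank_euclideanSpace_fin] at h
  simp_rw [inv_smul_smul₀ hs.ne'] at h
  have hsd : 0 < s ^ d := by positivity
  have e : ∀ ξ, w ξ * ‖ft (fun z => F (s⁻¹ • z)) ξ‖ₑ ^ 2 =
      ENNReal.ofReal (s ^ d) ^ 2 * (w ξ * ‖ft F (s • ξ)‖ₑ ^ 2) := by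
    intro ξ
    rw [ft_comp_inv_smul F hs, enorm_mul, mul_pow, ← ofReal_norm, Complex.norm_real,
      Real.norm_of_nonneg hsd.le]
    ring
  simp_rw [e]
  rw [lintegral_const_mul' _ _ (by simp), h, ← mul_assoc, ← mul_assoc,
    ← ENNReal.ofReal_pow hsd.le, ← ENNReal.ofReal_mul (by positivity),
    ← ENNReal.ofReal_mul (by positivity)]
  rw [show (s ^ d)⁻¹ * (s ^ d) ^ 2 * (s ^ d)⁻¹ = 1 by field_simp, ENNReal.ofReal_one, one_mul]

/-- A weight that decays as `ρ → 0` and as `ρ → ∞` is square summable over the dyadic dilations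
of a function of `L¹ ∩ L²`. -/
theorem IsHomogeneousDistance.tsum_dilated_ne_top (hρ : IsHomogeneousDistance β ρ) (hd : 1 ≤ d)
    {δ C : ℝ} (hδ : 0 < δ) (hC : 0 ≤ C) {F : EuclideanSpace ℝ (Fin d) → ℂ} (hF : Integrable F)
    (hF2 : ∫⁻ y, ‖F y‖ₑ ^ 2 ≠ ⊤) :
    ∑' i : ℕ, ENNReal.ofReal (((2 ^ i : ℝ) ^ (1 / β)) ^ d)⁻¹ *
      ∫⁻ ξ, ENNReal.ofReal (C * min (ρ ξ ^ δ) (ρ ξ ^ δ)⁻¹) *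
        ‖ft (fun z => F (((2 ^ i : ℝ) ^ (1 / β))⁻¹ • z)) ξ‖ₑ ^ 2 ≠ ⊤ := by
  have hρm := hρ.measurable
  have hFm : Measurable (ft F) := (continuous_ft hF).measurable
  set r : ℝ := 2 ^ (-δ) with hr
  have hr1 : r < 1 := Real.rpow_lt_one_of_one_lt_of_neg one_lt_two (by linarith)
  have hstep : ∀ i : ℕ, ENNReal.ofReal (((2 ^ i : ℝ) ^ (1 / β)) ^ d)⁻¹ *
      ∫⁻ ξ, ENNReal.ofReal (C * min (ρ ξ ^ δ) (ρ ξ ^ δ)⁻¹) *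
        ‖ft (fun z => F (((2 ^ i : ℝ) ^ (1 / β))⁻¹ • z)) ξ‖ₑ ^ 2 =
      ∫⁻ ξ, ENNReal.ofReal C * ENNReal.ofReal (min (ρ ξ ^ δ * r ^ i) (ρ ξ ^ δ * r ^ i)⁻¹) *
        ‖ft F ξ‖ₑ ^ 2 := by
    intro i
    rw [lintegral_mul_ft_comp_inv_smul F (by positivity)]
    refine lintegral_congr_ae ?_
    filter_upwards [ae_ne_zero hd] with ξ hξ
    have h1 : ρ (((2 ^ i : ℝ) ^ (1 / β))⁻¹ • ξ) = (2 ^ i)⁻¹ * ρ ξ := by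
      rw [← Real.inv_rpow (by positivity)]
      exact hρ.homogeneous _ (by positivity) ξ hξ
    have h2 : ((2 ^ i)⁻¹ * ρ ξ) ^ δ = ρ ξ ^ δ * r ^ i := by
      rw [Real.mul_rpow (by positivity) (hρ.pos ξ hξ).le, Real.inv_rpow (by positivity),
        ← Real.rpow_neg (by positivity), ← Real.rpow_natCast 2 i, ← Real.rpow_mul (by norm_num),
        ← Real.rpow_natCast r i, hr, ← Real.rpow_mul (by norm_num), mul_comm]
      ring_nf
    rw [h1, h2, ENNReal.ofReal_mul hC]
  simp_rw [hstep]
  rw [← lintegral_tsum fun i => by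
    refine Measurable.aemeasurable ?_
    fun_prop]
  refine ne_top_of_le_ne_top (b := ENNReal.ofReal C * ENNReal.ofReal (2 / (1 - r)) *
    ∫⁻ ξ, ‖ft F ξ‖ₑ ^ 2) ?_ ?_
  · refine ENNReal.mul_ne_top (by finiteness) (ne_top_of_le_ne_top ?_ (lintegral_ft_sq_le hF))
    exact ENNReal.mul_ne_top (by finiteness) hF2
  · rw [← lintegral_const_mul' _ _ (by finiteness)]
    refine lintegral_mono_ae ?_
    filter_upwards [ae_ne_zero hd] with ξ hξ
    rw [ENNReal.tsum_mul_right, ENNReal.tsum_mul_left]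
    gcongr
    exact tsum_min_geometric_le (by positivity) hr1 (Real.rpow_pos_of_pos (hρ.pos ξ hξ) _)

theorem IsExpMixture.lintegral_weight_ne_top {lam γ : ℝ} (hlam : 0 < lam) {ν : Measure ℝ}
    (hν : IsExpMixture γ ν) : ∫⁻ a, (∫⁻ τ : ℝ, ENNReal.ofReal (Real.exp (a / 4) *
      (1 + |τ|) ^ (-(lam + 1 + min a 1)))) ∂ν ≠ ⊤ := by
  have hJ := (integrable_one_add_abs_rpow (s := lam + 1) (by linarith)).lintegral_lt_top
  have hE := (hν.integrable (-1 / 4) (by norm_num)).lintegral_lt_top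
  refine ne_top_of_le_ne_top (ENNReal.mul_ne_top hE.ne hJ.ne) ?_
  rw [← lintegral_mul_const' _ _ hJ.ne]
  refine lintegral_mono_ae ?_
  filter_upwards [hν.nonneg] with a ha
  rw [← lintegral_const_mul' _ _ ENNReal.ofReal_ne_top]
  refine lintegral_mono fun τ => ?_
  rw [← ENNReal.ofReal_mul (by positivity)]
  refine ENNReal.ofReal_le_ofReal ?_
  have h1 : (1 : ℝ) ≤ 1 + |τ| := by linarith [abs_nonneg τ]
  have h2 : 0 ≤ min a 1 := le_min ha zero_le_one
  rw [show -(-1 / 4 : ℝ) * a = a / 4 by ring]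
  exact mul_le_mul_of_nonneg_left (Real.rpow_le_rpow_of_exponent_le h1 (by linarith))
    (Real.exp_pos _).le

/-- Minkowski's inequality in `L²` for a weighted superposition of functions of bounded norm. -/
theorem lintegral_sq_superposition_le {X Ω : Type*} [MeasurableSpace X] [MeasurableSpace Ω]
    {μ : Measure X} {κ : Measure Ω} [SFinite μ] [SFinite κ] {w : Ω → ℝ≥0∞} {P : Ω × X → ℝ≥0∞}
    (hw : Measurable w) (hP : Measurable P) (hW : ∫⁻ p, w p ∂κ ≠ ⊤) {A : ℝ≥0∞}
    (hA : ∀ᵐ p ∂κ, ∫⁻ z, P (p, z) ^ 2 ∂μ ≤ A) :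
    ∫⁻ z, (∫⁻ p, w p * P (p, z) ∂κ) ^ 2 ∂μ ≤ (∫⁻ p, w p ∂κ) ^ 2 * A := by
  have hPz : ∀ z, Measurable fun p => P (p, z) := fun z =>
    hP.comp (measurable_id.prodMk measurable_const)
  have hPp : ∀ p, Measurable fun z => P (p, z) := fun p =>
    hP.comp (measurable_const.prodMk measurable_id)
  have hm : Measurable fun q : X × Ω => w q.2 * P (q.2, q.1) ^ 2 :=
    (hw.comp measurable_snd).mul ((hP.comp measurable_swap).pow_const 2)
  calc _ ≤ ∫⁻ z, (∫⁻ p, w p ∂κ) * (∫⁻ p, w p * P (p, z) ^ 2 ∂κ) ∂μ :=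
        lintegral_mono fun z => lintegral_mul_sq_le' hw.aemeasurable (hPz z).aemeasurable
    _ = (∫⁻ p, w p ∂κ) * ∫⁻ p, w p * (∫⁻ z, P (p, z) ^ 2 ∂μ) ∂κ := by
        rw [lintegral_const_mul' _ _ hW, lintegral_lintegral_swap hm.aemeasurable]
        congr 1
        refine lintegral_congr fun p => ?_
        rw [lintegral_const_mul _ ((hPp p).pow_const 2)]
    _ ≤ (∫⁻ p, w p ∂κ) * ∫⁻ p, w p * A ∂κ := by
        refine mul_le_mul_right (lintegral_mono_ae ?_) _
        filter_upwards [hA] with p hp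
        exact mul_le_mul_right hp _
    _ = _ := by rw [lintegral_mul_const _ hw]; ring

theorem measurable_phaseFT_mixture {ρ : EuclideanSpace ℝ (Fin d) → ℝ}
    {G : EuclideanSpace ℝ (Fin d) → ℂ} (hρ : Measurable ρ) (hG : Measurable G) (lam : ℝ) :
    Measurable fun q : (ℝ × ℝ) × EuclideanSpace ℝ (Fin d) =>
      ‖phaseFT ρ G (((lam + q.1.1 : ℝ) : ℂ) + q.1.2 * Complex.I) q.2‖ₑ := by
  refine ((measurable_phaseFT hρ hG).comp (Measurable.prodMk ?_ measurable_snd)).enorm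
  fun_prop

/-- The maximal function over `t ∈ [1, 2]` of the high-frequency part is bounded on `L²`. -/
theorem IsHomogeneousDistance.exists_high_bound (hρ : IsHomogeneousDistance β ρ)
    {lam γ : ℝ} (hlam : 0 < lam) (hγ : 0 ≤ γ) : ∃ C : ℝ, 0 < C ∧
      ∀ G : EuclideanSpace ℝ (Fin d) → ℂ, Integrable G → Measurable G →
      (∀ ξ, G ξ ≠ 0 → ξ ∈ shell ρ (1 / 3) 3) →
      ∃ M : EuclideanSpace ℝ (Fin d) → ℝ≥0∞, Measurable M ∧
        (∀ t ∈ Icc (1 : ℝ) 2, ∀ z,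
          ‖invFT (fun ξ => (hlog lam γ (ρ ξ / t) : ℂ) * G ξ) z‖ₑ ≤ M z) ∧
        ∫⁻ z, M z ^ 2 ≤ ENNReal.ofReal C * ∫⁻ ξ, ‖G ξ‖ₑ ^ 2 := by
  obtain ⟨ν, hν⟩ := exists_isExpMixture hγ
  have := hν.finite
  obtain ⟨C, hC, h⟩ := exists_enorm_invFT_hlog_le (γ := γ) hlam hν
  have hρm := hρ.measurable
  set w : ℝ × ℝ → ℝ≥0∞ := fun p =>
    ENNReal.ofReal (Real.exp (p.1 / 4) * (1 + |p.2|) ^ (-(lam + 1 + min p.1 1))) with hw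
  have hwm : Measurable w := by fun_prop
  have hWt : ∫⁻ p, w p ∂(ν.prod volume) ≠ ⊤ := by
    rw [lintegral_prod _ hwm.aemeasurable]
    exact hν.lintegral_weight_ne_top hlam
  set W := ∫⁻ p, w p ∂(ν.prod volume) with hW
  have hpi := Real.pi_pos
  set D := C ^ 2 * (W.toReal ^ 2 * (2 * Real.pi) ^ d) with hD
  have hD0 : 0 ≤ D := by positivity
  refine ⟨D + 1, by positivity, fun G hGi hGm hGs => ?_⟩
  have hPm := measurable_phaseFT_mixture hρm hGm lam
  refine ⟨fun z => ENNReal.ofReal C * ∫⁻ p, w p *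
    ‖phaseFT ρ G (((lam + p.1 : ℝ) : ℂ) + p.2 * Complex.I) z‖ₑ ∂(ν.prod volume), ?_,
    fun t ht z => ?_, ?_⟩
  · refine Measurable.const_mul ?_ _
    exact Measurable.lintegral_prod_left' ((hwm.comp measurable_fst).mul hPm)
  · refine (h hρm G hGi hGs t ht z).trans (le_of_eq ?_)
    dsimp only
    rw [lintegral_prod]
    exact (hwm.mul (hPm.comp (measurable_id.prodMk measurable_const))).aemeasurable
  · have hp0 : ∀ᵐ p ∂(ν.prod (volume : Measure ℝ)), 0 ≤ p.1 :=
      (Measure.quasiMeasurePreserving_fst (μ := ν) (ν := (volume : Measure ℝ))).ae hν.nonneg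
    have key := lintegral_sq_superposition_le (μ := volume) (κ := ν.prod volume) hwm hPm hWt
      (A := ENNReal.ofReal ((2 * Real.pi) ^ d) * ∫⁻ ξ, ‖G ξ‖ₑ ^ 2) (by
        filter_upwards [hp0] with p hp
        refine lintegral_phaseFT_sq_le hρm hGi hGs ?_
        simp only [Complex.add_re, Complex.ofReal_re, Complex.mul_re, Complex.I_re,
          Complex.ofReal_im, Complex.I_im]
        linarith)
    simp_rw [mul_pow]
    rw [lintegral_const_mul' _ _ (by finiteness)]
    refine (mul_le_mul_right key _).trans ?_
    rw [← hW, ← mul_assoc, ← mul_assoc]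
    refine mul_le_mul_left ?_ _
    calc _ = ENNReal.ofReal D := by
          rw [hD, ENNReal.ofReal_mul (by positivity), ENNReal.ofReal_mul (by positivity),
            ENNReal.ofReal_pow ENNReal.toReal_nonneg, ENNReal.ofReal_toReal hWt,
            ENNReal.ofReal_pow hC.le, mul_assoc]
      _ ≤ _ := ENNReal.ofReal_le_ofReal (by linarith)

end SquareFunction

/-! ### Comparison of the means with a mollification -/

section Comparison

variable {d : ℕ} {β : ℝ} {ρ : EuclideanSpace ℝ (Fin d) → ℝ}

theorem min_rpow_inv_of_le_one {r δ : ℝ} (hr : 0 < r) (hr1 : r ≤ 1) (hδ : 0 ≤ δ) :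
    min (r ^ δ) (r ^ δ)⁻¹ = r ^ δ := by
  have h0 : 0 < r ^ δ := by positivity
  have h1 : r ^ δ ≤ 1 := Real.rpow_le_one hr.le hr1 hδ
  exact min_eq_left (h1.trans ((one_le_inv₀ h0).2 h1))

theorem min_rpow_inv_of_one_le {r δ : ℝ} (hr1 : 1 ≤ r) (hδ : 0 ≤ δ) :
    min (r ^ δ) (r ^ δ)⁻¹ = (r ^ δ)⁻¹ := by
  have h1 : 1 ≤ r ^ δ := Real.one_le_rpow hr1 hδ
  exact min_eq_right ((inv_le_one_of_one_le₀ h1).trans h1)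

theorem min_rpow_inv_nonneg {r δ : ℝ} (hr : 0 < r) : 0 ≤ min (r ^ δ) (r ^ δ)⁻¹ :=
  le_min (by positivity) (by positivity)

theorem min_rpow_inv_le_one {r δ : ℝ} (hr : 0 < r) : min (r ^ δ) (r ^ δ)⁻¹ ≤ 1 := by
  have h0 : 0 < r ^ δ := by positivity
  rcases le_total (r ^ δ) 1 with h | h
  · exact (min_le_left _ _).trans h
  · exact (min_le_right _ _).trans (inv_le_one_of_one_le₀ h)

theorem IsHomogeneousDistance.exists_norm_comparable (hρ : IsHomogeneousDistance β ρ)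
    (hd : 1 ≤ d) : ∃ C : ℝ, 0 < C ∧ ∀ ξ, ξ ≠ 0 →
      ‖ξ‖ ≤ C * ρ ξ ^ (1 / β) ∧ ρ ξ ^ (1 / β) ≤ C * ‖ξ‖ := by
  obtain ⟨c, C, hc, hC, h⟩ := hρ.exists_bounds hd
  have hβ := hρ.degree_pos
  refine ⟨(c⁻¹) ^ (1 / β) + C ^ (1 / β), by positivity, fun ξ hξ => ?_⟩
  have hn : 0 < ‖ξ‖ := norm_pos_iff.2 hξ
  have hr := hρ.pos ξ hξ
  have e : ‖ξ‖ = (‖ξ‖ ^ β) ^ (1 / β) := by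
    rw [← Real.rpow_mul hn.le, mul_one_div_cancel hβ.ne', Real.rpow_one]
  obtain ⟨h1, h2⟩ := h ξ hξ
  have hA : 0 < (c⁻¹) ^ (1 / β) := by positivity
  have hB : 0 < C ^ (1 / β) := by positivity
  constructor
  · calc ‖ξ‖ = (‖ξ‖ ^ β) ^ (1 / β) := e
      _ ≤ (c⁻¹ * ρ ξ) ^ (1 / β) := by
          refine Real.rpow_le_rpow (by positivity) ?_ (by positivity)
          rwa [← div_eq_inv_mul, le_div_iff₀ hc, mul_comm]
      _ = (c⁻¹) ^ (1 / β) * ρ ξ ^ (1 / β) := Real.mul_rpow (by positivity) hr.le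
      _ ≤ _ := by gcongr; linarith
  · calc ρ ξ ^ (1 / β) ≤ (C * ‖ξ‖ ^ β) ^ (1 / β) :=
          Real.rpow_le_rpow hr.le h2 (by positivity)
      _ = C ^ (1 / β) * ‖ξ‖ := by rw [Real.mul_rpow hC.le (by positivity), ← e]
      _ ≤ _ := by gcongr; linarith

theorem norm_ft_mollifier_le_one (ξ : EuclideanSpace ℝ (Fin d)) : ‖ft (mollifier d) ξ‖ ≤ 1 := by
  refine (norm_ft_le ξ).trans (le_of_eq ?_)
  simp_rw [norm_mollifier]
  exact ContDiffBump.integral_normed _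

theorem exists_low_profile (lam γ : ℝ) : ∃ g : ℝ → ℝ, ∃ G : ℝ, 0 < G ∧ ContDiff ℝ (⊤ : ℕ∞) g ∧
    (∀ r ∈ Icc (0 : ℝ) (1 / 2), g r = hlog lam γ r) ∧ (∀ r, |deriv g r| ≤ G) ∧
    ∀ r, |g r - 1| ≤ G * |r| := by
  obtain ⟨g, hg, hgc, hgh⟩ := exists_smooth_eq_hlog lam γ
  have hd : Continuous (deriv g) := hg.continuous_deriv (by simp)
  obtain ⟨G, hG⟩ := hd.bounded_above_of_compact_support hgc.deriv
  have hG1 : ∀ r, ‖deriv g r‖ ≤ G + 1 := fun r => (hG r).trans (by linarith)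
  have hG0 : 0 ≤ G := (norm_nonneg _).trans (hG 0)
  have h0 : g 0 = 1 := by
    rw [hgh 0 ⟨le_rfl, by norm_num⟩, hlog_eq one_pos]
    simp
  refine ⟨g, G + 1, by linarith, hg, hgh, hG1, fun r => ?_⟩
  have := convex_univ.norm_image_sub_le_of_norm_deriv_le (f := g) (C := G + 1)
    (fun x _ => (hg.differentiable (by simp)).differentiableAt) (fun x _ => hG1 x)
    (mem_univ 0) (mem_univ r)
  simpa [h0] using this

/-- The derivative in `v` of the low-frequency multiplier `g(ρ/v) cutLow(ρ)`. -/
noncomputable def lowDeriv (g : ℝ → ℝ) (r v : ℝ) : ℝ := -(r / v ^ 2) * deriv g (r / v) * cutLow r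

theorem measurable_lowDeriv (g : ℝ → ℝ) : Measurable fun q : ℝ × ℝ => lowDeriv g q.1 q.2 := by
  have h1 := measurable_deriv g
  have h2 := contDiff_cutLow.continuous.measurable
  unfold lowDeriv
  fun_prop

theorem abs_lowDeriv_le {g : ℝ → ℝ} {G : ℝ} (hG : ∀ r, |deriv g r| ≤ G) {r v : ℝ} (hr : 0 < r)
    (hv : 1 ≤ v) : |lowDeriv g r v| ≤ G * (r * cutLow r) := by
  have h1 : r / v ^ 2 ≤ r := div_le_self hr.le (one_le_pow₀ hv)
  have h2 : 0 ≤ r / v ^ 2 := by positivity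
  have hG0 : 0 ≤ G := (abs_nonneg _).trans (hG 0)
  rw [lowDeriv, abs_mul, abs_mul, abs_neg, abs_of_nonneg h2, abs_of_nonneg (cutLow_nonneg r)]
  calc r / v ^ 2 * |deriv g (r / v)| * cutLow r ≤ r * G * cutLow r := by
        gcongr
        · exact cutLow_nonneg r
        · exact hG _
    _ = _ := by ring

theorem integral_lowDeriv {g : ℝ → ℝ} (hg : ContDiff ℝ (⊤ : ℕ∞) g) (r : ℝ) {t : ℝ} (ht : 1 ≤ t) :
    ∫ v in (1 : ℝ)..t, lowDeriv g r v = (g (r / t) - g r) * cutLow r := by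
  have hpos : ∀ v ∈ uIcc 1 t, v ≠ 0 := fun v hv => by
    rw [uIcc_of_le ht] at hv
    linarith [hv.1]
  have hd : Continuous (deriv g) := hg.continuous_deriv (by simp)
  have hder : ∀ v ∈ uIcc 1 t,
      HasDerivAt (fun v => g (r / v)) (-(r / v ^ 2) * deriv g (r / v)) v := by
    intro v hv
    have h1 : HasDerivAt (fun v : ℝ => r / v) (-(r / v ^ 2)) v := by
      have := (hasDerivAt_inv (hpos v hv)).const_mul r
      simp only [div_eq_mul_inv]
      convert! this using 1
      ring
    have h2 := ((hg.differentiable (by simp)).differentiableAt (x := r / v)).hasDerivAt.comp v h1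
    convert! h2 using 1
    ring
  have hcont : ContinuousOn (fun v => -(r / v ^ 2) * deriv g (r / v)) (uIcc 1 t) := by
    refine ContinuousOn.mul (ContinuousOn.neg (continuousOn_const.div (by fun_prop) ?_))
      (hd.comp_continuousOn (continuousOn_const.div continuousOn_id hpos))
    intro v hv
    exact pow_ne_zero _ (hpos v hv)
  unfold lowDeriv
  rw [intervalIntegral.integral_mul_const,
    intervalIntegral.integral_eq_sub_of_hasDerivAt hder hcont.intervalIntegrable, div_one]

theorem mul_cutLow_le {r δ : ℝ} (hr : 0 < r) (hδ : 0 ≤ δ) (hδ1 : δ ≤ 1) :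
    r * cutLow r ≤ min (r ^ δ) (r ^ δ)⁻¹ := by
  rcases le_or_gt r (1 / 2) with h | h
  · rw [min_rpow_inv_of_le_one hr (by linarith) hδ]
    calc r * cutLow r ≤ r * 1 := by gcongr; exact cutLow_le_one r
      _ = r ^ (1 : ℝ) := by rw [mul_one, Real.rpow_one]
      _ ≤ r ^ δ := Real.rpow_le_rpow_of_exponent_ge hr (by linarith) hδ1
  · rw [cutLow_eq_zero h.le, mul_zero]
    exact min_rpow_inv_nonneg hr

theorem norm_midAmp_le_min {δ : ℝ} (hδ : 0 ≤ δ) (hδ1 : δ ≤ 1) {ξ : EuclideanSpace ℝ (Fin d)}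
    (hr : 0 < ρ ξ) : ‖midAmp ρ ξ‖ ≤ 3 * min (ρ ξ ^ δ) (ρ ξ ^ δ)⁻¹ := by
  by_cases h : midAmp ρ ξ = 0
  · rw [h, norm_zero]
    have := min_rpow_inv_nonneg (δ := δ) hr
    positivity
  · refine (norm_midAmp_le_one ξ).trans ?_
    obtain ⟨-, h1, h2⟩ := mem_shell_of_midAmp_ne_zero h
    rcases le_total (ρ ξ) 1 with h3 | h3
    · rw [min_rpow_inv_of_le_one hr h3 hδ]
      have : ρ ξ ^ (1 : ℝ) ≤ ρ ξ ^ δ := Real.rpow_le_rpow_of_exponent_ge hr h3 hδ1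
      rw [Real.rpow_one] at this
      linarith
    · rw [min_rpow_inv_of_one_le h3 hδ]
      have : ρ ξ ^ δ ≤ ρ ξ ^ (1 : ℝ) := Real.rpow_le_rpow_of_exponent_le h3 hδ1
      rw [Real.rpow_one] at this
      have h0 : 0 < ρ ξ ^ δ := by positivity
      rw [← div_eq_mul_inv, one_le_div h0]
      linarith

/-- The difference of the low-frequency multiplier at `t = 1` and the transform of the mollifier
decays at the origin and at infinity. -/
theorem IsHomogeneousDistance.exists_norm_low_sub_mollifier_le (hρ : IsHomogeneousDistance β ρ)
    (hd : 1 ≤ d) {g : ℝ → ℝ} {G : ℝ} (hG : 0 < G) (hg : ∀ r, |g r - 1| ≤ G * |r|)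
    (hg1 : ∀ r ∈ Icc (0 : ℝ) (1 / 2), |g r| ≤ 1) {δ : ℝ} (hδ : 0 ≤ δ) (hδ1 : δ ≤ 1)
    (hδβ : δ ≤ 1 / β) : ∃ C : ℝ, 0 < C ∧ ∀ ξ, ξ ≠ 0 →
      ‖((g (ρ ξ) * cutLow (ρ ξ) : ℝ) : ℂ) - ft (mollifier d) ξ‖ ≤
        C * min (ρ ξ ^ δ) (ρ ξ ^ δ)⁻¹ := by
  obtain ⟨C₁, hC₁, h₁⟩ := hρ.exists_norm_comparable hd
  obtain ⟨C₂, hC₂, h₂⟩ := exists_norm_mul_ft_mollifier_le d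
  refine ⟨G + 2 * C₁ + C₂ * C₁ + 6, by positivity, fun ξ hξ => ?_⟩
  have hr := hρ.pos ξ hξ
  have hn : 0 < ‖ξ‖ := norm_pos_iff.2 hξ
  obtain ⟨hn1, hn2⟩ := h₁ ξ hξ
  have hm := norm_ft_mollifier_sub_one_le ξ
  have hm1 := norm_ft_mollifier_le_one ξ
  have hrδ : 0 < ρ ξ ^ δ := by positivity
  set φ := ft (mollifier d) ξ
  rcases le_total (ρ ξ) 1 with h | h
  · rw [min_rpow_inv_of_le_one hr h hδ]
    have e1 : ρ ξ ≤ ρ ξ ^ δ := by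
      have : ρ ξ ^ (1 : ℝ) ≤ ρ ξ ^ δ := Real.rpow_le_rpow_of_exponent_ge hr h hδ1
      rwa [Real.rpow_one] at this
    have e2 : ρ ξ ^ (1 / β) ≤ ρ ξ ^ δ := Real.rpow_le_rpow_of_exponent_ge hr h hδβ
    rcases le_total (ρ ξ) (1 / 3) with h3 | h3
    -- Near the origin both multipliers are close to `1`.
    · rw [cutLow_eq_one h3, mul_one]
      have e3 : ((g (ρ ξ) : ℝ) : ℂ) - φ = ((g (ρ ξ) - 1 : ℝ) : ℂ) - (φ - 1) := by
        push_cast; ring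
      have e4 := hg (ρ ξ)
      rw [abs_of_pos hr] at e4
      calc _ ≤ ‖((g (ρ ξ) - 1 : ℝ) : ℂ)‖ + ‖φ - 1‖ := by rw [e3]; exact norm_sub_le _ _
        _ ≤ G * ρ ξ + 2 * (C₁ * ρ ξ ^ (1 / β)) := by
            rw [Complex.norm_real]
            exact add_le_add e4 (hm.trans (by gcongr))
        _ ≤ G * ρ ξ ^ δ + 2 * (C₁ * ρ ξ ^ δ) := by gcongr
        _ ≤ _ := by nlinarith [mul_pos (mul_pos hC₂ hC₁) hrδ]
    -- For `ρ ξ ∈ [1/3, 1]` the trivial bound is enough, as `6 (ρ ξ)^δ ≥ 2`.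
    · have e3 : |g (ρ ξ) * cutLow (ρ ξ)| ≤ 1 := by
        rcases le_total (ρ ξ) (1 / 2) with h4 | h4
        · rw [abs_mul, abs_of_nonneg (cutLow_nonneg _)]
          exact mul_le_one₀ (hg1 _ ⟨hr.le, h4⟩) (cutLow_nonneg _) (cutLow_le_one _)
        · rw [cutLow_eq_zero h4]; simp
      calc _ ≤ ‖((g (ρ ξ) * cutLow (ρ ξ) : ℝ) : ℂ)‖ + ‖φ‖ := norm_sub_le _ _
        _ ≤ 1 + 1 := by rw [Complex.norm_real]; exact add_le_add e3 hm1
        _ ≤ 6 * ρ ξ ^ δ := by linarith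
        _ ≤ _ := by gcongr; nlinarith [mul_pos hC₂ hC₁]
  -- For `ρ ξ ≥ 1` only the transform of the mollifier is left, and it is `O(1/|ξ|)`.
  · rw [min_rpow_inv_of_one_le h hδ, cutLow_eq_zero (by linarith), mul_zero, Complex.ofReal_zero,
      zero_sub, norm_neg]
    have e2 : ρ ξ ^ δ ≤ ρ ξ ^ (1 / β) := Real.rpow_le_rpow_of_exponent_le h hδβ
    have e3 : ‖φ‖ * ρ ξ ^ δ ≤ C₂ * C₁ := by
      calc ‖φ‖ * ρ ξ ^ δ ≤ ‖φ‖ * (C₁ * ‖ξ‖) := by gcongr; exact e2.trans hn2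
        _ = (‖ξ‖ * ‖φ‖) * C₁ := by ring
        _ ≤ _ := by gcongr; exact h₂ ξ
    rw [← div_eq_mul_inv, le_div_iff₀ hrδ]
    linarith

end Comparison

/-! ### Almost everywhere convergence for integrable square integrable functions -/

section Near

variable {d : ℕ} {β : ℝ} {ρ : EuclideanSpace ℝ (Fin d) → ℝ}

theorem ENNReal.add_sq_le_four_mul (a b : ℝ≥0∞) : (a + b) ^ 2 ≤ 4 * (a ^ 2 + b ^ 2) := by
  have key : ∀ a b : ℝ≥0∞, a ≤ b → (a + b) ^ 2 ≤ 4 * (a ^ 2 + b ^ 2) := by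
    intro a b h
    calc (a + b) ^ 2 ≤ (b + b) ^ 2 := by gcongr
      _ = 4 * b ^ 2 := by ring
      _ ≤ _ := by gcongr; exact le_add_self
  rcases le_total a b with h | h
  · exact key a b h
  · rw [add_comm, add_comm (a ^ 2)]
    exact key b a h

/-- Plancherel bound for a multiplier dominated by the weight `A ≤ 1`. -/
theorem lintegral_invFT_mul_ft_sq_le (hd : 1 ≤ d) {m F : EuclideanSpace ℝ (Fin d) → ℂ}
    (hm : Integrable m) (hF : Integrable F) {A : EuclideanSpace ℝ (Fin d) → ℝ} {C : ℝ}
    (hA : ∀ ξ, ξ ≠ 0 → 0 ≤ A ξ ∧ A ξ ≤ 1) (hmA : ∀ ξ, ξ ≠ 0 → ‖m ξ‖ ≤ C * A ξ) :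
    ∫⁻ z, ‖invFT (fun ξ => m ξ * ft F ξ) z‖ₑ ^ 2 ≤ ENNReal.ofReal ((2 * Real.pi) ^ d * C ^ 2) *
      ∫⁻ ξ, ENNReal.ofReal (A ξ) * ‖ft F ξ‖ₑ ^ 2 := by
  have hpi := Real.pi_pos
  refine (lintegral_invFT_sq_le (integrable_mul_ft hm hF)).trans ?_
  rw [ENNReal.ofReal_mul (by positivity), mul_assoc]
  refine mul_le_mul_right ?_ _
  rw [← lintegral_const_mul' _ _ ENNReal.ofReal_ne_top]
  refine lintegral_mono_ae ?_
  filter_upwards [IsHomogeneousDistance.ae_ne_zero hd] with ξ hξ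
  obtain ⟨h0, h1⟩ := hA ξ hξ
  rw [enorm_mul, mul_pow, ← mul_assoc, ← ENNReal.ofReal_mul (by positivity), ← ofReal_norm (m ξ),
    ← ENNReal.ofReal_pow (norm_nonneg _)]
  refine mul_le_mul_left (ENNReal.ofReal_le_ofReal ?_) _
  calc ‖m ξ‖ ^ 2 ≤ (C * A ξ) ^ 2 := by gcongr; exact hmA ξ hξ
    _ = C ^ 2 * (A ξ * A ξ) := by ring
    _ ≤ C ^ 2 * (A ξ * 1) := by gcongr
    _ = _ := by ring

theorem IsHomogeneousDistance.integrable_lowDeriv_prod (hρ : IsHomogeneousDistance β ρ)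
    (hd : 1 ≤ d) {g : ℝ → ℝ} {G : ℝ} (hG : ∀ r, |deriv g r| ≤ G) (t : ℝ)
    {e : EuclideanSpace ℝ (Fin d) → ℂ} (hem : Measurable e) {B : ℝ} (he : ∀ ξ, ‖e ξ‖ ≤ B) :
    Integrable (fun q : EuclideanSpace ℝ (Fin d) × ℝ => (lowDeriv g (ρ q.1) q.2 : ℂ) * e q.1)
      (volume.prod (volume.restrict (Ioc 1 t))) := by
  have hρm := hρ.measurable
  have hG0 : 0 ≤ G := (abs_nonneg _).trans (hG 0)
  have hB0 : 0 ≤ B := (norm_nonneg _).trans (he 0)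
  have hlm : Measurable fun q : EuclideanSpace ℝ (Fin d) × ℝ => lowDeriv g (ρ q.1) q.2 :=
    (measurable_lowDeriv g).comp ((hρm.comp measurable_fst).prodMk measurable_snd)
  have hdom := ((hρ.integrable_cutLow hd).norm.const_mul (G * B)).mul_prod
    (integrable_const (μ := volume.restrict (Ioc 1 t)) (1 : ℝ))
  refine hdom.mono' (Measurable.aestronglyMeasurable (by fun_prop)) ?_
  have h1 : ∀ᵐ q : EuclideanSpace ℝ (Fin d) × ℝ ∂(volume.prod (volume.restrict (Ioc 1 t))),
      q.1 ≠ 0 := Measure.quasiMeasurePreserving_fst.ae (ae_ne_zero hd)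
  have h2 : ∀ᵐ q : EuclideanSpace ℝ (Fin d) × ℝ ∂(volume.prod (volume.restrict (Ioc 1 t))),
      q.2 ∈ Ioc 1 t := Measure.quasiMeasurePreserving_snd.ae (ae_restrict_mem measurableSet_Ioc)
  filter_upwards [h1, h2] with q hq1 hq2
  have hr := hρ.pos _ hq1
  rw [norm_mul, Complex.norm_real, Complex.norm_real, mul_one,
    Real.norm_of_nonneg (cutLow_nonneg _)]
  have hl := abs_lowDeriv_le hG hr hq2.1.le
  have hc : ρ q.1 * cutLow (ρ q.1) ≤ cutLow (ρ q.1) := by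
    rcases le_total (ρ q.1) (1 / 2) with h | h
    · exact mul_le_of_le_one_left (cutLow_nonneg _) (by linarith)
    · rw [cutLow_eq_zero h, mul_zero]
  calc ‖lowDeriv g (ρ q.1) q.2‖ * ‖e q.1‖ ≤ (G * (ρ q.1 * cutLow (ρ q.1))) * B :=
        mul_le_mul hl (he _) (norm_nonneg _) ((abs_nonneg _).trans hl)
    _ ≤ (G * cutLow (ρ q.1)) * B := by gcongr
    _ = _ := by ring

theorem IsHomogeneousDistance.integrable_lowDeriv (hρ : IsHomogeneousDistance β ρ)
    (hd : 1 ≤ d) {g : ℝ → ℝ} {G : ℝ} (hG : ∀ r, |deriv g r| ≤ G) {v : ℝ} (hv : 1 ≤ v) :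
    Integrable fun ξ => (lowDeriv g (ρ ξ) v : ℂ) := by
  have hρm := hρ.measurable
  have hlm : Measurable fun ξ => lowDeriv g (ρ ξ) v :=
    (measurable_lowDeriv g).comp (hρm.prodMk measurable_const)
  refine hρ.integrable_of_support hd (B := 1 / 2) (G := G)
    (Measurable.aestronglyMeasurable (by fun_prop)) ?_ fun ξ _ h => ?_
  · filter_upwards [ae_ne_zero hd] with ξ hξ
    have hr := hρ.pos ξ hξ
    rw [Complex.norm_real]
    refine (abs_lowDeriv_le hG hr hv).trans (mul_le_of_le_one_right
      ((abs_nonneg _).trans (hG 0)) ?_)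
    exact (mul_cutLow_le hr le_rfl zero_le_one).trans (min_rpow_inv_le_one hr)
  · rw [lowDeriv, cutLow_eq_zero h.le, mul_zero, Complex.ofReal_zero]

/-- The low-frequency part at `t`, as its value at `t = 1` plus the integral of its derivative. -/
theorem IsHomogeneousDistance.invFT_low_eq (hρ : IsHomogeneousDistance β ρ) (hd : 1 ≤ d)
    {lam γ : ℝ} {g : ℝ → ℝ} (hgs : ContDiff ℝ (⊤ : ℕ∞) g) {G : ℝ} (hG : ∀ r, |deriv g r| ≤ G)
    (hgh : ∀ r ∈ Icc (0 : ℝ) (1 / 2), g r = hlog lam γ r)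
    {F : EuclideanSpace ℝ (Fin d) → ℂ} (hF : Integrable F)
    (hm : Integrable fun ξ => ((g (ρ ξ) * cutLow (ρ ξ) : ℝ) : ℂ)) {t : ℝ} (ht : 1 ≤ t)
    (z : EuclideanSpace ℝ (Fin d)) :
    invFT (fun ξ => (hlog lam γ (ρ ξ / t) : ℂ) * (cutLow (ρ ξ) : ℂ) * ft F ξ) z =
      invFT (fun ξ => ((g (ρ ξ) * cutLow (ρ ξ) : ℝ) : ℂ) * ft F ξ) z +
        ∫ v in Ioc 1 t, invFT (fun ξ => (lowDeriv g (ρ ξ) v : ℂ) * ft F ξ) z := by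
  set e : EuclideanSpace ℝ (Fin d) → ℂ := fun ξ =>
    ft F ξ * Complex.exp (Complex.I * (inner ℝ z ξ : ℝ)) with he
  have hem : Measurable e := by
    have h1 : Measurable (ft F) := (continuous_ft hF).measurable
    have h2 : Measurable fun ξ : EuclideanSpace ℝ (Fin d) => (inner ℝ z ξ : ℝ) := by fun_prop
    fun_prop
  have heb : ∀ ξ, ‖e ξ‖ ≤ ∫ y, ‖F y‖ := fun ξ => by
    rw [he, norm_mul, norm_cexp_I_mul_ofReal, mul_one]
    exact norm_ft_le ξ
  have hI := hρ.integrable_lowDeriv_prod hd hG t hem heb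
  have hswap := integral_integral_swap (f := fun ξ v => (lowDeriv g (ρ ξ) v : ℂ) * e ξ) hI
  have hR : ∫ v in Ioc 1 t, invFT (fun ξ => (lowDeriv g (ρ ξ) v : ℂ) * ft F ξ) z =
      ∫ v in Ioc 1 t, ∫ ξ, (lowDeriv g (ρ ξ) v : ℂ) * e ξ := by
    congr 1 with v
    rw [invFT]
    congr 1 with ξ
    rw [he, mul_assoc]
  rw [hR, ← hswap, invFT, invFT, ← integral_add (integrable_mul_cexp (integrable_mul_ft hm hF) z)
    hI.integral_prod_left]
  refine integral_congr_ae ?_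
  filter_upwards [ae_ne_zero hd] with ξ hξ
  have hr := hρ.pos ξ hξ
  have h1 : ∫ v in Ioc 1 t, (lowDeriv g (ρ ξ) v : ℂ) * e ξ =
      (((g (ρ ξ / t) - g (ρ ξ)) * cutLow (ρ ξ) : ℝ) : ℂ) * e ξ := by
    rw [integral_mul_const, integral_complex_ofReal, ← intervalIntegral.integral_of_le ht,
      integral_lowDeriv hgs _ ht]
  have h2 : hlog lam γ (ρ ξ / t) * cutLow (ρ ξ) = g (ρ ξ / t) * cutLow (ρ ξ) := by
    rcases le_total (ρ ξ) (1 / 2) with h | h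
    · rw [hgh]
      exact ⟨by positivity, (div_le_self hr.le ht).trans h⟩
    · rw [cutLow_eq_zero h, mul_zero, mul_zero]
  have h3 : (hlog lam γ (ρ ξ / t) : ℂ) * (cutLow (ρ ξ) : ℂ) =
      (g (ρ ξ / t) : ℂ) * (cutLow (ρ ξ) : ℂ) := by exact_mod_cast h2
  rw [h1, h3, he]
  push_cast
  ring

theorem measurable_invFT_lowDeriv (hρ : Measurable ρ) (g : ℝ → ℝ)
    {F : EuclideanSpace ℝ (Fin d) → ℂ} (hF : Measurable (ft F)) :
    Measurable fun q : ℝ × EuclideanSpace ℝ (Fin d) =>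
      invFT (fun ξ => (lowDeriv g (ρ ξ) q.1 : ℂ) * ft F ξ) q.2 := by
  unfold invFT
  refine StronglyMeasurable.measurable (StronglyMeasurable.integral_prod_right'
    (f := fun w : (ℝ × EuclideanSpace ℝ (Fin d)) × EuclideanSpace ℝ (Fin d) =>
      (lowDeriv g (ρ w.2) w.1.1 : ℂ) * ft F w.2 *
        Complex.exp (Complex.I * (inner ℝ w.1.2 w.2 : ℝ))) ?_)
  refine Measurable.stronglyMeasurable ?_
  have h1 : Measurable fun w : (ℝ × EuclideanSpace ℝ (Fin d)) × EuclideanSpace ℝ (Fin d) =>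
      (inner ℝ w.1.2 w.2 : ℝ) := by fun_prop
  have h2 : Measurable fun w : (ℝ × EuclideanSpace ℝ (Fin d)) × EuclideanSpace ℝ (Fin d) =>
      lowDeriv g (ρ w.2) w.1.1 :=
    (measurable_lowDeriv g).comp ((hρ.comp measurable_snd).prodMk
      (measurable_fst.comp measurable_fst))
  fun_prop

/-- On one dyadic block the means differ from a mollification by a function that is controlled
in `L²` by frequencies of size comparable to the block. -/
theorem IsHomogeneousDistance.exists_mean_sub_mollify_le (hρ : IsHomogeneousDistance β ρ)
    (hd : 1 ≤ d) {lam γ : ℝ} (hlam : 0 < lam) (hγ : 0 ≤ γ) : ∃ δ C : ℝ, 0 < δ ∧ 0 ≤ C ∧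
      ∀ F : EuclideanSpace ℝ (Fin d) → ℂ, Integrable F →
      ∃ M : EuclideanSpace ℝ (Fin d) → ℝ≥0∞, Measurable M ∧
        (∀ t ∈ Icc (1 : ℝ) 2, ∀ z,
          ‖rieszMean ρ lam γ t F z - ∫ y, F y * mollifier d (z - y)‖ₑ ≤ M z) ∧
        ∫⁻ z, M z ^ 2 ≤ ∫⁻ ξ, ENNReal.ofReal (C * min (ρ ξ ^ δ) (ρ ξ ^ δ)⁻¹) * ‖ft F ξ‖ₑ ^ 2 := by
  have hβ := hρ.degree_pos
  have hρm := hρ.measurable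
  have hpi := Real.pi_pos
  obtain ⟨g, G, hG, hgs, hgh, hgd, hg1⟩ := exists_low_profile lam γ
  set δ : ℝ := min 1 (1 / β) with hδ
  have hδ0 : 0 < δ := lt_min one_pos (by positivity)
  have hδ1 : δ ≤ 1 := min_le_left _ _
  have hgb : ∀ r ∈ Icc (0 : ℝ) (1 / 2), |g r| ≤ 1 := fun r hr => by
    rw [hgh r hr]; exact abs_hlog_le_one hlam.le hγ hr.1
  obtain ⟨C₁, hC₁, h₁⟩ := hρ.exists_norm_low_sub_mollifier_le hd hG hg1 hgb hδ0.le hδ1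
    (min_le_right _ _)
  obtain ⟨C₂, hC₂, h₂⟩ := hρ.exists_high_bound hlam hγ
  set A : EuclideanSpace ℝ (Fin d) → ℝ := fun ξ => min (ρ ξ ^ δ) (ρ ξ ^ δ)⁻¹ with hA
  have hAb : ∀ ξ, ξ ≠ 0 → 0 ≤ A ξ ∧ A ξ ≤ 1 := fun ξ hξ =>
    ⟨min_rpow_inv_nonneg (hρ.pos ξ hξ), min_rpow_inv_le_one (hρ.pos ξ hξ)⟩
  set P := (2 * Real.pi) ^ d with hP
  have hP1 : 1 ≤ P := one_le_pow₀ (by linarith [Real.two_le_pi])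
  set D := 4 * (P * C₁ ^ 2 + 4 * (P * G ^ 2 + C₂ * 3 ^ 2)) with hD
  have hD0 : 0 ≤ D := by positivity
  refine ⟨δ, D, hδ0, hD0, fun F hF => ?_⟩
  have hFm : Measurable (ft F) := (continuous_ft hF).measurable
  -- the three pieces of the dominating function
  have hml : Integrable fun ξ => ((g (ρ ξ) * cutLow (ρ ξ) : ℝ) : ℂ) := by
    have hc := contDiff_cutLow.continuous.measurable
    have hgm := hgs.continuous.measurable
    refine hρ.integrable_of_support hd (B := 1 / 2) (G := 1)
      (Measurable.aestronglyMeasurable (by fun_prop)) ?_ fun ξ _ h => ?_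
    · filter_upwards [ae_ne_zero hd] with ξ hξ
      rw [Complex.norm_real, norm_mul, Real.norm_of_nonneg (cutLow_nonneg _)]
      rcases le_total (ρ ξ) (1 / 2) with h | h
      · exact mul_le_one₀ (hgb _ ⟨(hρ.pos ξ hξ).le, h⟩) (cutLow_nonneg _) (cutLow_le_one _)
      · rw [cutLow_eq_zero h, mul_zero]; exact zero_le_one
    · rw [cutLow_eq_zero h.le, mul_zero, Complex.ofReal_zero]
  have hm0 : Integrable fun ξ => ((g (ρ ξ) * cutLow (ρ ξ) : ℝ) : ℂ) - ft (mollifier d) ξ :=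
    hml.sub integrable_ft_mollifier
  obtain ⟨MH, hMHm, hMH, hMH2⟩ := h₂ (shellFT ρ F) (hρ.integrable_shellFT hd hF)
    (hρ.measurable_shellFT hd hF) fun ξ => shellFT_support
  set U : ℝ × EuclideanSpace ℝ (Fin d) → ℝ≥0∞ := fun q =>
    ‖invFT (fun ξ => (lowDeriv g (ρ ξ) q.1 : ℂ) * ft F ξ) q.2‖ₑ with hU
  have hUm : Measurable U := (measurable_invFT_lowDeriv hρm g hFm).enorm
  set M0 : EuclideanSpace ℝ (Fin d) → ℝ≥0∞ := fun z =>
    ‖invFT (fun ξ => (((g (ρ ξ) * cutLow (ρ ξ) : ℝ) : ℂ) - ft (mollifier d) ξ) * ft F ξ) z‖ₑ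
    with hM0
  have hM0m : Measurable M0 := (continuous_invFT (integrable_mul_ft hm0 hF)).measurable.enorm
  set ML : EuclideanSpace ℝ (Fin d) → ℝ≥0∞ := fun z => ∫⁻ v in Ioc (1 : ℝ) 2, U (v, z) with hML
  have hMLm : Measurable ML := hUm.lintegral_prod_left'
  set N := ∫⁻ ξ, ENNReal.ofReal (A ξ) * ‖ft F ξ‖ₑ ^ 2 with hN
  have hM02 : ∫⁻ z, M0 z ^ 2 ≤ ENNReal.ofReal (P * C₁ ^ 2) * N :=
    lintegral_invFT_mul_ft_sq_le hd hm0 hF hAb h₁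
  have hML2 : ∫⁻ z, ML z ^ 2 ≤ ENNReal.ofReal (P * G ^ 2) * N := by
    have h := lintegral_sq_superposition_le (μ := volume) (κ := volume.restrict (Ioc (1 : ℝ) 2))
      (w := fun _ => 1) (P := U) measurable_const hUm (by simp)
      (A := ENNReal.ofReal (P * G ^ 2) * N) (by
        filter_upwards [ae_restrict_mem measurableSet_Ioc] with v hv
        refine lintegral_invFT_mul_ft_sq_le hd (hρ.integrable_lowDeriv hd hgd hv.1.le) hF hAb
          fun ξ hξ => ?_
        rw [Complex.norm_real]
        refine (abs_lowDeriv_le hgd (hρ.pos ξ hξ) hv.1.le).trans ?_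
        exact mul_le_mul_of_nonneg_left (mul_cutLow_le (hρ.pos ξ hξ) hδ0.le hδ1) hG.le)
    have h1 : volume (Ioc (1 : ℝ) 2) = 1 := by rw [Real.volume_Ioc]; norm_num
    simp only [one_mul, lintegral_one, Measure.restrict_apply_univ, h1, one_pow] at h
    exact h
  have hMH3 : ∫⁻ z, MH z ^ 2 ≤ ENNReal.ofReal (C₂ * 3 ^ 2) * N := by
    refine hMH2.trans ?_
    rw [ENNReal.ofReal_mul hC₂.le, mul_assoc]
    refine mul_le_mul_right ?_ _
    rw [← lintegral_const_mul' _ _ ENNReal.ofReal_ne_top]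
    refine lintegral_mono_ae ?_
    filter_upwards [ae_ne_zero hd] with ξ hξ
    obtain ⟨h0, h1⟩ := hAb ξ hξ
    rw [shellFT, enorm_mul, mul_pow, ← mul_assoc, ← ENNReal.ofReal_mul (by positivity),
      ← ofReal_norm (midAmp ρ ξ), ← ENNReal.ofReal_pow (norm_nonneg _)]
    refine mul_le_mul_left (ENNReal.ofReal_le_ofReal ?_) _
    calc ‖midAmp ρ ξ‖ ^ 2 ≤ (3 * A ξ) ^ 2 := by
          gcongr; exact norm_midAmp_le_min hδ0.le hδ1 (hρ.pos ξ hξ)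
      _ = 3 ^ 2 * (A ξ * A ξ) := by ring
      _ ≤ 3 ^ 2 * (A ξ * 1) := by gcongr
      _ = _ := by ring
  refine ⟨fun z => M0 z + (ML z + MH z), by fun_prop, fun t ht z => ?_, ?_⟩
  · have hmol : ∫ y, F y * mollifier d (z - y) =
        ((P : ℝ) : ℂ)⁻¹ * invFT (fun ξ => ft (mollifier d) ξ * ft F ξ) z := by
      rw [invFT_mul_ft integrable_ft_mollifier hF, ← integral_const_mul]
      congr 1 with y
      rw [invFT_ft_mollifier]
      have : (((2 * Real.pi) ^ d : ℝ) : ℂ) ≠ 0 := by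
        exact_mod_cast (show ((2 * Real.pi) ^ d : ℝ) ≠ 0 by positivity)
      rw [hP]
      field_simp
    have hsub : invFT (fun ξ => ((g (ρ ξ) * cutLow (ρ ξ) : ℝ) : ℂ) * ft F ξ) z =
        invFT (fun ξ => (((g (ρ ξ) * cutLow (ρ ξ) : ℝ) : ℂ) - ft (mollifier d) ξ) * ft F ξ) z +
          invFT (fun ξ => ft (mollifier d) ξ * ft F ξ) z := by
      rw [← invFT_add (integrable_mul_ft hm0 hF) (integrable_mul_ft integrable_ft_mollifier hF)]
      congr 1 with ξ
      ring
    have hdiff : rieszMean ρ lam γ t F z - ∫ y, F y * mollifier d (z - y) = ((P : ℝ) : ℂ)⁻¹ *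
        (invFT (fun ξ => (((g (ρ ξ) * cutLow (ρ ξ) : ℝ) : ℂ) - ft (mollifier d) ξ) * ft F ξ) z +
        ((∫ v in Ioc 1 t, invFT (fun ξ => (lowDeriv g (ρ ξ) v : ℂ) * ft F ξ) z) +
          invFT (fun ξ => (hlog lam γ (ρ ξ / t) : ℂ) * shellFT ρ F ξ) z)) := by
      rw [hρ.rieszMean_eq_low_add_high hd hlam.le hγ ht hF, hmol,
        hρ.invFT_low_eq hd hgs hgd hgh hF hml ht.1, hsub, ← hP]
      push_cast
      ring
    rw [hdiff, enorm_mul]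
    have hPinv : ‖((P : ℝ) : ℂ)⁻¹‖ₑ ≤ 1 := by
      rw [← ofReal_norm, ENNReal.ofReal_le_one, norm_inv, Complex.norm_real,
        Real.norm_of_nonneg (by positivity)]
      exact inv_le_one_of_one_le₀ hP1
    refine (mul_le_of_le_one_left' hPinv).trans ((enorm_add_le _ _).trans (add_le_add le_rfl
      ((enorm_add_le _ _).trans (add_le_add ?_ (hMH t ht z)))))
    exact (enorm_integral_le_lintegral_enorm _).trans
      (lintegral_mono_set (Ioc_subset_Ioc_right ht.2))
  · calc ∫⁻ z, (M0 z + (ML z + MH z)) ^ 2 ≤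
          ∫⁻ z, 4 * (M0 z ^ 2 + 4 * (ML z ^ 2 + MH z ^ 2)) := by
          refine lintegral_mono fun z => (ENNReal.add_sq_le_four_mul _ _).trans ?_
          gcongr
          exact ENNReal.add_sq_le_four_mul _ _
      _ = 4 * ((∫⁻ z, M0 z ^ 2) + 4 * ((∫⁻ z, ML z ^ 2) + ∫⁻ z, MH z ^ 2)) := by
          rw [lintegral_const_mul _ (by fun_prop), lintegral_add_left (by fun_prop),
            lintegral_const_mul _ (by fun_prop), lintegral_add_left (by fun_prop)]
      _ ≤ 4 * (ENNReal.ofReal (P * C₁ ^ 2) * N + 4 * (ENNReal.ofReal (P * G ^ 2) * N +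
            ENNReal.ofReal (C₂ * 3 ^ 2) * N)) := by gcongr
      _ = ENNReal.ofReal D * N := by
          have eD : ENNReal.ofReal D = 4 * (ENNReal.ofReal (P * C₁ ^ 2) +
              4 * (ENNReal.ofReal (P * G ^ 2) + ENNReal.ofReal (C₂ * 3 ^ 2))) := by
            rw [hD, ENNReal.ofReal_mul (p := 4) (by norm_num),
              ENNReal.ofReal_add (by positivity) (by positivity),
              ENNReal.ofReal_mul (p := 4) (by norm_num),
              ENNReal.ofReal_add (p := P * G ^ 2) (by positivity) (by positivity),
              ENNReal.ofReal_ofNat]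
          rw [eD]
          ring
      _ = _ := by
          rw [hN, ← lintegral_const_mul' _ _ ENNReal.ofReal_ne_top]
          congr 1 with ξ
          rw [ENNReal.ofReal_mul hD0, mul_assoc]

end Near

/-! ### Almost everywhere convergence in the Lorentz class -/

section Final

variable {d : ℕ} {β : ℝ} {ρ : EuclideanSpace ℝ (Fin d) → ℝ}

/-- Almost everywhere convergence for functions in `L¹ ∩ L²`. -/
theorem IsHomogeneousDistance.ae_tendsto_of_integrable (hρ : IsHomogeneousDistance β ρ)
    (hd : 1 ≤ d) {lam γ : ℝ} (hlam : 0 < lam) (hγ : 0 ≤ γ) {F : EuclideanSpace ℝ (Fin d) → ℂ}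
    (hF : Integrable F) (hF2 : ∫⁻ y, ‖F y‖ₑ ^ 2 ≠ ⊤) :
    ∀ᵐ x, Tendsto (fun t => rieszMean ρ lam γ t F x) atTop (𝓝 (F x)) := by
  have hβ := hρ.degree_pos
  obtain ⟨δ, C, hδ, hC, h⟩ := hρ.exists_mean_sub_mollify_le hd hlam hγ
  set s : ℕ → ℝ := fun i => (2 ^ i : ℝ) ^ (1 / β) with hs
  have hs0 : ∀ i, 0 < s i := fun i => by positivity
  have hsβ : ∀ i, s i ^ β = 2 ^ i := fun i => by
    rw [hs, ← Real.rpow_mul (by positivity), one_div_mul_cancel hβ.ne', Real.rpow_one]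
  have hslim : Tendsto s atTop atTop :=
    (tendsto_rpow_atTop (by positivity)).comp (tendsto_pow_atTop_atTop_of_one_lt one_lt_two)
  have hex := fun i => h (fun z => F ((s i)⁻¹ • z)) (hF.comp_smul (inv_ne_zero (hs0 i).ne'))
  choose M hMm hM1 hM2 using hex
  have hsum : ∑' i, ∫⁻ x, M i (s i • x) ^ 2 ≠ ⊤ := by
    refine ne_top_of_le_ne_top (hρ.tsum_dilated_ne_top hd hδ hC hF hF2)
      (ENNReal.tsum_le_tsum fun i => ?_)
    rw [lintegral_comp_smul volume (fun x => M i x ^ 2) (hs0 i), finrank_euclideanSpace_fin]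
    exact mul_le_mul_right (hM2 i) _
  have hzero := tendsto_zero_of_lintegral_tsum
    (fun i => ((hMm i).comp (measurable_const_smul (s i))).pow_const 2) hsum
  filter_upwards [hzero, ae_tendsto_mollify hF hs0 hslim] with x hx hmol
  have hMx : Tendsto (fun i => M i (s i • x)) atTop (𝓝 0) := by
    have := hx.ennrpow_const (1 / 2)
    simp_rw [← ENNReal.rpow_two, Function.comp_apply, ← ENNReal.rpow_mul] at this
    simpa using this
  rw [EMetric.tendsto_nhds] at hmol ⊢
  intro ε hε
  have hε2 : 0 < ε / 2 := ENNReal.half_pos hε.ne'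
  refine eventually_atTop_of_dyadic ?_
  filter_upwards [hMx.eventually (gt_mem_nhds hε2), hmol (ε / 2) hε2] with i h1 h2 u hu
  rw [← hsβ i, hρ.rieszMean_scale hd lam γ u (hs0 i)]
  calc _ ≤ edist (rieszMean ρ lam γ u (fun z => F ((s i)⁻¹ • z)) (s i • x))
        (∫ y, F ((s i)⁻¹ • y) * mollifier d (s i • x - y)) +
        edist (∫ y, F ((s i)⁻¹ • y) * mollifier d (s i • x - y)) (F x) := edist_triangle _ _ _
    _ < ε / 2 + ε / 2 := by
        refine ENNReal.add_lt_add (lt_of_le_of_lt ?_ h1) h2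
        rw [edist_eq_enorm_sub]
        exact hM1 i u hu (s i • x)
    _ = ε := ENNReal.add_halves ε

end Final

theorem theorem1p1 (d : ℕ) (hd : 2 ≤ d) (β : ℝ) (ρ : EuclideanSpace ℝ (Fin d) → ℝ)
    (hρ : IsHomogeneousDistance β ρ) (p : ℝ) (hp : 2 * (d : ℝ) / ((d : ℝ) - 1) < p)
    (q : ℝ≥0∞) (γ : ℝ) (hqγ : (1 < q ∧ 1 - (1 / q).toReal < γ) ∨ (q = 1 ∧ 0 ≤ γ))
    (f : EuclideanSpace ℝ (Fin d) → ℂ) (hf : MemLorentz f p q volume) :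
    (∀ t : ℝ, 0 < t → ∀ x : EuclideanSpace ℝ (Fin d),
      Integrable (fun y => rieszKernel ρ (criticalIndex d p) γ t (x - y) * f y)) ∧
    ∀ᵐ x : EuclideanSpace ℝ (Fin d),
      Tendsto (fun t : ℝ => rieszMean ρ (criticalIndex d p) γ t f x) atTop (𝓝 (f x)) := by
  have hd1 : 1 ≤ d := by omega
  have hd2 : (2 : ℝ) ≤ d := by exact_mod_cast hd
  rw [div_lt_iff₀ (by linarith)] at hp
  have hp2 : 2 < p := by
    by_contra! h
    nlinarith
  have hlam : 0 < criticalIndex d p := by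
    have e : criticalIndex d p = (p * (d - 1) - 2 * d) / (2 * p) := by
      have : p ≠ 0 := by linarith
      rw [criticalIndex]
      field_simp
      ring
    rw [e]
    exact div_pos (by linarith) (by linarith)
  have hcrit : criticalIndex d p + 1 / 2 = d * (1 / 2 - 1 / p) := by
    rw [criticalIndex]; ring
  have hq : 1 ≤ q := by
    rcases hqγ with h | h
    · exact h.1.le
    · exact h.1.ge
  have hγ : 0 ≤ γ := by
    rcases hqγ with ⟨h1, h2⟩ | h
    · have h3 : (1 / q).toReal ≤ 1 := by
        rw [← ENNReal.toReal_one]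
        refine ENNReal.toReal_mono ENNReal.one_ne_top ?_
        rw [one_div]
        exact ENNReal.inv_le_one.2 hq
      linarith
    · exact h.2
  set lam := criticalIndex d p
  have hsum : ∑' k, ENNReal.ofReal (annulusWeight d p γ k) *
      (∫⁻ y in annulus d k, ‖f y‖ₑ ^ 2) ^ (1 / 2 : ℝ) ≠ ⊤ :=
    (hf.tsum_annuli_lt_top hd1 hp2 hqγ hq hγ).ne
  have hloc : ∀ r : ℝ, ∫⁻ y in Metric.ball 0 r, ‖f y‖ₑ ^ 2 ≠ ⊤ := fun r =>
    (hf.lintegral_sq_lt_top hp2 hq measure_ball_lt_top.ne).ne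
  have hint : ∀ t : ℝ, 0 < t → ∀ x : EuclideanSpace ℝ (Fin d),
      Integrable (fun y => rieszKernel ρ lam γ t (x - y) * f y) := fun t ht x =>
    hρ.integrable_rieszKernel_mul_of_annuli hd1 hp2 hcrit hlam hγ hf.1 hsum hloc ht x
  refine ⟨hint, ?_⟩
  have hfar := fun n : ℕ => hρ.exists_far_mean_small hd1 hp2 hcrit hlam hγ hf.1 hsum
    (R := (n : ℝ) + 1) (by simp) (ε := ((n : ℝ≥0∞) + 1)⁻¹) (by simp)
  choose k hk hfar using hfar
  have hball : ∀ n, MeasurableSet (Metric.ball (0 : EuclideanSpace ℝ (Fin d)) (2 ^ k n)) := fun n =>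
    Metric.isOpen_ball.measurableSet
  have hnear := fun n : ℕ => hρ.ae_tendsto_of_integrable hd1 hlam hγ
    (F := (Metric.ball 0 (2 ^ k n)).indicator f)
    ((integrableOn_of_sq measure_ball_lt_top.ne hf.1 (hloc _)).integrable_indicator (hball n))
    (by
      rw [lintegral_eq_setLIntegral_of_eq_zero (hball n) fun y hy => by
        simp [indicator_of_notMem hy]]
      refine ne_top_of_le_ne_top (hloc (2 ^ k n)) (lintegral_mono fun y => ?_)
      gcongr
      exact enorm_indicator_le_enorm_self _ _)
  filter_upwards [ae_all_iff.2 hfar, ae_all_iff.2 hnear] with x hx1 hx2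
  rw [EMetric.tendsto_nhds]
  intro ε hε
  have hε2 : 0 < ε / 2 := ENNReal.half_pos hε.ne'
  obtain ⟨n₁, hn₁⟩ := ENNReal.exists_inv_nat_lt hε2.ne'
  obtain ⟨n₂, hn₂⟩ := exists_nat_gt ‖x‖
  set n := max n₁ n₂
  have hxn : ‖x‖ < (n : ℝ) + 1 := by
    have : (n₂ : ℝ) ≤ n := by exact_mod_cast le_max_right _ _
    linarith
  have hεn : ((n : ℝ≥0∞) + 1)⁻¹ < ε / 2 := by
    refine lt_of_le_of_lt (ENNReal.inv_le_inv.2 ?_) hn₁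
    have : (n₁ : ℝ≥0∞) ≤ n := by exact_mod_cast le_max_left _ _
    exact this.trans le_self_add
  have hfx : (Metric.ball 0 (2 ^ k n)).indicator f x = f x :=
    indicator_of_mem (by simpa using hxn.trans_le (hk n)) _
  have h2 := EMetric.tendsto_nhds.1 (hx2 n) (ε / 2) hε2
  rw [hfx] at h2
  filter_upwards [hx1 n hxn, h2, eventually_gt_atTop 0] with t ht1 ht2 ht
  have hcompl : (Metric.ball (0 : EuclideanSpace ℝ (Fin d)) (2 ^ k n))ᶜ = {y | 2 ^ k n ≤ ‖y‖} := by
    ext y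
    simp
  have hsplit : rieszMean ρ lam γ t f x =
      rieszMean ρ lam γ t ((Metric.ball 0 (2 ^ k n)).indicator f) x +
        rieszMean ρ lam γ t ({y | 2 ^ k n ≤ ‖y‖}.indicator f) x := by
    rw [← hcompl, rieszMean_indicator (hball n), rieszMean_indicator (hball n).compl,
      integral_add_compl (hball n) (hint t ht x), rieszMean]
  rw [hsplit, edist_eq_enorm_sub, add_sub_right_comm]
  rw [edist_eq_enorm_sub] at ht2
  calc _ ≤ ‖rieszMean ρ lam γ t ((Metric.ball 0 (2 ^ k n)).indicator f) x - f x‖ₑ +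
        ‖rieszMean ρ lam γ t ({y | 2 ^ k n ≤ ‖y‖}.indicator f) x‖ₑ := enorm_add_le _ _
    _ < ε / 2 + ε / 2 := ENNReal.add_lt_add ht2 (ht1.trans_lt hεn)
    _ = ε := ENNReal.add_halves ε
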